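/- **Conventions.** Let $K$ be a field of characteristic $0$, let $n\ge 1$, $K_n=K[x_1,\dots,x_n]$ with $x_1<\dots<x_n$, and let $\deg$ be the total degree. For $f\in K_n\setminus K$, the leading variable $\mathrm{lv}(f)$ is the greatest variable occurring in $f$, and the initial $\mathrm{ini}(f)$ is the leading coefficient of $f$ as a polynomial in $\mathrm{lv}(f)$. A *triangular set* is a list $\mathcal T=[T_1,\dots,T_r]$ ($r\ge 0$) of nonconstant polynomials with $\mathrm{lv}(T_1)<\dots<\mathrm{lv}(T_r)$; its parameters $\mathbf u$ are the variables that are not among the $\mathrm{lv}(T_i)$. Put $I_{\mathcal T}=\prod_i\mathrm{ini}(T_i)$ and $\mathrm{sat}(\mathcal T)=\{f\in K_n : I_{\mathcal T}^m f\in(\mathcal T)\text{ for some } m\ge 1\}$. $\mathcal T$ is *regular* if $(T_1,\dots,T_{i-1},\mathrm{ini}(T_i))\cap K[\mathbf u]\ne\{0\}$ for every $1\le i\le r$. For an algebraically closed extension $E$ of $K$ and $S\subseteq K_n$, $\mathrm{Zero}(S)\subseteq E^n$ is the set of common zeros of $S$. An ideal is *unmixed* if all its associated primes have the same dimension. An *algorithm*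 is a program, independent of $K$, for a list machine over $K$: its data are binary trees whose leaves are empty or hold an element of $K$, and each list operation (pairing, taking a component, test for emptiness), each arithmetic operation ($+,-,\cdot,/$, constants $0,1$) and each zero test in $K$ costs a constant number of steps. Polynomials are given as lists of their nonzero terms, natural numbers (exponents, $n$, $d$) in unary. **Theorem.** There are an algorithm, a natural number $c$ and a polynomial $p$ in two variables with natural number coefficients such that the following holds for every field $K$ of characteristic $0$, all $n,k\ge 1$, all $d$, and all $h_1,\dots,h_k\in K[x_1,\dots,x_n]$ with $\deg(h_i)<d$ (where $\deg(0)=0$, so $d\ge 1$). On input $(n,d,H)$ with $H=(h_1,\dots,h_k)$, the algorithm computes a list of regular triangular sets $\mathcal A_1,\dots,\mathcal A_N$ ($N\ge 0$), $\mathcal A_q=[\Psi_{q,1},\dots,\Psi_{q,l_q}]$, such that: 1. $\mathrm{Zero}(H)=\bigcup_{q=1}^N\mathrm{Zero}(\mathrm{sat}(\mathcal A_q))$ in $E^n$ for every algebraically closed extension $E$ of $K$, and this decomposition is unmixed: each ideal $\mathrm{sat}(\mathcal A_q)$ is unmixed. 2. $\deg(\Psi_{q,i})<d^{c^n}$ for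 all $q,i$, and $N\le k^n d^{\,n c^{n+2}}$. 3. The running time (number of steps) is at most $p\bigl(k^n,\,d^{\,n c^{n+2}}\bigr)$. -/

import Mathlib

open MvPolynomial

universe u v

namespace TriDec

/-! ### Triangular sets, saturation ideals, zero sets -/

section Algebra

variable {K : Type u} [Field K] {n : ℕ}

/-- The leading variable of `f`: the greatest variable that occurs in `f`, for the order
`x_1 < ⋯ < x_n` (that is, the order of `Fin n`); it is `⊥` exactly when `f` is a constant. -/
noncomputable def lv (f : MvPolynomial (Fin n) K) : WithBot (Fin n) :=
  f.vars.max

/-- The coefficient of `x_v ^ e` when `f` is read as a polynomial in `x_v` whose coefficients are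
polynomials in the other variables. -/
noncomputable def coeffIn (v : Fin n) (e : ℕ) (f : MvPolynomial (Fin n) K) :
    MvPolynomial (Fin n) K :=
  ∑ m ∈ f.support.filter (fun m => m v = e), monomial (m.erase v) (f.coeff m)

/-- The initial of `f`: its leading coefficient as a polynomial in its leading variable. (The value
at constants, which never belong to a triangular set, is immaterial.) -/
noncomputable def ini (f : MvPolynomial (Fin n) K) : MvPolynomial (Fin n) K :=
  if h : f.vars.Nonempty then coeffIn (f.vars.max' h) (f.degreeOf (f.vars.max' h)) f else f

/-- A triangular set, listed by strictly increasing leading variables: no element is a constant and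
distinct elements have distinct leading variables. -/
def IsTriangular (T : List (MvPolynomial (Fin n) K)) : Prop :=
  (∀ f ∈ T, lv f ≠ ⊥) ∧ T.Pairwise (fun f g => lv f < lv g)

/-- The parameters of `T`: the variables that are not the leading variable of an element of `T`. -/
def params (T : List (MvPolynomial (Fin n) K)) : Set (Fin n) :=
  {x | ∀ f ∈ T, lv f ≠ (x : WithBot (Fin n))}

/-- `T = [T_1, …, T_r]` is regular: for every `i`, the ideal generated by `T_1, …, T_{i-1}` and the
initial of `T_i` contains a nonzero polynomial in the parameters of `T`. -/
def IsRegular (T : List (MvPolynomial (Fin n) K)) : Prop :=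
  ∀ (i : ℕ) (hi : i < T.length), ∃ g : MvPolynomial (Fin n) K,
    g ≠ 0 ∧ g ∈ MvPolynomial.supported K (params T) ∧
      g ∈ Ideal.span ({f | f ∈ T.take i} ∪ {ini T[i]})

/-- The product of the initials of the elements of `T`. -/
noncomputable def iniProd (T : List (MvPolynomial (Fin n) K)) : MvPolynomial (Fin n) K :=
  (T.map ini).prod

/-- The saturation ideal `{f | I_T ^ d * f ∈ (T) for some d ≥ 1}`. -/
def sat (T : List (MvPolynomial (Fin n) K)) : Ideal (MvPolynomial (Fin n) K) where
  carrier := {f | ∃ d : ℕ, 0 < d ∧ iniProd T ^ d * f ∈ Ideal.span {g | g ∈ T}}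
  zero_mem' := ⟨1, Nat.one_pos, by simp⟩
  add_mem' := by
    rintro f g ⟨a, ha, hf⟩ ⟨b, _, hg⟩
    refine ⟨a + b, Nat.add_pos_left ha b, ?_⟩
    have h : iniProd T ^ (a + b) * (f + g) =
        iniProd T ^ b * (iniProd T ^ a * f) + iniProd T ^ a * (iniProd T ^ b * g) := by ring
    rw [h]
    exact Ideal.add_mem _ (Ideal.mul_mem_left _ _ hf) (Ideal.mul_mem_left _ _ hg)
  smul_mem' := by
    rintro r f ⟨a, ha, hf⟩
    refine ⟨a, ha, ?_⟩
    have h : iniProd T ^ a * (r • f) = r * (iniProd T ^ a * f) := by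
      rw [smul_eq_mul]; ring
    rw [h]
    exact Ideal.mul_mem_left _ _ hf

/-- The common zeros of `S` with coordinates in an extension field `E` of `K`. -/
def zeroSet (E : Type v) [Field E] [Algebra K E] (S : Set (MvPolynomial (Fin n) K)) :
    Set (Fin n → E) :=
  {η | ∀ f ∈ S, aeval η f = 0}

/-- An ideal is unmixed if its associated primes all have the same dimension. These include the
minimal primes, so the irreducible components of its zero set then all have the same dimension. -/
def IsUnmixed (I : Ideal (MvPolynomial (Fin n) K)) : Prop :=
  ∀ P ∈ associatedPrimes (MvPolynomial (Fin n) K) (MvPolynomial (Fin n) K ⧸ I),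
    ∀ Q ∈ associatedPrimes (MvPolynomial (Fin n) K) (MvPolynomial (Fin n) K ⧸ I),
      ringKrullDim (MvPolynomial (Fin n) K ⧸ P) = ringKrullDim (MvPolynomial (Fin n) K ⧸ Q)

end Algebra

/-! ### The machine model

A list machine over a field: its data are binary trees whose leaves are empty or hold one field
element, and its programs are finite terms that do not depend on the field and mention no field
constants but `0` and `1`. Every list operation, arithmetic operation and zero test counts as one
step. -/

/-- The data of the machine. -/
inductive Data (K : Type u) : Type u
  | nil : Data K
  | atom (a : K) : Data K
  | node (l r : Data K) : Data K

namespace Data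

variable {K : Type u}

/-- The left part of a pair (`nil` if the argument is not a pair). -/
def left : Data K → Data K
  | node l _ => l
  | _ => nil

/-- The right part of a pair (`nil` if the argument is not a pair). -/
def right : Data K → Data K
  | node _ r => r
  | _ => nil

/-- A list of data. -/
def ofList : List (Data K) → Data K
  | [] => nil
  | x :: l => node x (ofList l)

/-- A natural number, in unary. -/
def ofNat (m : ℕ) : Data K :=
  ofList (List.replicate m nil)

end Data

/-- Programs. Each computes a partial function of one datum. -/
inductive Code : Type
  /-- return the input -/
  | id : Code
  /-- return the empty datum -/
  | nil : Code
  /-- return the field element `0` -/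
  | zero : Code
  /-- return the field element `1` -/
  | one : Code
  /-- left part of a pair -/
  | left : Code
  /-- right part of a pair -/
  | right : Code
  /-- sum of a pair of field elements -/
  | add : Code
  /-- difference of a pair of field elements -/
  | sub : Code
  /-- product of a pair of field elements -/
  | mul : Code
  /-- quotient of a pair of field elements, the second one nonzero -/
  | div : Code
  /-- is the given field element zero? The answer is `nil` for no and a pair for yes. -/
  | isZero : Code
  /-- run both programs on the input and pair the results -/
  | pair (f g : Code) : Code
  /-- run `g`, then `f` on its result -/
  | comp (f g : Code) : Code
  /-- run the test `c` on the input, then `f` if the answer is not `nil` and `g` if it is -/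
  | branch (c f g : Code) : Code
  /-- as long as the answer of the test `c` on the current datum is not `nil`, replace the current
  datum by the result of `f` -/
  | loop (c f : Code) : Code

/-- `Eval P x y t`: on input `x`, the program `P` halts with output `y` after exactly `t` steps. -/
inductive Eval {K : Type u} [Field K] : Code → Data K → Data K → ℕ → Prop
  | id (x : Data K) : Eval Code.id x x 1
  | nil (x : Data K) : Eval Code.nil x Data.nil 1
  | zero (x : Data K) : Eval Code.zero x (Data.atom 0) 1
  | one (x : Data K) : Eval Code.one x (Data.atom 1) 1
  | left (x : Data K) : Eval Code.left x x.left 1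
  | right (x : Data K) : Eval Code.right x x.right 1
  | add (a b : K) : Eval Code.add (Data.node (Data.atom a) (Data.atom b)) (Data.atom (a + b)) 1
  | sub (a b : K) : Eval Code.sub (Data.node (Data.atom a) (Data.atom b)) (Data.atom (a - b)) 1
  | mul (a b : K) : Eval Code.mul (Data.node (Data.atom a) (Data.atom b)) (Data.atom (a * b)) 1
  | div (a b : K) (hb : b ≠ 0) :
      Eval Code.div (Data.node (Data.atom a) (Data.atom b)) (Data.atom (a / b)) 1
  | isZero_yes : Eval Code.isZero (Data.atom 0) (Data.node Data.nil Data.nil) 1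
  | isZero_no (a : K) (ha : a ≠ 0) : Eval Code.isZero (Data.atom a) Data.nil 1
  | pair {f g : Code} {x y z : Data K} {s t : ℕ} (hf : Eval f x y s) (hg : Eval g x z t) :
      Eval (Code.pair f g) x (Data.node y z) (s + t + 1)
  | comp {f g : Code} {x y z : Data K} {s t : ℕ} (hg : Eval g x y s) (hf : Eval f y z t) :
      Eval (Code.comp f g) x z (s + t + 1)
  | branch_yes {c f g : Code} {x b y : Data K} {s t : ℕ} (hc : Eval c x b s) (hb : b ≠ Data.nil)
      (hf : Eval f x y t) : Eval (Code.branch c f g) x y (s + t + 1)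
  | branch_no {c f g : Code} {x y : Data K} {s t : ℕ} (hc : Eval c x Data.nil s)
      (hg : Eval g x y t) : Eval (Code.branch c f g) x y (s + t + 1)
  | loop_stop {c f : Code} {x : Data K} {s : ℕ} (hc : Eval c x Data.nil s) :
      Eval (Code.loop c f) x x (s + 1)
  | loop_step {c f : Code} {x b y z : Data K} {s t r : ℕ} (hc : Eval c x b s) (hb : b ≠ Data.nil)
      (hf : Eval f x y t) (hl : Eval (Code.loop c f) y z r) :
      Eval (Code.loop c f) x z (s + t + r + 1)

/-! ### Polynomials as data of the machine -/

section Encoding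

variable {K : Type u} [Field K] {n : ℕ}

/-- The monomial with exponent vector `m`: the list of its `n` exponents. -/
def encodeMonomial (m : Fin n →₀ ℕ) : Data K :=
  Data.ofList (List.ofFn fun i => Data.ofNat (m i))

/-- A term: its monomial and its coefficient. -/
def encodeTerm (t : (Fin n →₀ ℕ) × K) : Data K :=
  Data.node (encodeMonomial t.1) (Data.atom t.2)

/-- `x` lists the terms of the polynomial `f`: each monomial that occurs in `f` once, in any order,
with its nonzero coefficient. -/
def IsPoly (f : MvPolynomial (Fin n) K) (x : Data K) : Prop :=
  ∃ l : List ((Fin n →₀ ℕ) × K), (l.map Prod.fst).Nodup ∧ (∀ t ∈ l, t.2 ≠ 0) ∧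
    (l.map fun t => monomial t.1 t.2).sum = f ∧ x = Data.ofList (l.map encodeTerm)

/-- `x` is a list of data that encode the members of the list `L` one by one, with `R a y` meaning
that `y` encodes `a`. -/
def IsListOf {α : Type u} (R : α → Data K → Prop) (L : List α) (x : Data K) : Prop :=
  ∃ ys : List (Data K), List.Forall₂ R L ys ∧ x = Data.ofList ys

/-- `x` encodes the input: the number `n` of variables, the degree bound `d`, and the list
`h_1, …, h_k` of polynomials. -/
def IsInput {k : ℕ} (d : ℕ) (h : Fin k → MvPolynomial (Fin n) K) (x : Data K) : Prop :=
  ∃ y : Data K, IsListOf IsPoly (List.ofFn h) y ∧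
    x = Data.node (Data.ofNat n) (Data.node (Data.ofNat d) y)

/-- `x` encodes the output: the list of the triangular sets, each a list of polynomials. -/
def IsOutput (A : List (List (MvPolynomial (Fin n) K))) (x : Data K) : Prop :=
  IsListOf (IsListOf IsPoly) A x

end Encoding

end TriDec

/-!
The bounds are doubly exponential in `n`, so it suffices to eliminate the variables one by one, the
greatest first, as long as one elimination takes polynomial time in the size of its data: `n` such steps
raise the size of the data to a power of the form `C ^ n`. The number `k` of polynomials enters only
before the first step, in which the given polynomials are replaced by a linear echelon form (`echelon`),
whose length is bounded by the number of monomials.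

The algorithm works with systems `P = 0`, `Q ≠ 0` in the remaining variables, together with the
polynomials already found for the triangular set. To eliminate the variable `Y`, either all of `P`
vanishes identically in `Y`, and `Y` becomes a parameter, or there is an `F` in `P` of some degree `m ≥ 1`
in `Y`, with leading coefficient `a`. In the latter case consider the product, over the roots `ζ` of `F`, of
`1 + s * (Q(ζ) * a * (Y - ζ) + s * (P₁(ζ) + s * (P₂(ζ) + ⋯)))`,
up to factors that are powers of `a`. It is a polynomial in the coefficients, and Newton's identities,
which require characteristic `0`, compute it from the power sums of the roots (`normP`). The factor of `ζ`
has a leading coefficient in `s` that depends on `Y` if and only if `ζ` is a solution of the system, and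
then it is `Y - ζ` up to a nonzero constant. Hence the zeros of the leading coefficient of the whole
product are exactly the solutions over the given point (`normAt_lc`), and this coefficient becomes the new
polynomial of the triangular set. The degree of `F`, that of the product in `s` and that of its leading
coefficient in `Y` depend on the point; for each possibility they are enforced by equations and an
inequation in the remaining variables, which form a new system (`sysItems`). The new systems describe
the projection of the old one: `sysItems_extends` and `exists_sysItems`. By induction, generic zeros
of the triangular sets are zeros of the given polynomials (`stage_sound`), and every zero of these is a
zero of one of the triangular sets at which the initials do not vanish (`stage_cover`).

By construction, the initials do not vanish at the points whose parameters are free over the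
preceding coordinates (`GenReg`). Applied to generic points of prime ideals that contain no nonzero
polynomial in the parameters, this gives regularity (`GenReg.isRegular`). By pseudo-division, nonzero
polynomials in the parameters are not zero divisors modulo the saturation ideal of a regular set
(`mem_sat_of_param_mul`). Hence the given polynomials belong to the radicals of the saturation ideals
(`exists_pow_mem_sat`), and every associated prime has a generic point at which the parameters form a
transcendence basis, so that its dimension is the number of parameters (`GenReg.isUnmixed`); the dimension
is the transcendence degree by Noether normalization (`ringKrullDim_eq_trdeg`).

For the running time, `Ok K I D f` states that the program `I` computes `f` on the domain `D` within a
fixed power of the size of the data. It is stable under composition and under folds whose intermediate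
values are bounded, and `stage_spec` provides the bounds for the iterated elimination. The polynomials
of a system are lists of terms with exponent vectors in which the greatest remaining variable stands
first; those of its triangular set have the order of the input.
-/
universe w

namespace TriDec

set_option linter.unusedSectionVars false

/-! ### Functions computed by programs in polynomially bounded time -/

/-- Objects that are represented by data of the machine, with a hereditary size bound: `Bd B a`
says that every list and every unary number inside `a` has length at most `B`. -/
class Dat (K : Type u) (α : Type*) where
  enc : α → Data K
  Bd : ℕ → α → Prop
  mono : ∀ {B B' : ℕ} {a : α}, B ≤ B' → Bd B a → Bd B' a

open Dat

section Instances

variable (K : Type u)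

instance Dat.field : Dat K K := ⟨Data.atom, fun _ _ => True, fun _ _ => trivial⟩

instance Dat.nat : Dat K ℕ := ⟨Data.ofNat, fun B n => n ≤ B, fun h h' => h'.trans h⟩

instance Dat.unit : Dat K Unit := ⟨fun _ => Data.nil, fun _ _ => True, fun _ _ => trivial⟩

instance Dat.bool : Dat K Bool :=
  ⟨fun b => if b then Data.node Data.nil Data.nil else Data.nil, fun _ _ => True,
    fun _ _ => trivial⟩

instance Dat.list {α : Type*} [Dat K α] : Dat K (List α) :=
  ⟨fun l => Data.ofList (l.map (enc (K := K))),
    fun B l => l.length ≤ B ∧ ∀ x ∈ l, Bd K B x,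
    fun h h' => ⟨h'.1.trans h, fun x hx => mono h (h'.2 x hx)⟩⟩

instance Dat.prod {α β : Type*} [Dat K α] [Dat K β] : Dat K (α × β) :=
  ⟨fun p => Data.node (enc p.1) (enc p.2), fun B p => Bd K B p.1 ∧ Bd K B p.2,
    fun h h' => ⟨mono h h'.1, mono h h'.2⟩⟩

end Instances

/-- A program together with the exponent of its time bound. -/
structure Impl where
  code : Code
  e : ℕ

/-- On the domain `D`, the implementation `I` computes `f`: if `D B a` then both the time spent on
`a` and the size of `f a` are at most `B ^ (I.e + 1)`. The exponent depends neither on the field nor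
on `B`; `D = Bd` is the ordinary notion of computability in polynomial time. -/
def Ok (K : Type u) [Field K] {α β : Type*} [Dat K α] [Dat K β] (I : Impl) (D : ℕ → α → Prop)
    (f : α → β) : Prop :=
  ∀ B a, 2 ≤ B → D B a → Bd K (B ^ (I.e + 1)) (f a) ∧
    ∃ s ≤ B ^ (I.e + 1), Eval I.code (enc a) (enc (f a) : Data K) s

theorem two_le_pow_succ {B : ℕ} (hB : 2 ≤ B) (e : ℕ) : 2 ≤ B ^ (e + 1) :=
  hB.trans (Nat.le_self_pow (by omega) B)

theorem self_le_pow_succ {B : ℕ} (e : ℕ) : B ≤ B ^ (e + 1) :=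
  Nat.le_self_pow (by omega) B

theorem pow_succ_mono {B : ℕ} (hB : 2 ≤ B) {e e' : ℕ} (h : e ≤ e') : B ^ (e + 1) ≤ B ^ (e' + 1) :=
  Nat.pow_le_pow_right (by omega) (by omega)

theorem add_le_pow_succ {B : ℕ} (hB : 2 ≤ B) {s t d e : ℕ} (hs : s ≤ B ^ (d + 1))
    (ht : t ≤ B ^ (e + 1)) : s + t + 1 ≤ B ^ (d + e + 2 + 1) := by
  have h1 := two_le_pow_succ hB d
  have h2 := two_le_pow_succ hB e
  have : B ^ (d + e + 2 + 1) = B ^ (d + 1) * B ^ (e + 1) * B := by ring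
  rw [this]
  have h3 : B ^ (d + 1) + B ^ (e + 1) ≤ B ^ (d + 1) * B ^ (e + 1) := by nlinarith
  calc s + t + 1 ≤ (B ^ (d + 1) * B ^ (e + 1)) * 2 := by omega
    _ ≤ _ := Nat.mul_le_mul_left _ hB

namespace Ok

variable {K : Type u} [Field K] {α β γ δ : Type*} [Dat K α] [Dat K β] [Dat K γ] [Dat K δ]
  {I J : Impl} {D : ℕ → α → Prop} {f : α → β}

/-- The implementation `I` on a domain whose bound is the power `k + 1` of the original one. -/
def _root_.TriDec.Impl.up (I : Impl) (k : ℕ) : Impl := ⟨I.code, k + I.e + k * I.e⟩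

theorem of (h : Ok K I D f) {D' : ℕ → α → Prop} (k : ℕ)
    (hD : ∀ B a, 2 ≤ B → D' B a → D (B ^ (k + 1)) a) : Ok K (I.up k) D' f := by
  intro B a hB ha
  have e : (B ^ (k + 1)) ^ (I.e + 1) = B ^ ((I.up k).e + 1) := by
    rw [← pow_mul]; congr 1; simp [Impl.up]; ring
  have := h _ a (two_le_pow_succ hB k) (hD B a hB ha)
  rwa [e] at this

theorem mono (h : Ok K I D f) {D' : ℕ → α → Prop}
    (hD : ∀ B a, 2 ≤ B → D' B a → D B a) : Ok K I D' f :=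
  fun B a hB ha => h B a hB (hD B a hB ha)

theorem congr (h : Ok K I D f) {g : α → β} (hg : ∀ a, g a = f a) : Ok K I D g := by
  rwa [show g = f from funext hg]

/-- Program composition: first `I`, then `J`. -/
def _root_.TriDec.Impl.comp (J I : Impl) : Impl :=
  ⟨Code.comp J.code I.code, I.e + (J.up I.e).e + 2⟩

/-- Composition when the second function is only computed on the domain `D2`. The size of the
intermediate value is a power of `B`, hence the time bounds are composed by `Impl.up`. -/
theorem compD {g : β → γ} {D2 : ℕ → β → Prop} (hg : Ok K J D2 g) (hf : Ok K I D f)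
    (h : ∀ B a, 2 ≤ B → D B a → D2 (B ^ (I.e + 1)) (f a)) :
    Ok K (J.comp I) D (fun a => g (f a)) := by
  intro B a hB ha
  obtain ⟨_, s, hs, hs'⟩ := hf B a hB ha
  obtain ⟨h2, t, ht, ht'⟩ := hg _ _ (two_le_pow_succ hB _) (h B a hB ha)
  have e : (B ^ (I.e + 1)) ^ (J.e + 1) = B ^ ((J.up I.e).e + 1) := by
    rw [← pow_mul]; congr 1; simp [Impl.up]; ring
  rw [e] at h2 ht
  refine ⟨Dat.mono (pow_succ_mono hB ?_) h2, s + t + 1, add_le_pow_succ hB hs ht,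
    Eval.comp hs' ht'⟩
  simp only [Impl.comp]; omega

theorem app {g : β → γ} (hg : Ok K J (Bd K) g) (hf : Ok K I D f) :
    Ok K (J.comp I) D (fun a => g (f a)) :=
  compD hg hf fun B a hB ha => (hf B a hB ha).1

/-- Both programs on the same input, results paired. -/
def _root_.TriDec.Impl.pair (I J : Impl) : Impl := ⟨Code.pair I.code J.code, I.e + J.e + 2⟩

theorem pair {g : α → γ} (hf : Ok K I D f) (hg : Ok K J D g) :
    Ok K (I.pair J) D (fun a => (f a, g a)) := by
  intro B a hB ha
  obtain ⟨h1, s, hs, hs'⟩ := hf B a hB ha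
  obtain ⟨h2, t, ht, ht'⟩ := hg B a hB ha
  exact ⟨⟨Dat.mono (pow_succ_mono hB (by simp only [Impl.pair]; omega)) h1,
    Dat.mono (pow_succ_mono hB (by simp only [Impl.pair]; omega)) h2⟩,
    s + t + 1, add_le_pow_succ hB hs ht, Eval.pair hs' ht'⟩

theorem app2 {g : β × γ → δ} {f' : α → γ} {I' : Impl} (hg : Ok K J (Bd K) g) (hf : Ok K I D f)
    (hf' : Ok K I' D f') : Ok K (J.comp (I.pair I')) D (fun a => g (f a, f' a)) :=
  hg.app (hf.pair hf')

/-- Case distinction. -/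
def _root_.TriDec.Impl.ite (C I J : Impl) : Impl :=
  ⟨Code.branch C.code I.code J.code, C.e + (I.e + J.e) + 2⟩

theorem ite {C : Impl} {c : α → Bool} {g : α → β} (hc : Ok K C D c) (hf : Ok K I D f)
    (hg : Ok K J D g) : Ok K (C.ite I J) D (fun a => if c a then f a else g a) := by
  intro B a hB ha
  obtain ⟨_, r, hr, hr'⟩ := hc B a hB ha
  cases h : c a with
  | true =>
    obtain ⟨h1, s, hs, hs'⟩ := hf B a hB ha
    rw [h] at hr'
    simp only [h, if_true]
    exact ⟨Dat.mono (pow_succ_mono hB (by simp only [Impl.ite]; omega)) h1,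
      r + s + 1, add_le_pow_succ hB hr (hs.trans (pow_succ_mono hB (by omega))),
      Eval.branch_yes hr' (by simp [Dat.enc]) hs'⟩
  | false =>
    obtain ⟨h1, s, hs, hs'⟩ := hg B a hB ha
    rw [h] at hr'
    simp only [h, Bool.false_eq_true, if_false]
    exact ⟨Dat.mono (pow_succ_mono hB (by simp only [Impl.ite]; omega)) h1,
      r + s + 1, add_le_pow_succ hB hr (hs.trans (pow_succ_mono hB (by omega))),
      Eval.branch_no hr' hs'⟩

/-- A single instruction, whose result is not larger than its input. -/
theorem prim {c : Code} {D : ℕ → α → Prop} {f : α → β}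
    (h : ∀ B a, 2 ≤ B → D B a → Bd K (B ^ (0 + 1)) (f a))
    (h' : ∀ a, Eval c (enc a) (enc (f a) : Data K) 1) : Ok K ⟨c, 0⟩ D f :=
  fun B a hB ha => ⟨h B a hB ha, 1, by simp; omega, h' a⟩

theorem id : Ok K ⟨Code.id, 0⟩ (Bd K) (fun a : α => a) :=
  prim (fun _ _ _ h => by simpa using h) fun a => Eval.id _

theorem fst : Ok K ⟨Code.left, 0⟩ (Bd K) (fun a : α × β => a.1) :=
  prim (fun _ _ _ h => by simpa using h.1) fun a => Eval.left _

theorem snd : Ok K ⟨Code.right, 0⟩ (Bd K) (fun a : α × β => a.2) :=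
  prim (fun _ _ _ h => by simpa using h.2) fun a => Eval.right _

theorem empty {D : ℕ → α → Prop} : Ok K ⟨Code.nil, 0⟩ D (fun _ : α => ([] : List β)) :=
  prim (fun _ _ _ _ => ⟨by simp, by simp⟩) fun _ => Eval.nil _

theorem unit {D : ℕ → α → Prop} : Ok K ⟨Code.nil, 0⟩ D (fun _ : α => ()) :=
  prim (fun _ _ _ _ => trivial) fun _ => Eval.nil _

theorem natZero {D : ℕ → α → Prop} : Ok K ⟨Code.nil, 0⟩ D (fun _ : α => 0) :=
  prim (fun _ _ _ _ => Nat.zero_le _) fun _ => Eval.nil _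

theorem bfalse {D : ℕ → α → Prop} : Ok K ⟨Code.nil, 0⟩ D (fun _ : α => false) :=
  prim (fun _ _ _ _ => trivial) fun _ => Eval.nil _

theorem zero {D : ℕ → α → Prop} : Ok K ⟨Code.zero, 0⟩ D (fun _ : α => (0 : K)) :=
  prim (fun _ _ _ _ => trivial) fun _ => Eval.zero _

theorem one {D : ℕ → α → Prop} : Ok K ⟨Code.one, 0⟩ D (fun _ : α => (1 : K)) :=
  prim (fun _ _ _ _ => trivial) fun _ => Eval.one _

theorem btrue {D : ℕ → α → Prop} :
    Ok K ⟨Code.pair Code.nil Code.nil, 2⟩ D (fun _ : α => true) :=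
  fun B _ hB _ => ⟨trivial, 3, by
    have := Nat.pow_le_pow_left hB 3
    simp only [Nat.reduceAdd]; omega, Eval.pair (Eval.nil _) (Eval.nil _)⟩

theorem add : Ok K ⟨Code.add, 0⟩ (Bd K) (fun a : K × K => a.1 + a.2) :=
  prim (fun _ _ _ _ => trivial) fun _ => Eval.add _ _

theorem sub : Ok K ⟨Code.sub, 0⟩ (Bd K) (fun a : K × K => a.1 - a.2) :=
  prim (fun _ _ _ _ => trivial) fun _ => Eval.sub _ _

theorem mul : Ok K ⟨Code.mul, 0⟩ (Bd K) (fun a : K × K => a.1 * a.2) :=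
  prim (fun _ _ _ _ => trivial) fun _ => Eval.mul _ _

open Classical in
theorem isZero : Ok K ⟨Code.isZero, 0⟩ (Bd K) (fun a : K => decide (a = 0)) := by
  refine prim (fun _ _ _ _ => trivial) fun a => ?_
  by_cases h : a = 0
  · subst h; simpa [Dat.enc] using Eval.isZero_yes
  · simpa [Dat.enc, h] using Eval.isZero_no a h

/-- Division, with `a / 0 = 0`. -/
theorem div : Ok K ⟨Code.branch (Code.comp Code.isZero Code.right) Code.zero Code.div, 3⟩ (Bd K)
    (fun a : K × K => a.1 / a.2) := by
  rintro B ⟨a, b⟩ hB -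
  have := Nat.pow_le_pow_left hB 4
  refine ⟨trivial, 5, by simp only [Nat.reduceAdd]; omega, ?_⟩
  by_cases h : b = 0
  · subst h
    have := Eval.branch_yes (g := Code.div) (Eval.comp (Eval.right (Data.node (Data.atom a) (Data.atom (0 : K))))
      Eval.isZero_yes) (by simp) (Eval.zero _)
    simpa [Dat.enc] using this
  · exact Eval.branch_no (Eval.comp (Eval.right _) (Eval.isZero_no b h)) (Eval.div a b h)

theorem cons : Ok K ⟨Code.id, 1⟩ (Bd K) (fun a : α × List α => a.1 :: a.2) := by
  rintro B ⟨a, l⟩ hB h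
  have h2 : B + B ≤ B ^ 2 := by nlinarith
  obtain ⟨h1, hl, hl'⟩ := h
  refine ⟨⟨by simp only [List.length_cons, Nat.reduceAdd] at *; omega, fun x hx => ?_⟩, 1,
    by simp only [Nat.reduceAdd]; omega, Eval.id _⟩
  rcases List.mem_cons.1 hx with rfl | hx
  · exact Dat.mono (by simp only [Nat.reduceAdd]; omega) h1
  · exact Dat.mono (by simp only [Nat.reduceAdd]; omega) (hl' x hx)

theorem tail : Ok K ⟨Code.right, 0⟩ (Bd K) (fun l : List α => l.tail) := by
  refine prim (fun B l _ h => ⟨?_, fun x hx => ?_⟩) fun l => ?_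
  · have := h.1; simp; omega
  · simpa using h.2 x (List.mem_of_mem_tail hx)
  · have := Eval.right (enc l : Data K)
    cases l <;> exact this

theorem head (d : α) (hd : (enc d : Data K) = Data.nil) (hd' : Bd K 0 d) :
    Ok K ⟨Code.left, 0⟩ (Bd K) (fun l : List α => l.headD d) := by
  refine prim (fun B l _ h => ?_) fun l => ?_
  · cases l with
    | nil => exact Dat.mono (Nat.zero_le _) hd'
    | cons x l => simpa using h.2 x (by simp)
  · have := Eval.left (enc l : Data K)
    cases l with
    | nil =>
      change Eval Code.left (enc ([] : List α)) (enc d) 1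
      rw [hd]; exact this
    | cons x l => exact this

theorem headNat : Ok K ⟨Code.left, 0⟩ (Bd K) (fun l : List ℕ => l.headD 0) :=
  head 0 rfl le_rfl

theorem headList : Ok K ⟨Code.left, 0⟩ (Bd K) (fun l : List (List α) => l.headD []) :=
  head [] rfl ⟨le_rfl, by simp⟩

theorem isNil : Ok K ⟨Code.branch Code.id Code.nil (Code.pair Code.nil Code.nil), 2⟩ (Bd K)
    (fun l : List α => l.isEmpty) := by
  intro B l hB _
  have := Nat.pow_le_pow_left hB 3
  cases l with
  | nil => exact ⟨trivial, 5, by simp only [Nat.reduceAdd]; omega,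
      Eval.branch_no (Eval.id _) (Eval.pair (Eval.nil _) (Eval.nil _))⟩
  | cons x l => exact ⟨trivial, 3, by simp only [Nat.reduceAdd]; omega,
      Eval.branch_yes (Eval.id _) (by simp [Dat.enc, Data.ofList]) (Eval.nil _)⟩

theorem natToList : Ok K ⟨Code.id, 0⟩ (Bd K) (fun n : ℕ => List.replicate n ()) :=
  prim (fun B n _ h => ⟨by rw [List.length_replicate, zero_add, pow_one]; exact h, fun _ _ => trivial⟩) fun n => by
    simpa [Dat.enc, Data.ofNat] using Eval.id (Data.ofNat n : Data K)

theorem natOfList : Ok K ⟨Code.id, 0⟩ (Bd K) (fun l : List Unit => l.length) :=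
  prim (fun B l _ h => by rw [zero_add, pow_one]; exact h.1) fun l => by
    have : (enc l : Data K) = enc l.length := by
      simp only [Dat.enc, Data.ofNat]
      congr 1
      exact List.eq_replicate_iff.2 ⟨by simp, by simp⟩
    rw [this]; exact Eval.id _

theorem natToZeros : Ok K ⟨Code.id, 0⟩ (Bd K) (fun n : ℕ => List.replicate n 0) :=
  prim (fun B n _ h => ⟨by rw [List.length_replicate, zero_add, pow_one]; exact h, fun x hx => by
    rw [List.eq_of_mem_replicate hx]; exact Nat.zero_le _⟩) fun n => by
    simpa [Dat.enc, Data.ofNat, Data.ofList] using Eval.id (Data.ofNat n : Data K)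

/-! ### Folding over a list -/

/-- The program that runs `J` over a list with an accumulator and a fixed context. -/
def _root_.TriDec.Impl.foldl (J : Impl) (k : ℕ) : Impl :=
  ⟨Code.comp (Code.comp Code.left Code.right)
    (Code.loop (Code.comp Code.right Code.right)
      (Code.pair Code.left (Code.pair
        (Code.comp J.code (Code.pair Code.left (Code.pair (Code.comp Code.left Code.right)
          (Code.comp Code.left (Code.comp Code.right Code.right)))))
        (Code.comp Code.right (Code.comp Code.right Code.right))))),
    (k + (J.up k).e + 2) + (5 + (k + 5 + 2) + 2) + 2⟩

/-- The `29` and `8` are the costs of the pairings and projections around each call of `J` and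
around the loop. -/
theorem eval_foldl {g : γ × β × δ → β} {J : Impl} {S : ℕ} (c : γ) (l : List δ) (b : β)
    (h : ∀ l1 x l2, l = l1 ++ x :: l2 → ∃ s ≤ S, Eval J.code
      (enc (c, l1.foldl (fun b x => g (c, b, x)) b, x) : Data K)
      (enc (g (c, l1.foldl (fun b x => g (c, b, x)) b, x))) s) :
    ∃ s ≤ l.length * (S + 29) + 8, Eval (J.foldl 0).code (enc (c, b, l) : Data K)
      (enc (l.foldl (fun b x => g (c, b, x)) b)) s := by
  have key : ∃ s ≤ l.length * (S + 29) + 4, Eval (Code.loop (Code.comp Code.right Code.right)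
      (Code.pair Code.left (Code.pair
        (Code.comp J.code (Code.pair Code.left (Code.pair (Code.comp Code.left Code.right)
          (Code.comp Code.left (Code.comp Code.right Code.right)))))
        (Code.comp Code.right (Code.comp Code.right Code.right)))))
      (enc (c, b, l) : Data K) (enc (c, l.foldl (fun b x => g (c, b, x)) b, ([] : List δ))) s := by
    induction l generalizing b with
    | nil => exact ⟨4, by simp, Eval.loop_stop (Eval.comp (Eval.right _) (Eval.right _))⟩
    | cons x l ih =>
      obtain ⟨s, hs, hs'⟩ := h [] x l rfl
      obtain ⟨t, ht, ht'⟩ := ih (g (c, b, x)) fun l1 y l2 e => by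
        obtain ⟨s, hs, hs'⟩ := h (x :: l1) y l2 (by simp [e])
        exact ⟨s, hs, hs'⟩
      refine ⟨_, ?_, Eval.loop_step (Eval.comp (Eval.right _) (Eval.right _)) ?_
        (Eval.pair (Eval.left _) (Eval.pair (Eval.comp (Eval.pair (Eval.left _)
          (Eval.pair (Eval.comp (Eval.right _) (Eval.left _)) (Eval.comp
            (Eval.comp (Eval.right _) (Eval.right _)) (Eval.left _)))) hs')
          (Eval.comp (Eval.comp (Eval.right _) (Eval.right _)) (Eval.right _)))) ht'⟩
      · simp only [List.length_cons, Nat.add_mul, Nat.one_mul]; omega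
      · simp [Dat.enc, Data.ofList, Data.right]
  obtain ⟨s, hs, hs'⟩ := key
  exact ⟨_, by omega, Eval.comp hs' (Eval.comp (Eval.right _) (Eval.left _))⟩

/-- A fold takes polynomially bounded time if all its intermediate values satisfy a bound
`B ^ (k + 1)` fixed in advance. Bounding the size of one step by a power of the size of its argument
would not be enough, since the powers would accumulate. -/
theorem foldl {g : γ × β × δ → β} {D' : ℕ → γ × β × δ → Prop} (hJ : Ok K J D' g) (k : ℕ)
    {D : ℕ → γ × β × List δ → Prop}
    (hinv : ∀ B c b l, 2 ≤ B → D B (c, b, l) → l.length ≤ B ^ (k + 1) ∧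
      Bd K (B ^ (k + 1)) (l.foldl (fun b x => g (c, b, x)) b) ∧
      ∀ l1 x l2, l = l1 ++ x :: l2 →
        D' (B ^ (k + 1)) (c, l1.foldl (fun b x => g (c, b, x)) b, x)) :
    Ok K (J.foldl k) D (fun p => p.2.2.foldl (fun b x => g (p.1, b, x)) p.2.1) := by
  rintro B ⟨c, b, l⟩ hB ha
  obtain ⟨h1, h2, h3⟩ := hinv B c b l hB ha
  have e : (B ^ (k + 1)) ^ (J.e + 1) = B ^ ((J.up k).e + 1) := by
    rw [← pow_mul]; congr 1; simp [Impl.up]; ring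
  obtain ⟨s, hs, hs'⟩ := eval_foldl c l b (S := B ^ ((J.up k).e + 1)) fun l1 x l2 hl =>
    e ▸ (hJ _ _ (two_le_pow_succ hB k) (h3 l1 x l2 hl)).2
  refine ⟨Dat.mono (pow_succ_mono hB (by simp only [Impl.foldl]; omega)) h2, s, ?_, hs'⟩
  refine hs.trans ?_
  have h32 : 29 ≤ B ^ (4 + 1) := by have := Nat.pow_le_pow_left hB 5; simp only [Nat.reduceAdd]; omega
  have h4 : B ^ ((J.up k).e + 1) + 29 ≤ B ^ ((J.up k).e + 5 + 2) := by
    have := add_le_pow_succ hB (le_refl (B ^ ((J.up k).e + 1))) h32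
    have := pow_succ_mono hB (show (J.up k).e + 4 + 2 ≤ (J.up k).e + 5 + 1 by omega)
    rw [show (J.up k).e + 5 + 2 = (J.up k).e + 5 + 1 + 1 by ring]
    omega
  have h5 : l.length * (B ^ ((J.up k).e + 1) + 29) ≤ B ^ (k + (J.up k).e + 7 + 1) :=
    (Nat.mul_le_mul h1 h4).trans (by rw [← pow_add]; exact Nat.pow_le_pow_right (by omega) (by omega))
  have h6 := add_le_pow_succ hB h5 h32
  refine le_trans (by omega) (h6.trans (pow_succ_mono hB ?_))
  simp only [Impl.foldl]; omega

end Ok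

open Dat

/-! ### Programs for lists, unary numbers and exponent vectors

A definition whose name ends in `I` is an implementation of the function with the name without `I`:
a program, chosen before the field, together with the proof that it computes the function over every
field in polynomially bounded time. -/

namespace Ok

variable {K : Type u} [Field K] {α β γ δ : Type*} [Dat K α] [Dat K β] [Dat K γ] [Dat K δ]
  {I J : Impl} {D : ℕ → α → Prop} {f : α → β}

theorem fstD {D : ℕ → α × β → Prop} (h : ∀ B a, D B a → Bd K B a.1) :
    Ok K ⟨Code.left, 0⟩ D (fun a : α × β => a.1) :=
  prim (fun B a _ ha => by simpa using h B a ha) fun _ => Eval.left _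

theorem sndD {D : ℕ → α × β → Prop} (h : ∀ B a, D B a → Bd K B a.2) :
    Ok K ⟨Code.right, 0⟩ D (fun a : α × β => a.2) :=
  prim (fun B a _ ha => by simpa using h B a ha) fun _ => Eval.right _

def _root_.TriDec.Impl.reverse : Impl :=
  (((⟨Code.id, 1⟩ : Impl).comp (Impl.pair (Impl.comp ⟨Code.right, 0⟩ ⟨Code.right, 0⟩)
    (Impl.comp ⟨Code.left, 0⟩ ⟨Code.right, 0⟩))).foldl 0).comp
    (Impl.pair ⟨Code.nil, 0⟩ (Impl.pair ⟨Code.nil, 0⟩ ⟨Code.id, 0⟩))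

theorem foldl_cons_eq (l acc : List α) : l.foldl (fun b x => x :: b) acc = l.reverse ++ acc := by
  induction l generalizing acc <;> simp_all

omit [Field K] in
theorem bd_append {B C : ℕ} {l l' : List α} (h : Bd K B l) (h' : Bd K C l') :
    Bd K (B + C) (l ++ l') :=
  ⟨by rw [List.length_append]; exact Nat.add_le_add h.1 h'.1, fun x hx => by
    rcases List.mem_append.1 hx with hx | hx
    · exact Dat.mono (by omega) (h.2 x hx)
    · exact Dat.mono (by omega) (h'.2 x hx)⟩

omit [Field K] in
theorem bd_sub {B : ℕ} {l l' : List α} (h : Bd K B l) (hl : l'.length ≤ l.length)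
    (hs : ∀ x ∈ l', x ∈ l) : Bd K B l' := ⟨hl.trans h.1, fun x hx => h.2 x (hs x hx)⟩

theorem reverse : Ok K Impl.reverse (Bd K) (fun l : List α => l.reverse) := by
  have step : Ok K _ (Bd K) (fun p : Unit × List α × α => p.2.2 :: p.2.1) :=
    cons.app2 (snd.app snd) (fst.app snd)
  refine ((step.foldl 0 (D := fun B p => p.2.1 = [] ∧ Bd K B p.2.2) ?_).compD
    (unit.pair (empty.pair id)) ?_).congr (f := fun l : List α => l.foldl (fun b x => x :: b) []) ?_
  · rintro B c b l hB ⟨rfl, h⟩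
    simp only [foldl_cons_eq, zero_add, pow_one, List.append_nil]
    refine ⟨h.1, bd_sub h (by simp) (by simp), ?_⟩
    rintro l1 x l2 rfl
    exact ⟨trivial, bd_sub h (by simp) (by simp +contextual), h.2 _ (by simp)⟩
  · exact fun B a hB h => ⟨rfl, Dat.mono (self_le_pow_succ _) h⟩
  · intro l; rw [foldl_cons_eq]; simp

theorem foldl_map_eq (g : α → β) (l : List α) (acc : List β) :
    l.foldl (fun b x => g x :: b) acc = (l.map g).reverse ++ acc := by
  induction l generalizing acc <;> simp_all

/-- One step of the program for `List.map`. -/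
def _root_.TriDec.Impl.mapStep (J : Impl) : Impl :=
  (⟨Code.id, 1⟩ : Impl).comp (Impl.pair (J.comp (Impl.pair ⟨Code.left, 0⟩
    (Impl.comp ⟨Code.right, 0⟩ ⟨Code.right, 0⟩))) (Impl.comp ⟨Code.left, 0⟩ ⟨Code.right, 0⟩))

/-- The program for `List.map`. -/
def _root_.TriDec.Impl.map (J : Impl) (k : ℕ) : Impl :=
  Impl.reverse.comp (((J.mapStep.foldl J.e).comp
    (Impl.pair ⟨Code.left, 0⟩ (Impl.pair ⟨Code.nil, 0⟩ ⟨Code.right, 0⟩))).up k)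

theorem map {g : γ × α → β} {D' : ℕ → γ × α → Prop} (hJ : Ok K J D' g)
    (hm : ∀ B B' a, B ≤ B' → D' B a → D' B' a) (k : ℕ) {D : ℕ → γ × List α → Prop}
    (h : ∀ B c l, 2 ≤ B → D B (c, l) → Bd K (B ^ (k + 1)) c ∧ Bd K (B ^ (k + 1)) l ∧
      ∀ x ∈ l, D' (B ^ (k + 1)) (c, x)) :
    Ok K (J.map k) D (fun p => p.2.map fun x => g (p.1, x)) := by
  have h1 : Ok K _ (fun B (p : γ × List β × α) => Bd K B p ∧ D' B (p.1, p.2.2))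
      (fun p => g (p.1, p.2.2)) :=
    hJ.compD ((fstD fun _ _ h => h.1.1).pair (snd.app (sndD fun _ _ h => h.1.2)))
      fun B a hB h => hm B _ _ (self_le_pow_succ _) h.2
  have step : Ok K J.mapStep (fun B (p : γ × List β × α) => Bd K B p ∧ D' B (p.1, p.2.2))
      (fun p => g (p.1, p.2.2) :: p.2.1) := cons.app2 h1 (fst.app (sndD fun _ _ h => h.1.2))
  have h2 := step.foldl J.e (D := fun B p => p.2.1 = [] ∧ (Bd K B p.1 ∧ Bd K B p.2.2) ∧
    ∀ x ∈ p.2.2, D' B (p.1, x)) (by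
      rintro B c b l hB ⟨hb, ⟨hc, hl⟩, hx⟩
      dsimp only at hb hc hl hx
      subst hb
      have key : ∀ l' : List α, l'.length ≤ l.length → (∀ x ∈ l', x ∈ l) →
          Bd K (B ^ (J.e + 1)) (l'.foldl (fun b x => g (c, x) :: b) []) := by
        intro l' h1 h2
        rw [foldl_map_eq (fun x => g (c, x)), List.append_nil]
        refine ⟨?_, fun y hy => ?_⟩
        · simpa using h1.trans (hl.1.trans (self_le_pow_succ _))
        · obtain ⟨x, hx', rfl⟩ := by simpa using hy
          exact (hJ B _ hB (hx x (h2 x hx'))).1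
      refine ⟨hl.1.trans (self_le_pow_succ _), key l le_rfl fun _ h => h, ?_⟩
      rintro l1 x l2 rfl
      refine ⟨⟨Dat.mono (self_le_pow_succ _) hc, key l1 (by simp) (by simp +contextual), ?_⟩, ?_⟩
      · exact Dat.mono (self_le_pow_succ _) (hl.2 x (by simp))
      · exact hm B _ _ (self_le_pow_succ _) (hx x (by simp)))
  have h3 := (h2.compD (D := fun B (p : γ × List α) => (Bd K B p.1 ∧ Bd K B p.2) ∧
    ∀ x ∈ p.2, D' B (p.1, x)) ((fstD fun _ _ h => h.1.1).pair (empty.pair (sndD fun _ _ h => h.1.2)))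
    fun B a hB h => ⟨rfl, ⟨Dat.mono (self_le_pow_succ _) h.1.1,
      Dat.mono (self_le_pow_succ _) h.1.2⟩, fun x hx => hm B _ _ (self_le_pow_succ _) (h.2 x hx)⟩)
  refine (reverse.app (h3.of k fun B a hB hD => ?_)).congr fun p => ?_
  · obtain ⟨h1, h2, h3⟩ := h B a.1 a.2 hB hD
    exact ⟨⟨h1, h2⟩, h3⟩
  · rw [foldl_map_eq (fun x => g (p.1, x))]; simp

theorem map' {g : γ × α → β} (hJ : Ok K J (Bd K) g) :
    Ok K (J.map 0) (Bd K) (fun p : γ × List α => p.2.map fun x => g (p.1, x)) :=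
  hJ.map (fun _ _ _ h h' => Dat.mono h h') 0 fun B c l hB h => by
    simp only [zero_add, pow_one]
    exact ⟨h.1, h.2, fun x hx => ⟨h.1, h.2.2 x hx⟩⟩

/-- `List.map` on a list and with a context that are computed from the input. -/
theorem mapOf {g : γ × δ → β} (hJ : Ok K J (Bd K) g) {c : α → γ} {l : α → List δ} {I1 I2 : Impl}
    (hc : Ok K I1 D c) (hl : Ok K I2 D l) :
    Ok K ((J.map 0).comp (I1.pair I2)) D (fun a => (l a).map fun x => g (c a, x)) :=
  hJ.map'.app2 hc hl

end Ok

open Ok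

def consStepI : {I : Impl // ∀ (K : Type u) [Field K] {α : Type v} [Dat K α],
    Ok K I (Bd K) (fun p : Unit × List α × α => p.2.2 :: p.2.1)} :=
  ⟨_, fun _ _ _ _ => cons.app2 (snd.app snd) (fst.app snd)⟩

def appendI : {I : Impl // ∀ (K : Type u) [Field K] {α : Type v} [Dat K α],
    Ok K I (Bd K) (fun p : List α × List α => p.1 ++ p.2)} :=
  ⟨_, fun K _ α _ => (((consStepI.2 K).foldl 1 (D := Bd K) (by
    rintro B c b l hB ⟨hc, hb, hl⟩
    simp only [foldl_cons_eq]
    have hB' : B ≤ B ^ (1 + 1) := self_le_pow_succ _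
    have h2 : B + B ≤ B ^ (1 + 1) := by
      rw [pow_succ, pow_one, ← two_mul]; exact Nat.mul_le_mul_right B hB
    refine ⟨hl.1.trans hB', Dat.mono h2 (bd_append (bd_sub hl (by simp) (by simp)) hb), ?_⟩
    rintro l1 x l2 rfl
    exact ⟨trivial, Dat.mono h2 (bd_append (bd_sub hl (by simp) (by simp +contextual)) hb),
      Dat.mono hB' (hl.2 x (by simp))⟩)).app2 unit (snd.pair (reverse.app fst))).congr
        fun p => by simp⟩

def flattenI : {I : Impl // ∀ (K : Type u) [Field K] {α : Type v} [Dat K α],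
    Ok K I (Bd K) (fun l : List (List α) => l.flatten)} :=
  ⟨_, fun K _ α _ => ((((appendI.2 K).app (α := Unit × List α × List α) snd).foldl 1
    (D := fun B p => p.2.1 = [] ∧ Bd K B p.2.2) (by
    have key : ∀ (l : List (List α)) (b : List α), l.foldl (fun b x => b ++ x) b = b ++ l.flatten := by
      intro l; induction l <;> simp_all
    rintro B c b l hB ⟨rfl, hl⟩
    have hB' : B ≤ B ^ (1 + 1) := self_le_pow_succ _
    have h2 : B * B = B ^ (1 + 1) := by ring
    have : ∀ l1 : List (List α), l1.length ≤ B → (∀ x ∈ l1, x ∈ l) → Bd K (B ^ (1 + 1)) l1.flatten := by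
      intro l1 h1 hs
      refine ⟨?_, fun x hx => ?_⟩
      · rw [List.length_flatten, ← h2]
        refine (List.sum_le_card_nsmul _ B ?_).trans ?_
        · intro x hx
          obtain ⟨y, hy, rfl⟩ := List.mem_map.1 hx
          exact (hl.2 y (hs y hy)).1
        · simpa using Nat.mul_le_mul_right B h1
      · obtain ⟨y, hy, hx⟩ := List.mem_flatten.1 hx
        exact Dat.mono hB' ((hl.2 y (hs y hy)).2 x hx)
    simp only [key, List.nil_append]
    refine ⟨hl.1.trans hB', this l hl.1 (fun _ h => h), ?_⟩
    rintro l1 x l2 rfl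
    refine ⟨trivial, this l1 ?_ (by simp +contextual), Dat.mono hB' (hl.2 x (by simp))⟩
    have := hl.1
    simp at this; omega)).compD (unit.pair (empty.pair id)) (by
      exact fun B a hB h => ⟨rfl, Dat.mono (self_le_pow_succ _) h⟩)).congr fun l => by
      have key : ∀ (l : List (List α)) (b : List α), l.foldl (fun b x => b ++ x) b = b ++ l.flatten := by
        intro l; induction l <;> simp_all
      simp [key]⟩

namespace Ok

variable {K : Type u} [Field K] {α β γ δ : Type*} [Dat K α] [Dat K β] [Dat K γ] [Dat K δ]
  {I J : Impl} {D : ℕ → α → Prop} {f : α → β}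

/-- The program for `++`. -/
def _root_.TriDec.Impl.append : Impl := appendI.{0, 0}.1

/-- The program for `List.flatten`. -/
def _root_.TriDec.Impl.flatten : Impl := flattenI.{0, 0}.1

theorem append {f g : α → List β} (h1 : Ok K I D f) (h2 : Ok K J D g) :
    Ok K (Impl.append.comp (I.pair J)) D (fun a => f a ++ g a) :=
  (show Ok K Impl.append _ _ from appendI.2 K).app2 h1 h2

theorem flatten {f : α → List (List β)} (h : Ok K I D f) :
    Ok K (Impl.flatten.comp I) D (fun a => (f a).flatten) :=
  (show Ok K Impl.flatten _ _ from flattenI.2 K).app h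

theorem flatMapOf {g : γ × δ → List β} (hJ : Ok K J (Bd K) g) {c : α → γ} {l : α → List δ}
    {I1 I2 : Impl} (hc : Ok K I1 D c) (hl : Ok K I2 D l) :
    Ok K (Impl.flatten.comp ((J.map 0).comp (I1.pair I2))) D
      (fun a => (l a).flatMap fun x => g (c a, x)) :=
  (hJ.mapOf hc hl).flatten.congr fun _ => by rw [List.flatMap_def]

theorem singleton {f : α → β} (h : Ok K I D f) :
    Ok K ((⟨Code.id, 1⟩ : Impl).comp (I.pair ⟨Code.nil, 0⟩)) D (fun a => [f a]) :=
  cons.app2 h empty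

/-- The program for `List.filter`. -/
def _root_.TriDec.Impl.filter (J : Impl) : Impl :=
  Impl.flatten.comp ((Impl.map (J.ite ((⟨Code.id, 1⟩ : Impl).comp
    (Impl.pair ⟨Code.right, 0⟩ ⟨Code.nil, 0⟩)) ⟨Code.nil, 0⟩) 0))

theorem filterOf {g : γ × β → Bool} (hJ : Ok K J (Bd K) g) {c : α → γ} {l : α → List β}
    {I1 I2 : Impl} (hc : Ok K I1 D c) (hl : Ok K I2 D l) :
    Ok K (J.filter.comp (I1.pair I2)) D (fun a => (l a).filter fun x => g (c a, x)) :=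
  (((hJ.ite (singleton snd) empty).map'.flatten).app2 hc hl).congr fun a => by
    simp only
    induction l a with
    | nil => rfl
    | cons x l ih =>
      simp only [List.filter_cons, List.map_cons, List.flatten_cons, ← ih]
      cases g (c a, x) <;> simp

theorem not {c : α → Bool} (h : Ok K I D c) :
    Ok K (I.ite ⟨Code.nil, 0⟩ ⟨Code.pair Code.nil Code.nil, 2⟩) D (fun a => !c a) :=
  (h.ite bfalse btrue).congr fun a => by cases c a <;> rfl

theorem and {c c' : α → Bool} (h : Ok K I D c) (h' : Ok K J D c') :
    Ok K (I.ite J ⟨Code.nil, 0⟩) D (fun a => c a && c' a) :=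
  (h.ite h' bfalse).congr fun a => by cases c a <;> rfl

/-- The program for `List.all`. -/
def _root_.TriDec.Impl.all (J : Impl) : Impl :=
  (⟨Code.branch Code.id Code.nil (Code.pair Code.nil Code.nil), 2⟩ : Impl).comp
    ((J.ite ⟨Code.nil, 0⟩ ⟨Code.pair Code.nil Code.nil, 2⟩).filter.comp
      (Impl.pair ⟨Code.left, 0⟩ ⟨Code.right, 0⟩))

theorem allOf {g : γ × β → Bool} (hJ : Ok K J (Bd K) g) {c : α → γ} {l : α → List β}
    {I1 I2 : Impl} (hc : Ok K I1 D c) (hl : Ok K I2 D l) :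
    Ok K (J.all.comp (I1.pair I2)) D (fun a => (l a).all fun x => g (c a, x)) :=
  ((isNil.app (filterOf hJ.not fst snd)).app2 hc hl).congr fun a => by
    simp only
    induction l a with
    | nil => rfl
    | cons x l ih =>
      simp only [List.all_cons, List.filter_cons, ih]
      cases g (c a, x) <;> simp

theorem pred : Ok K ⟨Code.right, 0⟩ (Bd K) (fun n : ℕ => n - 1) := by
  refine prim (fun B n _ h => ?_) fun n => ?_
  · change n - 1 ≤ _
    have : n ≤ B := h
    simp; omega
  · have := Eval.right (enc n : Data K)
    cases n <;> exact this

theorem succ : Ok K ⟨Code.pair Code.nil Code.id, 2⟩ (Bd K) (fun n : ℕ => n + 1) := by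
  intro B n hB h
  have h' : n ≤ B := h
  have h3 : 3 ≤ B ^ 3 := by have := Nat.pow_le_pow_left hB 3; omega
  have h4 : B + 1 ≤ B ^ 3 := by
    have : B * 2 ≤ B ^ 3 := by
      rw [pow_succ, mul_comm (B ^ 2)]
      exact Nat.mul_le_mul_left _ (hB.trans (Nat.le_self_pow two_ne_zero B))
    omega
  exact ⟨show n + 1 ≤ B ^ 3 by omega, 3, h3, Eval.pair (Eval.nil _) (Eval.id _)⟩

theorem foldl_const (f : β → β) (n : ℕ) (b : β) :
    (List.replicate n ()).foldl (fun b _ => f b) b = f^[n] b := by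
  induction n generalizing b with
  | zero => rfl
  | succ n ih => simp [List.replicate_succ, ih]

end Ok

def natSubI : {I : Impl // ∀ (K : Type u) [Field K],
    Ok K I (Bd K) (fun p : ℕ × ℕ => p.1 - p.2)} :=
  ⟨_, fun K _ => (((pred.app (fst.app (α := Unit × ℕ × Unit) snd)).foldl 0 (D := Bd K) (by
    have key : ∀ (l : List Unit) (n : ℕ), l.foldl (fun b _ => b - 1) n ≤ n := by
      intro l; induction l with
      | nil => simp
      | cons x l ih => exact fun n => (ih _).trans (by dsimp only; omega)
    rintro B c b l hB ⟨hc, hb, hl⟩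
    simp only [zero_add, pow_one]
    exact ⟨hl.1, (key l b).trans hb, fun l1 x l2 _ => ⟨trivial, (key l1 b).trans hb, trivial⟩⟩)).app2
    unit (fst.pair (natToList.app snd))).congr fun p => by
      simp only [Ok.foldl_const (fun b => b - 1)]
      generalize p.1 = a
      generalize p.2 = n
      induction n generalizing a with
      | zero => rfl
      | succ n ih => rw [Function.iterate_succ_apply, ← ih]; omega⟩

def natLeI : {I : Impl // ∀ (K : Type u) [Field K],
    Ok K I (Bd K) (fun p : ℕ × ℕ => decide (p.1 ≤ p.2))} :=
  ⟨_, fun K _ => (isNil.app (natToList.app (natSubI.2 K))).congr fun p => by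
    rw [Bool.eq_iff_iff]; simp [Nat.sub_eq_zero_iff_le]⟩

def natEqI : {I : Impl // ∀ (K : Type u) [Field K],
    Ok K I (Bd K) (fun p : ℕ × ℕ => decide (p.1 = p.2))} :=
  ⟨_, fun K _ => ((natLeI.2 K).and ((natLeI.2 K).app2 snd fst)).congr fun p => by
    rw [Bool.eq_iff_iff]; simp; omega⟩

def natAddI : {I : Impl // ∀ (K : Type u) [Field K],
    Ok K I (Bd K) (fun p : ℕ × ℕ => p.1 + p.2)} :=
  ⟨_, fun K _ => (natOfList.app ((natToList.app fst).append (natToList.app snd))).congr fun p => by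
    simp⟩

def lengthI : {I : Impl // ∀ (K : Type u) [Field K] {α : Type v} [Dat K α],
    Ok K I (Bd K) (fun l : List α => l.length)} :=
  ⟨_, fun K _ α _ => (natOfList.app ((Ok.unit (α := Unit × α) (D := Bd K)).mapOf
    Ok.unit id)).congr fun p => by simp⟩

/-- The maximum of a list of natural numbers. -/
def listMax (l : List ℕ) : ℕ := l.foldl (fun a b => a + (b - a)) 0

theorem foldl_max_le {B : ℕ} (l : List ℕ) (hl : ∀ x ∈ l, x ≤ B) (a : ℕ) (ha : a ≤ B) :
    l.foldl (fun a b => a + (b - a)) a ≤ B := by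
  induction l generalizing a with
  | nil => exact ha
  | cons x l ih =>
    have := hl x (by simp)
    exact ih (fun x hx => hl x (by simp [hx])) _ (by dsimp only; omega)

theorem listMax_le {B : ℕ} (l : List ℕ) (hl : ∀ x ∈ l, x ≤ B) : listMax l ≤ B :=
  foldl_max_le l hl 0 (Nat.zero_le _)

theorem le_listMax {l : List ℕ} {x : ℕ} (hx : x ∈ l) : x ≤ listMax l := by
  have h : ∀ (l : List ℕ) (a : ℕ), a ≤ l.foldl (fun a b => a + (b - a)) a := by
    intro l; induction l with
    | nil => simp
    | cons x l ih => exact fun a => (by omega : a ≤ a + (x - a)).trans (ih _)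
  have h' : ∀ (l : List ℕ) (a : ℕ), x ∈ l → x ≤ l.foldl (fun a b => a + (b - a)) a := by
    intro l; induction l with
    | nil => simp
    | cons y l ih =>
      intro a hx
      rcases List.mem_cons.1 hx with rfl | hx
      · exact (by omega : x ≤ a + (x - a)).trans (h l _)
      · exact ih _ hx
  exact h' l 0 hx

def listMaxI : {I : Impl // ∀ (K : Type u) [Field K], Ok K I (Bd K) listMax} :=
  ⟨_, fun K _ => ((((natAddI.2 K).app2 (fst.app (α := Unit × ℕ × ℕ) snd) ((natSubI.2 K).app2
    (snd.app snd) (fst.app snd))).foldl 0 (D := Bd K) (by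
    rintro B c b l hB ⟨hc, hb, hl⟩
    simp only [zero_add, pow_one]
    refine ⟨hl.1, foldl_max_le l hl.2 b hb, ?_⟩
    rintro l1 x l2 rfl
    exact ⟨trivial, foldl_max_le l1 (fun x hx => hl.2 x (by simp [hx])) b hb,
      hl.2 x (by simp)⟩)).app2 unit (natZero.pair id)).congr fun _ => rfl⟩

/-- The list `[n - 1, …, 1, 0]`. -/
def downTo (n : ℕ) : List ℕ := (List.range n).reverse

def downToI : {I : Impl // ∀ (K : Type u) [Field K], Ok K I (Bd K) downTo} :=
  have key (n m : ℕ) (l : List ℕ) : (List.replicate n ()).foldl (fun b _ => (b.1 + 1, b.1 :: b.2))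
      (m, l) = (m + n, ((List.range n).map (m + ·)).reverse ++ l) := by
    induction n generalizing m l with
    | zero => simp
    | succ n ih =>
      simp only [List.replicate_succ, List.foldl_cons, ih]
      rw [List.range_succ_eq_map]
      simp [Function.comp_def, Nat.add_assoc, Nat.add_comm 1]
  ⟨_, fun K _ => ((snd.app ((((succ.app (fst.app (fst.app (α := Unit × (ℕ × List ℕ) × Unit) snd))).pair
    (cons.app2 (fst.app (fst.app snd)) (snd.app (fst.app snd)))).foldl 0
    (D := fun B p => p.2.1 = (0, []) ∧ Bd K B p.2.2) (by
    rintro B c b l hB ⟨rfl, hl⟩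
    have h (n : ℕ) (hn : n ≤ B) : Bd K B ((List.replicate n ()).foldl
        (fun b _ => (b.1 + 1, b.1 :: b.2)) (0, ([] : List ℕ))) := by
      rw [key]
      refine ⟨show 0 + n ≤ B by omega, by simpa using hn, fun x hx => ?_⟩
      have : x < n := by simpa using hx
      exact show x ≤ B by omega
    have e (l : List Unit) : l = List.replicate l.length () := List.eq_replicate_iff.2 (by simp)
    have hl1 := hl.1
    simp only [zero_add, pow_one]
    refine ⟨hl1, by rw [e l]; exact h _ hl1, ?_⟩
    rintro l1 x l2 rfl
    rw [List.length_append] at hl1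
    exact ⟨trivial, by rw [e l1]; exact h _ (by omega), trivial⟩)).compD
    (unit.pair ((natZero.pair empty).pair natToList))
      fun B a hB h => ⟨rfl, by simpa using (show a ≤ _ from h.trans (self_le_pow_succ _)), fun _ _ => trivial⟩))).congr fun n => by
      simp only [key, downTo]; simp⟩

theorem foldl_zip_eq {α β : Type*} (d : β) (l1 : List α) (l2 : List β) (acc : List (α × β)) :
    l1.foldl (fun b x => if b.1.isEmpty then b else (b.1.tail, (x, b.1.headD d) :: b.2)) (l2, acc) =
      (l2.drop l1.length, (l1.zip l2).reverse ++ acc) := by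
  induction l1 generalizing l2 acc with
  | nil => simp
  | cons x l1 ih => cases l2 <;> simp_all

/-- The program for `List.zip`, when the second list has entries of a type with an element `d` that
is represented by the empty datum. -/
def zipI : {I : Impl // ∀ (K : Type u) [Field K] {α : Type v} {β : Type w} [Dat K α] [Dat K β]
    (d : β), (enc d : Data K) = Data.nil → Bd K 0 d →
    Ok K I (Bd K) (fun p : List α × List β => p.1.zip p.2)} :=
  ⟨_, fun K _ α β _ _ d hd hd' =>
    (reverse.app (snd.app ((((isNil.app (fst.app (fst.app (snd (α := Unit) (β := (List β × List (α × β)) × α))))).ite (fst.app snd)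
    ((tail.app (fst.app (fst.app snd))).pair (cons.app2 ((snd.app snd).pair
      ((head d hd hd').app (fst.app (fst.app snd)))) (snd.app (fst.app snd))))).foldl 0
    (D := fun B p => p.2.1.2 = [] ∧ Bd K B p.2.1.1 ∧ Bd K B p.2.2) (by
    rintro B c ⟨b, acc⟩ l hB ⟨h0, hb, hl⟩
    dsimp only at h0 hb hl
    subst h0
    have key (l1 : List α) (h1 : l1.length ≤ l.length) (hs : ∀ x ∈ l1, x ∈ l) :
        Bd K B (b.drop l1.length, (l1.zip b).reverse ++ []) := by
      refine ⟨bd_sub hb (by simp) fun x hx => List.mem_of_mem_drop hx, ?_, fun p hp => ?_⟩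
      · have := hl.1
        simp; omega
      · have hp : p ∈ l1.zip b := by simpa using hp
        exact ⟨hl.2 _ (hs _ (List.of_mem_zip (a := p.1) (b := p.2) hp).1),
          hb.2 _ (List.of_mem_zip (a := p.1) (b := p.2) hp).2⟩
    simp only [zero_add, pow_one, foldl_zip_eq]
    refine ⟨hl.1, key l le_rfl fun _ h => h, ?_⟩
    rintro l1 x l2 rfl
    exact ⟨trivial, key l1 (by simp) (by simp +contextual), hl.2 x (by simp)⟩)).compD
    (unit.pair ((snd.pair empty).pair fst)) fun B a hB h => ⟨rfl,
      Dat.mono (self_le_pow_succ _) h.2, Dat.mono (self_le_pow_succ _) h.1⟩))).congr fun p => by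
      simp only [foldl_zip_eq]; simp⟩

def zipNatI : {I : Impl // ∀ (K : Type u) [Field K],
    Ok K I (Bd K) (fun p : List ℕ × List ℕ => p.1.zip p.2)} :=
  ⟨_, fun K _ => zipI.2 K 0 rfl le_rfl⟩

def zipListI : {I : Impl // ∀ (K : Type u) [Field K] {α : Type v} [Dat K α],
    Ok K I (Bd K) (fun p : List (List α) × List (List α) => p.1.zip p.2)} :=
  ⟨_, fun K _ _ _ => zipI.2 K [] rfl ⟨le_rfl, by simp⟩⟩

/-- Sum of two exponent vectors. -/
def vadd (a b : List ℕ) : List ℕ := (a.zip b).map fun x => x.1 + x.2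

def vaddI : {I : Impl // ∀ (K : Type u) [Field K],
    Ok K I (Bd K) (fun p : List ℕ × List ℕ => vadd p.1 p.2)} :=
  ⟨_, fun K _ => (mapOf ((natAddI.2 K).app (snd (α := Unit))) unit (zipNatI.2 K)).congr
    fun _ => rfl⟩

def veqI : {I : Impl // ∀ (K : Type u) [Field K],
    Ok K I (Bd K) (fun p : List ℕ × List ℕ => decide (p.1 = p.2))} :=
  ⟨_, fun K _ => (((natEqI.2 K).app2 ((lengthI.2 K).app fst) ((lengthI.2 K).app snd)).and
    (allOf ((natEqI.2 K).app (snd (α := Unit))) unit (zipNatI.2 K))).congr fun p => by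
      rw [Bool.eq_iff_iff]
      obtain ⟨a, b⟩ := p
      simp only [decide_eq_true_eq, Bool.and_eq_true, List.all_eq_true]
      induction a generalizing b with
      | nil => cases b <;> simp
      | cons x a ih => cases b with
        | nil => simp
        | cons y b => simp [ih]; tauto⟩

/-- The `i`-th list in a list of lists. -/
def nth {α : Type*} (l : List (List α)) (i : ℕ) : List α := (l.drop i).headD []

def nthI : {I : Impl // ∀ (K : Type u) [Field K] {α : Type v} [Dat K α],
    Ok K I (Bd K) (fun p : List (List α) × ℕ => nth p.1 p.2)} :=
  ⟨_, fun K _ α _ => (headList.app ((((tail (α := List α)).app (fst.app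
    (snd (α := Unit) (β := _ × Unit)))).foldl 0 (D := Bd K) (by
    have key (l : List Unit) (b : List (List α)) : l.foldl (fun b _ => b.tail) b = b.drop l.length := by
      induction l generalizing b <;> simp_all
    rintro B c b l hB ⟨hc, hb, hl⟩
    simp only [zero_add, pow_one, key]
    exact ⟨hl.1, bd_sub hb (by simp) fun x hx => List.mem_of_mem_drop hx, fun l1 x l2 _ =>
      ⟨trivial, bd_sub hb (by simp) fun x hx => List.mem_of_mem_drop hx, trivial⟩⟩)).app2
    unit (fst.pair (natToList.app snd)))).congr fun p => by
      simp only [foldl_const (fun b : List (List α) => b.tail), nth]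
      congr 1
      generalize p.1 = l
      induction p.2 generalizing l with
      | zero => rfl
      | succ n ih => rw [Function.iterate_succ_apply, ← ih]; simp⟩

/-- A natural number as an element of the field. -/
def natI : {I : Impl // ∀ (K : Type u) [Field K], Ok K I (Bd K) (fun n : ℕ => (n : K))} :=
  ⟨_, fun K _ => (((add.app2 (fst.app (snd (α := Unit) (β := K × Unit))) one).foldl 0 (D := Bd K) (by
    rintro B c b l hB ⟨hc, hb, hl⟩
    simp only [zero_add, pow_one]
    exact ⟨hl.1, trivial, fun l1 x l2 _ => ⟨trivial, trivial, trivial⟩⟩)).app2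
    unit (zero.pair natToList)).congr fun n => by
      simp only [foldl_const (fun b : K => b + 1)]
      induction n with
      | zero => simp
      | succ n ih => rw [Function.iterate_succ_apply', ← ih]; simp⟩

/-! ### Polynomials as lists of terms -/

/-- A term: an exponent vector and a coefficient. -/
abbrev Term (K : Type u) := List ℕ × K

/-- A polynomial: a list of terms, in general neither sorted nor reduced. -/
abbrev Poly (K : Type u) := List (Term K)

section Defs

variable {K : Type u} [Field K]

/-- The coefficient at the exponent vector `e`. -/
def coefOf (p : Poly K) (e : List ℕ) : K :=
  (p.filter fun t => decide (t.1 = e)).foldl (fun a t => a + t.2) 0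

open Classical in
/-- Add one term to a polynomial. -/
noncomputable def insT (p : Poly K) (t : Term K) : Poly K :=
  if decide (t.2 + coefOf p t.1 = 0) then p.filter (fun t' => !decide (t'.1 = t.1))
  else (t.1, t.2 + coefOf p t.1) :: p.filter (fun t' => !decide (t'.1 = t.1))

/-- Collect equal monomials and remove zero coefficients. -/
noncomputable def collect (l : Poly K) : Poly K := l.foldl insT []

/-- Product of two terms. -/
def mulT (t t' : Term K) : Term K := (vadd t.1 t'.1, t.2 * t'.2)

/-- Product of two polynomials. -/
noncomputable def pmul (p q : Poly K) : Poly K := collect (p.flatMap fun t => q.map fun t' => mulT t t')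

/-- Sum of a list of polynomials. -/
noncomputable def psum (l : List (Poly K)) : Poly K := collect l.flatten

/-- A polynomial times a constant. -/
noncomputable def pscal (c : K) (p : Poly K) : Poly K := collect (p.map fun t => (t.1, c * t.2))

/-- The exponents of the first variable in the terms of `p`. -/
def heads (p : Poly K) : List ℕ := p.map fun t => t.1.headD 0

/-- The coefficient of the `i`-th power of the first variable. -/
def coefH (i : ℕ) (p : Poly K) : Poly K :=
  (p.filter fun t => decide (t.1.headD 0 = i)).map fun t => (t.1.tail, t.2)

/-- All coefficients with respect to the first variable. -/
def coefs (p : Poly K) : List (Poly K) := (heads p).map fun i => coefH i p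

/-- The coefficients of the powers of the first variable above the `m`-th. -/
def coefsAbove (m : ℕ) (p : Poly K) : List (Poly K) :=
  ((heads p).filter fun i => !decide (i ≤ m)).map fun i => coefH i p

end Defs

/-! Programs for these operations. -/

def coefOfI : {I : Impl // ∀ (K : Type u) [Field K],
    Ok K I (Bd K) (fun p : Poly K × List ℕ => coefOf p.1 p.2)} :=
  ⟨_, fun K _ => (((add.app2 (fst.app (snd (α := Unit) (β := K × Term K))) (snd.app (snd.app snd))).foldl
    0 (D := Bd K) (by
    rintro B c b l hB ⟨hc, hb, hl⟩
    simp only [zero_add, pow_one]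
    exact ⟨hl.1, trivial, fun l1 x l2 e => ⟨trivial, trivial, hl.2 x (by simp [e])⟩⟩)).app2
    unit (zero.pair (filterOf ((veqI.2 K).app2 (fst.app (snd (α := List ℕ) (β := Term K))) fst)
      snd fst))).congr fun _ => rfl⟩

section

variable {K : Type u} [Field K]

theorem insT_length (p : Poly K) (t : Term K) : (insT p t).length ≤ p.length + 1 := by
  rw [insT]
  have := List.length_filter_le (fun t' : Term K => !decide (t'.1 = t.1)) p
  split <;> simp <;> omega

theorem collect_append (l l' : Poly K) : collect (l ++ l') = l'.foldl insT (collect l) := by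
  simp [collect]

theorem collect_length (l : Poly K) : (collect l).length ≤ l.length := by
  induction l using List.reverseRecOn with
  | nil => simp [collect]
  | append_singleton l t ih =>
    rw [collect_append]
    simpa using (insT_length _ _).trans (by simpa using ih)

theorem mem_insT {p : Poly K} {t x : Term K} (h : x ∈ insT p t) : x ∈ p ∨ x.1 = t.1 := by
  rw [insT] at h
  split at h
  · exact .inl (List.mem_filter.1 h).1
  · rcases List.mem_cons.1 h with rfl | h
    · exact .inr rfl
    · exact .inl (List.mem_filter.1 h).1

theorem mem_collect {l : Poly K} {x : Term K} (h : x ∈ collect l) : ∃ t ∈ l, x.1 = t.1 := by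
  induction l using List.reverseRecOn generalizing x with
  | nil => simp [collect] at h
  | append_singleton l t ih =>
    rw [collect_append] at h
    rcases mem_insT h with h | h
    · obtain ⟨t', h1, h2⟩ := ih h
      exact ⟨t', by simp [h1], h2⟩
    · exact ⟨t, by simp, h⟩

theorem bd_collect {B : ℕ} {l : Poly K} (h : Bd K B l) : Bd K B (collect l) :=
  ⟨(collect_length l).trans h.1, fun x hx => by
    obtain ⟨t, ht, e⟩ := mem_collect hx
    exact ⟨e ▸ (h.2 t ht).1, trivial⟩⟩

end

def insTI : {I : Impl // ∀ (K : Type u) [Field K],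
    Ok K I (Bd K) (fun p : Poly K × Term K => insT p.1 p.2)} :=
  ⟨_, fun K _ =>
    have c : Ok K _ (Bd K) (fun p : Poly K × Term K => p.2.2 + coefOf p.1 p.2.1) :=
      add.app2 (snd.app snd) ((coefOfI.2 K).app2 fst (fst.app snd))
    have r : Ok K _ (Bd K) (fun p : Poly K × Term K => p.1.filter (fun t' => !decide (t'.1 = p.2.1))) :=
      filterOf (((veqI.2 K).app2 (fst.app (snd (α := List ℕ) (β := Term K))) fst).not)
        (fst.app snd) fst
    ((isZero.app c).ite r (cons.app2 ((fst.app snd).pair c) r)).congr fun _ => rfl⟩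

def collectI : {I : Impl // ∀ (K : Type u) [Field K], Ok K I (Bd K) (collect (K := K))} :=
  ⟨_, fun K _ => ((((insTI.2 K).app (snd (α := Unit) (β := Poly K × Term K))).foldl 0
    (D := fun B p => p.2.1 = [] ∧ Bd K B p.2.2) (by
    rintro B c b l hB ⟨rfl, hl⟩
    dsimp only at hl
    simp only [zero_add, pow_one]
    refine ⟨hl.1, bd_collect hl, ?_⟩
    rintro l1 x l2 rfl
    exact ⟨trivial, bd_collect (bd_sub hl (by simp) (by simp +contextual)), hl.2 x (by simp)⟩)).compD
    (unit.pair (empty.pair id)) fun B a hB h => ⟨rfl, Dat.mono (self_le_pow_succ _) h⟩).congr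
    fun _ => rfl⟩

def mulTI : {I : Impl // ∀ (K : Type u) [Field K],
    Ok K I (Bd K) (fun p : Term K × Term K => mulT p.1 p.2)} :=
  ⟨_, fun K _ => (((vaddI.2 K).app2 (fst.app fst) (fst.app snd)).pair
    (mul.app2 (snd.app fst) (snd.app snd))).congr fun _ => rfl⟩

def pmulI : {I : Impl // ∀ (K : Type u) [Field K],
    Ok K I (Bd K) (fun p : Poly K × Poly K => pmul p.1 p.2)} :=
  ⟨_, fun K _ => ((collectI.2 K).app (flatMapOf (mapOf (mulTI.2 K)
    (snd (α := Poly K) (β := Term K)) fst) snd fst)).congr fun _ => rfl⟩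

def psumI : {I : Impl // ∀ (K : Type u) [Field K], Ok K I (Bd K) (psum (K := K))} :=
  ⟨_, fun K _ => ((collectI.2 K).app id.flatten).congr fun _ => rfl⟩

def pscalI : {I : Impl // ∀ (K : Type u) [Field K],
    Ok K I (Bd K) (fun p : K × Poly K => pscal p.1 p.2)} :=
  ⟨_, fun K _ => ((collectI.2 K).app (mapOf ((fst.app (snd (α := K) (β := Term K))).pair
    (mul.app2 fst (snd.app snd))) fst snd)).congr fun _ => rfl⟩

def headsI : {I : Impl // ∀ (K : Type u) [Field K], Ok K I (Bd K) (heads (K := K))} :=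
  ⟨_, fun K _ => (mapOf (headNat.app (fst.app (snd (α := Unit) (β := Term K)))) unit id).congr
    fun _ => rfl⟩

def coefHI : {I : Impl // ∀ (K : Type u) [Field K],
    Ok K I (Bd K) (fun p : ℕ × Poly K => coefH p.1 p.2)} :=
  ⟨_, fun K _ => (mapOf ((tail.app (fst.app (snd (α := Unit) (β := Term K)))).pair (snd.app snd)) unit
    (filterOf ((natEqI.2 K).app2 (headNat.app (fst.app (snd (α := ℕ) (β := Term K)))) fst)
      fst snd)).congr fun _ => rfl⟩

def coefsI : {I : Impl // ∀ (K : Type u) [Field K], Ok K I (Bd K) (coefs (K := K))} :=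
  ⟨_, fun K _ => (mapOf ((coefHI.2 K).app2 (snd (α := Poly K)) fst) id (headsI.2 K)).congr
    fun _ => rfl⟩

def coefsAboveI : {I : Impl // ∀ (K : Type u) [Field K],
    Ok K I (Bd K) (fun p : ℕ × Poly K => coefsAbove p.1 p.2)} :=
  ⟨_, fun K _ => (mapOf ((coefHI.2 K).app2 (snd (α := Poly K)) fst) snd
    (filterOf ((natLeI.2 K).app2 (snd (α := ℕ)) fst).not fst ((headsI.2 K).app snd))).congr
    fun _ => rfl⟩

/-! ### Reduced polynomials and degree bounds -/

section

variable {K : Type u} [Field K]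

/-- Every monomial is listed once, with a nonzero coefficient. -/
def Nm (p : Poly K) : Prop := (p.map Prod.fst).Nodup ∧ ∀ t ∈ p, t.2 ≠ 0

/-- The exponent vectors of `p` have length `v`, their first entries are at most `S`, and the others
at most `E`. -/
def PB (v S E : ℕ) (p : Poly K) : Prop :=
  ∀ t ∈ p, t.1.length = v ∧ t.1.headD 0 ≤ S ∧ ∀ e ∈ t.1.tail, e ≤ E

theorem nm_sublist {p q : Poly K} (h : Nm p) (hq : q.Sublist p) : Nm q :=
  ⟨h.1.sublist (hq.map _), fun t ht => h.2 t (hq.subset ht)⟩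

theorem nm_nil : Nm ([] : Poly K) := ⟨by simp, by simp⟩

theorem nm_insT {p : Poly K} (h : Nm p) (t : Term K) : Nm (insT p t) := by
  have h1 : Nm (p.filter fun t' => !decide (t'.1 = t.1)) := nm_sublist h List.filter_sublist
  rw [insT]
  split
  · exact h1
  · rename_i h0
    refine ⟨?_, fun x hx => ?_⟩
    · rw [List.map_cons, List.nodup_cons]
      refine ⟨fun hm => ?_, h1.1⟩
      obtain ⟨x, hx, e⟩ := List.mem_map.1 hm
      simpa [e] using (List.mem_filter.1 hx).2
    · rcases List.mem_cons.1 hx with rfl | hx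
      · simpa using h0
      · exact h1.2 x hx

theorem nm_collect (l : Poly K) : Nm (collect l) := by
  induction l using List.reverseRecOn with
  | nil => exact nm_nil
  | append_singleton l t ih => rw [collect_append]; exact nm_insT ih t

theorem nm_coefH {p : Poly K} {v : ℕ} (h : Nm p) (hl : ∀ t ∈ p, t.1.length = v + 1) (i : ℕ) :
    Nm (coefH i p) := by
  refine ⟨?_, fun t ht => ?_⟩
  · rw [coefH, List.map_map]
    have : ((p.filter fun t => decide (t.1.headD 0 = i)).map Prod.fst).Nodup :=
      (nm_sublist h List.filter_sublist).1
    rw [show (Prod.fst ∘ fun t : Term K => (t.1.tail, t.2)) = List.tail ∘ Prod.fst from rfl,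
      ← List.map_map]
    refine List.Nodup.map_on ?_ this
    intro x hx y hy hxy
    obtain ⟨⟨x, c⟩, hx0, rfl⟩ := List.mem_map.1 hx
    obtain ⟨⟨y, d⟩, hy0, rfl⟩ := List.mem_map.1 hy
    obtain ⟨hx1, hx2⟩ := List.mem_filter.1 hx0
    obtain ⟨hy1, hy2⟩ := List.mem_filter.1 hy0
    have h1 := hl _ hx1
    have h2 := hl _ hy1
    cases x with
    | nil => simp at h1
    | cons a x => cases y with
      | nil => simp at h2
      | cons b y =>
        have e1 : a = i := by simpa using hx2
        have e2 : b = i := by simpa using hy2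
        have e3 : x = y := hxy
        subst e3; simp only [e1, e2]
  · obtain ⟨x, hx, rfl⟩ := List.mem_map.1 ht
    exact h.2 x (List.mem_filter.1 hx).1

variable {v S E S' E' : ℕ} {p q : Poly K}

theorem PB.mono (h : PB v S E p) (hS : S ≤ S') (hE : E ≤ E') : PB v S' E' p := fun t ht =>
  ⟨(h t ht).1, (h t ht).2.1.trans hS, fun e he => ((h t ht).2.2 e he).trans hE⟩

theorem PB.collect (h : PB v S E p) : PB v S E (collect p) := fun t ht => by
  obtain ⟨x, hx, e⟩ := mem_collect ht
  rw [e]; exact h x hx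

theorem vadd_length (a b : List ℕ) (h : a.length = v) (h' : b.length = v) :
    (vadd a b).length = v := by simp [vadd, h, h']

theorem vadd_cons (x y : ℕ) (a b : List ℕ) : vadd (x :: a) (y :: b) = (x + y) :: vadd a b := rfl

theorem vadd_le {a b : List ℕ} (ha : ∀ e ∈ a, e ≤ E) (hb : ∀ e ∈ b, e ≤ E') :
    ∀ e ∈ vadd a b, e ≤ E + E' := by
  intro e he
  obtain ⟨⟨x, y⟩, h, rfl⟩ := List.mem_map.1 he
  exact Nat.add_le_add (ha _ (List.of_mem_zip h).1) (hb _ (List.of_mem_zip h).2)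

theorem PB.mulT {t t' : Term K} (h : PB v S E [t]) (h' : PB v S' E' [t']) :
    PB v (S + S') (E + E') [mulT t t'] := by
  simp only [PB, List.mem_singleton, forall_eq] at h h' ⊢
  obtain ⟨a, c⟩ := t
  obtain ⟨b, d⟩ := t'
  refine ⟨vadd_length _ _ h.1 h'.1, ?_⟩
  cases a with
  | nil => simp [TriDec.mulT, vadd]
  | cons x a => cases b with
    | nil => simp [TriDec.mulT, vadd]
    | cons y b => exact ⟨Nat.add_le_add h.2.1 h'.2.1, vadd_le h.2.2 h'.2.2⟩

theorem PB.single (h : PB v S E p) {t : Term K} (ht : t ∈ p) : PB v S E [t] := by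
  simp only [PB, List.mem_singleton, forall_eq]; exact h t ht

theorem PB.pmul (h : PB v S E p) (h' : PB v S' E' q) : PB v (S + S') (E + E') (pmul p q) := by
  refine PB.collect fun t ht => ?_
  obtain ⟨x, hx, ht⟩ := List.mem_flatMap.1 ht
  obtain ⟨y, hy, rfl⟩ := List.mem_map.1 ht
  exact PB.mulT (h.single hx) (h'.single hy) _ (List.mem_singleton_self _)

theorem PB.flatten {l : List (Poly K)} (h : ∀ p ∈ l, PB v S E p) : PB v S E l.flatten :=
  fun t ht => by
    obtain ⟨p, hp, ht⟩ := List.mem_flatten.1 ht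
    exact h p hp t ht

theorem PB.psum {l : List (Poly K)} (h : ∀ p ∈ l, PB v S E p) : PB v S E (psum l) :=
  (PB.flatten h).collect

theorem PB.pscal (h : PB v S E p) (c : K) : PB v S E (pscal c p) := by
  refine PB.collect fun t ht => ?_
  obtain ⟨x, hx, rfl⟩ := List.mem_map.1 ht
  exact h x hx

theorem PB.append (h : PB v S E p) (h' : PB v S E q) : PB v S E (p ++ q) := fun t ht => by
  rcases List.mem_append.1 ht with ht | ht
  · exact h t ht
  · exact h' t ht

theorem PB.nil : PB v S E ([] : Poly K) := fun t ht => by simp at ht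

theorem PB.coefH (h : PB (v + 1) S E p) (i : ℕ) : PB v E E (coefH i p) := fun t ht => by
  obtain ⟨⟨a, c⟩, hx, rfl⟩ := List.mem_map.1 ht
  obtain ⟨h1, h2, h3⟩ := h _ (List.mem_filter.1 hx).1
  refine ⟨by simp at h1 ⊢; omega, ?_, fun e he => h3 e (List.mem_of_mem_tail he)⟩
  cases h : a.tail with
  | nil => simp
  | cons y b => exact h3 y (by simp [h])

theorem PB.heads_le (h : PB v S E p) : ∀ i ∈ heads p, i ≤ S := fun i hi => by
  obtain ⟨t, ht, rfl⟩ := List.mem_map.1 hi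
  exact (h t ht).2.1

/-- A reduced polynomial has at most as many terms as there are exponent vectors. -/
theorem PB.length_le (h : PB v S E p) (hn : Nm p) : p.length ≤ (S + 1) * (E + 1) ^ v := by
  let φ : List ℕ → Fin (S + 1) × (Fin v → Fin (E + 1)) := fun a =>
    (Fin.ofNat (S + 1) (a.headD 0), fun i => Fin.ofNat (E + 1) (a.tail.getD i 0))
  have : ((p.map Prod.fst).map φ).Nodup := by
    refine List.Nodup.map_on ?_ hn.1
    intro a ha b hb hab
    obtain ⟨⟨a, c⟩, ha0, rfl⟩ := List.mem_map.1 ha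
    obtain ⟨⟨b, d⟩, hb0, rfl⟩ := List.mem_map.1 hb
    obtain ⟨ha1, ha2, ha3⟩ := h _ ha0
    obtain ⟨hb1, hb2, hb3⟩ := h _ hb0
    dsimp only at *
    cases a with
    | nil => cases b with
      | nil => rfl
      | cons y b => simp at ha1 hb1; omega
    | cons x a => cases b with
      | nil => simp at ha1 hb1; omega
      | cons y b =>
        simp only [φ, Prod.mk.injEq, Fin.ext_iff, Fin.val_ofNat, funext_iff, List.headD_cons,
          List.tail_cons, List.length_cons] at *
        rw [Nat.mod_eq_of_lt (by omega), Nat.mod_eq_of_lt (by omega)] at hab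
        refine List.cons_eq_cons.2 ⟨hab.1, List.ext_getElem (by omega) fun i h1 h2 => ?_⟩
        have h3 := hab.2 ⟨i, by omega⟩
        have h4 := ha3 a[i] (List.getElem_mem _)
        have h5 := hb3 b[i] (List.getElem_mem _)
        simp only [List.getD_eq_getElem _ _ h1, List.getD_eq_getElem _ _ h2] at h3
        rwa [Nat.mod_eq_of_lt (by omega), Nat.mod_eq_of_lt (by omega)] at h3
  have := this.length_le_card
  simpa [Fintype.card_prod, Fintype.card_fin, Fintype.card_pi] using this

theorem PB.bd {B : ℕ} (h : PB v S E p) (hn : Nm p) (hv : v ≤ B) (hE : E ≤ B)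
    (hB : (S + 1) * (E + 1) ^ v ≤ B) : Bd K B p := by
  refine ⟨(h.length_le hn).trans hB, fun t ht => ⟨⟨(h t ht).1.trans_le hv, fun e he => ?_⟩, trivial⟩⟩
  change e ≤ B
  obtain ⟨h1, h2, h3⟩ := h t ht
  cases ha : t.1 with
  | nil => simp [ha] at he
  | cons x a =>
    rw [ha] at h2 h3 he
    rcases List.mem_cons.1 he with rfl | he
    · have : (S + 1) * 1 ≤ (S + 1) * (E + 1) ^ v := Nat.mul_le_mul_left _ (Nat.one_le_pow _ _ (by omega))
      have : e ≤ S := h2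
      omega
    · exact (h3 e he).trans hE

/-- A polynomial in at most `w + 3` variables with exponents at most `t ^ c` has polynomially many
terms in terms of the size `B` of the data. -/
theorem pow_bound {t w B c X : ℕ} (ht : 2 ≤ t) (hB : t ^ (w + 3) ≤ B) (hX : X ≤ t ^ c) {v : ℕ}
    (hv : v ≤ w + 3) : (X + 1) ^ v ≤ B ^ (c + 1) := by
  have h1 : X + 1 ≤ t ^ (c + 1) := by
    have := Nat.one_le_pow c t (by omega)
    rw [pow_succ]; nlinarith
  calc (X + 1) ^ v ≤ (t ^ (c + 1)) ^ v := Nat.pow_le_pow_left h1 v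
    _ ≤ (t ^ (c + 1)) ^ (w + 3) := Nat.pow_le_pow_right (Nat.pos_of_ne_zero (by positivity)) hv
    _ = (t ^ (w + 3)) ^ (c + 1) := by rw [← pow_mul, ← pow_mul, mul_comm]
    _ ≤ _ := Nat.pow_le_pow_left hB _

end

namespace Ok

variable {K : Type u} [Field K] {α β γ : Type*} [Dat K α] [Dat K β] [Dat K γ]
  {I J : Impl} {D : ℕ → α → Prop} {f : α → β}

/-- Composition where the second program has a restricted domain. -/
theorem compK {g : β → γ} {D2 : ℕ → β → Prop} (hg : Ok K J D2 g)
    (hm : ∀ B B' a, B ≤ B' → D2 B a → D2 B' a) (k : ℕ) (hf : Ok K I D f)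
    (h : ∀ B a, 2 ≤ B → D B a → D2 (B ^ (k + 1)) (f a)) :
    Ok K ((J.up k).comp I) D (fun a => g (f a)) :=
  (hg.of (D' := fun B a => D2 (B ^ (k + 1)) a) k fun _ _ _ h => h).compD hf fun B a hB ha =>
    hm _ _ _ (Nat.pow_le_pow_left (self_le_pow_succ _) _) (h B a hB ha)

end Ok

/-! ### The norm polynomial -/

section

variable {K : Type u} [Field K]

/-- The pairs `(i, coefficient of F at i, times a ^ l)` for the entries `i` of `idx`, where `l` is the
position of `i` in `idx`; the first component is the next power of `a`. -/
noncomputable def homList (s : Poly K × List (ℕ × Poly K)) (a F : Poly K) (idx : List ℕ) :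
    Poly K × List (ℕ × Poly K) :=
  idx.foldl (fun s i => (pmul s.1 a, (i, pmul (coefH i F) s.1) :: s.2)) s

/-- The constant `c`; `zs` is the zero exponent vector. -/
def constP (zs : List ℕ) (c : K) : Poly K := [(zs, c)]

/-- `q` as a polynomial in three more variables, times a power of the second one. -/
def emb (i : ℕ) (q : Poly K) : Poly K := q.map fun t => (0 :: i :: 0 :: t.1, t.2)

/-- The coefficients `c_1, …, c_m` of the monic polynomial `z ^ m + c_1 * z ^ (m - 1) + ⋯ + c_m` whose
roots are `a` times the roots of the first `m + 1` terms of `F`, where `a` is the coefficient of `F`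
at `m`. -/
noncomputable def monicCoefs (zs : List ℕ) (F : Poly K) (m : ℕ) : List (Poly K) :=
  (homList (constP zs 1, []) (coefH m F) F (downTo m)).2.reverse.map fun x => emb 0 x.2

/-- `F(z / a)` multiplied by a power of `a`, as a polynomial in `z`. -/
noncomputable def scaled (zs : List ℕ) (a F : Poly K) : Poly K :=
  (homList (constP zs 1, []) a F (downTo (listMax (heads F) + 1))).2.flatMap fun x => emb x.1 x.2

/-- Multiplication by the first variable. -/
def shiftS (p : Poly K) : Poly K := p.map fun t => ((t.1.headD 0 + 1) :: t.1.tail, t.2)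

/-- Horner's scheme with respect to the first variable `s`. -/
def horner (l : List (Poly K)) : Poly K := l.foldl (fun acc F => shiftS acc ++ F) []

/-- The polynomial `a * Y - z`. -/
def linP (zs : List ℕ) (a : Poly K) : Poly K :=
  (a.map fun t => (0 :: 0 :: 1 :: t.1, t.2)) ++ [(0 :: 1 :: 0 :: zs, 0 - 1)]

/-- The polynomial `1 + s * (Q(z) * (a * Y - z) + s * (⋯))` whose norm separates the common zeros of
`P` where `Q` does not vanish. Here `Q` and the entries of `P` are scaled by `a`. -/
noncomputable def sepP (zs : List ℕ) (a : Poly K) (P : List (Poly K)) (Q : Poly K) : Poly K :=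
  collect (shiftS (shiftS (horner (P.map fun F => scaled zs a F)) ++
    pmul (scaled zs a Q) (linP zs a)) ++ constP (0 :: 0 :: 0 :: zs) 1)

/-- The list `[g ^ m, …, g ^ 2, g]`, preceded by the last power `g ^ m`. -/
noncomputable def powers (s : Poly K × List (Poly K)) (g : Poly K) (l : List Unit) :
    Poly K × List (Poly K) :=
  l.foldl (fun s _ => (pmul s.1 g, pmul s.1 g :: s.2)) s

/-- Newton's identities, from coefficients to power sums. The state consists of the next index `k`,
the power sums `p_{k - 1}, …, p_1` and the coefficients `c_k, c_{k + 1}, …`. -/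
noncomputable def powerSums (cs : List (Poly K)) (s : K × List (Poly K) × List (Poly K))
    (l : List Unit) : K × List (Poly K) × List (Poly K) :=
  l.foldl (fun s _ => (s.1 + 1,
    psum [pscal (0 - s.1) (s.2.2.headD []),
      pscal (0 - 1) (psum ((cs.zip s.2.1).map fun x => pmul x.1 x.2))] :: s.2.1, s.2.2.tail)) s

/-- Newton's identities, from power sums `Ps = [P_1, …, P_m]` to coefficients. The state consists of
the next index `k` and the coefficients `C_{k - 1}, …, C_0`. -/
noncomputable def newtonCoefs (Ps : List (Poly K)) (s : K × List (Poly K)) (l : List (Poly K)) :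
    K × List (Poly K) :=
  l.foldl (fun s _ => (s.1 + 1,
    pscal (0 - 1 / s.1) (psum ((s.2.zip Ps).map fun x => pmul x.1 x.2)) :: s.2)) s

/-- Replace the powers `z ^ i` by the entries `ps i`. -/
noncomputable def trace (ps : List (Poly K)) (w : Poly K) : Poly K :=
  collect (w.flatMap fun t => (nth ps (t.1.tail.headD 0)).map fun t' =>
    mulT (t.1.headD 0 :: 0 :: t.1.tail.tail, t.2) t')

/-- The powers `g, g ^ 2, …, g ^ m`. -/
noncomputable def powerList (zs : List ℕ) (g : Poly K) (m : ℕ) : List (Poly K) :=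
  (powers (constP (0 :: 0 :: 0 :: zs) 1, []) g (List.replicate m ())).2.reverse

/-- The degree of `p` in its second variable. -/
def zDeg (p : Poly K) : ℕ := listMax (p.map fun t => t.1.tail.headD 0)

/-- The power sums `p_0, …, p_L` of the roots of the monic polynomial with coefficients `cs`. -/
noncomputable def powerSumList (zs : List ℕ) (cs : List (Poly K)) (L : ℕ) : List (Poly K) :=
  constP (0 :: 0 :: 0 :: zs) (cs.length : K) ::
    (powerSums cs (1, [], cs) (List.replicate L ())).2.1.reverse

/-- The product of the values at the roots with power sums `Ps`, up to sign. -/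
noncomputable def prodOfSums (zs : List ℕ) (Ps : List (Poly K)) : Poly K :=
  (newtonCoefs Ps (1, [constP (0 :: 0 :: 0 :: zs) 1]) Ps).2.headD []

/-- Remove the second variable, which does not occur. -/
noncomputable def dropZ (p : Poly K) : Poly K :=
  collect (p.map fun t => (t.1.headD 0 :: t.1.tail.tail, t.2))

/-- The norm, up to sign, of `sepP` with respect to the first `m + 1` terms of `F`: a polynomial in
`s`, `Y` and the variables of the coefficients. -/
noncomputable def normP (m : ℕ) (zs : List ℕ) (F : Poly K) (P : List (Poly K)) (Q : Poly K) :
    Poly K :=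
  dropZ (prodOfSums zs ((powerList zs (sepP zs (coefH m F) P Q) m).map
    (trace (powerSumList zs (monicCoefs zs F m)
      (zDeg (powerList zs (sepP zs (coefH m F) P Q) m).flatten)))))

/-! Degree bounds for these polynomials. -/

variable {v w S E S' E' : ℕ} {p q : Poly K}

theorem constP_pb (zs : List ℕ) (h : zs = List.replicate v 0) (c : K) : PB v S E (constP zs c) := by
  intro t ht
  rw [constP, List.mem_singleton] at ht
  subst ht
  subst h
  refine ⟨by simp, ?_, fun e he => ?_⟩
  · cases v <;> simp [List.replicate_succ]
  · rw [List.eq_of_mem_replicate (List.mem_of_mem_tail he)]; exact Nat.zero_le _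

theorem constP_nm (zs : List ℕ) {c : K} (hc : c ≠ 0) : Nm (constP zs c) := by
  simp [Nm, constP, hc]

theorem emb_pb (h : PB v S E p) (i : ℕ) {E' : ℕ} (hS : S ≤ E') (hE : E ≤ E') (hi : i ≤ E') :
    PB (v + 3) 0 E' (emb i p) := by
  intro t ht
  obtain ⟨⟨a, c⟩, hx, rfl⟩ := List.mem_map.1 ht
  obtain ⟨h1, h2, h3⟩ := h _ hx
  refine ⟨by simpa using h1, le_rfl, fun e he => ?_⟩
  simp only [List.tail_cons, List.mem_cons] at he
  rcases he with rfl | rfl | he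
  · exact hi
  · exact Nat.zero_le _
  · cases a with
    | nil => simp at he
    | cons y a =>
      rcases List.mem_cons.1 he with rfl | he
      · exact le_trans h2 hS
      · exact (h3 e he).trans hE

theorem homList_spec (s : Poly K × List (ℕ × Poly K)) {a F : Poly K} (ha : PB w E E a)
    (hF : PB (w + 1) E E F) (E0 : ℕ) (idx : List ℕ) (L : ℕ) (hL : E0 + idx.length * E ≤ L)
    (hs : Nm s.1 ∧ PB w E0 E0 s.1) (hs2 : ∀ x ∈ s.2, Nm x.2 ∧ PB w (E + L) (E + L) x.2) :
    (Nm (homList s a F idx).1 ∧ PB w L L (homList s a F idx).1) ∧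
      (∀ x ∈ (homList s a F idx).2, Nm x.2 ∧ PB w (E + L) (E + L) x.2) ∧
      (homList s a F idx).2.map Prod.fst = idx.reverse ++ s.2.map Prod.fst := by
  induction idx generalizing s E0 with
  | nil => exact ⟨⟨hs.1, hs.2.mono (by simp at hL; omega) (by simp at hL; omega)⟩, hs2, rfl⟩
  | cons i idx ih =>
    simp only [List.length_cons, Nat.add_mul, Nat.one_mul] at hL
    have := ih (pmul s.1 a, (i, pmul (coefH i F) s.1) :: s.2) (E0 + E) (by omega)
      ⟨nm_collect _, hs.2.pmul ha⟩ (by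
        intro x hx
        rcases List.mem_cons.1 hx with rfl | hx
        · exact ⟨nm_collect _, ((hF.coefH i).pmul hs.2).mono (by omega) (by omega)⟩
        · exact hs2 x hx)
    simpa [homList] using this

theorem powers_spec (s : Poly K × List (Poly K)) {g : Poly K} (hg : PB v S E g) (l : List Unit)
    (k M : ℕ) (hM : k + l.length ≤ M) (hs : Nm s.1 ∧ PB v (k * S) (k * E) s.1)
    (hs2 : ∀ x ∈ s.2, Nm x ∧ PB v (M * S) (M * E) x) :
    (Nm (powers s g l).1 ∧ PB v (M * S) (M * E) (powers s g l).1) ∧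
      (∀ x ∈ (powers s g l).2, Nm x ∧ PB v (M * S) (M * E) x) ∧
      (powers s g l).2.length = l.length + s.2.length := by
  induction l generalizing s k with
  | nil =>
    exact ⟨⟨hs.1, hs.2.mono (Nat.mul_le_mul_right _ (by simp at hM; omega))
      (Nat.mul_le_mul_right _ (by simp at hM; omega))⟩, hs2, by simp [powers]⟩
  | cons i l ih =>
    simp only [List.length_cons] at hM
    have h1 : PB v ((k + 1) * S) ((k + 1) * E) (pmul s.1 g) := by
      simpa [Nat.add_mul] using hs.2.pmul hg
    have := ih (pmul s.1 g, pmul s.1 g :: s.2) (k + 1) (by omega) ⟨nm_collect _, h1⟩ (by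
        intro x hx
        rcases List.mem_cons.1 hx with rfl | hx
        · exact ⟨nm_collect _, h1.mono (Nat.mul_le_mul_right _ (by omega))
            (Nat.mul_le_mul_right _ (by omega))⟩
        · exact hs2 x hx)
    simp only [powers, List.foldl_cons, List.length_cons] at this ⊢
    exact ⟨this.1, this.2.1, by rw [this.2.2]; omega⟩

/-- The lists of Newton's identities: the entry with index `i` has degree at most `i` times the
bound. -/
theorem zip_bound {l l' : List (Poly K)} {n : ℕ} (hl : ∀ x ∈ l, PB v S E x)
    (hl' : ∀ x ∈ l', PB v (n * S) (n * E) x) :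
    PB v ((n + 1) * S) ((n + 1) * E) (psum ((l.zip l').map fun x => pmul x.1 x.2)) := by
  refine PB.psum fun p hp => ?_
  obtain ⟨⟨x, y⟩, h, rfl⟩ := List.mem_map.1 hp
  have := (hl x (List.of_mem_zip h).1).pmul (hl' y (List.of_mem_zip h).2)
  refine this.mono ?_ ?_ <;> · rw [Nat.add_mul]; omega

theorem powerSums_spec {cs : List (Poly K)} (hcs : ∀ c ∈ cs, PB v 0 E c) (l : List Unit)
    (s : K × List (Poly K) × List (Poly K)) (k M : ℕ) (hM : k + l.length ≤ M)
    (h1 : ∀ x ∈ s.2.1, Nm x ∧ PB v 0 (k * E) x) (h2 : ∀ x ∈ s.2.2, x ∈ cs) :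
    (∀ x ∈ (powerSums cs s l).2.1, Nm x ∧ PB v 0 (M * E) x) ∧
      (powerSums cs s l).2.1.length = l.length + s.2.1.length ∧
      (∀ x ∈ (powerSums cs s l).2.2, x ∈ cs) ∧ (powerSums cs s l).2.2.length ≤ s.2.2.length := by
  induction l generalizing s k with
  | nil => exact ⟨fun x hx => ⟨(h1 x hx).1, (h1 x hx).2.mono le_rfl
      (Nat.mul_le_mul_right _ (by simp at hM; omega))⟩, by simp [powerSums], h2, le_rfl⟩
  | cons i l ih =>
    simp only [List.length_cons] at hM
    have h3 : PB v 0 ((k + 1) * E) (psum [pscal (0 - s.1) (s.2.2.headD []),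
        pscal (0 - 1) (psum ((cs.zip s.2.1).map fun x => pmul x.1 x.2))]) := by
      refine PB.psum fun p hp => ?_
      simp only [List.mem_cons, List.not_mem_nil, or_false] at hp
      rcases hp with rfl | rfl
      · refine PB.pscal ?_ _
        cases h : s.2.2 with
        | nil => exact PB.nil
        | cons c r =>
          exact (hcs c (h2 c (by simp [h]))).mono le_rfl (by rw [Nat.add_mul]; omega)
      · exact PB.pscal (by simpa using zip_bound hcs (by simpa using fun x hx => (h1 x hx).2)) _
    have := ih (s.1 + 1, psum [pscal (0 - s.1) (s.2.2.headD []),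
        pscal (0 - 1) (psum ((cs.zip s.2.1).map fun x => pmul x.1 x.2))] :: s.2.1, s.2.2.tail)
      (k + 1) (by omega) (by
        intro x hx
        rcases List.mem_cons.1 hx with rfl | hx
        · exact ⟨nm_collect _, h3⟩
        · exact ⟨(h1 x hx).1, (h1 x hx).2.mono le_rfl (Nat.mul_le_mul_right _ (by omega))⟩)
      (fun x hx => h2 x (List.mem_of_mem_tail hx))
    simp only [powerSums, List.foldl_cons, List.length_cons, List.length_tail] at this ⊢
    exact ⟨this.1, by rw [this.2.1]; omega, this.2.2.1, by omega⟩

theorem newtonCoefs_spec {Ps : List (Poly K)} (hPs : ∀ c ∈ Ps, PB v S E c) (l : List (Poly K))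
    (s : K × List (Poly K)) (k M : ℕ) (hM : k + l.length ≤ M)
    (h1 : ∀ x ∈ s.2, Nm x ∧ PB v (k * S) (k * E) x) :
    (∀ x ∈ (newtonCoefs Ps s l).2, Nm x ∧ PB v (M * S) (M * E) x) ∧
      (newtonCoefs Ps s l).2.length = l.length + s.2.length := by
  induction l generalizing s k with
  | nil => exact ⟨fun x hx => ⟨(h1 x hx).1, (h1 x hx).2.mono
      (Nat.mul_le_mul_right _ (by simp at hM; omega))
      (Nat.mul_le_mul_right _ (by simp at hM; omega))⟩, by simp [newtonCoefs]⟩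
  | cons i l ih =>
    simp only [List.length_cons] at hM
    have h3 : PB v ((k + 1) * S) ((k + 1) * E)
        (pscal (0 - 1 / s.1) (psum ((s.2.zip Ps).map fun x => pmul x.1 x.2))) := by
      refine PB.pscal (PB.psum fun p hp => ?_) _
      obtain ⟨⟨x, y⟩, h, rfl⟩ := List.mem_map.1 hp
      have := ((h1 x (List.of_mem_zip h).1).2).pmul (hPs y (List.of_mem_zip h).2)
      simpa [Nat.add_mul] using this
    have := ih (s.1 + 1, pscal (0 - 1 / s.1) (psum ((s.2.zip Ps).map fun x => pmul x.1 x.2)) :: s.2)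
      (k + 1) (by omega) (by
        intro x hx
        rcases List.mem_cons.1 hx with rfl | hx
        · exact ⟨nm_collect _, h3⟩
        · exact ⟨(h1 x hx).1, (h1 x hx).2.mono (Nat.mul_le_mul_right _ (by omega))
            (Nat.mul_le_mul_right _ (by omega))⟩)
    simp only [newtonCoefs, List.foldl_cons, List.length_cons] at this ⊢
    exact ⟨this.1, by rw [this.2]; omega⟩

theorem shiftS_pb (h : PB (v + 1) S E p) : PB (v + 1) (S + 1) E (shiftS p) := by
  intro t ht
  obtain ⟨⟨a, c⟩, hx, rfl⟩ := List.mem_map.1 ht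
  obtain ⟨h1, h2, h3⟩ := h _ hx
  exact ⟨by simp at h1 ⊢; omega, Nat.succ_le_succ h2, h3⟩

theorem horner_pb {l : List (Poly K)} (hl : ∀ x ∈ l, PB (v + 1) 0 E x) :
    PB (v + 1) l.length E (horner l) := by
  induction l using List.reverseRecOn with
  | nil => exact PB.nil
  | append_singleton l x ih =>
    simp only [horner, List.foldl_append, List.foldl_cons, List.foldl_nil, List.length_append,
      List.length_singleton]
    exact (shiftS_pb (ih fun x hx => hl x (by simp [hx]))).append
      ((hl x (by simp)).mono (Nat.zero_le _) le_rfl)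

theorem scaled_pb {zs : List ℕ} (hz : zs = List.replicate w 0) {a F : Poly K} (ha : PB w E E a)
    (hF : PB (w + 1) E E F) : PB (w + 3) 0 ((E + 2) ^ 2) (scaled zs a F) := by
  have hh : listMax (heads F) ≤ E := listMax_le _ hF.heads_le
  have hp := Nat.mul_le_mul_right E (Nat.succ_le_succ hh)
  obtain ⟨-, h2, h3⟩ := homList_spec (constP zs 1, []) ha hF 0 (downTo (listMax (heads F) + 1))
    ((E + 1) * E) (by simpa [downTo] using hp) ⟨constP_nm _ one_ne_zero, constP_pb _ hz _⟩ (by simp)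
  intro t ht
  obtain ⟨⟨i, q⟩, hx, ht⟩ := List.mem_flatMap.1 ht
  have hi : i ∈ (homList (constP zs 1, []) a F (downTo (listMax (heads F) + 1))).2.map Prod.fst :=
    List.mem_map.2 ⟨_, hx, rfl⟩
  rw [h3] at hi
  simp [downTo] at hi
  have hb : E + (E + 1) * E ≤ (E + 2) ^ 2 := by nlinarith
  have hi' : i ≤ (E + 2) ^ 2 := by nlinarith
  exact emb_pb (h2 _ hx).2 i hb hb hi' t ht

theorem linP_pb {zs : List ℕ} (hz : zs = List.replicate w 0) {a : Poly K} (ha : PB w E E a) :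
    PB (w + 3) 0 (E + 1) (linP zs a) := by
  refine PB.append (fun t ht => ?_) fun t ht => ?_
  · obtain ⟨⟨b, c⟩, hx, rfl⟩ := List.mem_map.1 ht
    obtain ⟨h1, h2, h3⟩ := ha _ hx
    refine ⟨by simpa using h1, le_rfl, fun e he => ?_⟩
    simp only [List.tail_cons, List.mem_cons] at he
    rcases he with rfl | rfl | he
    · omega
    · omega
    · cases b with
      | nil => simp at he
      | cons y b =>
        rcases List.mem_cons.1 he with rfl | he
        · exact Nat.le_succ_of_le h2
        · exact Nat.le_succ_of_le (h3 e he)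
  · rw [List.mem_singleton] at ht
    subst ht; subst hz
    refine ⟨by simp, by simp, fun e he => ?_⟩
    simp only [List.tail_cons, List.mem_cons, List.mem_replicate] at he
    omega

theorem sepP_pb {zs : List ℕ} (hz : zs = List.replicate w 0) {a Q : Poly K} {P : List (Poly K)}
    (ha : PB w E E a) (hP : ∀ F ∈ P, PB (w + 1) E E F) (hQ : PB (w + 1) E E Q) :
    PB (w + 3) (P.length + 2) ((E + 2) ^ 3) (sepP zs a P Q) := by
  have e1 : (E + 2) ^ 2 ≤ (E + 2) ^ 3 := Nat.pow_le_pow_right (by omega) (by omega)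
  have e2 : (E + 2) ^ 2 + (E + 1) ≤ (E + 2) ^ 3 := by nlinarith [sq_nonneg E]
  have h1 : PB (w + 3) P.length ((E + 2) ^ 2) (horner (P.map fun F => scaled zs a F)) := by
    simpa using horner_pb (v := w + 2) (l := P.map fun F => scaled zs a F) (fun x hx => by
      obtain ⟨F, hF, rfl⟩ := List.mem_map.1 hx
      exact scaled_pb hz ha (hP F hF))
  have h2 := (scaled_pb hz ha hQ).pmul (linP_pb hz ha)
  refine PB.collect (PB.append (shiftS_pb (v := w + 2) (PB.append ((shiftS_pb (v := w + 2) h1).mono le_rfl e1)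
    (h2.mono (by omega) e2))) (constP_pb _ ?_ _))
  simp [hz, List.replicate_succ]

theorem monicCoefs_spec {zs : List ℕ} (hz : zs = List.replicate w 0) {F : Poly K} {m : ℕ}
    (hF : PB (w + 1) E E F) (hm : m ≤ E) :
    (monicCoefs zs F m).length = m ∧
      ∀ c ∈ monicCoefs zs F m, PB (w + 3) 0 ((E + 2) ^ 2) c := by
  have hp := Nat.mul_le_mul_right E hm
  obtain ⟨-, h2, h3⟩ := homList_spec (constP zs 1, []) (hF.coefH m) hF 0 (downTo m)
    (E * E) (by simpa [downTo] using hp) ⟨constP_nm _ one_ne_zero, constP_pb _ hz _⟩ (by simp)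
  refine ⟨?_, fun c hc => ?_⟩
  · have := congrArg List.length h3
    simpa [monicCoefs, downTo] using this
  · obtain ⟨⟨i, q⟩, hx, rfl⟩ := List.mem_map.1 hc
    have hb : E + E * E ≤ (E + 2) ^ 2 := by nlinarith
    exact emb_pb (h2 _ (List.mem_reverse.1 hx)).2 0 hb hb (Nat.zero_le _)

theorem trace_pb {ps : List (Poly K)} (hps : ∀ x ∈ ps, PB (v + 2) 0 E' x)
    (h : PB (v + 2) S E p) : PB (v + 2) S (E + E') (trace ps p) := by
  refine PB.collect fun t ht => ?_
  obtain ⟨⟨a, c⟩, hx, ht⟩ := List.mem_flatMap.1 ht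
  obtain ⟨t', ht', rfl⟩ := List.mem_map.1 ht
  have h1 : PB (v + 2) 0 E' (nth ps (a.tail.headD 0)) := by
    rw [nth]
    cases hd : ps.drop (a.tail.headD 0) with
    | nil => exact PB.nil
    | cons q r => exact hps q (List.mem_of_mem_drop (by rw [hd]; simp))
  refine (PB.mulT (S := S) (E := E) ?_ (h1.single ht')) _ (List.mem_singleton_self _)
  obtain ⟨h2, h3, h4⟩ := h _ hx
  intro t ht
  rw [List.mem_singleton] at ht
  subst ht
  refine ⟨by simp at h2 ⊢; omega, h3, fun e he => ?_⟩
  rcases List.mem_cons.1 he with rfl | he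
  · exact Nat.zero_le _
  · exact h4 e (List.mem_of_mem_tail he)

theorem dropZ_pb (h : PB (v + 2) S E p) : PB (v + 1) S E (dropZ p) := by
  refine PB.collect fun t ht => ?_
  obtain ⟨⟨a, c⟩, hx, rfl⟩ := List.mem_map.1 ht
  obtain ⟨h2, h3, h4⟩ := h _ hx
  exact ⟨by simp at h2 ⊢; omega, h3, fun e he => h4 e (List.mem_of_mem_tail he)⟩

theorem zDeg_le (h : PB (v + 2) S E p) : zDeg p ≤ E := by
  refine listMax_le _ fun x hx => ?_
  obtain ⟨⟨a, c⟩, ht, rfl⟩ := List.mem_map.1 hx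
  have h1 := (h _ ht).2.2
  cases ha : a.tail with
  | nil => simp
  | cons y b => exact h1 y (by simp [ha])

theorem powerList_spec {zs : List ℕ} (hz : 0 :: 0 :: 0 :: zs = List.replicate v 0) {g : Poly K}
    (hg : PB v S E g) (m : ℕ) : (powerList zs g m).length = m ∧
      ∀ x ∈ powerList zs g m, Nm x ∧ PB v (m * S) (m * E) x := by
  obtain ⟨-, h2, h3⟩ := powers_spec (constP (0 :: 0 :: 0 :: zs) 1, []) hg (List.replicate m ()) 0 m
    (by simp) ⟨constP_nm _ one_ne_zero, constP_pb _ hz _⟩ (by simp)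
  exact ⟨by simpa [powerList] using h3, fun x hx => h2 x (List.mem_reverse.1 hx)⟩

theorem powerSumList_spec {zs : List ℕ} (hz : 0 :: 0 :: 0 :: zs = List.replicate v 0)
    {cs : List (Poly K)} (hcs : ∀ c ∈ cs, PB v 0 E c) (L : ℕ) :
    ∀ x ∈ powerSumList zs cs L, PB v 0 (L * E) x := by
  obtain ⟨h1, -⟩ := powerSums_spec hcs (List.replicate L ()) (1, [], cs) 0 L (by simp) (by simp)
    (fun _ h => h)
  intro x hx
  rcases List.mem_cons.1 hx with rfl | hx
  · exact constP_pb _ hz _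
  · exact (h1 x (List.mem_reverse.1 hx)).2

theorem prodOfSums_pb {zs : List ℕ} (hz : 0 :: 0 :: 0 :: zs = List.replicate v 0)
    {Ps : List (Poly K)} (hPs : ∀ c ∈ Ps, PB v S E c) :
    PB v (Ps.length * S) (Ps.length * E) (prodOfSums zs Ps) := by
  obtain ⟨h1, h2⟩ := newtonCoefs_spec hPs Ps (1, [constP (0 :: 0 :: 0 :: zs) 1]) 0 Ps.length (by simp)
    (by
      intro x hx
      rw [List.mem_singleton] at hx
      subst hx
      exact ⟨constP_nm _ one_ne_zero, constP_pb _ hz _⟩)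
  rw [prodOfSums]
  cases h : (newtonCoefs Ps (1, [constP (0 :: 0 :: 0 :: zs) 1]) Ps).2 with
  | nil => exact PB.nil
  | cons p l => exact (h1 p (by simp [h])).2

theorem trace_sum_bound (E m : ℕ) (hm : m ≤ E) :
    m * (m * (E + 2) ^ 3 + m * (E + 2) ^ 3 * (E + 2) ^ 2) ≤ (E + 2) ^ 8 := by
  have h1 : 1 + (E + 2) ^ 2 ≤ (E + 2) ^ 3 := by nlinarith [sq_nonneg E]
  have h2 : m * m ≤ (E + 2) ^ 2 := by nlinarith
  calc _ = (m * m) * ((E + 2) ^ 3 * (1 + (E + 2) ^ 2)) := by ring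
    _ ≤ (E + 2) ^ 2 * ((E + 2) ^ 3 * (E + 2) ^ 3) := by gcongr
    _ = _ := by ring

theorem normP_pb {zs : List ℕ} (hz : zs = List.replicate w 0) {F Q : Poly K} {P : List (Poly K)}
    {m : ℕ} (hF : PB (w + 1) E E F) (hP : ∀ F ∈ P, PB (w + 1) E E F) (hQ : PB (w + 1) E E Q)
    (hm : m ≤ E) : PB (w + 2) (m * (m * (P.length + 2))) ((E + 2) ^ 8) (normP m zs F P Q) := by
  have hz3 : 0 :: 0 :: 0 :: zs = List.replicate (w + 3) 0 := by simp [hz, List.replicate_succ]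
  obtain ⟨h1, h2⟩ := powerList_spec hz3 (sepP_pb hz (hF.coefH m) hP hQ) m
  have h3 := zDeg_le (v := w + 1) (PB.flatten fun x hx => (h2 x hx).2)
  have h4 := powerSumList_spec hz3 (monicCoefs_spec hz hF hm).2
    (zDeg (powerList zs (sepP zs (coefH m F) P Q) m).flatten)
  have h5 := prodOfSums_pb hz3 (Ps := (powerList zs (sepP zs (coefH m F) P Q) m).map
    (trace (powerSumList zs (monicCoefs zs F m)
      (zDeg (powerList zs (sepP zs (coefH m F) P Q) m).flatten)))) (by
      intro c hc
      obtain ⟨x, hx, rfl⟩ := List.mem_map.1 hc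
      exact trace_pb (v := w + 1) (fun x hx => (h4 x hx).mono le_rfl (Nat.mul_le_mul_right _ h3))
        (h2 x hx).2)
  rw [List.length_map, h1] at h5
  exact dropZ_pb (v := w + 1) (h5.mono le_rfl (trace_sum_bound E m hm))

end

/-! ### Programs for the norm polynomial -/

section

variable {K : Type u} [Field K]

theorem le_of_pow_le {t w B : ℕ} (ht : 2 ≤ t) (hB : t ^ (w + 3) ≤ B) : w + 3 ≤ B ∧ t ≤ B :=
  ⟨((Nat.lt_pow_self (by omega : 1 < t)).le).trans hB, (Nat.le_self_pow (by omega) t).trans hB⟩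

theorem PB.bd_pow {v S E t w B a c : ℕ} {p : Poly K} (h : PB v S E p) (hn : Nm p) (ht : 2 ≤ t)
    (hB : t ^ (w + 3) ≤ B) (hv : v ≤ w + 3) (hE : E ≤ t ^ c) (hS : S + 1 ≤ B ^ a) :
    Bd K (B ^ (a + c + 1)) p := by
  obtain ⟨h1, h2⟩ := le_of_pow_le ht hB
  have hB1 : 1 ≤ B := by omega
  refine h.bd hn (hv.trans (h1.trans (Nat.le_self_pow (by omega) B))) ?_ ?_
  · calc E ≤ t ^ c := hE
      _ ≤ B ^ c := Nat.pow_le_pow_left h2 c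
      _ ≤ _ := Nat.pow_le_pow_right hB1 (by omega)
  · calc _ ≤ B ^ a * B ^ (c + 1) := Nat.mul_le_mul hS (pow_bound ht hB hE hv)
      _ = _ := by rw [← pow_add, add_assoc]

theorem PB.bd_same {v E t w B : ℕ} {p : Poly K} (h : PB v E E p) (hn : Nm p) (c : ℕ) (ht : 2 ≤ t)
    (hB : t ^ (w + 3) ≤ B) (hv : v ≤ w + 3) (hE : E ≤ t ^ c) : Bd K (B ^ (2 * c + 2)) p := by
  have := h.bd_pow (a := c + 1) hn ht hB hv hE
    (by simpa using pow_bound ht hB hE (show 1 ≤ w + 3 by omega))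
  exact Dat.mono (le_of_eq (by congr 1; omega)) this

theorem bd_zeros {w B : ℕ} (h : w ≤ B) : Bd K B (List.replicate w 0) :=
  ⟨by simpa using h, fun x hx => by rw [List.eq_of_mem_replicate hx]; exact Nat.zero_le _⟩

theorem pow_mono_le {B a b : ℕ} (hB : 2 ≤ B) (h : a ≤ b) : B ^ a ≤ B ^ b :=
  Nat.pow_le_pow_right (by omega) h

/-- The domain of the function that scales coefficients. -/
def ScaleDom (B : ℕ) (x : List ℕ × Poly K × Poly K) : Prop :=
  ∃ w E, x.1 = List.replicate w 0 ∧ (PB w E E x.2.1 ∧ Nm x.2.1) ∧ (PB (w + 1) E E x.2.2 ∧ Nm x.2.2) ∧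
    (E + 2) ^ (w + 3) ≤ B

/-- The domain of the function that scales coefficients, with the list of exponents. -/
def HomDom (B : ℕ) (x : (List ℕ × Poly K × Poly K) × List ℕ) : Prop :=
  ∃ w E, x.1.1 = List.replicate w 0 ∧ (PB w E E x.1.2.1 ∧ Nm x.1.2.1) ∧
    (PB (w + 1) E E x.1.2.2 ∧ Nm x.1.2.2) ∧ (E + 2) ^ (w + 3) ≤ B ∧ x.2.length ≤ E + 1 ∧
    ∀ i ∈ x.2, i ≤ E

theorem ScaleDom.bd {B : ℕ} {x : List ℕ × Poly K × Poly K} (h : ScaleDom B x) :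
    Bd K (B ^ (3 + 1)) x := by
  obtain ⟨w, E, hz, ⟨h1, h2⟩, ⟨h3, h4⟩, hB⟩ := h
  have ht : 2 ≤ E + 2 := by omega
  obtain ⟨h5, h6⟩ := le_of_pow_le ht hB
  have hE : E ≤ (E + 2) ^ 1 := by rw [pow_one]; omega
  refine ⟨?_, h1.bd_same h2 1 ht hB (by omega) hE, h3.bd_same h4 1 ht hB (by omega) hE⟩
  rw [hz]
  exact bd_zeros (le_trans (by omega) (Nat.le_self_pow (by omega) B))

theorem HomDom.bd {B : ℕ} {x : (List ℕ × Poly K × Poly K) × List ℕ} (h : HomDom B x) :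
    Bd K (B ^ (3 + 1)) x := by
  obtain ⟨w, E, hz, h1, h3, hB, h7, h8⟩ := h
  have ht : 2 ≤ E + 2 := by omega
  obtain ⟨h5, h6⟩ := le_of_pow_le ht hB
  have hb : B ≤ B ^ (3 + 1) := Nat.le_self_pow (by omega) B
  exact ⟨ScaleDom.bd ⟨w, E, hz, h1, h3, hB⟩, by omega,
    fun i hi => by have := h8 i hi; change _ ≤ _; omega⟩

end

def constPI : {I : Impl // ∀ (K : Type u) [Field K],
    Ok K I (Bd K) (fun p : List ℕ × K => constP p.1 p.2)} :=
  ⟨_, fun _ _ => (Ok.singleton id).congr fun _ => rfl⟩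

def embI : {I : Impl // ∀ (K : Type u) [Field K],
    Ok K I (Bd K) (fun p : ℕ × Poly K => emb p.1 p.2)} :=
  ⟨_, fun K _ => (mapOf ((cons.app2 natZero (cons.app2 (fst (α := ℕ) (β := Term K)) (cons.app2 natZero
    (fst.app snd)))).pair (snd.app snd)) fst snd).congr fun _ => rfl⟩

def homI : {I : Impl // ∀ (K : Type u) [Field K], Ok K I (HomDom (K := K))
    (fun x => (homList (constP x.1.1 1, []) x.1.2.1 x.1.2.2 x.2).2)} :=
  ⟨_, fun K _ => snd.app (((((pmulI.2 K).app2 (fst.app (fst.app snd)) (fst.app fst)).pair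
    (cons.app2 ((snd.app snd).pair ((pmulI.2 K).app2 ((coefHI.2 K).app2 (snd.app snd) (snd.app fst))
      (fst.app (fst.app snd)))) (snd.app (fst.app (snd (α := Poly K × Poly K)
      (β := (Poly K × List (ℕ × Poly K)) × ℕ)))))).foldl 7
    (D := fun B x => ∃ zs, x.2.1 = (constP zs 1, []) ∧ HomDom B ((zs, x.1), x.2.2)) (by
      rintro B ⟨a, F⟩ b l hB ⟨zs, hb, w, E, hz, ⟨h1, h2⟩, ⟨h3, h4⟩, hB', h7, h8⟩
      dsimp only at hz h1 h2 h3 h4 h7 h8 hb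
      subst hb
      have ht : 2 ≤ E + 2 := by omega
      obtain ⟨h5, h6⟩ := le_of_pow_le ht hB'
      have hb : B ≤ B ^ (7 + 1) := self_le_pow_succ _
      have key (l1 : List ℕ) (hl1 : l1.length ≤ l.length) (hs : ∀ i ∈ l1, i ∈ l) :
          Bd K (B ^ (7 + 1)) (homList (constP zs 1, []) a F l1) := by
        have hp := Nat.mul_le_mul_right E (hl1.trans h7)
        obtain ⟨h9, h10, h11⟩ := homList_spec (constP zs 1, []) h1 h3 0 l1 ((E + 1) * E)
          (by omega) ⟨constP_nm _ one_ne_zero, constP_pb _ hz _⟩ (by simp)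
        have hb1 : (E + 1) * E ≤ (E + 2) ^ 2 := by nlinarith
        have hb2 : E + (E + 1) * E ≤ (E + 2) ^ 2 := by nlinarith
        refine ⟨Dat.mono (pow_mono_le hB (by norm_num))
          (h9.2.bd_same h9.1 2 ht hB' (by omega) hb1), ?_, fun x hx => ⟨?_, ?_⟩⟩
        · have := congrArg List.length h11
          simp only [List.length_map, List.length_append, List.length_reverse, List.length_nil] at this
          omega
        · have : x.1 ∈ l1.reverse ++ _ := h11 ▸ List.mem_map.2 ⟨x, hx, rfl⟩
          have := h8 x.1 (hs _ (by simpa using this))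
          change x.1 ≤ _; omega
        · exact Dat.mono (pow_mono_le hB (by norm_num))
            ((h10 x hx).2.bd_same (h10 x hx).1 2 ht hB' (by omega) hb2)
      refine ⟨by omega, key l le_rfl fun _ h => h, ?_⟩
      rintro l1 x l2 rfl
      have hx := h8 x (by simp)
      refine ⟨⟨Dat.mono (pow_mono_le hB (by norm_num)) (h1.bd_same h2 1 ht hB' (by omega) (by rw [pow_one]; omega)),
        Dat.mono (pow_mono_le hB (by norm_num)) (h3.bd_same h4 1 ht hB' (by omega) (by rw [pow_one]; omega))⟩,
        key l1 (by simp) (by simp +contextual), ?_⟩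
      change x ≤ _; omega)).compK (by
      rintro B B' a h ⟨zs, h1, w, E, h2, h3, h4, h5, h6⟩
      exact ⟨zs, h1, w, E, h2, h3, h4, h5.trans h, h6⟩) 0
    (((snd.app fst).pair ((((constPI.2 K).app2 (fst.app fst) one).pair empty).pair snd)).of 3
      (D' := HomDom (K := K)) fun B a _ h => h.bd) fun B a hB h => ⟨a.1.1, rfl, by simpa using h⟩)⟩

theorem HomDom.mono {K : Type u} [Field K] {B B' : ℕ} {x : (List ℕ × Poly K × Poly K) × List ℕ}
    (h : B ≤ B') (hx : HomDom B x) : HomDom B' x := by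
  obtain ⟨w, E, h2, h3, h4, h5, h6⟩ := hx
  exact ⟨w, E, h2, h3, h4, h5.trans h, h6⟩

theorem ScaleDom.mono {K : Type u} [Field K] {B B' : ℕ} {x : List ℕ × Poly K × Poly K}
    (h : B ≤ B') (hx : ScaleDom B x) : ScaleDom B' x := by
  obtain ⟨w, E, h2, h3, h4, h5⟩ := hx
  exact ⟨w, E, h2, h3, h4, h5.trans h⟩

def scaledI : {I : Impl // ∀ (K : Type u) [Field K], Ok K I (ScaleDom (K := K))
    (fun x => scaled x.1 x.2.1 x.2.2)} :=
  ⟨_, fun K _ => (flatMapOf ((embI.2 K).app (snd (α := Unit))) unit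
    ((homI.2 K).compK (fun _ _ _ h h' => h'.mono h) 0
      ((id.pair ((downToI.2 K).app (succ.app ((listMaxI.2 K).app ((headsI.2 K).app (snd.app snd)))))).of 3
      (D' := ScaleDom (K := K)) fun B a _ h => h.bd) (by
      rintro B ⟨zs, a, F⟩ hB ⟨w, E, h2, h3, h4, h5⟩
      have hh : listMax (heads F) ≤ E := listMax_le _ h4.1.heads_le
      refine ⟨w, E, h2, h3, h4, by simpa using h5, ?_, fun i hi => ?_⟩
      · simpa [downTo] using hh
      · simp [downTo] at hi
        omega))).congr fun _ => rfl⟩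

def shiftSI : {I : Impl // ∀ (K : Type u) [Field K], Ok K I (Bd K) (shiftS (K := K))} :=
  ⟨_, fun K _ => (mapOf ((cons.app2 (succ.app (headNat.app (fst.app (snd (α := Unit)
    (β := Term K))))) (tail.app (fst.app snd))).pair (snd.app snd)) unit id).congr fun _ => rfl⟩

theorem bd_horner {K : Type u} [Field K] {B : ℕ} (hB : 2 ≤ B) (l : List (Poly K)) (h : Bd K B l) :
    Bd K (B ^ (1 + 1)) (horner l) := by
  have key (l : List (Poly K)) (h : ∀ x ∈ l, Bd K B x) : (horner l).length ≤ l.length * B ∧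
      ∀ t ∈ horner l, t.1.length ≤ B ∧ ∀ e ∈ t.1, e ≤ B + l.length := by
    induction l using List.reverseRecOn with
    | nil => exact ⟨by simp [horner], by simp [horner]⟩
    | append_singleton l x ih =>
      obtain ⟨h1, h2⟩ := ih fun x hx => h x (by simp [hx])
      have e : horner (l ++ [x]) = shiftS (horner l) ++ x := by simp [horner]
      have hx := h x (by simp)
      rw [e]
      refine ⟨?_, fun t ht => ?_⟩
      · have := hx.1
        simp only [shiftS, List.length_append, List.length_map, List.length_singleton, Nat.add_mul]
        omega
      · rw [List.length_append, List.length_singleton]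
        rcases List.mem_append.1 ht with ht | ht
        · obtain ⟨⟨a, c⟩, ha, rfl⟩ := List.mem_map.1 ht
          obtain ⟨h3, h4⟩ := h2 _ ha
          cases a with
          | nil =>
            refine ⟨by simp; omega, fun e he => ?_⟩
            simp at he; omega
          | cons y a =>
            refine ⟨h3, fun e he => ?_⟩
            rcases List.mem_cons.1 he with rfl | he
            · have := h4 y (by simp)
              simp only [List.headD_cons]; omega
            · have := h4 e (by simp only [List.tail_cons] at he; simp [he])
              omega
        · exact ⟨(hx.2 t ht).1.1, fun e he => le_trans ((hx.2 t ht).1.2 e he) (by omega)⟩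
  have h1 := key l h.2
  have h2 := h.1
  have e : B ^ (1 + 1) = B * B := by ring
  have h3 : B + B ≤ B * B := by rw [← two_mul]; exact Nat.mul_le_mul_right B hB
  refine ⟨h1.1.trans (by rw [e]; exact Nat.mul_le_mul_right B h2), fun t ht => ⟨⟨?_, fun x hx => ?_⟩, trivial⟩⟩
  · have := (h1.2 t ht).1; omega
  · have := (h1.2 t ht).2 x hx
    change x ≤ _; omega

def hornerI : {I : Impl // ∀ (K : Type u) [Field K], Ok K I (Bd K) (horner (K := K))} :=
  ⟨_, fun K _ => (((((shiftSI.2 K).app (fst.app (snd (α := Unit) (β := Poly K × Poly K)))).append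
    (snd.app snd)).foldl 1 (D := fun B p => p.2.1 = [] ∧ Bd K B p.2.2) (by
    rintro B c b l hB ⟨rfl, hl⟩
    dsimp only at hl
    refine ⟨hl.1.trans (self_le_pow_succ _), bd_horner hB l hl, ?_⟩
    rintro l1 x l2 rfl
    exact ⟨trivial, bd_horner hB l1 (bd_sub hl (by simp) (by simp +contextual)),
      Dat.mono (self_le_pow_succ _) (hl.2 x (by simp))⟩)).compD
    (unit.pair (empty.pair id)) fun B a hB h => ⟨rfl, Dat.mono (self_le_pow_succ _) h⟩).congr
    fun _ => rfl⟩

def linPI : {I : Impl // ∀ (K : Type u) [Field K],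
    Ok K I (Bd K) (fun p : List ℕ × Poly K => linP p.1 p.2)} :=
  ⟨_, fun K _ => ((mapOf ((cons.app2 natZero (cons.app2 natZero (cons.app2 (succ.app natZero)
    (fst.app (snd (α := Unit) (β := Term K)))))).pair (snd.app snd)) unit snd).append
    (Ok.singleton ((cons.app2 natZero (cons.app2 (succ.app natZero) (cons.app2 natZero fst))).pair
      (sub.app2 zero one)))).congr fun _ => rfl⟩

/-- The domain of the function that builds the polynomial `sepP`. -/
def SepDom {K : Type u} [Field K] (B : ℕ) (x : (List ℕ × Poly K) × List (Poly K) × Poly K) : Prop :=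
  ∃ w E, x.1.1 = List.replicate w 0 ∧ (PB w E E x.1.2 ∧ Nm x.1.2) ∧
    (∀ F ∈ x.2.1, PB (w + 1) E E F ∧ Nm F) ∧ (PB (w + 1) E E x.2.2 ∧ Nm x.2.2) ∧
    x.2.1.length ≤ B ∧ (E + 2) ^ (w + 3) ≤ B

theorem SepDom.bd {K : Type u} [Field K] {B : ℕ} {x : (List ℕ × Poly K) × List (Poly K) × Poly K}
    (h : SepDom B x) : Bd K (B ^ (3 + 1)) x := by
  obtain ⟨w, E, h1, h2, h3, h4, h5, h6⟩ := h
  have hb := ScaleDom.bd (x := (x.1.1, x.1.2, x.2.2)) ⟨w, E, h1, h2, h4, h6⟩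
  exact ⟨⟨hb.1, hb.2.1⟩, ⟨h5.trans (Nat.le_self_pow (by omega) B), fun F hF =>
    (ScaleDom.bd (x := (x.1.1, x.1.2, F)) ⟨w, E, h1, h2, h3 F hF, h6⟩).2.2⟩, hb.2.2⟩

def sepPI : {I : Impl // ∀ (K : Type u) [Field K], Ok K I (SepDom (K := K))
    (fun x => sepP x.1.1 x.1.2 x.2.1 x.2.2)} :=
  ⟨_, fun K _ =>
    have all {β : Type u} [Dat K β] {J : Impl} {f : (List ℕ × Poly K) × List (Poly K) × Poly K → β}
      (h : Ok K J (Bd K) f) : Ok K (J.up 3) SepDom f := h.of 3 fun _ _ _ h => h.bd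
    have sc : Ok K _ (SepDom (K := K)) (fun x => scaled x.1.1 x.1.2 x.2.2) :=
      (scaledI.2 K).compK (fun _ _ _ h h' => h'.mono h) 0
        (all ((fst.app fst).pair ((snd.app fst).pair (snd.app snd)))) (by
        rintro B a - ⟨w, E, h1, h2, h3, h4, h5, h6⟩
        exact ⟨w, E, h1, h2, h4, by simpa using h6⟩)
    have scs : Ok K _ (SepDom (K := K)) (fun x => x.2.1.map fun F => scaled x.1.1 x.1.2 F) :=
      (((scaledI.2 K).compK (D := fun B (x : (List ℕ × Poly K) × Poly K) =>
        ScaleDom B (x.1.1, x.1.2, x.2)) (fun _ _ _ h h' => h'.mono h) 0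
        (((fst.app fst).pair ((snd.app fst).pair snd)).of 3 fun B a _ h =>
          ⟨⟨h.bd.1, h.bd.2.1⟩, h.bd.2.2⟩) fun B a _ h => by simpa using h).map
      (fun _ _ _ h h' => h'.mono h) 0 (D := fun B x => Bd K B x ∧ ∀ F ∈ x.2, ScaleDom B (x.1.1, x.1.2, F))
      fun B c l _ h => by simpa using ⟨h.1.1, h.1.2, h.2⟩).compK
      (fun _ _ _ h h' => ⟨Dat.mono h h'.1, fun F hF => (h'.2 F hF).mono h⟩) 3
      (all (fst.pair (fst.app snd))) (by
        rintro B a hB h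
        refine ⟨⟨h.bd.1, h.bd.2.1⟩, ?_⟩
        obtain ⟨w, E, h1, h2, h3, h4, h5, h6⟩ := h
        exact fun F hF => ⟨w, E, h1, h2, h3 F hF, h6.trans (self_le_pow_succ _)⟩)
    ((collectI.2 K).app (((shiftSI.2 K).app (((shiftSI.2 K).app ((hornerI.2 K).app scs)).append
      ((pmulI.2 K).app2 sc (all ((linPI.2 K).app fst))))).append
      (all ((constPI.2 K).app2 (cons.app2 natZero (cons.app2 natZero (cons.app2 natZero
        (fst.app fst)))) one)))).congr fun _ => rfl⟩

namespace Ok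

variable {K : Type u} [Field K] {α β γ : Type*} [Dat K α] [Dat K β] [Dat K γ]
  {I J : Impl} {D : ℕ → α → Prop} {f : α → β}

/-- Composition where the second program has a restricted domain of bounded data. -/
theorem compB {g : β → γ} {D2 : ℕ → β → Prop} (hg : Ok K J (fun B a => Bd K B a ∧ D2 B a) g)
    (hm : ∀ B B' a, B ≤ B' → D2 B a → D2 B' a) (k : ℕ) (hf : Ok K I D f)
    (h : ∀ B a, 2 ≤ B → D B a → D2 (B ^ (k + 1)) (f a)) :
    Ok K ((J.up k).comp I) D (fun a => g (f a)) :=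
  (hg.of (D' := fun B a => Bd K B a ∧ D2 (B ^ (k + 1)) a) k fun _ _ _ h =>
    ⟨Dat.mono (self_le_pow_succ _) h.1, h.2⟩).compD hf fun B a hB ha =>
    ⟨(hf B a hB ha).1, hm _ _ _ (Nat.pow_le_pow_left (self_le_pow_succ _) _) (h B a hB ha)⟩

/-- A function on all data, restricted to a domain. -/
theorem res {D2 : ℕ → α → Prop} (h : Ok K I (Bd K) f) : Ok K I (fun B a => Bd K B a ∧ D2 B a) f :=
  h.mono fun _ _ _ h => h.1

/-- `List.flatMap` over a list of the input, with a context, for a function with a restricted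
domain. -/
theorem flatMapB {δ : Type*} [Dat K δ] {g : γ × δ → List β} {D2 : ℕ → γ × δ → Prop}
    (hg : Ok K J (fun B a => Bd K B a ∧ D2 B a) g) (hm : ∀ B B' a, B ≤ B' → D2 B a → D2 B' a)
    {c : α → γ} {l : α → List δ} {I1 I2 : Impl} (hc : Ok K I1 D c) (hl : Ok K I2 D l)
    (h : ∀ B a, 2 ≤ B → D B a → ∀ x ∈ l a, D2 B (c a, x)) :
    Ok K (Impl.flatten.comp (((J.map 0).up 0).comp (I1.pair I2))) D
      (fun a => (l a).flatMap fun x => g (c a, x)) :=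
  (flatten ((hg.map (D := fun B a => Bd K B a ∧ ∀ x ∈ a.2, D2 B (a.1, x))
    (fun _ _ _ h h' => ⟨Dat.mono h h'.1, hm _ _ _ h h'.2⟩) 0 (fun B c l _ h => by
      simp only [zero_add, pow_one]
      exact ⟨h.1.1, h.1.2, fun x hx => ⟨⟨h.1.1, h.1.2.2 x hx⟩, h.2 x hx⟩⟩)).compB
    (D2 := fun B a => ∀ x ∈ a.2, D2 B (a.1, x))
    (fun B B' p h h' x hx => hm B B' (p.1, x) h (h' x hx)) 0 (hc.pair hl) fun B a hB ha => by
      simpa using h B a hB ha)).congr fun a => by rw [List.flatMap_def]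

end Ok

section

variable {K : Type u} [Field K]

/-- The domain of the function `powerList`. -/
def PowDom (B : ℕ) (x : ℕ × List ℕ × Poly K) : Prop :=
  ∃ v S E, 0 :: 0 :: 0 :: x.2.1 = List.replicate v 0 ∧ PB v S E x.2.2 ∧ v ≤ B ∧ x.1 * E ≤ B ∧
    (x.1 * S + 1) * (x.1 * E + 1) ^ v ≤ B

theorem PowDom.mono {B B' : ℕ} {x : ℕ × List ℕ × Poly K} (h : B ≤ B') (hx : PowDom B x) :
    PowDom B' x := by
  obtain ⟨w, S, E, h1, h2, h3, h4, h5⟩ := hx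
  exact ⟨w, S, E, h1, h2, h3.trans h, h4.trans h, h5.trans h⟩

/-- The domain of the function `powerSumList`. -/
def SumDom (B : ℕ) (x : List ℕ × List (Poly K) × ℕ) : Prop :=
  ∃ v E, 0 :: 0 :: 0 :: x.1 = List.replicate v 0 ∧ (∀ c ∈ x.2.1, PB v 0 E c) ∧ v ≤ B ∧
    x.2.2 * E ≤ B ∧ (x.2.2 * E + 1) ^ v ≤ B

theorem SumDom.mono {B B' : ℕ} {x : List ℕ × List (Poly K) × ℕ} (h : B ≤ B') (hx : SumDom B x) :
    SumDom B' x := by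
  obtain ⟨w, E, h1, h2, h3, h4, h5⟩ := hx
  exact ⟨w, E, h1, h2, h3.trans h, h4.trans h, h5.trans h⟩

/-- The domain of the function `prodOfSums`. -/
def ProdDom (B : ℕ) (x : List ℕ × List (Poly K)) : Prop :=
  ∃ v S E, 0 :: 0 :: 0 :: x.1 = List.replicate v 0 ∧ (∀ c ∈ x.2, PB v S E c) ∧ v ≤ B ∧
    x.2.length * E ≤ B ∧ (x.2.length * S + 1) * (x.2.length * E + 1) ^ v ≤ B

theorem ProdDom.mono {B B' : ℕ} {x : List ℕ × List (Poly K)} (h : B ≤ B') (hx : ProdDom B x) :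
    ProdDom B' x := by
  obtain ⟨w, S, E, h1, h2, h3, h4, h5⟩ := hx
  exact ⟨w, S, E, h1, h2, h3.trans h, h4.trans h, h5.trans h⟩

end

def const3I : {I : Impl // ∀ (K : Type u) [Field K],
    Ok K I (Bd K) (fun p : List ℕ × K => constP (0 :: 0 :: 0 :: p.1) p.2)} :=
  ⟨_, fun K _ => (constPI.2 K).app2 (cons.app2 natZero (cons.app2 natZero (cons.app2 natZero fst)))
    snd⟩

def powerListI : {I : Impl // ∀ (K : Type u) [Field K],
    Ok K I (fun B (x : ℕ × List ℕ × Poly K) => Bd K B x ∧ PowDom B x)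
    (fun x => powerList x.2.1 x.2.2 x.1)} :=
  ⟨_, fun K _ =>
    have st : Ok K _ (Bd K) (fun x : Poly K × (Poly K × List (Poly K)) × Unit => pmul x.2.1.1 x.1) :=
      (pmulI.2 K).app2 (fst.app (fst.app snd)) fst
    (reverse.app (snd.app (((st.pair (cons.app2 st (snd.app (fst.app snd)))).foldl 0
    (D := fun B x => ∃ zs, x.2.1 = (constP (0 :: 0 :: 0 :: zs) 1, []) ∧
      Bd K B (x.2.2.length, zs, x.1) ∧ PowDom B (x.2.2.length, zs, x.1)) (by
      rintro B g b l hB ⟨zs, hb, h0, v, S, E, h1, h2, h3, h4, h5⟩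
      dsimp only at hb h1 h2 h3 h4 h5
      subst hb
      have key (l1 : List Unit) (hl : l1.length ≤ l.length) :
          Bd K B (powers (constP (0 :: 0 :: 0 :: zs) 1, []) g l1) := by
        obtain ⟨h6, h7, h8⟩ := powers_spec (constP (0 :: 0 :: 0 :: zs) 1, []) h2 l1 0 l.length
          (by omega) ⟨constP_nm _ one_ne_zero, constP_pb _ h1 _⟩ (by simp)
        refine ⟨h6.2.bd h6.1 h3 h4 h5, ?_, fun x hx => (h7 x hx).2.bd (h7 x hx).1 h3 h4 h5⟩
        rw [h8]
        exact le_trans hl h0.1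
      simp only [zero_add, pow_one]
      refine ⟨h0.1, key l le_rfl, ?_⟩
      rintro l1 x l2 rfl
      exact ⟨h0.2.2, key l1 (by simp), trivial⟩)).compD
      (D := fun B (x : ℕ × List ℕ × Poly K) => Bd K B x ∧ PowDom B x)
      (res ((snd.app snd).pair ((((const3I.2 K).app2 (fst.app snd) one).pair empty).pair
        (natToList.app fst)))) fun B a hB h => ⟨a.2.1, rfl, by
          simpa using Dat.mono (self_le_pow_succ _) h.1, by
          simpa using h.2.mono (self_le_pow_succ _)⟩))).congr fun _ => rfl⟩

def powerSumListI : {I : Impl // ∀ (K : Type u) [Field K],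
    Ok K I (fun B (x : List ℕ × List (Poly K) × ℕ) => Bd K B x ∧ SumDom B x)
    (fun x => powerSumList x.1 x.2.1 x.2.2)} :=
  ⟨_, fun K _ =>
    have st : Ok K _ (Bd K) (fun x : List (Poly K) × (K × List (Poly K) × List (Poly K)) × Unit =>
      psum [pscal (0 - x.2.1.1) (x.2.1.2.2.headD []),
        pscal (0 - 1) (psum ((x.1.zip x.2.1.2.1).map fun y => pmul y.1 y.2))]) :=
      (psumI.2 K).app (cons.app2 ((pscalI.2 K).app2 (sub.app2 zero (fst.app (fst.app snd)))
        (headList.app (snd.app (snd.app (fst.app snd))))) (Ok.singleton ((pscalI.2 K).app2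
          (sub.app2 zero one) ((psumI.2 K).app (mapOf ((pmulI.2 K).app (snd (α := Unit))) unit
            ((zipListI.2 K).app2 fst (fst.app (snd.app (fst.app snd)))))))))
    (cons.app2 (res ((const3I.2 K).app2 fst ((natI.2 K).app ((lengthI.2 K).app (fst.app snd)))))
    (reverse.app (fst.app (snd.app ((((add.app2 (fst.app (fst.app snd)) one).pair
      ((cons.app2 st (fst.app (snd.app (fst.app snd)))).pair
        (tail.app (snd.app (snd.app (fst.app snd)))))).foldl 0
    (D := fun B x => x.2.1 = (1, [], x.1) ∧
      ∃ zs, Bd K B (zs, x.1, x.2.2.length) ∧ SumDom B (zs, x.1, x.2.2.length)) (by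
      rintro B cs b l hB ⟨hb, zs, h0, v, E, h1, h2, h3, h4, h5⟩
      dsimp only at hb h1 h2 h3 h4 h5
      subst hb
      have key (l1 : List Unit) (hl : l1.length ≤ l.length) :
          Bd K B (powerSums cs (1, [], cs) l1) := by
        obtain ⟨h6, h7, h8, h9⟩ := powerSums_spec h2 l1 (1, [], cs) 0 l.length (by omega)
          (by simp) (fun _ h => h)
        refine ⟨trivial, ⟨?_, fun x hx => (h6 x hx).2.bd (h6 x hx).1 h3 h4 (by simpa using h5)⟩,
          h9.trans h0.2.1.1, fun x hx => h0.2.1.2 x (h8 x hx)⟩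
        rw [h7]
        exact le_trans hl h0.2.2
      simp only [zero_add, pow_one]
      refine ⟨h0.2.2, key l le_rfl, ?_⟩
      rintro l1 x l2 rfl
      exact ⟨h0.2.1, key l1 (by simp), trivial⟩)).compD
      (D := fun B (x : List ℕ × List (Poly K) × ℕ) => Bd K B x ∧ SumDom B x)
      (res ((fst.app snd).pair ((one.pair (empty.pair (fst.app snd))).pair
        (natToList.app (snd.app snd))))) fun B a hB h => ⟨rfl, a.1, by
          simpa using Dat.mono (self_le_pow_succ _) h.1, by
          simpa using h.2.mono (self_le_pow_succ _)⟩))))).congr fun _ => rfl⟩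

def prodOfSumsI : {I : Impl // ∀ (K : Type u) [Field K],
    Ok K I (fun B (x : List ℕ × List (Poly K)) => Bd K B x ∧ ProdDom B x)
    (fun x => prodOfSums x.1 x.2)} :=
  ⟨_, fun K _ =>
    have st : Ok K _ (Bd K) (fun x : List (Poly K) × (K × List (Poly K)) × Poly K =>
      pscal (0 - 1 / x.2.1.1) (psum ((x.2.1.2.zip x.1).map fun y => pmul y.1 y.2))) :=
      (pscalI.2 K).app2 (sub.app2 zero (div.app2 one (fst.app (fst.app snd))))
        ((psumI.2 K).app (mapOf ((pmulI.2 K).app (snd (α := Unit))) unit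
          ((zipListI.2 K).app2 (snd.app (fst.app snd)) fst)))
    (headList.app (snd.app ((((add.app2 (fst.app (fst.app snd)) one).pair
      (cons.app2 st (snd.app (fst.app snd)))).foldl 1
    (D := fun B x => ∃ zs, x.2.1 = (1, [constP (0 :: 0 :: 0 :: zs) 1]) ∧ x.2.2 = x.1 ∧
      Bd K B (zs, x.1) ∧ ProdDom B (zs, x.1)) (by
      rintro B Ps b l hB ⟨zs, hb, hl, h0, v, S, E, h1, h2, h3, h4, h5⟩
      dsimp only at hb h1 h2 h3 h4 h5 hl
      subst hb
      subst hl
      have hB' : B ≤ B ^ (1 + 1) := self_le_pow_succ _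
      have hB2 : B + 1 ≤ B ^ (1 + 1) := by
        have : B * 2 ≤ B * B := Nat.mul_le_mul_left B hB
        rw [pow_succ, pow_one]; omega
      have key (l1 : List (Poly K)) (hl : l1.length ≤ l.length) :
          Bd K (B ^ (1 + 1)) (newtonCoefs l (1, [constP (0 :: 0 :: 0 :: zs) 1]) l1) := by
        obtain ⟨h6, h7⟩ := newtonCoefs_spec h2 l1 (1, [constP (0 :: 0 :: 0 :: zs) 1]) 0 l.length
          (by omega) (by
            intro x hx
            rw [List.mem_singleton] at hx
            subst hx
            exact ⟨constP_nm _ one_ne_zero, constP_pb _ h1 _⟩)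
        refine ⟨trivial, ?_, fun x hx => Dat.mono hB' ((h6 x hx).2.bd (h6 x hx).1 h3 h4 h5)⟩
        rw [h7]
        have := h0.2.1
        simp only [List.length_singleton]
        dsimp only at this
        omega
      refine ⟨h0.2.1.trans hB', key l le_rfl, ?_⟩
      rintro l1 x l2 e
      refine ⟨Dat.mono hB' h0.2, key l1 (by simp [e]), Dat.mono hB' (h0.2.2 x (by simp [e]))⟩)).compD
      (D := fun B (x : List ℕ × List (Poly K)) => Bd K B x ∧ ProdDom B x)
      (res (snd.pair ((one.pair (Ok.singleton ((const3I.2 K).app2 fst one))).pair snd)))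
      fun B a hB h => ⟨a.1, rfl, rfl, Dat.mono (self_le_pow_succ _) h.1,
        h.2.mono (self_le_pow_succ _)⟩))).congr fun _ => rfl⟩

def traceI : {I : Impl // ∀ (K : Type u) [Field K],
    Ok K I (Bd K) (fun x : List (Poly K) × Poly K => trace x.1 x.2)} :=
  ⟨_, fun K _ => ((collectI.2 K).app (flatMapOf (mapOf (c := fun x : List (Poly K) × Term K =>
    ((x.2.1.headD 0 :: 0 :: x.2.1.tail.tail, x.2.2) : Term K)) (mulTI.2 K)
    ((cons.app2 (headNat.app (fst.app snd)) (cons.app2 natZero (tail.app (tail.app (fst.app snd))))).pair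
      (snd.app snd))
    ((nthI.2 K).app2 fst (headNat.app (tail.app (fst.app snd))))) fst snd)).congr fun _ => rfl⟩

def zDegI : {I : Impl // ∀ (K : Type u) [Field K], Ok K I (Bd K) (zDeg (K := K))} :=
  ⟨_, fun K _ => ((listMaxI.2 K).app (mapOf (headNat.app (tail.app (fst.app (snd (α := Unit)
    (β := Term K))))) unit id)).congr fun _ => rfl⟩

def dropZI : {I : Impl // ∀ (K : Type u) [Field K], Ok K I (Bd K) (dropZ (K := K))} :=
  ⟨_, fun K _ => ((collectI.2 K).app (mapOf ((cons.app2 (headNat.app (fst.app (snd (α := Unit)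
    (β := Term K)))) (tail.app (tail.app (fst.app snd)))).pair (snd.app snd)) unit id)).congr
    fun _ => rfl⟩

/-- The domain of the function `normP`. -/
def NormDom {K : Type u} [Field K] (B : ℕ)
    (x : ℕ × List ℕ × Poly K × List (Poly K) × Poly K) : Prop :=
  ∃ w E, x.2.1 = List.replicate w 0 ∧ x.1 ≤ E ∧ (PB (w + 1) E E x.2.2.1 ∧ Nm x.2.2.1) ∧
    (∀ F ∈ x.2.2.2.1, PB (w + 1) E E F ∧ Nm F) ∧ (PB (w + 1) E E x.2.2.2.2 ∧ Nm x.2.2.2.2) ∧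
    x.2.2.2.1.length ≤ B ∧ (E + 2) ^ (w + 3) ≤ B

theorem NormDom.mono {K : Type u} [Field K] {B B' : ℕ}
    {x : ℕ × List ℕ × Poly K × List (Poly K) × Poly K} (h : B ≤ B') (hx : NormDom B x) :
    NormDom B' x := by
  obtain ⟨w, E, h1, h2, h3, h4, h5, h6, h7⟩ := hx
  exact ⟨w, E, h1, h2, h3, h4, h5, h6.trans h, h7.trans h⟩

theorem SepDom.mono {K : Type u} [Field K] {B B' : ℕ}
    {x : (List ℕ × Poly K) × List (Poly K) × Poly K} (h : B ≤ B') (hx : SepDom B x) :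
    SepDom B' x := by
  obtain ⟨w, E, h1, h2, h3, h4, h5, h6⟩ := hx
  exact ⟨w, E, h1, h2, h3, h4, h5.trans h, h6.trans h⟩

/-- The estimates for the computation of the norm: exponents stay below a fixed power of `E + 2`,
and three auxiliary variables are added to the `w` remaining ones. -/
theorem norm_arith {B E w L : ℕ} (hB : (E + 2) ^ (w + 3) ≤ B) (hL : L ≤ B) {m : ℕ} (hm : m ≤ E)
    {X c : ℕ} (hX : X ≤ (E + 2) ^ c) :
    w + 3 ≤ B ^ (c + 7 + 1) ∧ X ≤ B ^ (c + 7 + 1) ∧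
      (m * (m * (L + 2)) + 1) * (X + 1) ^ (w + 3) ≤ B ^ (c + 7 + 1) ∧
      (m * (L + 2) + 1) * (X + 1) ^ (w + 3) ≤ B ^ (c + 7 + 1) ∧
      (X + 1) ^ (w + 3) ≤ B ^ (c + 7 + 1) := by
  have ht : 2 ≤ E + 2 := by omega
  obtain ⟨h1, h2⟩ := le_of_pow_le ht hB
  have h3 : B ≤ B ^ (c + 7 + 1) := Nat.le_self_pow (by omega) B
  have h4 := pow_bound ht hB hX (le_refl (w + 3))
  have h5 : m * (L + 2) + 1 ≤ B ^ 3 := by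
    have : m ≤ B := by omega
    have h : m * (L + 2) ≤ B * (B + 2) := Nat.mul_le_mul this (by omega)
    have : B * (B + 2) + 1 ≤ B ^ 3 := by
      have h3 : 3 ≤ B := by omega
      have h4 : 3 * B ≤ B * B := Nat.mul_le_mul_right B h3
      have h5 : 3 * (B * B) ≤ B * (B * B) := Nat.mul_le_mul_right _ h3
      have e : B ^ 3 = B * (B * B) := by ring
      rw [e, mul_add]; linarith
    omega
  have h6 : m * (m * (L + 2)) + 1 ≤ B ^ 4 := by
    have h : m * (m * (L + 2)) ≤ E * B ^ 3 := Nat.mul_le_mul hm (by omega)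
    have h' : (E + 1) * B ^ 3 ≤ B * B ^ 3 := Nat.mul_le_mul_right _ (by omega)
    have : 0 < B ^ 3 := by have : 0 < B := by omega
                           positivity
    have e : B ^ 4 = B * B ^ 3 := by ring
    rw [e]; nlinarith
  have hB1 : 1 ≤ B := by omega
  refine ⟨h1.trans h3, ?_, ?_, ?_, h4.trans (Nat.pow_le_pow_right hB1 (by omega))⟩
  · have : X + 1 ≤ (X + 1) ^ (w + 3) := Nat.le_self_pow (by omega) _
    have := h4.trans (Nat.pow_le_pow_right hB1 (show c + 1 ≤ c + 7 + 1 by omega))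
    omega
  · exact (Nat.mul_le_mul h6 h4).trans (by
      rw [← pow_add]; exact Nat.pow_le_pow_right hB1 (by omega))
  · exact (Nat.mul_le_mul h5 h4).trans (by
      rw [← pow_add]; exact Nat.pow_le_pow_right hB1 (by omega))

def coefNormI : {I : Impl // ∀ (K : Type u) [Field K],
    Ok K I (Bd K) (fun x : ℕ × List ℕ × Poly K × List (Poly K) × Poly K => coefH x.1 x.2.2.1)} :=
  ⟨_, fun K _ => (coefHI.2 K).app2 fst (fst.app (snd.app snd))⟩

def sepNormI : {I : Impl // ∀ (K : Type u) [Field K],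
    Ok K I (fun B (x : ℕ × List ℕ × Poly K × List (Poly K) × Poly K) => Bd K B x ∧ NormDom B x)
    (fun x => sepP x.2.1 (coefH x.1 x.2.2.1) x.2.2.2.1 x.2.2.2.2)} :=
  ⟨_, fun K _ => ((sepPI.2 K).compK
    (fun _ _ _ h h' => h'.mono h) 0 (res (((fst.app snd).pair (coefNormI.2 K)).pair
      (snd.app (snd.app snd)))) (by
    rintro B a - ⟨-, w, E, h1, h2, h3, h4, h5, h6, h7⟩
    exact ⟨w, E, h1, ⟨h3.1.coefH _, nm_coefH h3.2 (fun t ht => (h3.1 t ht).1) _⟩, h4, h5,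
      by simpa using h6, by simpa using h7⟩)).congr fun _ => rfl⟩

def monicNormI : {I : Impl // ∀ (K : Type u) [Field K],
    Ok K I (fun B (x : ℕ × List ℕ × Poly K × List (Poly K) × Poly K) => Bd K B x ∧ NormDom B x)
    (fun x => monicCoefs x.2.1 x.2.2.1 x.1)} :=
  ⟨_, fun K _ => (mapOf ((embI.2 K).app2 natZero
    (snd.app (snd (α := Unit) (β := ℕ × Poly K)))) unit
    (reverse.app ((homI.2 K).compK (fun _ _ _ h h' => h'.mono h) 0 (res (((fst.app snd).pair
      ((coefNormI.2 K).pair (fst.app (snd.app snd)))).pair ((downToI.2 K).app fst))) (by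
      rintro B a - ⟨-, w, E, h1, h2, h3, h4, h5, h6, h7⟩
      refine ⟨w, E, h1, ⟨h3.1.coefH _, nm_coefH h3.2 (fun t ht => (h3.1 t ht).1) _⟩, h3,
        by simpa using h7, by simp [downTo]; omega, fun i hi => ?_⟩
      simp [downTo] at hi
      omega)))).congr fun _ => rfl⟩

def powerListNormI : {I : Impl // ∀ (K : Type u) [Field K],
    Ok K I (fun B (x : ℕ × List ℕ × Poly K × List (Poly K) × Poly K) => Bd K B x ∧ NormDom B x)
    (fun x => powerList x.2.1 (sepP x.2.1 (coefH x.1 x.2.2.1) x.2.2.2.1 x.2.2.2.2) x.1)} :=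
  ⟨_, fun K _ => ((powerListI.2 K).compB (fun _ _ _ h h' => h'.mono h) (4 + 7)
    ((res fst).pair ((res (fst.app snd)).pair (sepNormI.2 K))) (by
        rintro B ⟨m, zs, F, P, Q⟩ - ⟨-, w, E, h1, h2, h3, h4, h5, h6, h7⟩
        dsimp only at h1 h2 h3 h4 h5 h6 h7
        have hX : m * (E + 2) ^ 3 ≤ (E + 2) ^ 4 := by
          rw [pow_succ _ 3, mul_comm]; exact Nat.mul_le_mul_left _ (by omega)
        obtain ⟨a1, a2, a3, a4, a5⟩ := norm_arith h7 h6 h2 hX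
        exact ⟨w + 3, P.length + 2, (E + 2) ^ 3, by simp [h1, List.replicate_succ],
          sepP_pb h1 (h3.1.coefH m) (fun F hF => (h4 F hF).1) h5.1, a1, a2, a4⟩)).congr fun _ => rfl⟩

def powerSumListNormI : {I : Impl // ∀ (K : Type u) [Field K],
    Ok K I (fun B (x : ℕ × List ℕ × Poly K × List (Poly K) × Poly K) => Bd K B x ∧ NormDom B x)
    (fun x => powerSumList x.2.1 (monicCoefs x.2.1 x.2.2.1 x.1) (zDeg
      (powerList x.2.1 (sepP x.2.1 (coefH x.1 x.2.2.1) x.2.2.2.1 x.2.2.2.2) x.1).flatten))} :=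
  ⟨_, fun K _ => ((powerSumListI.2 K).compB (fun _ _ _ h h' => h'.mono h) (6 + 7)
    ((res (fst.app snd)).pair ((monicNormI.2 K).pair
      ((zDegI.2 K).app (powerListNormI.2 K).flatten))) (by
        rintro B ⟨m, zs, F, P, Q⟩ - ⟨-, w, E, h1, h2, h3, h4, h5, h6, h7⟩
        dsimp only at h1 h2 h3 h4 h5 h6 h7
        have hz3 : 0 :: 0 :: 0 :: zs = List.replicate (w + 3) 0 := by simp [h1, List.replicate_succ]
        have hz := zDeg_le (v := w + 1) (PB.flatten fun x hx => ((powerList_spec hz3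
          (sepP_pb h1 (h3.1.coefH m) (fun F hF => (h4 F hF).1) h5.1) m).2 x hx).2)
        have hX : zDeg (powerList zs (sepP zs (coefH m F) P Q) m).flatten * (E + 2) ^ 2 ≤
            (E + 2) ^ 6 := by
          calc _ ≤ (m * (E + 2) ^ 3) * (E + 2) ^ 2 := Nat.mul_le_mul_right _ hz
            _ ≤ ((E + 2) * (E + 2) ^ 3) * (E + 2) ^ 2 := by gcongr; omega
            _ = _ := by ring
        obtain ⟨a1, a2, a3, a4, a5⟩ := norm_arith h7 h6 h2 hX
        exact ⟨w + 3, (E + 2) ^ 2, hz3, (monicCoefs_spec h1 h3.1 h2).2, a1, a2, a5⟩)).congr fun _ => rfl⟩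

def normPI : {I : Impl // ∀ (K : Type u) [Field K],
    Ok K I (fun B (x : ℕ × List ℕ × Poly K × List (Poly K) × Poly K) => Bd K B x ∧ NormDom B x)
    (fun x => normP x.1 x.2.1 x.2.2.1 x.2.2.2.1 x.2.2.2.2)} :=
  ⟨_, fun K _ => ((dropZI.2 K).app ((prodOfSumsI.2 K).compB (fun _ _ _ h h' => h'.mono h) (8 + 7)
    ((res (fst.app snd)).pair (mapOf (traceI.2 K) (powerSumListNormI.2 K) (powerListNormI.2 K))) (by
        rintro B ⟨m, zs, F, P, Q⟩ - ⟨-, w, E, h1, h2, h3, h4, h5, h6, h7⟩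
        dsimp only at h1 h2 h3 h4 h5 h6 h7
        have hz3 : 0 :: 0 :: 0 :: zs = List.replicate (w + 3) 0 := by simp [h1, List.replicate_succ]
        obtain ⟨b1, b2⟩ := powerList_spec hz3
          (sepP_pb h1 (h3.1.coefH m) (fun F hF => (h4 F hF).1) h5.1) m
        have hz := zDeg_le (v := w + 1) (PB.flatten fun x hx => (b2 x hx).2)
        have b3 := powerSumList_spec hz3 (monicCoefs_spec h1 h3.1 h2).2
          (zDeg (powerList zs (sepP zs (coefH m F) P Q) m).flatten)
        obtain ⟨a1, a2, a3, a4, a5⟩ := norm_arith h7 h6 h2 (trace_sum_bound E m h2)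
        refine ⟨w + 3, m * (P.length + 2), m * (E + 2) ^ 3 + m * (E + 2) ^ 3 * (E + 2) ^ 2, hz3, ?_,
          a1, by simpa [b1] using a2, by simpa [b1] using a3⟩
        intro c hc
        obtain ⟨x, hx, rfl⟩ := List.mem_map.1 hc
        exact trace_pb (v := w + 1) (fun x hx => (b3 x hx).mono le_rfl (Nat.mul_le_mul_right _ hz))
          (b2 x hx).2))).congr fun _ => rfl⟩

/-! ### Eliminating one variable -/

/-- A system: the equations `P`, the inequation `Q`, and the part of a triangular set found so
far. -/
abbrev Sys (K : Type u) := List (Poly K) × Poly K × List (Poly K)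

section

variable {K : Type u} [Field K]

/-- The system that says that `N` (a polynomial in `s`, `Y`, …) has degree `σ` in `s`, its leading
coefficient `g` has degree `e` in `Y`, and `F` has degree `m`. The new polynomial is `g`. -/
noncomputable def item (m : ℕ) (F N : Poly K) (σ e : ℕ) : List (Sys K) :=
  if decide (e = 0) then [] else
  if (pmul (coefH m F) (coefH e (coefH σ N))).isEmpty then [] else
    [(coefsAbove m F ++ ((coefsAbove σ N).flatMap coefs ++ coefsAbove e (coefH σ N)),
      pmul (coefH m F) (coefH e (coefH σ N)),
      [(coefH σ N).filter fun t => decide (t.1.headD 0 ≤ e)])]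

/-- All systems `item` for given `m`. -/
noncomputable def items (m : ℕ) (F N : Poly K) : List (Sys K) :=
  (heads N).flatMap fun σ => (heads (coefH σ N)).flatMap fun e => item m F N σ e

/-- The systems for common zeros where the polynomial `F` has degree `m` in the first variable. -/
noncomputable def itemsFor (m : ℕ) (zs : List ℕ) (F : Poly K) (P : List (Poly K)) (Q : Poly K) :
    List (Sys K) :=
  if decide (m = 0) then [] else items m F (normP m zs F P Q)

/-- The systems for the points at which all polynomials in `P` vanish identically in the first
variable. -/
def freeItems (P : List (Poly K)) (Q : Poly K) : List (Sys K) :=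
  (heads Q).map fun b => (P.flatMap coefs, coefH b Q, [])

/-- The systems that describe the projection of the set `P = 0, Q ≠ 0`. -/
noncomputable def sysItems (zs : List ℕ) (P : List (Poly K)) (Q : Poly K) : List (Sys K) :=
  freeItems P Q ++ P.flatMap fun F => (heads F).flatMap fun m => itemsFor m zs F P Q

/-- Restore the original order of the variables, and add the greater variables. -/
def outP (pad : List ℕ) (G : Poly K) : Poly K := G.map fun t => (t.1.reverse ++ pad, t.2)

/-- One elimination step for one system. -/
noncomputable def stepSys (zs pad : List ℕ) (s : Sys K) : List (Sys K) :=
  (sysItems zs s.1 s.2.1).map fun it =>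
    (it.1, it.2.1, (it.2.2.map fun G => outP pad G) ++ s.2.2)

/-- One elimination step for a list of systems. The first two components are zero vectors whose
lengths are the numbers of the remaining and the eliminated variables. -/
noncomputable def step (x : List ℕ × List ℕ × List (Sys K)) : List ℕ × List ℕ × List (Sys K) :=
  (x.1.tail, 0 :: x.2.1, x.2.2.flatMap fun s => stepSys x.1.tail x.2.1 s)

/-- A polynomial in `v` variables of degree at most `E` in each of them, in reduced form. -/
def RB (v E : ℕ) (p : Poly K) : Prop := PB v E E p ∧ Nm p

theorem RB.mono {v E E' : ℕ} {p : Poly K} (h : RB v E p) (hE : E ≤ E') : RB v E' p :=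
  ⟨h.1.mono hE hE, h.2⟩

theorem RB.coefH {v E : ℕ} {p : Poly K} (h : RB (v + 1) E p) (i : ℕ) : RB v E (coefH i p) :=
  ⟨h.1.coefH i, nm_coefH h.2 (fun t ht => (h.1 t ht).1) i⟩

theorem RB.coefs {v E : ℕ} {p : Poly K} (h : RB (v + 1) E p) : ∀ q ∈ coefs p, RB v E q := by
  intro q hq
  obtain ⟨i, -, rfl⟩ := List.mem_map.1 hq
  exact h.coefH i

theorem RB.coefsAbove {v E : ℕ} {p : Poly K} (h : RB (v + 1) E p) (m : ℕ) :
    ∀ q ∈ coefsAbove m p, RB v E q := by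
  intro q hq
  obtain ⟨i, -, rfl⟩ := List.mem_map.1 hq
  exact h.coefH i

/-- The degree bound for the systems of `w` variables that arise from systems of `w + 1` variables
with degree bound `E`. -/
theorem item_spec {w S E E8 m σ e : ℕ} {F N : Poly K} (hF : RB (w + 1) E F)
    (hN : PB (w + 2) S E8 N) (hN' : Nm N) :
    ∀ s ∈ item m F N σ e, (∀ p ∈ s.1, RB w (E + E8) p) ∧ RB w (E + E8) s.2.1 ∧
      ∀ G ∈ s.2.2, RB (w + 1) (E + E8) G := by
  intro s hs
  have hc (σ : ℕ) : RB (w + 1) E8 (coefH σ N) :=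
    ⟨hN.coefH σ, nm_coefH hN' (fun t ht => (hN t ht).1) σ⟩
  rw [item] at hs
  split at hs
  · simp at hs
  split at hs
  · simp at hs
  rw [List.mem_singleton] at hs
  subst hs
  refine ⟨fun p hp => ?_, ⟨((hF.1.coefH m).pmul ((hc σ).1.coefH e)), nm_collect _⟩, fun G hG => ?_⟩
  · rcases List.mem_append.1 hp with hp | hp
    · exact (hF.coefsAbove m p hp).mono (by omega)
    · rcases List.mem_append.1 hp with hp | hp
      · obtain ⟨q, hq, hp⟩ := List.mem_flatMap.1 hp
        obtain ⟨i, -, rfl⟩ := List.mem_map.1 hq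
        exact ((hc i).coefs p hp).mono (by omega)
      · exact ((hc σ).coefsAbove e p hp).mono (by omega)
  · rw [List.mem_singleton] at hG
    subst hG
    exact RB.mono ⟨fun t ht => (hc σ).1 t (List.mem_filter.1 ht).1,
      nm_sublist (hc σ).2 List.filter_sublist⟩ (by omega)

/-- The norm has exponents at most `(E + 2) ^ 8`; the initial of the new polynomial is multiplied by
the leading coefficient of `F`, which adds at most `E`. -/
theorem sysItems_spec {w E : ℕ} {zs : List ℕ} (hz : zs = List.replicate w 0) {P : List (Poly K)}
    {Q : Poly K} (hP : ∀ F ∈ P, RB (w + 1) E F) (hQ : RB (w + 1) E Q) :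
    ∀ s ∈ sysItems zs P Q, (∀ p ∈ s.1, RB w ((E + 2) ^ 9) p) ∧ RB w ((E + 2) ^ 9) s.2.1 ∧
      ∀ G ∈ s.2.2, RB (w + 1) ((E + 2) ^ 9) G := by
  have hE : E ≤ (E + 2) ^ 9 := by have := Nat.le_self_pow (n := 9) (by omega) (E + 2); omega
  have hE8 : E + (E + 2) ^ 8 ≤ (E + 2) ^ 9 := by
    have := Nat.le_self_pow (n := 8) (by omega) (E + 2)
    rw [pow_succ _ 8]; nlinarith
  intro s hs
  rcases List.mem_append.1 hs with hs | hs
  · obtain ⟨b, -, rfl⟩ := List.mem_map.1 hs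
    refine ⟨fun p hp => ?_, (hQ.coefH b).mono hE, by simp⟩
    obtain ⟨F, hF, hp⟩ := List.mem_flatMap.1 hp
    exact ((hP F hF).coefs p hp).mono hE
  · obtain ⟨F, hF, hs⟩ := List.mem_flatMap.1 hs
    obtain ⟨m, hm, hs⟩ := List.mem_flatMap.1 hs
    rw [itemsFor] at hs
    split at hs
    · simp at hs
    obtain ⟨σ, -, hs⟩ := List.mem_flatMap.1 hs
    obtain ⟨e, -, hs⟩ := List.mem_flatMap.1 hs
    obtain ⟨h1, h2, h3⟩ := item_spec (hP F hF) (normP_pb hz (hP F hF).1 (fun F hF => (hP F hF).1) hQ.1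
      ((hP F hF).1.heads_le m hm)) (nm_collect _) s hs
    exact ⟨fun p hp => (h1 p hp).mono hE8, h2.mono hE8, fun G hG => (h3 G hG).mono hE8⟩

theorem outP_rb {v k E : ℕ} {pad : List ℕ} (hpad : pad = List.replicate k 0) {G : Poly K}
    (h : RB v E G) : RB (v + k) E (outP pad G) := by
  subst hpad
  have hall : ∀ t ∈ G, ∀ e ∈ t.1, e ≤ E := by
    intro t ht e he
    obtain ⟨h1, h2, h3⟩ := h.1 t ht
    cases ha : t.1 with
    | nil => simp [ha] at he
    | cons y a =>
      rw [ha] at h2 h3 he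
      rcases List.mem_cons.1 he with rfl | he
      · exact h2
      · exact h3 e he
  refine ⟨fun t ht => ?_, ?_, fun t ht => ?_⟩
  · obtain ⟨x, hx, rfl⟩ := List.mem_map.1 ht
    have hall' : ∀ e ∈ x.1.reverse ++ List.replicate k 0, e ≤ E := fun e he => by
      rcases List.mem_append.1 he with he | he
      · exact hall x hx e (List.mem_reverse.1 he)
      · rw [List.eq_of_mem_replicate he]; exact Nat.zero_le _
    refine ⟨by simp [(h.1 x hx).1], ?_, fun e he => hall' e (List.mem_of_mem_tail he)⟩
    dsimp only
    cases ha : x.1.reverse ++ List.replicate k 0 with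
    | nil => simp
    | cons y a => exact hall' y (by simp [ha])
  · rw [outP, List.map_map, show (Prod.fst ∘ fun t : Term K => (t.1.reverse ++ List.replicate k 0, t.2)) =
      (fun a : List ℕ => a.reverse ++ List.replicate k 0) ∘ Prod.fst from rfl, ← List.map_map]
    exact h.2.1.map fun a b hab => by simpa using hab
  · obtain ⟨x, hx, rfl⟩ := List.mem_map.1 ht
    exact h.2.2 x hx

/-- The bounds that are maintained by the elimination: `w` variables remain out of `n`. -/
def SysOK (n w E : ℕ) (s : Sys K) : Prop :=
  (∀ p ∈ s.1, RB w E p) ∧ RB w E s.2.1 ∧ ∀ G ∈ s.2.2, RB n E G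

theorem step_spec {n w E k : ℕ} {x : List ℕ × List ℕ × List (Sys K)} (h1 : x.1 = List.replicate (w + 1) 0)
    (h2 : x.2.1 = List.replicate k 0) (hn : w + 1 + k = n) (h : ∀ s ∈ x.2.2, SysOK n (w + 1) E s) :
    (step x).1 = List.replicate w 0 ∧ (step x).2.1 = List.replicate (k + 1) 0 ∧
      ∀ s ∈ (step x).2.2, SysOK n w ((E + 2) ^ 9) s := by
  have hE : E ≤ (E + 2) ^ 9 := by have := Nat.le_self_pow (n := 9) (by omega) (E + 2); omega
  refine ⟨by simp [step, h1], by simp [step, h2, List.replicate_succ], fun s hs => ?_⟩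
  obtain ⟨s0, hs0, hs⟩ := List.mem_flatMap.1 hs
  obtain ⟨it, hit, rfl⟩ := List.mem_map.1 hs
  obtain ⟨a1, a2, a3⟩ := h s0 hs0
  obtain ⟨b1, b2, b3⟩ := sysItems_spec (by simp [h1]) a1 a2 it hit
  refine ⟨b1, b2, fun G hG => ?_⟩
  rcases List.mem_append.1 hG with hG | hG
  · obtain ⟨G0, hG0, rfl⟩ := List.mem_map.1 hG
    exact hn ▸ outP_rb h2 (b3 G0 hG0)
  · exact (a3 G hG).mono hE

end

/-! Programs for the elimination step. -/

def itemI : {I : Impl // ∀ (K : Type u) [Field K],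
    Ok K I (Bd K) (fun x : ((ℕ × Poly K × Poly K) × ℕ) × ℕ =>
      item x.1.1.1 x.1.1.2.1 x.1.1.2.2 x.1.2 x.2)} :=
  ⟨_, fun K _ =>
    have m : Ok K _ (Bd K) (fun x : ((ℕ × Poly K × Poly K) × ℕ) × ℕ => x.1.1.1) :=
      fst.app (fst.app fst)
    have F : Ok K _ (Bd K) (fun x : ((ℕ × Poly K × Poly K) × ℕ) × ℕ => x.1.1.2.1) :=
      fst.app (snd.app (fst.app fst))
    have N : Ok K _ (Bd K) (fun x : ((ℕ × Poly K × Poly K) × ℕ) × ℕ => x.1.1.2.2) :=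
      snd.app (snd.app (fst.app fst))
    have σ : Ok K _ (Bd K) (fun x : ((ℕ × Poly K × Poly K) × ℕ) × ℕ => x.1.2) := snd.app fst
    have g : Ok K _ (Bd K) (fun x : ((ℕ × Poly K × Poly K) × ℕ) × ℕ => coefH x.1.2 x.1.1.2.2) :=
      (coefHI.2 K).app2 σ N
    have q : Ok K _ (Bd K) (fun x : ((ℕ × Poly K × Poly K) × ℕ) × ℕ =>
        pmul (coefH x.1.1.1 x.1.1.2.1) (coefH x.2 (coefH x.1.2 x.1.1.2.2))) :=
      (pmulI.2 K).app2 ((coefHI.2 K).app2 m F) ((coefHI.2 K).app2 snd g)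
    (((natEqI.2 K).app2 snd natZero).ite empty ((isNil.app q).ite empty (Ok.singleton
      ((((coefsAboveI.2 K).app2 m F).append ((flatMapOf ((coefsI.2 K).app (snd (α := Unit)
        (β := Poly K))) unit ((coefsAboveI.2 K).app2 σ N)).append
          ((coefsAboveI.2 K).app2 snd g))).pair (q.pair (Ok.singleton
            (filterOf ((natLeI.2 K).app2 (headNat.app (fst.app (snd (α := ℕ) (β := Term K)))) fst)
              snd g))))))).congr fun _ => rfl⟩

def itemsI : {I : Impl // ∀ (K : Type u) [Field K],
    Ok K I (Bd K) (fun x : ℕ × Poly K × Poly K => items x.1 x.2.1 x.2.2)} :=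
  ⟨_, fun K _ => (flatMapOf (flatMapOf (itemI.2 K) id
    ((headsI.2 K).app ((coefHI.2 K).app2 snd (snd.app (snd.app (fst (α := ℕ × Poly K × Poly K)
      (β := ℕ))))))) id ((headsI.2 K).app (snd.app snd))).congr fun _ => rfl⟩

def itemsForI : {I : Impl // ∀ (K : Type u) [Field K],
    Ok K I (fun B (x : ℕ × List ℕ × Poly K × List (Poly K) × Poly K) => Bd K B x ∧ NormDom B x)
    (fun x => itemsFor x.1 x.2.1 x.2.2.1 x.2.2.2.1 x.2.2.2.2)} :=
  ⟨_, fun K _ => ((res ((natEqI.2 K).app2 fst natZero)).ite (res empty) ((itemsI.2 K).app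
    ((res fst).pair ((res (fst.app (snd.app snd))).pair (normPI.2 K))))).congr fun _ => rfl⟩

def freeItemsI : {I : Impl // ∀ (K : Type u) [Field K],
    Ok K I (Bd K) (fun x : List (Poly K) × Poly K => freeItems x.1 x.2)} :=
  ⟨_, fun K _ => (mapOf ((flatMapOf ((coefsI.2 K).app (snd (α := Unit) (β := Poly K))) unit
    (fst.app (fst (α := List (Poly K) × Poly K) (β := ℕ)))).pair
      (((coefHI.2 K).app2 snd (snd.app fst)).pair (empty (β := Poly K)))) id
      ((headsI.2 K).app snd)).congr fun _ => rfl⟩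

/-- The domain of the function `sysItems`. -/
def ItemsDom {K : Type u} [Field K] (B : ℕ) (x : List ℕ × List (Poly K) × Poly K) : Prop :=
  ∃ w E, x.1 = List.replicate w 0 ∧ (∀ F ∈ x.2.1, RB (w + 1) E F) ∧ RB (w + 1) E x.2.2 ∧
    (E + 2) ^ (w + 3) ≤ B

theorem ItemsDom.mono {K : Type u} [Field K] {B B' : ℕ} {x : List ℕ × List (Poly K) × Poly K}
    (h : B ≤ B') (hx : ItemsDom B x) : ItemsDom B' x := by
  obtain ⟨w, E, h1, h2, h3, h4⟩ := hx
  exact ⟨w, E, h1, h2, h3, h4.trans h⟩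

def mainItemsI : {I : Impl // ∀ (K : Type u) [Field K],
    Ok K I (fun B (x : (List ℕ × List (Poly K) × Poly K) × Poly K) => Bd K B x ∧
      (ItemsDom B x.1 ∧ x.2 ∈ x.1.2.1))
    (fun x => (heads x.2).flatMap fun m => itemsFor m x.1.1 x.2 x.1.2.1 x.1.2.2)} :=
  ⟨_, fun K _ => (flatMapB (D2 := fun B (x : ((List ℕ × List (Poly K) × Poly K) × Poly K) × ℕ) =>
      ItemsDom B x.1.1 ∧ x.1.2 ∈ x.1.1.2.1 ∧ x.2 ∈ heads x.1.2)
    (((itemsForI.2 K).compB (fun _ _ _ h h' => h'.mono h) 0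
      (res (D2 := fun B (x : ((List ℕ × List (Poly K) × Poly K) × Poly K) × ℕ) =>
      ItemsDom B x.1.1 ∧ x.1.2 ∈ x.1.1.2.1 ∧ x.2 ∈ heads x.1.2) (snd.pair ((fst.app (fst.app fst)).pair ((snd.app fst).pair (snd.app (fst.app fst))))))
      (by
        rintro B a - ⟨h0, ⟨w, E, h1, h2, h3, h4⟩, h5, h6⟩
        exact ⟨w, E, h1, (h2 _ h5).1.heads_le _ h6, h2 _ h5, h2, h3,
          by simpa using h0.1.1.2.1.1, by simpa using h4⟩)).congr
      (g := fun x => itemsFor x.2 x.1.1.1 x.1.2 x.1.1.2.1 x.1.1.2.2) fun _ => rfl)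
    (fun _ _ _ h h' => ⟨h'.1.mono h, h'.2⟩) (res id) (res ((headsI.2 K).app snd))
    (fun B a _ h x hx => ⟨h.2.1, h.2.2, hx⟩)).congr fun _ => rfl⟩

def sysItemsI : {I : Impl // ∀ (K : Type u) [Field K],
    Ok K I (fun B (x : List ℕ × List (Poly K) × Poly K) => Bd K B x ∧ ItemsDom B x)
    (fun x => sysItems x.1 x.2.1 x.2.2)} :=
  ⟨_, fun K _ => ((res ((freeItemsI.2 K).app snd)).append (flatMapB (mainItemsI.2 K)
    (fun _ _ _ h h' => ⟨h'.1.mono h, h'.2⟩) (res id) (res (fst.app snd))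
    (fun _ _ _ h _ hx => ⟨h.2, hx⟩))).congr fun _ => rfl⟩

def outPI : {I : Impl // ∀ (K : Type u) [Field K],
    Ok K I (Bd K) (fun x : List ℕ × Poly K => outP x.1 x.2)} :=
  ⟨_, fun K _ => (mapOf (((reverse.app (fst.app (snd (α := List ℕ) (β := Term K)))).append fst).pair
    (snd.app snd)) fst snd).congr fun _ => rfl⟩

def stepSysI : {I : Impl // ∀ (K : Type u) [Field K],
    Ok K I (fun B (x : (List ℕ × List ℕ) × Sys K) => Bd K B x ∧
      ItemsDom B (x.1.1, x.2.1, x.2.2.1))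
    (fun x => stepSys x.1.1 x.1.2 x.2)} :=
  ⟨_, fun K _ => (mapOf (c := fun x : (List ℕ × List ℕ) × Sys K => (x.1.2, x.2.2.2))
    ((fst.app snd).pair ((fst.app (snd.app snd)).pair ((mapOf (outPI.2 K)
      (fst.app (fst (α := List ℕ × List (Poly K)) (β := Sys K))) (snd.app (snd.app snd))).append
        (snd.app fst))))
    (res ((snd.app fst).pair (snd.app (snd.app snd))))
    ((sysItemsI.2 K).compB (fun _ _ _ h h' => h'.mono h) 0
      (res ((fst.app fst).pair ((fst.app snd).pair (fst.app (snd.app snd)))))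
      (fun B a _ h => by simpa using h.2))).congr fun _ => rfl⟩

/-- The domain of the elimination step. -/
def StepDom {K : Type u} [Field K] (B : ℕ) (x : List ℕ × List ℕ × List (Sys K)) : Prop :=
  ∀ s ∈ x.2.2, ItemsDom B (x.1.tail, s.1, s.2.1)

def stepI : {I : Impl // ∀ (K : Type u) [Field K],
    Ok K I (fun B (x : List ℕ × List ℕ × List (Sys K)) => Bd K B x ∧ StepDom B x) step} :=
  ⟨_, fun K _ => ((res (tail.app fst)).pair ((res (cons.app2 natZero (fst.app snd))).pair
    (flatMapB (D := fun B (x : List ℕ × List ℕ × List (Sys K)) => Bd K B x ∧ StepDom B x)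
      (c := fun x => (x.1.tail, x.2.1)) (stepSysI.2 K)
      (fun _ _ _ h h' => h'.mono h) (res ((tail.app fst).pair (fst.app snd)))
      (res (snd.app snd)) (fun _ _ _ h x hx => h.2 x hx)))).congr fun _ => rfl⟩

/-! ### Reducing the number of polynomials -/

section

variable {K : Type u} [Field K]

/-- The monomial of the first term. -/
def lead (b : Poly K) : List ℕ := (b.map Prod.fst).headD []

/-- Subtract a multiple of `b` that removes the monomial `lead b`. -/
noncomputable def redBy (h b : Poly K) : Poly K :=
  psum [h, pscal ((0 - coefOf h (lead b)) / coefOf b (lead b)) b]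

/-- Extend an echelon list by a polynomial, unless that reduces to zero. -/
noncomputable def extend (bs : List (Poly K)) (h : Poly K) : List (Poly K) :=
  if (bs.foldl redBy h).isEmpty then bs else bs ++ [bs.foldl redBy h]

/-- An echelon list with the same linear span as `H`. -/
noncomputable def echelon (H : List (Poly K)) : List (Poly K) := H.foldl extend []

theorem sum_filter_nm {p : Poly K} (h : Nm p) {t : Term K} (ht : t ∈ p) : coefOf p t.1 = t.2 := by
  have : p.filter (fun t' => decide (t'.1 = t.1)) = [t] := by
    induction p with
    | nil => simp at ht
    | cons x p ih =>
      have hp : Nm p := nm_sublist h (List.sublist_cons_self _ _)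
      have hx : ∀ y ∈ p, y.1 ≠ x.1 := fun y hy e => by
        have := h.1
        rw [List.map_cons, List.nodup_cons] at this
        exact this.1 (e ▸ List.mem_map.2 ⟨y, hy, rfl⟩)
      rcases List.mem_cons.1 ht with rfl | ht
      · rw [List.filter_cons_of_pos (by simp), List.filter_eq_nil_iff.2 fun y hy => by simpa using hx y hy]
      · rw [List.filter_cons_of_neg (by simpa using fun e => hx t ht e.symm), ih hp ht]
  rw [coefOf, this]; simp

theorem coefOf_eq_zero {p : Poly K} {e : List ℕ} (h : ∀ t ∈ p, t.1 ≠ e) : coefOf p e = 0 := by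
  rw [coefOf, List.filter_eq_nil_iff.2 fun y hy => by simpa using h y hy]; rfl

theorem coefOf_eq_sum (p : Poly K) (e : List ℕ) :
    coefOf p e = ((p.filter fun t => decide (t.1 = e)).map Prod.snd).sum := by
  have (l : Poly K) (a : K) : l.foldl (fun a t => a + t.2) a = a + (l.map Prod.snd).sum := by
    induction l generalizing a <;> simp_all [add_assoc]
  rw [coefOf, this, zero_add]

theorem coefOf_append (p q : Poly K) (e : List ℕ) :
    coefOf (p ++ q) e = coefOf p e + coefOf q e := by
  simp [coefOf_eq_sum]

theorem coefOf_insT (p : Poly K) (t : Term K) (e : List ℕ) :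
    coefOf (insT p t) e = coefOf p e + if t.1 = e then t.2 else 0 := by
  have h1 : coefOf (p.filter fun t' => !decide (t'.1 = t.1)) e =
      if t.1 = e then 0 else coefOf p e := by
    split
    · rename_i h
      exact coefOf_eq_zero fun x hx => by simpa [h] using (List.mem_filter.1 hx).2
    · rename_i h
      rw [coefOf_eq_sum, coefOf_eq_sum, List.filter_filter]
      congr 3
      funext x
      by_cases hx : x.1 = e
      · simp [hx, Ne.symm h]
      · simp [hx]
  by_cases h : t.1 = e
  · subst h
    simp only [if_true] at h1 ⊢
    rw [insT]
    split
    · rename_i h0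
      rw [h1, add_comm]; exact (by simpa using h0 : _ = (0:K)).symm
    · have := coefOf_append [(t.1, t.2 + coefOf p t.1)] (p.filter fun t' => !decide (t'.1 = t.1)) t.1
      rw [List.singleton_append] at this
      rw [this, h1, coefOf_eq_sum [_]]
      simp [add_comm]
  · simp only [h, if_false, add_zero] at h1 ⊢
    rw [insT]
    split
    · exact h1
    · have := coefOf_append [(t.1, t.2 + coefOf p t.1)] (p.filter fun t' => !decide (t'.1 = t.1)) e
      rw [List.singleton_append] at this
      rw [this, h1, coefOf_eq_sum [_]]
      simp [h]

theorem coefOf_collect (p : Poly K) (e : List ℕ) : coefOf (collect p) e = coefOf p e := by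
  induction p using List.reverseRecOn with
  | nil => rfl
  | append_singleton l t ih =>
    rw [collect_append, List.foldl_cons, List.foldl_nil, coefOf_insT, ih, coefOf_append,
      coefOf_eq_sum [t]]
    congr 1
    by_cases h : t.1 = e <;> simp [h]

theorem coefOf_pscal (c : K) (p : Poly K) (e : List ℕ) : coefOf (pscal c p) e = c * coefOf p e := by
  rw [pscal, coefOf_collect, coefOf_eq_sum, coefOf_eq_sum, List.filter_map, List.map_map,
    ← List.sum_map_mul_left]
  rfl

theorem coefOf_redBy (h b : Poly K) (e : List ℕ) : coefOf (redBy h b) e =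
    coefOf h e + (0 - coefOf h (lead b)) / coefOf b (lead b) * coefOf b e := by
  rw [redBy, psum, coefOf_collect]
  simp [coefOf_append, coefOf_pscal]

theorem mem_of_coefOf {p : Poly K} {e : List ℕ} (h : coefOf p e ≠ 0) : ∃ t ∈ p, t.1 = e := by
  by_contra! hc
  exact h (coefOf_eq_zero hc)

/-- The leading monomials are distinct, and do not occur in later entries. -/
def Ech (bs : List (Poly K)) : Prop :=
  (∀ b ∈ bs, coefOf b (lead b) ≠ 0) ∧ bs.Pairwise fun b b' => coefOf b' (lead b) = 0

theorem coefOf_foldl_redBy {bs : List (Poly K)} (h : Ech bs) (p : Poly K) (e : List ℕ)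
    (he : (∀ b ∈ bs, coefOf b e = 0) ∧ coefOf p e = 0 ∨ ∃ b ∈ bs, e = lead b) :
    coefOf (bs.foldl redBy p) e = 0 := by
  induction bs generalizing p with
  | nil => rcases he with he | ⟨b, hb, -⟩
           · exact he.2
           · simp at hb
  | cons b bs ih =>
    obtain ⟨h1, h2⟩ := h
    rw [List.pairwise_cons] at h2
    have h' : Ech bs := ⟨fun c hc => h1 c (by simp [hc]), h2.2⟩
    have hb := h1 b (by simp)
    refine ih h' _ ?_
    rcases he with he | ⟨c, hc, rfl⟩
    · exact .inl ⟨fun c hc => he.1 c (by simp [hc]), by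
        rw [coefOf_redBy, he.2, he.1 b (by simp)]; simp⟩
    · rcases List.mem_cons.1 hc with rfl | hc
      · exact .inl ⟨h2.1, by rw [coefOf_redBy]; field_simp; simp⟩
      · exact .inr ⟨c, hc, rfl⟩

theorem coefOf_lead {p : Poly K} (h : Nm p) (hp : p ≠ []) : coefOf p (lead p) ≠ 0 := by
  cases p with
  | nil => exact absurd rfl hp
  | cons t p =>
    have : lead (t :: p) = t.1 := rfl
    rw [this, sum_filter_nm h (by simp)]
    exact h.2 t (by simp)

theorem ech_extend {bs : List (Poly K)} (h : Ech bs) (p : Poly K) (hn : Nm (bs.foldl redBy p)) :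
    Ech (extend bs p) := by
  rw [extend]
  split
  · exact h
  · rename_i h0
    have h0 : bs.foldl redBy p ≠ [] := by simpa using h0
    refine ⟨fun b hb => ?_, ?_⟩
    · rcases List.mem_append.1 hb with hb | hb
      · exact h.1 b hb
      · rw [List.mem_singleton] at hb
        subst hb
        exact coefOf_lead hn h0
    · rw [List.pairwise_append]
      refine ⟨h.2, by simp, fun b hb c hc => ?_⟩
      rw [List.mem_singleton] at hc
      subst hc
      exact coefOf_foldl_redBy h p _ (.inr ⟨b, hb, rfl⟩)

/-- Reduction does not raise the exponents, since it takes linear combinations over `K` only. -/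
theorem redBy_rb {v E : ℕ} {h b : Poly K} (hh : PB v E E h) (hb : PB v E E b) :
    RB v E (redBy h b) := by
  refine ⟨PB.psum fun p hp => ?_, nm_collect _⟩
  simp only [List.mem_cons, List.not_mem_nil, or_false] at hp
  rcases hp with rfl | rfl
  · exact hh
  · exact hb.pscal _

theorem foldl_redBy_rb {v E : ℕ} {bs : List (Poly K)} (hb : ∀ b ∈ bs, RB v E b) {p : Poly K}
    (hp : RB v E p) : RB v E (bs.foldl redBy p) := by
  induction bs generalizing p with
  | nil => exact hp
  | cons b bs ih =>
    exact ih (fun b hb' => hb b (by simp [hb'])) (redBy_rb hp.1 (hb b (by simp)).1)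

/-- The leading exponent vectors of an echelon form are distinct, so there are at most as many
polynomials as monomials, however long the original list was. -/
theorem ech_length {v E : ℕ} {bs : List (Poly K)} (h : Ech bs) (hb : ∀ b ∈ bs, RB v E b) :
    bs.length ≤ (E + 1) ^ (v + 1) := by
  have h1 : PB v E E (bs.map fun b => (lead b, (1 : K))) := by
    intro t ht
    obtain ⟨b, hb', rfl⟩ := List.mem_map.1 ht
    obtain ⟨x, hx, e⟩ := mem_of_coefOf (h.1 b hb')
    dsimp only
    rw [← e]
    exact (hb b hb').1 x hx
  have h2 : Nm (bs.map fun b => (lead b, (1 : K))) := by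
    refine ⟨?_, by simp⟩
    rw [List.map_map]
    refine List.pairwise_map.2 ?_
    refine (List.Pairwise.and_mem.1 h.2).imp fun {b c} hbc e => ?_
    have e : lead b = lead c := e
    exact h.1 c hbc.2.1 (by rw [← e]; exact hbc.2.2)
  have := h1.length_le h2
  rw [List.length_map] at this
  rwa [pow_succ, mul_comm]

/-- Gaussian elimination yields an echelon form with the same bound for the exponents. -/
theorem echelon_spec {v E : ℕ} {H : List (Poly K)} (hH : ∀ h ∈ H, RB v E h) :
    Ech (echelon H) ∧ ∀ b ∈ echelon H, RB v E b := by
  induction H using List.reverseRecOn with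
  | nil => exact ⟨⟨by simp [echelon], by simp [echelon]⟩, by simp [echelon]⟩
  | append_singleton H h ih =>
    obtain ⟨h1, h2⟩ := ih fun h hh => hH h (by simp [hh])
    have e : echelon (H ++ [h]) = extend (echelon H) h := by simp [echelon]
    have hr := foldl_redBy_rb h2 (hH h (by simp))
    rw [e]
    refine ⟨ech_extend h1 h hr.2, fun b hb => ?_⟩
    rw [extend] at hb
    split at hb
    · exact h2 b hb
    · rcases List.mem_append.1 hb with hb | hb
      · exact h2 b hb
      · rw [List.mem_singleton] at hb
        exact hb ▸ hr

theorem RB.bd {v E B : ℕ} {p : Poly K} (h : RB v E p) (hB : (E + 2) ^ (v + 3) ≤ B) : Bd K B p := by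
  obtain ⟨h1, h2⟩ := le_of_pow_le (by omega) hB
  refine h.1.bd h.2 (by omega) (by omega) ((Nat.mul_comm _ _).trans_le ?_)
  rw [← pow_succ]
  calc (E + 1) ^ (v + 1) ≤ (E + 2) ^ (v + 1) := Nat.pow_le_pow_left (by omega) _
    _ ≤ (E + 2) ^ (v + 3) := Nat.pow_le_pow_right (by omega) (by omega)
    _ ≤ B := hB

theorem echelon_length {v E : ℕ} {H : List (Poly K)} (hH : ∀ h ∈ H, RB v E h) :
    (echelon H).length ≤ (E + 2) ^ (v + 3) := by
  obtain ⟨h1, h2⟩ := echelon_spec hH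
  calc _ ≤ (E + 1) ^ (v + 1) := ech_length h1 h2
    _ ≤ (E + 2) ^ (v + 1) := Nat.pow_le_pow_left (by omega) _
    _ ≤ (E + 2) ^ (v + 3) := Nat.pow_le_pow_right (by omega) (by omega)

/-- The domain of the function `echelon`. -/
def EchDom (B : ℕ) (H : List (Poly K)) : Prop :=
  H.length ≤ B ∧ ∃ v E, (∀ h ∈ H, RB v E h) ∧ (E + 2) ^ (v + 3) ≤ B

theorem EchDom.bd {B : ℕ} {H : List (Poly K)} (h : EchDom B H) : Bd K B H := by
  obtain ⟨h1, v, E, h2, h3⟩ := h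
  exact ⟨h1, fun x hx => (h2 x hx).bd h3⟩

theorem EchDom.mono {B B' : ℕ} {H : List (Poly K)} (hB : B ≤ B') (h : EchDom B H) : EchDom B' H := by
  obtain ⟨h1, v, E, h2, h3⟩ := h
  exact ⟨h1.trans hB, v, E, h2, h3.trans hB⟩

/-- The domain of the function `extend`. -/
def ExtDom (B : ℕ) (x : List (Poly K) × Poly K) : Prop :=
  ∃ v E, (∀ h ∈ x.1, RB v E h) ∧ RB v E x.2 ∧ (E + 2) ^ (v + 3) ≤ B

theorem ExtDom.mono {B B' : ℕ} {x : List (Poly K) × Poly K} (hB : B ≤ B') (h : ExtDom B x) :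
    ExtDom B' x := by
  obtain ⟨v, E, h2, h3, h4⟩ := h
  exact ⟨v, E, h2, h3, h4.trans hB⟩

end

def leadI : {I : Impl // ∀ (K : Type u) [Field K], Ok K I (Bd K) (lead (K := K))} :=
  ⟨_, fun K _ => (headList.app (mapOf (fst.app (snd (α := Unit) (β := Term K))) unit id)).congr
    fun _ => rfl⟩

def redByI : {I : Impl // ∀ (K : Type u) [Field K],
    Ok K I (Bd K) (fun x : Poly K × Poly K => redBy x.1 x.2)} :=
  ⟨_, fun K _ => ((psumI.2 K).app (cons.app2 fst (Ok.singleton ((pscalI.2 K).app2 (div.app2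
    (sub.app2 zero ((coefOfI.2 K).app2 fst ((leadI.2 K).app snd)))
    ((coefOfI.2 K).app2 snd ((leadI.2 K).app snd))) snd)))).congr fun _ => rfl⟩

def foldRedI : {I : Impl // ∀ (K : Type u) [Field K],
    Ok K I (fun B (x : List (Poly K) × Poly K) => Bd K B x ∧ ExtDom B x)
    (fun x => x.1.foldl redBy x.2)} :=
  ⟨_, fun K _ => ((((redByI.2 K).app (snd (α := Unit) (β := Poly K × Poly K))).foldl 0
    (D := fun B x => Bd K B (x.2.2, x.2.1) ∧ ExtDom B (x.2.2, x.2.1)) (by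
      rintro B c b l hB ⟨⟨hl, hb⟩, v, E, h1, h2, h3⟩
      dsimp only at hl hb h1 h2
      simp only [zero_add, pow_one]
      refine ⟨hl.1, (foldl_redBy_rb h1 h2).bd h3, ?_⟩
      rintro l1 x l2 rfl
      exact ⟨trivial, (foldl_redBy_rb (fun b hb => h1 b (by simp [hb])) h2).bd h3,
        hl.2 x (by simp)⟩)).compD (D := fun B (x : List (Poly K) × Poly K) => Bd K B x ∧ ExtDom B x)
      (unit.pair (res (snd.pair fst))) fun B a hB h =>
        ⟨Dat.mono (self_le_pow_succ _) h.1, h.2.mono (self_le_pow_succ _)⟩).congr fun _ => rfl⟩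

def extendI : {I : Impl // ∀ (K : Type u) [Field K],
    Ok K I (fun B (x : List (Poly K) × Poly K) => Bd K B x ∧ ExtDom B x)
    (fun x => extend x.1 x.2)} :=
  ⟨_, fun K _ => ((isNil.app (foldRedI.2 K)).ite (res fst) ((res fst).append
    (Ok.singleton (foldRedI.2 K)))).congr fun _ => rfl⟩

def echelonI : {I : Impl // ∀ (K : Type u) [Field K], Ok K I (EchDom (K := K)) echelon} :=
  ⟨_, fun K _ => ((((extendI.2 K).compB (D := fun B (x : Unit × List (Poly K) × Poly K) =>
      Bd K B x ∧ ExtDom B x.2) (fun _ _ _ h h' => h'.mono h) 0 (res snd)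
      (fun B a _ h => by simpa using h.2)).foldl 0
    (D := fun B x => x.2.1 = [] ∧ EchDom B x.2.2) (by
      rintro B c b l hB ⟨hb, h0, v, E, h1, h2⟩
      dsimp only at h1 hb h0
      subst hb
      simp only [zero_add, pow_one]
      have key (l1 : List (Poly K)) (hl : ∀ x ∈ l1, x ∈ l) : Bd K B (echelon l1) := by
        have h3 : ∀ x ∈ l1, RB v E x := fun x hx => h1 x (hl x hx)
        exact ⟨(echelon_length h3).trans h2, fun x hx => ((echelon_spec h3).2 x hx).bd h2⟩
      refine ⟨h0, key l fun _ h => h, ?_⟩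
      rintro l1 x l2 rfl
      exact ⟨⟨trivial, key l1 (by simp +contextual), (h1 x (by simp)).bd h2⟩, v, E,
        (echelon_spec (fun x hx => h1 x (by simp [hx]))).2, h1 x (by simp), h2⟩)).compD
      (unit.pair (empty.pair (id.mono fun B a _ h => EchDom.bd h))) fun B a hB h =>
        ⟨rfl, EchDom.mono (self_le_pow_succ _) h⟩).congr fun _ => rfl⟩

/-! ### The program -/

section

variable {K : Type u} [Field K]

/-- The system `H = 0` for polynomials in `n` variables, listed with their least variable first. -/
noncomputable def initial (n : ℕ) (H : List (Poly K)) : List ℕ × List ℕ × List (Sys K) :=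
  (List.replicate n 0, [],
    [(echelon (H.map fun h => outP [] h), constP (List.replicate n 0) 1, [])])

/-- The state after `i` elimination steps. -/
noncomputable def stage (n : ℕ) (H : List (Poly K)) (i : ℕ) : List ℕ × List ℕ × List (Sys K) :=
  (List.replicate i ()).foldl (fun s _ => step s) (initial n H)

/-- The triangular sets of those systems whose conditions are fulfilled, when no variable is left. -/
noncomputable def results (L : List (Sys K)) : List (List (Poly K)) :=
  (L.filter fun s => (s.1.all fun p => p.isEmpty) && !s.2.1.isEmpty).map fun s => s.2.2

theorem stage_succ (n : ℕ) (H : List (Poly K)) (i : ℕ) : stage n H (i + 1) = step (stage n H i) := by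
  simp [stage, List.replicate_succ']

end

/-- The base of the double exponential bounds. It exceeds the exponent of the time bound of one step,
and also `10`, which takes care of the growth of the exponents, from `E` to `(E + 2) ^ 9`. -/
def stepBase.{a} : ℕ := stepI.{a}.1.e + 10

section

variable {K : Type u} [Field K]

theorem initial_spec {n E : ℕ} {H : List (Poly K)} (hH : ∀ h ∈ H, RB n E h) :
    (∀ s ∈ (initial n H).2.2, SysOK n n E s) ∧ Bd K ((E + 2) ^ (n + 3)) (initial n H) := by
  have h1 : ∀ h ∈ H.map fun h => outP [] h, RB n E h := by
    intro h hh
    obtain ⟨g, hg, rfl⟩ := List.mem_map.1 hh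
    exact outP_rb (k := 0) rfl (hH g hg)
  have h2 := (echelon_spec h1).2
  have h3 : RB n E (constP (List.replicate n 0) (1 : K)) :=
    ⟨constP_pb _ rfl _, constP_nm _ one_ne_zero⟩
  obtain ⟨h4, h5⟩ := le_of_pow_le (by omega) (le_refl ((E + 2) ^ (n + 3)))
  refine ⟨fun s hs => ?_, ⟨by simp only [initial, List.length_replicate]; omega, fun x hx => ?_⟩, ⟨by simp [initial], by simp [initial]⟩,
    by simp only [initial, List.length_singleton]; omega, fun s hs => ?_⟩
  · rw [initial, List.mem_singleton] at hs
    subst hs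
    exact ⟨h2, h3, by simp⟩
  · rw [List.eq_of_mem_replicate hx]; exact Nat.zero_le _
  · rw [initial, List.mem_singleton] at hs
    subst hs
    exact ⟨⟨echelon_length h1, fun x hx => (h2 x hx).bd le_rfl⟩, h3.bd le_rfl, ⟨by simp, by simp⟩⟩

/-- Invariants of the eliminations: after `i` steps the exponents are at most
`(E + 2) ^ stepBase ^ i`, and the size of the whole state obeys a bound of the same kind. Each step
raises both to a power that does not depend on the input. -/
theorem stage_spec {n E : ℕ} {H : List (Poly K)} (hH : ∀ h ∈ H, RB n E h) (i : ℕ) (hi : i ≤ n) :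
    (stage n H i).1 = List.replicate (n - i) 0 ∧ (stage n H i).2.1 = List.replicate i 0 ∧
      (∃ E', E' + 2 ≤ (E + 2) ^ stepBase.{u} ^ i ∧ ∀ s ∈ (stage n H i).2.2, SysOK n (n - i) E' s) ∧
      Bd K (((E + 2) ^ (n + 3)) ^ stepBase.{u} ^ i) (stage n H i) ∧
      (i < n → StepDom (((E + 2) ^ (n + 3)) ^ stepBase.{u} ^ i) (stage n H i)) := by
  have dom (i E' : ℕ) (hi : i < n) (h1 : (stage n H i).1 = List.replicate (n - i) 0)
      (h3 : E' + 2 ≤ (E + 2) ^ stepBase.{u} ^ i) (h4 : ∀ s ∈ (stage n H i).2.2, SysOK n (n - i) E' s) :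
      StepDom (((E + 2) ^ (n + 3)) ^ stepBase.{u} ^ i) (stage n H i) := by
    intro s hs
    obtain ⟨w, hw⟩ : ∃ w, n - i = w + 1 := ⟨n - i - 1, by omega⟩
    rw [hw] at h1 h4
    refine ⟨w, E', by rw [h1]; rfl, (h4 s hs).1, (h4 s hs).2.1, ?_⟩
    calc (E' + 2) ^ (w + 3) ≤ ((E + 2) ^ stepBase.{u} ^ i) ^ (w + 3) := Nat.pow_le_pow_left h3 _
      _ ≤ ((E + 2) ^ stepBase.{u} ^ i) ^ (n + 3) :=
        Nat.pow_le_pow_right (Nat.pow_pos (by omega)) (by omega)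
      _ = _ := by rw [← pow_mul, ← pow_mul, mul_comm]
  induction i with
  | zero =>
    obtain ⟨h1, h2⟩ := initial_spec hH
    have h3 : ∃ E', E' + 2 ≤ (E + 2) ^ stepBase.{u} ^ 0 ∧ ∀ s ∈ (stage n H 0).2.2, SysOK n (n - 0) E' s :=
      ⟨E, by simp, h1⟩
    refine ⟨rfl, rfl, h3, by rw [pow_zero, pow_one]; exact h2, fun h => ?_⟩
    exact dom 0 E h rfl (by simp) h1
  | succ i ih =>
    obtain ⟨h1, h2, ⟨E', h3, h4⟩, h5, h6⟩ := ih (by omega)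
    obtain ⟨w, hw⟩ : ∃ w, n - i = w + 1 := ⟨n - i - 1, by omega⟩
    have hw' : n - (i + 1) = w := by omega
    rw [hw] at h1 h4
    obtain ⟨a1, a2, a3⟩ := step_spec h1 h2 (by omega) h4
    rw [← stage_succ] at a1 a2 a3
    have hB : 2 ≤ ((E + 2) ^ (n + 3)) ^ stepBase.{u} ^ i := by
      rw [← pow_mul]
      refine le_trans (by omega) (Nat.le_self_pow (Nat.mul_ne_zero (by omega)
        (pow_ne_zero _ (by simp [stepBase]))) (E + 2))
    have hE' : (E' + 2) ^ 9 + 2 ≤ (E + 2) ^ stepBase.{u} ^ (i + 1) := by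
      have : 2 ≤ (E' + 2) ^ 9 := le_trans (by omega) (Nat.le_self_pow (by omega) (E' + 2))
      calc (E' + 2) ^ 9 + 2 ≤ (E' + 2) ^ 10 := by rw [pow_succ _ 9]; nlinarith
        _ ≤ ((E + 2) ^ stepBase.{u} ^ i) ^ 10 := Nat.pow_le_pow_left h3 _
        _ ≤ ((E + 2) ^ stepBase.{u} ^ i) ^ stepBase.{u} :=
          Nat.pow_le_pow_right (Nat.pow_pos (by omega)) (by simp [stepBase])
        _ = _ := by rw [← pow_mul, ← pow_succ]
    have hbd := (((stepI.2 K) _ _ hB ⟨h5, h6 (by omega)⟩).1)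
    rw [← stage_succ] at hbd
    rw [hw']
    refine ⟨a1, a2, ⟨_, hE', a3⟩, ?_, fun hi => dom _ _ hi (by rw [hw', a1]) hE' (by rwa [hw'])⟩
    refine Dat.mono ?_ hbd
    rw [pow_succ stepBase.{u}, pow_mul _ _ stepBase.{u}]
    exact Nat.pow_le_pow_right (by omega) (by simp [stepBase])

/-- The domain of the program. -/
def MainDom (B : ℕ) (x : ℕ × Data K × List (Poly K)) : Prop :=
  ∃ E, (∀ h ∈ x.2.2, RB x.1 E h) ∧ x.2.2.length ≤ B ∧
    ((E + 2) ^ (x.1 + 3)) ^ stepBase.{u} ^ x.1 ≤ B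

end

/-- An arbitrary datum, whose size is not bounded. -/
instance Dat.data (K : Type u) : Dat K (Data K) := ⟨fun x => x, fun _ _ => True, fun _ _ => trivial⟩

/-- Is the datum empty? -/
def isNilD {K : Type u} : Data K → Bool
  | Data.nil => true
  | _ => false

theorem isNilD_ok {K : Type u} [Field K] :
    Ok K ⟨Code.branch Code.id Code.nil (Code.pair Code.nil Code.nil), 2⟩ (Bd K)
      (isNilD (K := K)) := by
  intro B x hB _
  have := Nat.pow_le_pow_left hB 3
  cases x with
  | nil => exact ⟨trivial, 5, by simp only [Nat.reduceAdd]; omega,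
      Eval.branch_no (Eval.id _) (Eval.pair (Eval.nil _) (Eval.nil _))⟩
  | atom => exact ⟨trivial, 3, by simp only [Nat.reduceAdd]; omega,
      Eval.branch_yes (Eval.id _) (by simp [Dat.enc]) (Eval.nil _)⟩
  | node => exact ⟨trivial, 3, by simp only [Nat.reduceAdd]; omega,
      Eval.branch_yes (Eval.id _) (by simp [Dat.enc]) (Eval.nil _)⟩

/-- The output for constant polynomials: is each of them zero? -/
def easyI : {I : Impl // ∀ (K : Type u) [Field K], Ok K I (Bd K)
    (fun x : Data K × Data K × List (Data K) =>
      if x.2.2.all fun y => isNilD y then [([] : List (Poly K))] else [])} :=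
  ⟨_, fun K _ => ((allOf (isNilD_ok.app (snd (α := Unit) (β := Data K))) unit (snd.app snd)).ite
    (Ok.singleton empty) empty).congr fun _ => rfl⟩

theorem MainDom.bd {K : Type u} [Field K] {B : ℕ} {x : ℕ × Data K × List (Poly K)}
    (h : MainDom B x) : x.1 ≤ B ∧ Bd K B x.2.2 ∧ ∃ E, (∀ h ∈ x.2.2, RB x.1 E h) ∧
      (E + 2) ^ (x.1 + 3) ≤ B := by
  obtain ⟨E, h1, h2, h3⟩ := h
  have h4 : (E + 2) ^ (x.1 + 3) ≤ B :=
    (Nat.le_self_pow (pow_ne_zero _ (by simp [stepBase])) _).trans h3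
  obtain ⟨h5, h6⟩ := le_of_pow_le (by omega) h4
  exact ⟨by omega, ⟨h2, fun p hp => (h1 p hp).bd h4⟩, E, h1, h4⟩

def initialI : {I : Impl // ∀ (K : Type u) [Field K],
    Ok K I (MainDom (K := K)) (fun x => initial x.1 x.2.2)} :=
  ⟨_, fun K _ =>
    have n : Ok K _ (MainDom (K := K)) (fun x => List.replicate x.1 0) :=
      natToZeros.app (fstD fun _ _ h => h.bd.1)
    have H : Ok K _ (MainDom (K := K)) (fun x => x.2.2.map fun h => outP [] h) :=
      mapOf (c := fun _ => ()) (g := fun x : Unit × Poly K => outP [] x.2)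
        ((outPI.2 K).app2 empty snd) unit
        (snd.app (sndD fun _ _ h => ⟨trivial, h.bd.2.1⟩))
    (n.pair (empty.pair (Ok.singleton (((echelonI.2 K).compD H fun B a hB h => by
      obtain ⟨-, h2, E, h3, h4⟩ := h.bd
      refine ⟨?_, a.1, E, ?_, h4.trans (self_le_pow_succ _)⟩
      · rw [List.length_map]; exact h2.1.trans (self_le_pow_succ _)
      · intro x hx
        obtain ⟨g, hg, rfl⟩ := List.mem_map.1 hx
        exact outP_rb (k := 0) rfl (h3 g hg)).pair
      (((constPI.2 K).app2 n one).pair empty))))).congr fun _ => rfl⟩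

def mainI : {I : Impl // ∀ (K : Type u) [Field K],
    Ok K I (MainDom (K := K)) (fun x => results (stage x.1 x.2.2 x.1).2.2)} :=
  ⟨_, fun K _ => (mapOf (snd.app (snd.app (snd (α := Unit) (β := Sys K)))) unit
    (filterOf ((allOf (isNil.app (snd (α := Unit) (β := Poly K))) unit
      (fst.app (snd (α := Unit) (β := Sys K)))).and (isNil.app (fst.app (snd.app snd))).not)
      unit (snd.app (snd.app ((((stepI.2 K).compB
      (D := fun B (x : Unit × (List ℕ × List ℕ × List (Sys K)) × Unit) =>
        Bd K B x ∧ StepDom B x.2.1) (fun B B' a h h' s hs => (h' s hs).mono h) 0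
        (res (fst.app snd)) (fun B a _ h => by simpa using h.2)).foldl 0
    (D := fun B x => ∃ E n H, x.2.1 = initial n H ∧ x.2.2.length = n ∧ (∀ h ∈ H, RB n E h) ∧
      ((E + 2) ^ (n + 3)) ^ stepBase.{u} ^ n ≤ B) (by
      rintro B c b l hB ⟨E, n, H, h1, h2, h3, h4⟩
      dsimp only at h1 h2
      subst h1
      have key (l1 : List Unit) : l1.foldl (fun b _ => step b) (initial n H) =
          stage n H l1.length := by
        rw [stage]; congr 1; exact List.eq_replicate_iff.2 ⟨rfl, by simp⟩
      have hle (i : ℕ) (hi : i ≤ n) : ((E + 2) ^ (n + 3)) ^ stepBase.{u} ^ i ≤ B :=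
        (Nat.pow_le_pow_right (Nat.pow_pos (by omega))
          (Nat.pow_le_pow_right (by simp [stepBase]) hi)).trans h4
      simp only [zero_add, pow_one]
      refine ⟨?_, ?_, ?_⟩
      · rw [h2]
        obtain ⟨h5, h6⟩ := le_of_pow_le (t := E + 2) (B := B) (w := n) (by omega) (by simpa using hle 0 (Nat.zero_le _))
        omega
      · rw [key, h2]
        exact Dat.mono h4 (stage_spec h3 n le_rfl).2.2.2.1
      · rintro l1 x l2 rfl
        rw [key]
        simp only [List.length_append, List.length_cons] at h2
        obtain ⟨-, -, -, h5, h6⟩ := stage_spec h3 l1.length (by omega)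
        have := hle l1.length (by omega)
        exact ⟨⟨trivial, Dat.mono this h5, trivial⟩, fun s hs => (h6 (by omega) s hs).mono this⟩)).compD
      (D := MainDom (K := K))
      (unit.pair ((initialI.2 K).pair (natToList.app (fstD fun _ _ h => h.bd.1))))
      fun B a _ h => by
        obtain ⟨E, h1, -, h2⟩ := h
        exact ⟨E, a.1, a.2.2, rfl, by simp, h1, h2.trans (self_le_pow_succ _)⟩))))).congr
          fun _ => rfl⟩

/-! ### Evaluation -/

section

variable {K : Type u} [Field K] {A : Type v} [CommRing A] [Algebra K A]

/-- The value of the monomial with exponents `e` at the point `η`. -/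
def mon (η : List A) (e : List ℕ) : A := (List.zipWith (fun x i => x ^ i) η e).prod

/-- The value of a polynomial at the point `η`. -/
def ev (η : List A) (p : Poly K) : A := (p.map fun t => algebraMap K A t.2 * mon η t.1).sum

@[simp] theorem mon_nil (e : List ℕ) : mon ([] : List A) e = 1 := by simp [mon]

@[simp] theorem mon_nil_right (η : List A) : mon η [] = 1 := by simp [mon]

@[simp] theorem mon_cons (y : A) (η : List A) (i : ℕ) (e : List ℕ) :
    mon (y :: η) (i :: e) = y ^ i * mon η e := by simp [mon]

theorem mon_headD (y : A) (η : List A) (e : List ℕ) :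
    mon (y :: η) e = y ^ e.headD 0 * mon η e.tail := by cases e <;> simp

theorem mon_zeros (η : List A) (k : ℕ) : mon η (List.replicate k 0) = 1 := by
  induction η generalizing k with
  | nil => simp
  | cons y η ih => cases k <;> simp [List.replicate_succ, ih]

theorem mon_vadd {η : List A} {a b : List ℕ} (ha : a.length = η.length) (hb : b.length = η.length) :
    mon η (vadd a b) = mon η a * mon η b := by
  induction η generalizing a b with
  | nil => simp
  | cons y η ih =>
    cases a with
    | nil => simp at ha
    | cons i a =>
      cases b with
      | nil => simp at hb
      | cons j b =>
        rw [vadd_cons, mon_cons, mon_cons, mon_cons, ih (by simpa using ha) (by simpa using hb)]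
        ring

theorem mon_append {η η' : List A} {a b : List ℕ} (ha : a.length = η.length) :
    mon (η ++ η') (a ++ b) = mon η a * mon η' b := by
  rw [mon, List.zipWith_append ha.symm, List.prod_append]; rfl

theorem mon_reverse {η : List A} {a : List ℕ} (ha : a.length = η.length) :
    mon η.reverse a.reverse = mon η a := by
  rw [mon, ← List.reverse_zipWith ha.symm, List.prod_reverse]; rfl

@[simp] theorem ev_nil (η : List A) : ev η ([] : Poly K) = 0 := rfl

@[simp] theorem ev_cons (η : List A) (t : Term K) (p : Poly K) :
    ev η (t :: p) = algebraMap K A t.2 * mon η t.1 + ev η p := rfl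

@[simp] theorem ev_append (η : List A) (p q : Poly K) : ev η (p ++ q) = ev η p + ev η q := by
  simp [ev]

theorem ev_flatMap {α : Type*} (η : List A) (l : List α) (g : α → Poly K) :
    ev η (l.flatMap g) = (l.map fun x => ev η (g x)).sum := by
  induction l <;> simp_all

theorem ev_insT (η : List A) (p : Poly K) (t : Term K) :
    ev η (insT p t) = ev η p + algebraMap K A t.2 * mon η t.1 := by
  have h : ev η p = algebraMap K A (coefOf p t.1) * mon η t.1 +
      ev η (p.filter fun t' => !decide (t'.1 = t.1)) := by
    rw [coefOf_eq_sum]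
    induction p with
    | nil => simp
    | cons x p ih =>
      by_cases hx : x.1 = t.1
      · simp [hx, ih]; ring
      · simp [hx, ih]; ring
  rw [insT]
  split
  · rename_i h0
    have h0 : t.2 + coefOf p t.1 = 0 := by simpa using h0
    rw [h, add_right_comm, ← add_mul, ← map_add, add_comm _ t.2, h0]; simp
  · rw [ev_cons, h, map_add]; ring

@[simp] theorem ev_collect (η : List A) (p : Poly K) : ev η (collect p) = ev η p := by
  induction p using List.reverseRecOn with
  | nil => rfl
  | append_singleton l t ih => rw [collect_append, List.foldl_cons, List.foldl_nil, ev_insT, ih]; simp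

theorem ev_psum (η : List A) (l : List (Poly K)) : ev η (psum l) = (l.map (ev η)).sum := by
  rw [psum, ev_collect]
  induction l <;> simp_all

theorem ev_pscal (η : List A) (c : K) (p : Poly K) : ev η (pscal c p) = algebraMap K A c * ev η p := by
  rw [pscal, ev_collect]
  induction p with
  | nil => simp
  | cons t p ih => simp [ih]; ring

/-- All exponent vectors have length `v`. -/
def Len (v : ℕ) (p : Poly K) : Prop := ∀ t ∈ p, t.1.length = v

theorem PB.len {v S E : ℕ} {p : Poly K} (h : PB v S E p) : Len v p := fun t ht => (h t ht).1

theorem ev_mulT {η : List A} {t : Term K} {q : Poly K} (ht : t.1.length = η.length)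
    (hq : Len η.length q) :
    ev η (q.map fun t' => mulT t t') = algebraMap K A t.2 * mon η t.1 * ev η q := by
  induction q with
  | nil => simp
  | cons t' q ih =>
    rw [List.map_cons, ev_cons, ev_cons, ih fun x hx => hq x (by simp [hx]), mulT,
      mon_vadd ht (hq t' (by simp)), map_mul]
    ring

theorem ev_pmul {η : List A} {p q : Poly K} (hp : Len η.length p) (hq : Len η.length q) :
    ev η (pmul p q) = ev η p * ev η q := by
  rw [pmul, ev_collect, ev_flatMap]
  induction p with
  | nil => simp
  | cons t p ih =>
    rw [List.map_cons, List.sum_cons, ih fun x hx => hp x (by simp [hx]), ev_mulT (hp t (by simp)) hq,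
      ev_cons]
    ring

theorem ev_hom {B : Type w} [CommRing B] [Algebra K B] (φ : A →ₐ[K] B) (η : List A) (p : Poly K) :
    φ (ev η p) = ev (η.map φ) p := by
  have hm (η : List A) (e : List ℕ) : φ (mon η e) = mon (η.map φ) e := by
    induction η generalizing e with
    | nil => simp
    | cons y η ih => cases e <;> simp [ih]
  induction p with
  | nil => simp
  | cons t p ih => simp [ih, hm]

/-- The polynomial in the first variable with the other variables set to `η`. -/
noncomputable def toPoly (η : List A) (p : Poly K) : Polynomial A :=
  (p.map fun t => Polynomial.monomial (t.1.headD 0) (algebraMap K A t.2 * mon η t.1.tail)).sum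

theorem eval_toPoly (y : A) (η : List A) (p : Poly K) :
    (toPoly η p).eval y = ev (y :: η) p := by
  rw [toPoly]
  induction p with
  | nil => simp
  | cons t p ih =>
    rw [List.map_cons, List.sum_cons, Polynomial.eval_add, ih, Polynomial.eval_monomial, ev_cons,
      mon_headD]
    ring

theorem coeff_toPoly (η : List A) (p : Poly K) (i : ℕ) :
    (toPoly η p).coeff i = ev η (coefH i p) := by
  rw [toPoly, coefH]
  induction p with
  | nil => simp
  | cons t p ih =>
    rw [List.map_cons, List.sum_cons, Polynomial.coeff_add, ih, Polynomial.coeff_monomial]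
    by_cases h : t.1.headD 0 = i
    · rw [List.filter_cons_of_pos (by simpa using h), if_pos h, List.map_cons, ev_cons]
    · rw [List.filter_cons_of_neg (by simpa using h), if_neg h, zero_add]

theorem mem_heads_of_ev {η : List A} {p : Poly K} {i : ℕ} (h : ev η (coefH i p) ≠ 0) :
    i ∈ heads p := by
  by_contra hc
  refine h ?_
  rw [coefH, List.filter_eq_nil_iff.2, List.map_nil, ev_nil]
  intro t ht he
  exact hc (List.mem_map.2 ⟨t, ht, by simpa using he⟩)

end

/-! ### Newton's identities -/

section

variable {K : Type u} [Field K] {A : Type v} [CommRing A] [Algebra K A]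

/-- The coefficient of `X ^ (card S - k)` in the monic polynomial with roots `S`. -/
def monicCoef (S : Multiset A) (k : ℕ) : A := (-1) ^ k * S.esymm k

/-- The sum of the `k`-th powers. -/
def powerSum (S : Multiset A) (k : ℕ) : A := (S.map fun x => x ^ k).sum

theorem monicCoef_zero (S : Multiset A) : monicCoef S 0 = 1 := by
  simp [monicCoef, Multiset.esymm]

theorem monicCoef_of_lt {S : Multiset A} {k : ℕ} (h : Multiset.card S < k) : monicCoef S k = 0 := by
  simp [monicCoef, Multiset.esymm, Multiset.powersetCard_eq_empty _ h]

theorem monicCoef_card (S : Multiset A) :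
    monicCoef S (Multiset.card S) = (-1) ^ Multiset.card S * S.prod := by
  simp [monicCoef, Multiset.esymm, Multiset.powersetCard_self]

/-- Newton's identities. -/
theorem mul_monicCoef (S : Multiset A) (k : ℕ) :
    (k : A) * monicCoef S k =
      - ∑ i ∈ Finset.range k, monicCoef S i * powerSum S (k - i) := by
  obtain ⟨l, hl⟩ : ∃ l : List A, (l : Multiset A) = S := Quot.exists_rep S
  have hS : S = Finset.univ.val.map l.get := by
    rw [Fin.univ_val_map, List.ofFn_get, hl]
  have h := congrArg (aeval (R := ℤ) l.get) (MvPolynomial.mul_esymm_eq_sum (Fin l.length) ℤ k)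
  have hp (i : ℕ) : aeval (R := ℤ) l.get (MvPolynomial.psum (Fin l.length) ℤ i) = powerSum S i := by
    rw [powerSum, hS, Multiset.map_map, MvPolynomial.psum, map_sum]
    simp only [map_pow, aeval_X]
    rfl
  rw [map_mul, map_natCast, map_mul, map_sum, aeval_esymm_eq_multiset_esymm, ← hS] at h
  have e : ∑ a ∈ Finset.HasAntidiagonal.antidiagonal k with a.1 < k, aeval (R := ℤ) l.get
      ((-1) ^ a.1 * esymm (Fin l.length) ℤ a.1 * MvPolynomial.psum (Fin l.length) ℤ a.2) =
      ∑ i ∈ Finset.range k, monicCoef S i * powerSum S (k - i) := by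
    refine Finset.sum_bij (fun a _ => a.1) ?_ ?_ ?_ ?_
    · intro a ha; simp at ha ⊢; omega
    · intro a ha b hb hab
      simp at ha hb
      ext <;> omega
    · intro i hi
      simp at hi
      exact ⟨(i, k - i), by simp; omega, rfl⟩
    · intro a ha
      simp at ha
      rw [map_mul, map_mul, hp, aeval_esymm_eq_multiset_esymm, ← hS, monicCoef,
        show k - a.1 = a.2 by omega]
      simp
  rw [e] at h
  rw [monicCoef, mul_left_comm, h, ← mul_assoc]
  simp only [map_pow, map_neg, map_one]
  rw [← pow_add, show k + (k + 1) = 2 * k + 1 by ring, pow_succ, pow_mul]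
  simp

theorem sum_zipWith_mul (l l' : List A) : (List.zipWith (· * ·) l l').sum =
    ∑ i ∈ Finset.range l'.length, l.getD i 0 * l'.getD i 0 := by
  induction l' generalizing l with
  | nil => simp
  | cons y l' ih =>
    cases l with
    | nil => simp
    | cons x l => rw [List.length_cons, Finset.sum_range_succ']; simp [ih, add_comm]

theorem ev_zip' {θ : List A} {l l' : List (Poly K)} (hl : ∀ p ∈ l, Len θ.length p)
    (hl' : ∀ p ∈ l', Len θ.length p) :
    ev θ (psum ((l.zip l').map fun x => pmul x.1 x.2)) =
      (List.zipWith (· * ·) (l.map (ev θ)) (l'.map (ev θ))).sum := by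
  rw [ev_psum, List.map_map, List.zipWith_map, ← List.map_uncurry_zip_eq_zipWith]
  congr 1
  refine List.map_congr_left fun x hx => ?_
  exact ev_pmul (hl _ (List.of_mem_zip (a := x.1) (b := x.2) hx).1)
    (hl' _ (List.of_mem_zip (a := x.1) (b := x.2) hx).2)

theorem ev_zip {θ : List A} {l l' : List (Poly K)} (hl : ∀ p ∈ l, Len θ.length p)
    (hl' : ∀ p ∈ l', Len θ.length p) :
    ev θ (psum ((l.zip l').map fun x => pmul x.1 x.2)) =
      ∑ i ∈ Finset.range l'.length, (l.map (ev θ)).getD i 0 * (l'.map (ev θ)).getD i 0 := by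
  rw [ev_zip' hl hl', sum_zipWith_mul, List.length_map]

theorem Len.collect {v : ℕ} {p : Poly K} (h : Len v p) : Len v (collect p) := fun t ht => by
  obtain ⟨x, hx, e⟩ := mem_collect ht
  rw [e]; exact h x hx

theorem Len.pmul {v : ℕ} {p q : Poly K} (h : Len v p) (h' : Len v q) : Len v (pmul p q) := by
  refine Len.collect fun t ht => ?_
  obtain ⟨x, hx, ht⟩ := List.mem_flatMap.1 ht
  obtain ⟨y, hy, rfl⟩ := List.mem_map.1 ht
  exact vadd_length _ _ (h x hx) (h' y hy)

theorem Len.psum {v : ℕ} {l : List (Poly K)} (h : ∀ p ∈ l, Len v p) : Len v (psum l) := by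
  refine Len.collect fun t ht => ?_
  obtain ⟨x, hx, ht⟩ := List.mem_flatten.1 ht
  exact h x hx t ht

theorem Len.pscal {v : ℕ} {p : Poly K} (h : Len v p) (c : K) : Len v (pscal c p) := by
  refine Len.collect fun t ht => ?_
  obtain ⟨x, hx, rfl⟩ := List.mem_map.1 ht
  exact h x hx

theorem Len.zip {v : ℕ} {l l' : List (Poly K)} (hl : ∀ p ∈ l, Len v p) (hl' : ∀ p ∈ l', Len v p) :
    Len v (TriDec.psum ((l.zip l').map fun x => TriDec.pmul x.1 x.2)) := by
  refine Len.psum fun p hp => ?_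
  obtain ⟨x, hx, rfl⟩ := List.mem_map.1 hp
  exact (hl _ (List.of_mem_zip (a := x.1) (b := x.2) hx).1).pmul
    (hl' _ (List.of_mem_zip (a := x.1) (b := x.2) hx).2)

/-- The invariant of the loop for the power sums: after `j` rounds the state consists of `j + 1`, the
first `j` power sums with the last one in front, and the coefficients that are still to be used. -/
theorem ev_powerSums {θ : List A} {S : Multiset A} {cs : List (Poly K)}
    (hcs : ∀ p ∈ cs, Len θ.length p)
    (hc : ∀ i, (cs.map (ev θ)).getD i 0 = monicCoef S (i + 1)) (l : List Unit)
    (s : K × List (Poly K) × List (Poly K)) (j : ℕ) (h1 : s.1 = ((j + 1 : ℕ) : K))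
    (h2 : s.2.1.map (ev θ) = (List.range j).map fun i => powerSum S (j - i))
    (h2' : ∀ p ∈ s.2.1, Len θ.length p)
    (h3 : ∀ i, (s.2.2.map (ev θ)).getD i 0 = monicCoef S (j + 1 + i))
    (h3' : ∀ p ∈ s.2.2, Len θ.length p) :
    (powerSums cs s l).2.1.map (ev θ) =
      (List.range (j + l.length)).map fun i => powerSum S (j + l.length - i) := by
  induction l generalizing s j with
  | nil => exact h2
  | cons i l ih =>
    rw [show j + (i :: l).length = (j + 1) + l.length by simp; omega]
    refine ih (s.1 + 1, psum [pscal (0 - s.1) (s.2.2.headD []),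
        pscal (0 - 1) (psum ((cs.zip s.2.1).map fun x => pmul x.1 x.2))] :: s.2.1, s.2.2.tail)
      (j + 1) (by rw [h1]; push_cast; ring) ?_ ?_ ?_ (fun p hp => h3' p (List.mem_of_mem_tail hp))
    · have hz := ev_zip hcs h2'
      have hlen : s.2.1.length = j := by simpa using congrArg List.length h2
      rw [List.range_succ_eq_map, List.map_cons, List.map_cons, List.map_map, h2]
      congr 1
      · have h0 : ev θ (s.2.2.headD []) = monicCoef S (j + 1) := by
          have := h3 0
          cases h : s.2.2 <;> simp_all
        have hn := mul_monicCoef S (j + 1)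
        rw [Finset.sum_range_succ', monicCoef_zero, one_mul] at hn
        rw [ev_psum]
        simp only [List.map_cons, List.map_nil, List.sum_cons, List.sum_nil, add_zero, ev_pscal]
        rw [hz, h0, h1, hlen]
        have e : ∑ i ∈ Finset.range j, (cs.map (ev θ)).getD i 0 * (s.2.1.map (ev θ)).getD i 0 =
            ∑ i ∈ Finset.range j, monicCoef S (i + 1) * powerSum S (j + 1 - (i + 1)) := by
          refine Finset.sum_congr rfl fun i hi => ?_
          rw [hc, h2, Nat.add_sub_add_right]
          congr 1
          simp at hi
          simp [hi]
        rw [e]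
        simp only [zero_sub, map_neg, map_natCast, map_one]
        rw [neg_mul, hn]; simp
      · refine List.map_congr_left fun i _ => ?_
        simp
    · intro p hp
      rcases List.mem_cons.1 hp with rfl | hp
      · refine Len.psum fun p hp => ?_
        simp only [List.mem_cons, List.not_mem_nil, or_false] at hp
        rcases hp with rfl | rfl
        · refine Len.pscal ?_ _
          cases h : s.2.2 with
          | nil => intro t ht; simp at ht
          | cons c r => exact h3' _ (by simp [h])
        · exact (Len.zip hcs h2').pscal _
      · exact h2' p hp
    · intro i
      have := h3 (i + 1)
      cases h : s.2.2 with
      | nil => rw [h] at this; simp at this ⊢; rw [this]; congr 1; omega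
      | cons c r => rw [h] at this; simp at this ⊢; rw [this]; congr 1; omega

/-- The invariant of the loop from power sums to coefficients, by Newton's identities solved for the
coefficients. Here characteristic `0` is used: the identities are divided by `j + 1`. -/
theorem ev_newtonCoefs [CharZero K] {θ : List A} {S : Multiset A} {Ps : List (Poly K)}
    (hPs : ∀ p ∈ Ps, Len θ.length p)
    (hP : ∀ i < Ps.length, (Ps.map (ev θ)).getD i 0 = powerSum S (i + 1)) (l : List (Poly K))
    (s : K × List (Poly K)) (j : ℕ) (hj : j + l.length ≤ Ps.length) (h1 : s.1 = ((j + 1 : ℕ) : K))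
    (h2 : s.2.map (ev θ) = (List.range (j + 1)).map fun i => monicCoef S (j - i))
    (h2' : ∀ p ∈ s.2, Len θ.length p) :
    (newtonCoefs Ps s l).2.map (ev θ) =
      (List.range (j + l.length + 1)).map fun i => monicCoef S (j + l.length - i) := by
  induction l generalizing s j with
  | nil => exact h2
  | cons i l ih =>
    rw [show j + (i :: l).length = (j + 1) + l.length by simp; omega]
    rw [List.length_cons] at hj
    refine ih (s.1 + 1, pscal (0 - 1 / s.1) (psum ((s.2.zip Ps).map fun x => pmul x.1 x.2)) :: s.2)
      (j + 1) (by omega) (by rw [h1]; push_cast; ring) ?_ ?_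
    · have hz : ev θ (psum ((s.2.zip Ps).map fun x => pmul x.1 x.2)) =
          ∑ i ∈ Finset.range (j + 1), monicCoef S i * powerSum S (j + 1 - i) := by
        have hlen : s.2.length = j + 1 := by simpa using congrArg List.length h2
        rw [ev_zip' h2' hPs, List.zipWith_comm]
        simp only [mul_comm]
        rw [sum_zipWith_mul, List.length_map, hlen,
          ← Finset.sum_range_reflect]
        refine Finset.sum_congr rfl fun i hi => ?_
        rw [Finset.mem_range] at hi
        rw [hP _ (by omega), h2, mul_comm, show j + 1 - 1 - i + 1 = j + 1 - i by omega]
        congr 1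
        simp [show j - i < j + 1 by omega, show j - (j - i) = i by omega]
      rw [List.range_succ_eq_map, List.map_cons, List.map_cons, List.map_map, h2]
      congr 1
      · have hn := mul_monicCoef S (j + 1)
        rw [ev_pscal, hz, h1]
        have hk : ((j + 1 : ℕ) : K) ≠ 0 := by exact_mod_cast Nat.succ_ne_zero j
        have hk' : algebraMap K A (1 / ((j + 1 : ℕ) : K)) * ((j + 1 : ℕ) : A) = 1 := by
          rw [← map_natCast (algebraMap K A), ← map_mul, one_div_mul_cancel hk, map_one]
        rw [zero_sub, map_neg, neg_mul, ← mul_neg, ← hn, ← mul_assoc, hk', one_mul, Nat.sub_zero]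
      · refine List.map_congr_left fun i _ => ?_
        simp
    · intro p hp
      rcases List.mem_cons.1 hp with rfl | hp
      · exact (Len.zip h2' hPs).pscal _
      · exact h2' p hp

end

/-! ### The value of the norm -/

section

variable {K : Type u} [Field K] {A : Type v} [CommRing A] [Algebra K A]

theorem Len.coefH {v : ℕ} {p : Poly K} (h : Len (v + 1) p) (i : ℕ) : Len v (coefH i p) := by
  intro t ht
  obtain ⟨x, hx, rfl⟩ := List.mem_map.1 ht
  simp [h x (List.mem_filter.1 hx).1]

theorem mon_headD₂ (s z : A) (η : List A) (e : List ℕ) :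
    mon (s :: z :: η) e = s ^ e.headD 0 * z ^ e.tail.headD 0 * mon η e.tail.tail := by
  rw [mon_headD, mon_headD, mul_assoc]

theorem ev_constP (η : List A) (k : ℕ) (c : K) :
    ev η (constP (List.replicate k 0) c) = algebraMap K A c := by
  simp [constP, mon_zeros]

theorem ev_emb (s z Y : A) (η : List A) (i : ℕ) (q : Poly K) :
    ev (s :: z :: Y :: η) (emb i q) = z ^ i * ev η q := by
  rw [emb]
  induction q with
  | nil => simp
  | cons t q ih => rw [List.map_cons, ev_cons, ih, ev_cons]; simp; ring

theorem sum_map_range {M : Type*} [AddCommMonoid M] (f : ℕ → M) (n : ℕ) :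
    ((List.range n).map f).sum = ∑ i ∈ Finset.range n, f i := by
  induction n with
  | zero => simp
  | succ n ih => simp [List.range_succ, Finset.sum_range_succ, ih]

theorem ev_homList {η : List A} {a F : Poly K} (ha : Len η.length a) (hF : Len (η.length + 1) F)
    (N : ℕ) (s : Poly K × List (ℕ × Poly K)) (hs : Len η.length s.1) :
    (homList s a F (downTo N)).2.map (fun x => (x.1, ev η x.2)) =
      ((List.range N).map fun i =>
        (i, ev η (coefH i F) * (ev η s.1 * ev η a ^ (N - 1 - i)))) ++
          s.2.map (fun x => (x.1, ev η x.2)) := by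
  induction N generalizing s with
  | zero => simp [homList, downTo]
  | succ N ih =>
    have e : downTo (N + 1) = N :: downTo N := by simp [downTo, List.range_succ]
    have := ih (pmul s.1 a, (N, pmul (coefH N F) s.1) :: s.2) (hs.pmul ha)
    rw [e, homList, List.foldl_cons, ← homList, this, List.range_succ, List.map_append,
      List.append_assoc, List.map_cons, ev_pmul (hF.coefH N) hs, ev_pmul hs ha]
    congr 1
    · refine List.map_congr_left fun i hi => ?_
      simp only [List.mem_range] at hi
      rw [show N + 1 - 1 - i = N - 1 - i + 1 by omega, pow_succ]
      congr 1
      ring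
    · simp

/-- Substituting `a * y` for `z` in the scaled polynomial gives a multiple of the value at `y`. The
scaling avoids the division by the leading coefficient `a` of the chosen polynomial. -/
theorem ev_scaled {η : List A} {a F : Poly K} (ha : Len η.length a) (hF : Len (η.length + 1) F)
    (s y Y : A) : ev (s :: (ev η a * y) :: Y :: η) (scaled (List.replicate η.length 0) a F) =
      ev η a ^ listMax (heads F) * ev (y :: η) F := by
  have hdeg : (toPoly η F).natDegree ≤ listMax (heads F) := by
    rw [Polynomial.natDegree_le_iff_coeff_eq_zero]
    intro i hi
    rw [coeff_toPoly]
    by_contra h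
    have := le_listMax (mem_heads_of_ev h)
    omega
  have h := ev_homList ha hF (listMax (heads F) + 1) (constP (List.replicate η.length 0) 1, [])
    (by simp [Len, constP])
  have h2 := congrArg (fun l => (l.map fun x => (ev η a * y) ^ x.1 * x.2).sum) h
  simp only [List.map_map, List.map_nil, List.append_nil] at h2
  rw [scaled, ev_flatMap]
  refine Eq.trans (congrArg List.sum (List.map_congr_left fun x _ => ev_emb s (ev η a * y) Y η x.1 x.2)) ?_
  refine h2.trans ?_
  rw [← eval_toPoly, Polynomial.eval_eq_sum_range' (Nat.lt_succ_of_le hdeg), Finset.mul_sum, sum_map_range]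
  refine Finset.sum_congr rfl fun i hi => ?_
  rw [Finset.mem_range] at hi
  have e : ev η a ^ listMax (heads F) = ev η a ^ i * ev η a ^ (listMax (heads F) - i) := by
    rw [← pow_add]; congr 1; omega
  simp only [Function.comp, ev_constP, map_one, one_mul, Nat.add_sub_cancel]
  rw [coeff_toPoly, e, mul_pow]
  ring

/-- The coefficients of the monic polynomial whose roots are `a` times the roots of `F`, where `a` is
the coefficient of `F` of degree `m`. -/
theorem ev_monicCoefs {η : List A} {F : Poly K} (hF : Len (η.length + 1) F) (m : ℕ) (s z Y : A) :
    (monicCoefs (List.replicate η.length 0) F m).map (ev (s :: z :: Y :: η)) =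
      (List.range m).reverse.map fun i => ev η (coefH i F) * ev η (coefH m F) ^ (m - 1 - i) := by
  have h := ev_homList (hF.coefH m) hF m (constP (List.replicate η.length 0) 1, [])
    (by simp [Len, constP])
  have h2 := congrArg (fun l => l.map Prod.snd) h
  simp only [List.map_map, List.map_nil, List.append_nil] at h2
  rw [monicCoefs, List.map_map, List.map_reverse, List.map_reverse]
  congr 1
  refine Eq.trans (List.map_congr_left fun x _ => ?_) (h2.trans (List.map_congr_left fun i _ => ?_))
  · simp [ev_emb]
  · simp [ev_constP]

theorem ev_shiftS (s : A) (η : List A) (p : Poly K) :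
    ev (s :: η) (shiftS p) = s * ev (s :: η) p := by
  rw [shiftS]
  induction p with
  | nil => simp
  | cons t p ih => rw [List.map_cons, ev_cons, ih, ev_cons, mon_headD, mon_headD]; simp; ring

/-- The value of Horner's scheme. -/
def hornerVal (s : A) (l : List A) : A := l.foldl (fun acc x => s * acc + x) 0

theorem ev_horner (s : A) (η : List A) (l : List (Poly K)) :
    ev (s :: η) (horner l) = hornerVal s (l.map (ev (s :: η))) := by
  have (p : Poly K) : ev (s :: η) (l.foldl (fun acc F => shiftS acc ++ F) p) =
      (l.map (ev (s :: η))).foldl (fun acc x => s * acc + x) (ev (s :: η) p) := by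
    induction l generalizing p with
    | nil => rfl
    | cons x l ih => rw [List.foldl_cons, ih, ev_append, ev_shiftS]; rfl
  exact this []

theorem ev_linP (η : List A) (a : Poly K) (s z Y : A) :
    ev (s :: z :: Y :: η) (linP (List.replicate η.length 0) a) = ev η a * Y - z := by
  have h : ev (s :: z :: Y :: η) (a.map fun t => (0 :: 0 :: 1 :: t.1, t.2)) = ev η a * Y := by
    induction a with
    | nil => simp
    | cons t p ih => rw [List.map_cons, ev_cons, ih, ev_cons]; simp; ring
  rw [linP, ev_append, h]
  simp [mon_zeros]
  ring

theorem ev_sepP {E : ℕ} {η : List A} {a Q : Poly K} {P : List (Poly K)} (ha : PB η.length E E a)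
    (hP : ∀ F ∈ P, PB (η.length + 1) E E F) (hQ : PB (η.length + 1) E E Q) (s y Y : A) :
    ev (s :: (ev η a * y) :: Y :: η) (sepP (List.replicate η.length 0) a P Q) =
      1 + s * (ev η a ^ listMax (heads Q) * ev (y :: η) Q * (ev η a * Y - ev η a * y) +
        s * hornerVal s (P.map fun F => ev η a ^ listMax (heads F) * ev (y :: η) F)) := by
  rw [sepP, ev_collect, ev_append, ev_shiftS, ev_append, ev_shiftS, ev_horner,
    ev_pmul (η := s :: (ev η a * y) :: Y :: η) (scaled_pb rfl ha hQ).len (linP_pb rfl ha).len, ev_linP, ev_scaled ha.len hQ.len,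
    List.map_map]
  have h1 : ev (s :: (ev η a * y) :: Y :: η) (constP (0 :: 0 :: 0 :: List.replicate η.length 0) (1 : K)) =
      (1 : A) := by
    have := ev_constP (s :: (ev η a * y) :: Y :: η) (η.length + 3) (1 : K)
    simpa [List.replicate_succ] using this
  have h2 : P.map (ev (s :: (ev η a * y) :: Y :: η) ∘ fun F =>
      scaled (List.replicate η.length 0) a F) =
        P.map fun F => ev η a ^ listMax (heads F) * ev (y :: η) F :=
    List.map_congr_left fun F hF => ev_scaled ha.len (hP F hF).len s y Y
  rw [h1, h2]
  ring

theorem ev_powers {θ : List A} {g : Poly K} (hg : Len θ.length g) (l : List Unit)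
    (s : Poly K × List (Poly K)) (j : ℕ) (h1 : ev θ s.1 = ev θ g ^ j) (h1' : Len θ.length s.1)
    (h2 : s.2.map (ev θ) = (List.range j).map fun i => ev θ g ^ (j - i)) :
    (powers s g l).2.map (ev θ) =
      (List.range (j + l.length)).map fun i => ev θ g ^ (j + l.length - i) := by
  induction l generalizing s j with
  | nil => exact h2
  | cons i l ih =>
    rw [show j + (i :: l).length = (j + 1) + l.length by simp; omega]
    refine ih (pmul s.1 g, pmul s.1 g :: s.2) (j + 1) ?_ (h1'.pmul hg) ?_
    · rw [ev_pmul h1' hg, h1, pow_succ]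
    · rw [List.range_succ_eq_map, List.map_cons, List.map_cons, List.map_map, h2, ev_pmul h1' hg, h1,
        ← pow_succ]
      congr 1
      exact List.map_congr_left fun i _ => by simp

theorem reverse_range_map {α : Type*} (f : ℕ → α) (n : ℕ) :
    ((List.range n).map fun i => f (n - i)).reverse = (List.range n).map fun i => f (i + 1) := by
  refine List.ext_getElem (by simp) fun i h1 h2 => ?_
  simp at h1
  simp
  congr 1
  omega

theorem ev_powerList {θ : List A} {g : Poly K} (hg : Len θ.length g) {zs : List ℕ}
    (hz : 0 :: 0 :: 0 :: zs = List.replicate θ.length 0) (m : ℕ) :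
    (powerList zs g m).map (ev θ) = (List.range m).map fun i => ev θ g ^ (i + 1) := by
  have := ev_powers hg (List.replicate m ()) (constP (0 :: 0 :: 0 :: zs) 1, []) 0
    (by rw [hz, ev_constP]; simp) (by rw [hz]; simp [Len, constP]) (by simp)
  rw [powerList, List.map_reverse, this]
  simpa using reverse_range_map (fun i => ev θ g ^ i) m

theorem ev_powerSumList {θ : List A} {S : Multiset A} {cs : List (Poly K)}
    (hcs : ∀ p ∈ cs, Len θ.length p) (hcard : Multiset.card S = cs.length)
    (hc : ∀ i, (cs.map (ev θ)).getD i 0 = monicCoef S (i + 1)) {zs : List ℕ}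
    (hz : 0 :: 0 :: 0 :: zs = List.replicate θ.length 0) (L i : ℕ) (hi : i ≤ L) :
    ev θ (nth (powerSumList zs cs L) i) = powerSum S i := by
  have := ev_powerSums hcs hc (List.replicate L ()) (1, [], cs) 0 (by simp) (by simp) (by simp)
    (fun i => by rw [hc]; congr 1; omega) hcs
  have h2 : (powerSumList zs cs L).map (ev θ) = (List.range (L + 1)).map (powerSum S) := by
    rw [powerSumList, List.map_cons, List.map_reverse, this, List.range_succ_eq_map, List.map_cons,
      List.map_map]
    congr 1
    · rw [hz, ev_constP]; simp [powerSum, hcard]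
    · simp only [zero_add, List.length_replicate]
      exact reverse_range_map (fun i => powerSum S i) L
  have hl : i < (powerSumList zs cs L).length := by
    have := congrArg List.length h2
    simp at this
    omega
  have h3 : nth (powerSumList zs cs L) i = (powerSumList zs cs L)[i] := by
    rw [nth, List.headD_eq_head?_getD, List.head?_drop, List.getElem?_eq_getElem hl]; rfl
  rw [h3, ← List.getElem_map (ev θ) (h := by simpa using hl)]
  simp [h2]

/-- The sum of the values of `p` over the roots in `S`: replacing the powers of `z` in `p` by the
power sums of `S` computes it without the roots. -/
theorem ev_trace {s Y : A} {η : List A} {S : Multiset A} {ps : List (Poly K)} {L : ℕ}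
    (hps : ∀ p ∈ ps, Len (η.length + 3) p)
    (hS : ∀ i ≤ L, ev (s :: 1 :: Y :: η) (nth ps i) = powerSum S i) (p : Poly K)
    (hp : Len (η.length + 3) p) (hL : ∀ t ∈ p, t.1.tail.headD 0 ≤ L) :
    ev (s :: 1 :: Y :: η) (trace ps p) = (S.map fun ζ => ev (s :: ζ :: Y :: η) p).sum := by
  rw [trace, ev_collect]
  induction p with
  | nil => simp
  | cons t p ih =>
    have hn (i : ℕ) : Len (η.length + 3) (nth ps i) := by
      rw [nth, List.headD_eq_head?_getD, List.head?_drop]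
      rcases h : ps[i]? with _ | q
      · intro t ht; simp at ht
      · exact hps q (List.mem_of_getElem? h)
    have hlen := hp t (by simp)
    rw [List.flatMap_cons, ev_append, ih (fun x hx => hp x (by simp [hx]))
      (fun x hx => hL x (by simp [hx])), ev_mulT (η := s :: 1 :: Y :: η) (by
        rcases h : t.1 with _ | ⟨a, _ | ⟨b, e⟩⟩ <;> rw [h] at hlen <;> simp at hlen ⊢; omega) (hn _),
      hS _ (hL t (by simp)), powerSum]
    simp only [ev_cons, mon_headD₂ s _ (Y :: η) t.1, Multiset.sum_map_add]
    congr 1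
    simp only [mon_cons, pow_zero, one_mul]
    rw [← Multiset.sum_map_mul_left]
    refine congrArg _ (Multiset.map_congr rfl fun ζ _ => ?_)
    ring

/-- The product of the elements of `S`, up to its sign, is obtained from their power sums. -/
theorem ev_prodOfSums [CharZero K] {θ : List A} {S : Multiset A} {Ps : List (Poly K)}
    (hPs : ∀ p ∈ Ps, Len θ.length p) (hcard : Multiset.card S = Ps.length)
    (hP : ∀ i < Ps.length, (Ps.map (ev θ)).getD i 0 = powerSum S (i + 1)) {zs : List ℕ}
    (hz : 0 :: 0 :: 0 :: zs = List.replicate θ.length 0) :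
    ev θ (prodOfSums zs Ps) = (-1) ^ Multiset.card S * S.prod := by
  have := ev_newtonCoefs hPs hP Ps (1, [constP (0 :: 0 :: 0 :: zs) 1]) 0 (by simp) (by simp)
    (by rw [hz]; simp [ev_constP, monicCoef_zero]) (by rw [hz]; simp [Len, constP])
  rw [prodOfSums, ← monicCoef_card, hcard]
  rcases h : (newtonCoefs Ps (1, [constP (0 :: 0 :: 0 :: zs) 1]) Ps).2 with _ | ⟨q, l⟩
  · rw [h] at this
    simp at this
  · rw [h, List.range_succ_eq_map] at this
    simp at this
    simpa using this.1

theorem ev_dropZ (s Y : A) (η : List A) (p : Poly K) :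
    ev (s :: Y :: η) (dropZ p) = ev (s :: 1 :: Y :: η) p := by
  rw [dropZ, ev_collect]
  induction p with
  | nil => simp
  | cons t p ih => rw [List.map_cons, ev_cons, ih, ev_cons, mon_headD₂ s 1 (Y :: η), mon_cons]; simp

/-- The value of the norm is the product of the values at the roots, up to sign. -/
theorem ev_normP [CharZero K] {E m : ℕ} {η : List A} {F Q : Poly K} {P : List (Poly K)}
    (hF : PB (η.length + 1) E E F) (hP : ∀ F ∈ P, PB (η.length + 1) E E F)
    (hQ : PB (η.length + 1) E E Q) (hm : m ≤ E) {S : Multiset A} (hcard : Multiset.card S = m)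
    (hS : ∀ i < m, monicCoef S (i + 1) = ev η (coefH (m - 1 - i) F) * ev η (coefH m F) ^ i)
    (s Y : A) :
    ev (s :: Y :: η) (normP m (List.replicate η.length 0) F P Q) =
      (-1) ^ m * (S.map fun ζ =>
        ev (s :: ζ :: Y :: η) (sepP (List.replicate η.length 0) (coefH m F) P Q)).prod := by
  have hz3 : 0 :: 0 :: 0 :: List.replicate η.length 0 = List.replicate (η.length + 3) 0 := by
    simp [List.replicate_succ]
  have hg := sepP_pb rfl (hF.coefH m) hP hQ
  obtain ⟨h1, h2⟩ := powerList_spec hz3 hg m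
  obtain ⟨hm1, hm2⟩ := monicCoefs_spec rfl hF hm
  rw [normP, ev_dropZ]
  set zs := List.replicate η.length 0 with hzs
  set L := zDeg (powerList zs (sepP zs (coefH m F) P Q) m).flatten with hL
  have h4 := powerSumList_spec hz3 hm2 L
  have hsum (i : ℕ) (hi : i ≤ L) :
      ev (s :: 1 :: Y :: η) (nth (powerSumList zs (monicCoefs zs F m) L) i) = powerSum S i := by
    refine ev_powerSumList (θ := s :: 1 :: Y :: η) (fun p hp => (hm2 p hp).len) (hcard.trans hm1.symm)
      (fun i => ?_) hz3 L i hi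
    rw [ev_monicCoefs hF.len]
    by_cases hi : i < m
    · rw [hS i hi]
      have e : m - 1 - (m - 1 - i) = i := by omega
      simp [hi, e]
    · rw [monicCoef_of_lt (by omega)]
      simp [hi]
  rw [ev_prodOfSums (S := S.map fun ζ => ev (s :: ζ :: Y :: η) (sepP zs (coefH m F) P Q))
    (θ := s :: 1 :: Y :: η) ?_ (by simp [hcard, h1]) ?_ hz3, Multiset.card_map, hcard]
  · intro p hp
    obtain ⟨q, hq, rfl⟩ := List.mem_map.1 hp
    exact (trace_pb (v := η.length + 1) h4 (h2 q hq).2).len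
  · intro i hi
    rw [List.length_map] at hi
    have hmem := List.getElem_mem hi
    rw [List.map_map, List.getD_eq_getElem?_getD, List.getElem?_map, List.getElem?_eq_getElem hi,
      Option.map_some, Option.getD_some, Function.comp, ev_trace (L := L) (fun p hp => (h4 p hp).len) hsum _
        (h2 _ hmem).2.len, powerSum, Multiset.map_map]
    · congr 1
      refine Multiset.map_congr rfl fun ζ _ => ?_
      have := ev_powerList (θ := s :: ζ :: Y :: η) hg.len hz3 m
      rw [← List.getElem_map (ev (s :: ζ :: Y :: η)) (h := by simpa using hi)]
      simp only [hzs] at this ⊢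
      simp [this]
    · intro t ht
      exact le_listMax (List.mem_map.2 ⟨t, List.mem_flatten.2 ⟨_, hmem, ht⟩, rfl⟩)

end

/-! ### The leading coefficient of the norm -/

section

theorem esymm_map_hom {A : Type*} {B : Type*} [CommRing A] [CommRing B] (φ : A →+* B)
    (S : Multiset A) (k : ℕ) : (S.map φ).esymm k = φ (S.esymm k) := by
  simp [Multiset.esymm, Multiset.powersetCard_map, Multiset.map_map, map_multiset_sum,
    map_multiset_prod]

theorem esymm_map_mul {A : Type*} [CommRing A] (a : A) (S : Multiset A) (k : ℕ) :
    (S.map fun x => a * x).esymm k = a ^ k * S.esymm k := by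
  rw [Multiset.esymm, Multiset.esymm, ← Multiset.sum_map_mul_left, Multiset.powersetCard_map,
    Multiset.map_map]
  refine congrArg _ (Multiset.map_congr rfl fun T hT => ?_)
  rw [Function.comp, Multiset.prod_map_mul, Multiset.map_const', Multiset.prod_replicate,
    (Multiset.mem_powersetCard.1 hT).2, Multiset.map_id']

theorem leadingCoeff_C_add_X_mul {R : Type*} [CommRing R] [IsDomain R] (u : R) (h : Polynomial R) :
    (Polynomial.C u + Polynomial.X * h).leadingCoeff = (open Classical in if h = 0 then u else h.leadingCoeff) := by
  split
  · rename_i h0; simp [h0]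
  · rename_i h0
    rw [Polynomial.leadingCoeff_add_of_degree_lt, mul_comm, Polynomial.leadingCoeff_mul_X]
    refine lt_of_le_of_lt Polynomial.degree_C_le ?_
    rw [Polynomial.degree_mul, Polynomial.degree_X, Polynomial.degree_eq_natDegree h0]
    exact_mod_cast Nat.add_pos_left Nat.one_pos _

variable {L : Type v} [Field L]

theorem hornerVal_append {A : Type*} [CommRing A] (s : A) (l : List A) (x : A) :
    hornerVal s (l ++ [x]) = s * hornerVal s l + x := by
  simp [hornerVal]

/-- Horner's scheme for constants `l`, at a variable, vanishes only if all constants do, and has a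
constant leading coefficient. -/
theorem hornerVal_lc (l : List L) :
    (hornerVal Polynomial.X (l.map fun x => Polynomial.C (Polynomial.C x)) = (0 : Polynomial (Polynomial L)) ↔ ∀ x ∈ l, x = 0) ∧
      ∃ c : L, (hornerVal Polynomial.X (l.map fun x => Polynomial.C (Polynomial.C x)) : Polynomial (Polynomial L)).leadingCoeff = Polynomial.C c := by
  induction l using List.reverseRecOn with
  | nil => exact ⟨by simp [hornerVal], 0, by simp [hornerVal]⟩
  | append_singleton l x ih =>
    obtain ⟨h1, c, h2⟩ := ih
    rw [List.map_append, List.map_singleton, hornerVal_append, add_comm]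
    have h3 := leadingCoeff_C_add_X_mul (Polynomial.C x)
      (hornerVal Polynomial.X (l.map fun x => Polynomial.C (Polynomial.C x)) : Polynomial (Polynomial L))
    constructor
    · constructor
      · intro h
        rw [h] at h3
        split at h3
        · rename_i h0
          intro y hy
          rcases List.mem_append.1 hy with hy | hy
          · exact h1.1 h0 y hy
          · rw [List.mem_singleton] at hy
            subst hy
            simpa using h3.symm
        · rename_i h0
          simp at h3
          exact absurd (Polynomial.leadingCoeff_eq_zero.1 h3.symm) h0
      · intro h
        rw [h1.2 fun y hy => h y (by simp [hy]), h x (by simp)]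
        simp
    · split at h3
      · exact ⟨x, h3⟩
      · exact ⟨c, h3.trans h2⟩

/-- The factor of the norm that belongs to the root `r`. Here `q` is the value of the inequation at
`r`, and `l` consists of the values of the equations. -/
theorem factor_lc (q a r : L) (ha : a ≠ 0) (l : List L) (g : Polynomial (Polynomial L))
    (hg : g = 1 + Polynomial.X * (Polynomial.C (Polynomial.C q * (Polynomial.C a * Polynomial.X - Polynomial.C a * Polynomial.C r)) + Polynomial.X * hornerVal Polynomial.X (l.map fun x => Polynomial.C (Polynomial.C x)))) :
    g ≠ 0 ∧ ∀ y, g.leadingCoeff.eval y = 0 ↔ (∀ x ∈ l, x = 0) ∧ q ≠ 0 ∧ y = r := by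
  obtain ⟨h1, c, h2⟩ := hornerVal_lc l
  have hu : (Polynomial.C q * (Polynomial.C a * Polynomial.X - Polynomial.C a * Polynomial.C r) : Polynomial L) = Polynomial.C (q * a) * (Polynomial.X - Polynomial.C r) := by
    rw [Polynomial.C.map_mul]; ring
  have h4 := leadingCoeff_C_add_X_mul (Polynomial.C q * (Polynomial.C a * Polynomial.X - Polynomial.C a * Polynomial.C r))
    (hornerVal Polynomial.X (l.map fun x => Polynomial.C (Polynomial.C x)) : Polynomial (Polynomial L))
  have h3 := leadingCoeff_C_add_X_mul 1 (Polynomial.C (Polynomial.C q * (Polynomial.C a * Polynomial.X - Polynomial.C a * Polynomial.C r)) + Polynomial.X *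
    hornerVal Polynomial.X (l.map fun x => Polynomial.C (Polynomial.C x)) : Polynomial (Polynomial L))
  rw [Polynomial.C.map_one, ← hg] at h3
  -- If all equations hold at `r`, the leading coefficient is `q * a * (Y - r)` or, for `q = 0`, it
  -- is `1`. Otherwise it is the leading coefficient of the part from the equations, a constant.
  by_cases h0 : hornerVal Polynomial.X (l.map fun x => Polynomial.C (Polynomial.C x)) = (0 : Polynomial (Polynomial L))
  · rw [if_pos h0] at h4
    by_cases hq : q = 0
    · subst hq
      rw [h0] at h3
      simp at h3
      refine ⟨fun e => by simp [e] at h3, fun y => ?_⟩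
      simp [h3]
    · have hu0 : (Polynomial.C q * (Polynomial.C a * Polynomial.X - Polynomial.C a * Polynomial.C r) : Polynomial L) ≠ 0 := by
        rw [hu]
        exact mul_ne_zero (by simp [hq, ha]) (Polynomial.X_sub_C_ne_zero r)
      rw [if_neg (fun e => hu0 (by rw [e] at h4; simpa using h4.symm)), h4] at h3
      refine ⟨fun e => hu0 (by rw [e] at h3; simpa using h3.symm), fun y => ?_⟩
      rw [h3, hu]
      simp [ha, hq, sub_eq_zero]
      intro _
      exact h1.1 h0
  · rw [if_neg h0] at h4
    have hc : (hornerVal Polynomial.X (l.map fun x => Polynomial.C (Polynomial.C x)) : Polynomial (Polynomial L)).leadingCoeff ≠ 0 := by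
      simpa using h0
    rw [if_neg (fun e => hc (by rw [e] at h4; simpa using h4.symm)), h4] at h3
    refine ⟨fun e => hc (by rw [e] at h3; simpa using h3.symm), fun y => ?_⟩
    rw [h2] at hc h3
    rw [h3, Polynomial.eval_C]
    exact ⟨fun h => absurd (by rw [h]; simp) hc, fun h => absurd (h1.2 h.1) h0⟩

variable {K : Type u} [Field K] [Algebra K L]

theorem ev_X_cons {A : Type w} [CommRing A] [Algebra K A] (η : List A) (p : Poly K) :
    ev (Polynomial.X :: η.map Polynomial.C) p = toPoly η p := by
  have hm (η : List A) (e : List ℕ) : Polynomial.C (mon η e) = mon (η.map Polynomial.C) e := by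
    induction η generalizing e with
    | nil => simp
    | cons y η ih => cases e <;> simp [ih]
  rw [toPoly]
  induction p with
  | nil => simp
  | cons t p ih =>
    rw [List.map_cons, List.sum_cons, ← ih, ev_cons, mon_headD, ← hm,
      ← Polynomial.C_mul_X_pow_eq_monomial, Polynomial.C.map_mul, Polynomial.algebraMap_apply]
    ring

/-- The norm with all variables but `s` and `Y` specialized. -/
noncomputable def normAt (m : ℕ) (η : List L) (F : Poly K) (P : List (Poly K)) (Q : Poly K) :
    Polynomial (Polynomial L) :=
  toPoly (Polynomial.X :: η.map Polynomial.C) (normP m (List.replicate η.length 0) F P Q)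

theorem coeff_normAt (m : ℕ) (η : List L) (F : Poly K) (P : List (Poly K)) (Q : Poly K) (σ : ℕ) :
    (normAt m η F P Q).coeff σ =
      toPoly η (coefH σ (normP m (List.replicate η.length 0) F P Q)) := by
  rw [normAt, coeff_toPoly, ev_X_cons]

/-- The leading coefficient of the norm with respect to `s` is, up to a nonzero constant, the product
of the `a * (Y - r)` over the solutions `r` of `P = 0`, `Q ≠ 0`, with multiplicities. So it vanishes
exactly at the solutions. -/
theorem normAt_lc [CharZero K] [IsAlgClosed L] {E m : ℕ} {η : List L} {F Q : Poly K}
    {P : List (Poly K)} (hF : PB (η.length + 1) E E F) (hP : ∀ F ∈ P, PB (η.length + 1) E E F)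
    (hQ : PB (η.length + 1) E E Q) (hm : m ≤ E) (hFP : F ∈ P) (ha : ev η (coefH m F) ≠ 0)
    (hlt : ∀ i, m < i → ev η (coefH i F) = 0) :
    normAt m η F P Q ≠ 0 ∧ ∀ y, (normAt m η F P Q).leadingCoeff.eval y = 0 ↔
      (∀ F ∈ P, ev (y :: η) F = 0) ∧ ev (y :: η) Q ≠ 0 := by
  set a := ev η (coefH m F) with hadef
  set f := toPoly η F with hf
  have hfm : f.natDegree = m := by
    refine le_antisymm ?_ (Polynomial.le_natDegree_of_ne_zero (by rwa [hf, coeff_toPoly]))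
    rw [Polynomial.natDegree_le_iff_coeff_eq_zero]
    intro i hi
    rw [hf, coeff_toPoly, hlt i hi]
  have hlc : f.leadingCoeff = a := by rw [Polynomial.leadingCoeff, hfm, hf, coeff_toPoly]
  have hf0 : f ≠ 0 := fun h => ha (by rw [← hlc, h]; simp)
  have hcard : Multiset.card f.roots = f.natDegree :=
    ((IsAlgClosed.splits f).natDegree_eq_card_roots).symm
  let ι : L →+* Polynomial (Polynomial L) := (Polynomial.C : Polynomial L →+* _).comp Polynomial.C
  have hι (x : L) : ι x = Polynomial.C (Polynomial.C x) := rfl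
  -- `S` consists of the roots of the monic polynomial that the norm is computed with.
  let S : Multiset (Polynomial (Polynomial L)) := f.roots.map fun r => ι a * ι r
  have hev (p : Poly K) : ev ((η.map Polynomial.C).map Polynomial.C) p = ι (ev η p) := by
    have := ev_hom ((Polynomial.CAlgHom (R := K) (A := Polynomial L)).comp
      (Polynomial.CAlgHom (R := K) (A := L))) η p
    rw [List.map_map]
    exact this.symm
  have hev' (r : L) (p : Poly K) :
      ev (ι r :: (η.map Polynomial.C).map Polynomial.C) p = ι (ev (r :: η) p) := by
    have := ev_hom ((Polynomial.CAlgHom (R := K) (A := Polynomial L)).comp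
      (Polynomial.CAlgHom (R := K) (A := L))) (r :: η) p
    rw [List.map_map]
    exact this.symm
  have hS : ∀ i < m, monicCoef S (i + 1) =
      ev ((η.map Polynomial.C).map Polynomial.C) (coefH (m - 1 - i) F) * ev ((η.map Polynomial.C).map Polynomial.C) (coefH m F) ^ i := by
    intro i hi
    have h1 := Polynomial.coeff_eq_esymm_roots_of_card hcard (k := m - 1 - i) (by omega)
    rw [hfm, hlc, show m - (m - 1 - i) = i + 1 by omega, hf, coeff_toPoly, ← hf] at h1
    have h2 : S = (f.roots.map ι).map fun x => ι a * x := by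
      rw [Multiset.map_map]; rfl
    rw [hev, hev, h1, ← hadef, monicCoef, h2, esymm_map_mul, esymm_map_hom]
    simp only [map_mul, map_pow, map_neg, map_one]
    ring
  have hN := ev_normP (η := (η.map Polynomial.C).map Polynomial.C) (m := m) (F := F) (Q := Q) (P := P) (S := S) (E := E)
    (by simpa using hF) (by simpa using hP) (by simpa using hQ) hm (by simp [S, hcard, hfm]) hS
    Polynomial.X (Polynomial.C Polynomial.X)
  set g : L → Polynomial (Polynomial L) := fun r =>
    ev (Polynomial.X :: (ι a * ι r) :: Polynomial.C Polynomial.X ::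
      (η.map Polynomial.C).map Polynomial.C)
        (sepP (List.replicate η.length 0) (coefH m F) P Q) with hgdef
  have hnorm : normAt m η F P Q = (-1) ^ m * (f.roots.map g).prod := by
    rw [normAt, ← ev_X_cons]
    simp only [List.length_map, S, Multiset.map_map] at hN
    exact hN
  have hg (r : L) := factor_lc (a ^ listMax (heads Q) * ev (r :: η) Q) a r ha
    (P.map fun F => a ^ listMax (heads F) * ev (r :: η) F) (g r) (by
      have := ev_sepP (η := (η.map Polynomial.C).map Polynomial.C) (E := E) (a := coefH m F) (Q := Q)
        (P := P) (by simpa using hF.coefH m) (by simpa using hP) (by simpa using hQ) Polynomial.X (ι r)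
        (Polynomial.C Polynomial.X)
      simp only [hev, hev', List.length_map] at this
      refine this.trans ?_
      rw [List.map_map]
      simp only [hι, Function.comp_def, map_mul, map_pow, map_sub, ← hadef])
  have hroot (y : L) (h : ∀ F ∈ P, ev (y :: η) F = 0) : y ∈ f.roots := by
    rw [Polynomial.mem_roots hf0, Polynomial.IsRoot, hf, eval_toPoly, h F hFP]
  constructor
  · rw [hnorm]
    refine mul_ne_zero (pow_ne_zero _ (by simp)) ?_
    rw [Ne, Multiset.prod_eq_zero_iff, Multiset.mem_map]
    rintro ⟨r, -, hr⟩
    exact (hg r).1 hr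
  · intro y
    -- Taking the leading coefficient in `s` and evaluating it at `y` is multiplicative, so the
    -- factors of the norm can be treated separately.
    let μ : Polynomial (Polynomial L) →* L :=
      (Polynomial.evalRingHom y : Polynomial L →* L).comp Polynomial.leadingCoeffHom
    have hμ (p : Polynomial (Polynomial L)) : μ p = p.leadingCoeff.eval y := rfl
    have hg' (r : L) : μ (g r) = 0 ↔ ((∀ F ∈ P, ev (r :: η) F = 0) ∧ ev (r :: η) Q ≠ 0) ∧ y = r := by
      rw [hμ, (hg r).2 y]
      simp [ha, and_assoc]
    rw [← hμ, hnorm, map_mul, map_multiset_prod, mul_eq_zero, Multiset.prod_eq_zero_iff,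
      Multiset.map_map, Multiset.mem_map]
    have h1 : μ ((-1) ^ m) ≠ 0 := by
      rw [map_pow]
      exact pow_ne_zero _ (by rw [hμ]; simp)
    constructor
    · rintro (h | ⟨r, -, hr⟩)
      · exact absurd h h1
      · obtain ⟨h2, rfl⟩ := (hg' r).1 hr
        exact h2
    · intro h
      exact .inr ⟨y, hroot y h.1, (hg' y).2 ⟨h, rfl⟩⟩

end

/-! ### The elimination step is a projection -/

section

variable {K : Type u} [Field K] {L : Type v} [Field L] [Algebra K L]

/-- The point `η` is a solution of the system `P = 0`, `Q ≠ 0`. -/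
def Holds (η : List L) (P : List (Poly K)) (Q : Poly K) : Prop :=
  (∀ F ∈ P, ev η F = 0) ∧ ev η Q ≠ 0

theorem coefs_zero {η : List L} {p : Poly K} :
    (∀ q ∈ coefs p, ev η q = 0) ↔ ∀ i, ev η (coefH i p) = 0 := by
  constructor
  · intro h i
    by_contra hi
    exact hi (h _ (List.mem_map.2 ⟨i, mem_heads_of_ev hi, rfl⟩))
  · rintro h q hq
    obtain ⟨i, -, rfl⟩ := List.mem_map.1 hq
    exact h i

theorem coefsAbove_zero {η : List L} {p : Poly K} {m : ℕ} :
    (∀ q ∈ coefsAbove m p, ev η q = 0) ↔ ∀ i, m < i → ev η (coefH i p) = 0 := by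
  constructor
  · intro h i hm
    by_contra hi
    exact hi (h _ (List.mem_map.2 ⟨i, List.mem_filter.2 ⟨mem_heads_of_ev hi, by simpa using hm⟩, rfl⟩))
  · rintro h q hq
    obtain ⟨i, hi, rfl⟩ := List.mem_map.1 hq
    exact h i (by simpa using (List.mem_filter.1 hi).2)

theorem toPoly_eq_zero {η : List L} {p : Poly K} :
    toPoly η p = 0 ↔ ∀ i, ev η (coefH i p) = 0 := by
  simp [Polynomial.ext_iff, coeff_toPoly]

theorem coefH_filter_le (e i : ℕ) (p : Poly K) :
    coefH i (p.filter fun t => decide (t.1.headD 0 ≤ e)) = if i ≤ e then coefH i p else [] := by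
  rw [coefH, List.filter_filter]
  split
  · rename_i h
    rw [coefH]
    congr 1
    refine List.filter_congr fun t _ => ?_
    by_cases ht : t.1.headD 0 = i
    · rw [ht]; simp [h]
    · simp only [ht, decide_false, Bool.false_and]
  · rename_i h
    rw [List.filter_eq_nil_iff.2, List.map_nil]
    intro t _ ht
    simp only [Bool.and_eq_true, decide_eq_true_eq] at ht
    omega

theorem ev_filter_le {η : List L} {p : Poly K} {e : ℕ} (h : ∀ i, e < i → ev η (coefH i p) = 0) (y : L) :
    ev (y :: η) (p.filter fun t => decide (t.1.headD 0 ≤ e)) = (toPoly η p).eval y := by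
  rw [← eval_toPoly]
  congr 1
  ext i
  rw [coeff_toPoly, coeff_toPoly, coefH_filter_le]
  split
  · rfl
  · rw [h i (by omega), ev_nil]

/-- What a system of `w` variables with a new polynomial `G` has to do with a system of `w + 1`
variables: a solution of the former extends to the solutions of the latter by the zeros of `G`, whose
leading coefficient does not vanish, or by almost all values if there is no new polynomial. -/
def Extends (η : List L) (P : List (Poly K)) (Q : Poly K) (it : Sys K) : Prop :=
  (it.2.2 = [] ∧ (∃ b, ev η (coefH b Q) ≠ 0) ∧ ∀ y, ev (y :: η) Q ≠ 0 → Holds (y :: η) P Q) ∨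
  ∃ G e, it.2.2 = [G] ∧ 1 ≤ e ∧ (∀ i ∈ heads G, i ≤ e) ∧ ev η (coefH e G) ≠ 0 ∧
    ∀ y, ev (y :: η) G = 0 → Holds (y :: η) P Q

/-- A solution of the conditions of an item fixes the degree `m` of `F`, the degree `σ` of the norm in
`s`, and the degree `e` of its leading coefficient in `Y`; then the zeros of this coefficient are the
solutions of the given system. -/
theorem item_extends [CharZero K] [IsAlgClosed L] {E m σ e : ℕ} {η : List L} {F Q : Poly K}
    {P : List (Poly K)} (hF : PB (η.length + 1) E E F) (hP : ∀ F ∈ P, PB (η.length + 1) E E F)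
    (hQ : PB (η.length + 1) E E Q) (hm : m ≤ E) (hFP : F ∈ P) {it : Sys K}
    (hit : it ∈ item m F (normP m (List.replicate η.length 0) F P Q) σ e)
    (h : Holds η it.1 it.2.1) : Extends η P Q it := by
  set N := normP m (List.replicate η.length 0) F P Q with hN
  rw [item] at hit
  split at hit
  · simp at hit
  rename_i he
  split at hit
  · simp at hit
  rw [List.mem_singleton] at hit
  subst hit
  have he : e ≠ 0 := by simpa using he
  obtain ⟨h1, h2⟩ := h
  dsimp only at h1 h2
  have hNl := (normP_pb rfl hF hP hQ hm).len
  rw [← hN] at hNl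
  rw [ev_pmul (hF.coefH m).len ((hNl.coefH σ).coefH e)] at h2
  have ha := left_ne_zero_of_mul h2
  have hlead := right_ne_zero_of_mul h2
  have hlt := (coefsAbove_zero (η := η) (p := F) (m := m)).1 fun q hq => h1 q (by simp [hq])
  have hσ : ∀ i, σ < i → (normAt m η F P Q).coeff i = 0 := by
    intro i hi
    rw [coeff_normAt, toPoly_eq_zero, ← coefs_zero]
    intro q hq
    by_cases hc : i ∈ heads N
    · exact h1 q (by
        simp only [List.mem_append, List.mem_flatMap]
        exact .inr (.inl ⟨coefH i N, List.mem_map.2 ⟨i, List.mem_filter.2 ⟨hc, by simpa using hi⟩, rfl⟩,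
          hq⟩))
    · have : coefH i N = [] := by
        rw [coefH, List.filter_eq_nil_iff.2, List.map_nil]
        intro t ht he
        exact hc (List.mem_map.2 ⟨t, ht, by simpa using he⟩)
      rw [this] at hq
      simp [coefs, heads] at hq
  have he' := (coefsAbove_zero (η := η) (p := coefH σ N) (m := e)).1 fun q hq => h1 q (by simp [hq])
  obtain ⟨hn0, hn⟩ := normAt_lc hF hP hQ hm hFP ha hlt
  have hlc : (normAt m η F P Q).leadingCoeff = toPoly η (coefH σ N) := by
    rw [Polynomial.leadingCoeff, ← coeff_normAt]
    congr 1
    refine le_antisymm ((Polynomial.natDegree_le_iff_coeff_eq_zero).2 hσ)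
      (Polynomial.le_natDegree_of_ne_zero ?_)
    rw [coeff_normAt]
    intro h0
    exact hlead (toPoly_eq_zero.1 h0 e)
  refine .inr ⟨_, e, rfl, by omega, ?_, ?_, fun y hy => (hn y).1 ?_⟩
  · intro i hi
    obtain ⟨t, ht, rfl⟩ := List.mem_map.1 hi
    simpa using (List.mem_filter.1 ht).2
  · rw [coefH_filter_le, if_pos le_rfl]
    exact hlead
  · rw [hlc, ← ev_filter_le he' y]
    exact hy

/-- Soundness of the elimination step: the solutions of the new systems extend only to solutions of
the given system. -/
theorem sysItems_extends [CharZero K] [IsAlgClosed L] {E : ℕ} {η : List L} {Q : Poly K}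
    {P : List (Poly K)} (hP : ∀ F ∈ P, PB (η.length + 1) E E F)
    (hQ : PB (η.length + 1) E E Q) {it : Sys K}
    (hit : it ∈ sysItems (List.replicate η.length 0) P Q)
    (h : Holds η it.1 it.2.1) : Extends η P Q it := by
  rcases List.mem_append.1 hit with hit | hit
  · obtain ⟨b, -, rfl⟩ := List.mem_map.1 hit
    refine .inl ⟨rfl, ⟨b, h.2⟩, fun y hy => ⟨fun F hF => ?_, hy⟩⟩
    rw [← eval_toPoly, toPoly_eq_zero.2, Polynomial.eval_zero]
    exact coefs_zero.1 fun q hq => h.1 q (List.mem_flatMap.2 ⟨F, hF, hq⟩)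
  · obtain ⟨F, hF, hit⟩ := List.mem_flatMap.1 hit
    obtain ⟨m, hm, hit⟩ := List.mem_flatMap.1 hit
    rw [itemsFor] at hit
    split at hit
    · simp at hit
    obtain ⟨σ, -, hit⟩ := List.mem_flatMap.1 hit
    obtain ⟨e, -, hit⟩ := List.mem_flatMap.1 hit
    exact item_extends (hP F hF) hP hQ ((hP F hF).heads_le m hm) hF hit h

/-- Completeness of the elimination step: every solution of the given system lies over a solution of
one of the new systems, and is a zero of the new polynomial. -/
theorem exists_sysItems [CharZero K] [IsAlgClosed L] {E : ℕ} {η : List L} {Q : Poly K}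
    {P : List (Poly K)} (hP : ∀ F ∈ P, PB (η.length + 1) E E F)
    (hQ : PB (η.length + 1) E E Q) {y : L} (h : Holds (y :: η) P Q) :
    ∃ it ∈ sysItems (List.replicate η.length 0) P Q, Holds η it.1 it.2.1 ∧
      ∀ G ∈ it.2.2, ev (y :: η) G = 0 := by
  by_cases hfree : ∀ F ∈ P, toPoly η F = 0
  · have hb : toPoly η Q ≠ 0 := fun h0 => h.2 (by rw [← eval_toPoly, h0, Polynomial.eval_zero])
    rw [Ne, toPoly_eq_zero] at hb
    push Not at hb
    obtain ⟨b, hb⟩ := hb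
    refine ⟨_, List.mem_append_left _ (List.mem_map.2 ⟨b, mem_heads_of_ev hb, rfl⟩), ⟨?_, hb⟩,
      by simp⟩
    intro q hq
    obtain ⟨F, hF, hq⟩ := List.mem_flatMap.1 hq
    exact coefs_zero.2 (toPoly_eq_zero.1 (hfree F hF)) q hq
  · push Not at hfree
    obtain ⟨F, hF, hF0⟩ := hfree
    -- `m`, `σ` and `e` are the actual degrees at the point `η`. They are positive where the item
    -- requires it, since the polynomials in question do not vanish identically but have the zero `y`.
    set m := (toPoly η F).natDegree with hm
    have ha : ev η (coefH m F) ≠ 0 := by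
      rw [← coeff_toPoly]; simpa [hm] using hF0
    have hlt (i : ℕ) (hi : m < i) : ev η (coefH i F) = 0 := by
      rw [← coeff_toPoly]; exact Polynomial.coeff_eq_zero_of_natDegree_lt hi
    have hmE := (hP F hF).heads_le m (mem_heads_of_ev ha)
    have hm0 : m ≠ 0 := by
      intro h0
      rw [hm] at h0
      rw [Polynomial.eq_C_of_natDegree_eq_zero h0] at hF0
      have := h.1 F hF
      rw [← eval_toPoly, Polynomial.eq_C_of_natDegree_eq_zero h0, Polynomial.eval_C] at this
      rw [this] at hF0
      simp at hF0
    obtain ⟨hn0, hn⟩ := normAt_lc (hP F hF) hP hQ hmE hF ha hlt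
    set N := normP m (List.replicate η.length 0) F P Q with hN
    set σ := (normAt m η F P Q).natDegree with hσ
    have hlc : (normAt m η F P Q).leadingCoeff = toPoly η (coefH σ N) := by
      rw [Polynomial.leadingCoeff, ← hσ, coeff_normAt]
    have hg0 : toPoly η (coefH σ N) ≠ 0 := by
      rw [← hlc]; simpa using hn0
    have hgy : (toPoly η (coefH σ N)).eval y = 0 := by
      rw [← hlc]; exact (hn y).2 h
    set e := (toPoly η (coefH σ N)).natDegree with he
    have hlead : ev η (coefH e (coefH σ N)) ≠ 0 := by
      rw [← coeff_toPoly]; simpa [he] using hg0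
    have he0 : e ≠ 0 := by
      intro h0
      rw [he] at h0
      rw [Polynomial.eq_C_of_natDegree_eq_zero h0] at hg0
      rw [Polynomial.eq_C_of_natDegree_eq_zero h0, Polynomial.eval_C] at hgy
      rw [hgy] at hg0
      simp at hg0
    have he' (i : ℕ) (hi : e < i) : ev η (coefH i (coefH σ N)) = 0 := by
      rw [← coeff_toPoly]; exact Polynomial.coeff_eq_zero_of_natDegree_lt hi
    have hNl := (normP_pb rfl (hP F hF) hP hQ hmE).len
    rw [← hN] at hNl
    have hq : ev η (pmul (coefH m F) (coefH e (coefH σ N))) ≠ 0 := by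
      rw [ev_pmul ((hP F hF).coefH m).len ((hNl.coefH σ).coefH e)]
      exact mul_ne_zero ha hlead
    have hσN : σ ∈ heads N := by
      by_contra hc
      refine hg0 ?_
      have : coefH σ N = [] := by
        rw [coefH, List.filter_eq_nil_iff.2, List.map_nil]
        intro t ht he
        exact hc (List.mem_map.2 ⟨t, ht, by simpa using he⟩)
      rw [this]; rfl
    have hit : (coefsAbove m F ++ ((coefsAbove σ N).flatMap coefs ++ coefsAbove e (coefH σ N)),
        pmul (coefH m F) (coefH e (coefH σ N)),
        [(coefH σ N).filter fun t => decide (t.1.headD 0 ≤ e)]) ∈ item m F N σ e := by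
      rw [item, if_neg (by simpa using he0), if_neg, List.mem_singleton]
      intro h0
      rw [List.isEmpty_iff] at h0
      rw [h0] at hq
      exact hq rfl
    obtain ⟨it, hit, e1, e2, e3⟩ : ∃ it, it ∈ item m F N σ e ∧ it.1 = coefsAbove m F ++
        ((coefsAbove σ N).flatMap coefs ++ coefsAbove e (coefH σ N)) ∧
        it.2.1 = pmul (coefH m F) (coefH e (coefH σ N)) ∧
        it.2.2 = [(coefH σ N).filter fun t => decide (t.1.headD 0 ≤ e)] := ⟨_, hit, rfl, rfl, rfl⟩
    have hmem : it ∈ itemsFor m (List.replicate η.length 0) F P Q := by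
      rw [itemsFor, if_neg (by simpa using hm0)]
      exact List.mem_flatMap.2 ⟨σ, hσN, List.mem_flatMap.2 ⟨e, mem_heads_of_ev hlead, hit⟩⟩
    refine ⟨it, List.mem_append_right _ (List.mem_flatMap.2 ⟨F, hF, List.mem_flatMap.2 ⟨m,
      mem_heads_of_ev ha, hmem⟩⟩), ⟨?_, by rwa [e2]⟩, ?_⟩
    · rw [e1]
      intro p hp
      rcases List.mem_append.1 hp with hp | hp
      · exact coefsAbove_zero.2 hlt p hp
      · rcases List.mem_append.1 hp with hp | hp
        · obtain ⟨q, hq, hp⟩ := List.mem_flatMap.1 hp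
          obtain ⟨i, hi, rfl⟩ := List.mem_map.1 hq
          have hi : σ < i := by simpa using (List.mem_filter.1 hi).2
          refine coefs_zero.2 (toPoly_eq_zero.1 ?_) p hp
          rw [hN, ← coeff_normAt]
          exact Polynomial.coeff_eq_zero_of_natDegree_lt hi
        · exact coefsAbove_zero.2 he' p hp
    · rw [e3]
      intro G hG
      rw [List.mem_singleton] at hG
      subst hG
      exact (ev_filter_le he' y).trans hgy

end

/-! ### Polynomials in one of the variables -/

section

variable {K : Type u} [Field K] {n : ℕ}

theorem mem_of_mem_vars_monomial {m : Fin n →₀ ℕ} {c : K} {i : Fin n}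
    (h : i ∈ (monomial m c).vars) : i ∈ m.support := by
  by_cases hc : c = 0
  · simp [hc] at h
  · rwa [vars_monomial hc] at h

/-- A polynomial, read as a polynomial in the variable `v`. -/
noncomputable def sepVar (v : Fin n) :
    MvPolynomial (Fin n) K →ₐ[K] Polynomial (MvPolynomial (Fin n) K) :=
  aeval fun i => if i = v then Polynomial.X else Polynomial.C (X i)

theorem sepVar_X_self (v : Fin n) : sepVar (K := K) v (X v) = Polynomial.X := by simp [sepVar]

theorem sepVar_of_notMem {v : Fin n} {f : MvPolynomial (Fin n) K} (h : v ∉ f.vars) :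
    sepVar v f = Polynomial.C f := by
  refine MvPolynomial.hom_congr_vars (f₁ := (sepVar v).toRingHom) (f₂ := Polynomial.C) ?_ ?_ rfl
  · ext a; simp [sepVar]
  · intro i hi _
    have : i ≠ v := fun e => h (e ▸ hi)
    simp [sepVar, this]

theorem sepVar_monomial (v : Fin n) (m : Fin n →₀ ℕ) (c : K) :
    sepVar v (monomial m c) = Polynomial.C (monomial (m.erase v) c) * Polynomial.X ^ m v := by
  have h : monomial m c = monomial (m.erase v) c * X v ^ m v := by
    rw [X_pow_eq_monomial, monomial_mul, mul_one, Finsupp.erase_add_single]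
  rw [h, map_mul, map_pow, sepVar_X_self, sepVar_of_notMem]
  intro hv
  have := mem_of_mem_vars_monomial hv
  simp at this

theorem coeff_sepVar (v : Fin n) (e : ℕ) (f : MvPolynomial (Fin n) K) :
    (sepVar v f).coeff e = coeffIn v e f := by
  conv_lhs => rw [f.as_sum]
  rw [map_sum, Polynomial.finsetSum_coeff, coeffIn, Finset.sum_filter]
  refine Finset.sum_congr rfl fun m _ => ?_
  rw [sepVar_monomial, Polynomial.coeff_C_mul, Polynomial.coeff_X_pow]
  by_cases h : m v = e
  · simp [h]
  · simp [h, Ne.symm h]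

theorem eval_sepVar (v : Fin n) (f : MvPolynomial (Fin n) K) : (sepVar v f).eval (X v) = f := by
  have : ((Polynomial.aeval (X v) : Polynomial (MvPolynomial (Fin n) K) →ₐ[MvPolynomial (Fin n) K]
      MvPolynomial (Fin n) K).restrictScalars K).comp (sepVar v) = AlgHom.id K _ := by
    ext i
    by_cases h : i = v <;> simp [sepVar, h]
  have := DFunLike.congr_fun this f
  simpa [Polynomial.aeval_def] using this

theorem natDegree_sepVar (v : Fin n) (f : MvPolynomial (Fin n) K) :
    (sepVar v f).natDegree = f.degreeOf v := by
  refine le_antisymm ?_ ?_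
  · rw [Polynomial.natDegree_le_iff_coeff_eq_zero]
    intro i hi
    rw [coeff_sepVar, coeffIn, Finset.filter_eq_empty_iff.2, Finset.sum_empty]
    intro m hm he
    have := degreeOf_le_iff.1 (le_refl (f.degreeOf v)) m hm
    omega
  · rw [degreeOf_le_iff]
    intro m hm
    refine Polynomial.le_natDegree_of_ne_zero fun h => ?_
    rw [coeff_sepVar, coeffIn] at h
    have h2 := congrArg (coeff (m.erase v)) h
    rw [coeff_sum, Finset.sum_eq_single m] at h2
    · rw [coeff_monomial, if_pos rfl, coeff_zero] at h2
      exact (mem_support_iff.1 hm) h2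
    · intro m' hm' hne
      rw [coeff_monomial, if_neg]
      intro he
      refine hne ?_
      have h1 := (Finset.mem_filter.1 hm').2
      rw [← Finsupp.erase_add_single v m', he, h1, Finsupp.erase_add_single]
    · intro hc
      exact absurd (by simpa using mem_support_iff.1 hm) hc

theorem vars_coeffIn {v : Fin n} {e : ℕ} {f : MvPolynomial (Fin n) K} {i : Fin n}
    (h : i ∈ (coeffIn v e f).vars) : i ∈ f.vars ∧ i ≠ v := by
  classical
  rw [coeffIn] at h
  obtain ⟨m, hm, hi⟩ := Finset.mem_biUnion.1 (vars_sum_subset _ _ h)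
  have hi := mem_of_mem_vars_monomial hi
  rw [Finsupp.support_erase, Finset.mem_erase] at hi
  exact ⟨(mem_vars_iff_mem_support i).2 ⟨m, (Finset.mem_filter.1 hm).1, hi.2⟩, hi.1⟩

/-- The leading variable and the initial of a polynomial, from an expression by powers of the leading
variable. -/
theorem lv_ini_of_eval {v : Fin n} {q : Polynomial (MvPolynomial (Fin n) K)}
    (hq : ∀ i, ∀ j ∈ (q.coeff i).vars, j < v) (hd : 1 ≤ q.natDegree) :
    lv (q.eval (X v)) = v ∧ ini (q.eval (X v)) = q.leadingCoeff := by
  classical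
  have h1 : sepVar v (q.eval (X v)) = q := by
    rw [Polynomial.eval_eq_sum_range, map_sum]
    conv_rhs => rw [q.as_sum_range_C_mul_X_pow]
    refine Finset.sum_congr rfl fun i _ => ?_
    rw [map_mul, map_pow, sepVar_X_self, sepVar_of_notMem]
    exact fun h => (hq i v h).false
  have h2 : (q.eval (X v)).degreeOf v = q.natDegree := by rw [← natDegree_sepVar, h1]
  have hv : v ∈ (q.eval (X v)).vars := by
    rw [mem_vars_iff_degreeOf_ne_zero]
    omega
  have hle : ∀ j ∈ (q.eval (X v)).vars, j ≤ v := by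
    intro j hj
    rw [Polynomial.eval_eq_sum_range] at hj
    obtain ⟨i, -, hi⟩ := Finset.mem_biUnion.1 (vars_sum_subset _ _ hj)
    rcases Finset.mem_union.1 (vars_mul _ _ hi) with hi | hi
    · exact (hq i j hi).le
    · have := vars_pow _ _ hi
      rw [vars_X, Finset.mem_singleton] at this
      exact this.le
  have hmax : (q.eval (X v)).vars.max' ⟨v, hv⟩ = v :=
    le_antisymm (Finset.max'_le _ _ _ hle) (Finset.le_max' _ _ hv)
  refine ⟨?_, ?_⟩
  · rw [lv, ← Finset.coe_max' ⟨v, hv⟩, hmax]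
  · rw [ini, dif_pos ⟨v, hv⟩, hmax, ← coeff_sepVar, h1, h2, Polynomial.leadingCoeff]

end

/-! ### Lists of terms as polynomials -/

section

variable {K : Type u} [Field K] {n : ℕ} {A : Type v} [CommRing A] [Algebra K A]

/-- The polynomial with a given list of terms. -/
noncomputable def toMv (n : ℕ) (p : Poly K) : MvPolynomial (Fin n) K := ev (List.ofFn X) p

theorem aeval_toMv (η : Fin n → A) (p : Poly K) : aeval η (toMv n p) = ev (List.ofFn η) p := by
  rw [toMv, ev_hom, List.map_ofFn]
  congr 2
  funext i
  simp

/-- The first `j` coordinates of a point, in reversed order. -/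
def low (η : Fin n → A) (j : ℕ) : List A := ((List.ofFn η).take j).reverse

theorem low_length (η : Fin n → A) {j : ℕ} (h : j ≤ n) : (low η j).length = j := by
  simp [low, h]

theorem low_succ (η : Fin n → A) (j : Fin n) : low η (j + 1) = η j :: low η j := by
  rw [low, low, List.take_add_one, List.reverse_append]
  simp

theorem low_map {B : Type w} [CommRing B] [Algebra K B] (φ : A → B) (η : Fin n → A) (j : ℕ) :
    (low η j).map φ = low (fun i => φ (η i)) j := by
  rw [low, low, List.map_reverse, List.map_take, List.map_ofFn]; rfl

theorem ev_outP (η : Fin n → A) {w : ℕ} (hw : w ≤ n) {G : Poly K} (hG : Len w G) :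
    ev (List.ofFn η) (outP (List.replicate (n - w) 0) G) = ev (low η w) G := by
  have h (a : List ℕ) (ha : a.length = w) :
      mon (List.ofFn η) (a.reverse ++ List.replicate (n - w) 0) = mon (low η w) a := by
    conv_lhs => rw [← List.take_append_drop w (List.ofFn η)]
    rw [mon_append (by simp [ha, hw]), mon_zeros, mul_one, low,
      ← List.reverse_reverse ((List.ofFn η).take w), mon_reverse (by simp [ha, hw]), List.reverse_reverse]
  rw [outP]
  induction G with
  | nil => rfl
  | cons t G ih =>
    rw [List.map_cons, ev_cons, ev_cons, ih fun x hx => hG x (by simp [hx]), h _ (hG t (by simp))]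

/-- The exponent vector with given entries. -/
noncomputable def expo (n : ℕ) (e : List ℕ) : Fin n →₀ ℕ :=
  Finsupp.equivFunOnFinite.symm fun i => e.getD i 0

theorem expo_inj {e e' : List ℕ} (h : e.length = n) (h' : e'.length = n) (he : expo n e = expo n e') :
    e = e' := by
  refine List.ext_getElem (h.trans h'.symm) fun i h1 h2 => ?_
  have := DFunLike.congr_fun he ⟨i, h ▸ h1⟩
  simpa [expo, h1, h2] using this

theorem ofFn_expo {e : List ℕ} (h : e.length = n) : List.ofFn (fun i => expo n e i) = e := by
  refine List.ext_getElem (by simp [h]) fun i h1 h2 => ?_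
  simp [expo, h2]

theorem mon_X {e : List ℕ} (h : e.length = n) :
    mon (List.ofFn X) e = (monomial (expo n e) 1 : MvPolynomial (Fin n) K) := by
  have h2 : List.zipWith (fun x i => x ^ i) (List.ofFn X) e =
      List.ofFn (fun i : Fin n => (X i ^ expo n e i : MvPolynomial (Fin n) K)) := by
    refine List.ext_getElem (by simp [h]) fun i h1 h2 => ?_
    have : i < e.length := by simpa [h] using h2
    simp [expo, this]
  rw [mon, h2, List.prod_ofFn, monomial_eq, C_1, one_mul, Finsupp.prod_fintype _ _ (by simp)]

theorem toMv_eq_sum {p : Poly K} (h : Len n p) :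
    toMv n p = (p.map fun t => monomial (expo n t.1) t.2).sum := by
  rw [toMv]
  induction p with
  | nil => rfl
  | cons t p ih =>
    rw [ev_cons, ih fun x hx => h x (by simp [hx]), List.map_cons, List.sum_cons, mon_X (h t (by simp)),
      algebraMap_eq, C_mul_monomial, mul_one]

/-- No terms cancel if the exponent vectors are distinct. -/
theorem coeff_toMv {p : Poly K} (h : Len n p) (hn : (p.map Prod.fst).Nodup) {t : Term K} (ht : t ∈ p) :
    coeff (expo n t.1) (toMv n p) = t.2 := by
  obtain ⟨p1, p2, rfl⟩ := List.append_of_mem ht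
  have h0 (q : Poly K) (hq : ∀ x ∈ q, x.1.length = n ∧ x.1 ≠ t.1) :
      coeff (expo n t.1) (q.map fun t => monomial (expo n t.1) t.2).sum = (0 : K) := by
    induction q with
    | nil => simp
    | cons y q ih =>
      rw [List.map_cons, List.sum_cons, coeff_add, ih (fun x hx => hq x (by simp [hx])), coeff_monomial,
        if_neg, add_zero]
      exact fun e => (hq y (by simp)).2 (expo_inj (hq y (by simp)).1 (h t ht) e)
  have h1 : ∀ x ∈ p1 ++ p2, x.1 ≠ t.1 := fun x hx e => by
    rw [List.map_append, List.map_cons, List.nodup_middle, List.nodup_cons, ← List.map_append] at hn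
    exact hn.1 (e ▸ List.mem_map.2 ⟨x, hx, rfl⟩)
  rw [toMv_eq_sum h, List.map_append, List.map_cons, List.sum_append, List.sum_cons, coeff_add, coeff_add,
    coeff_monomial, if_pos rfl, h0 p1 fun x hx => ⟨h x (by simp [hx]), h1 x (by simp [hx])⟩,
    h0 p2 fun x hx => ⟨h x (by simp [hx]), h1 x (by simp [hx])⟩, zero_add, add_zero]

theorem toMv_ne_zero {p : Poly K} (h : Len n p) (hn : Nm p) (hp : p ≠ []) : toMv n p ≠ 0 := by
  obtain ⟨t, ht⟩ := List.exists_mem_of_ne_nil _ hp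
  intro h0
  refine hn.2 t ht ?_
  rw [← coeff_toMv h hn.1 ht, h0, coeff_zero]

theorem ev_mem (S : Subalgebra K A) {η : List A} (h : ∀ x ∈ η, x ∈ S) (p : Poly K) : ev η p ∈ S := by
  have hm (e : List ℕ) : mon η e ∈ S := by
    induction η generalizing e with
    | nil => rw [mon_nil]; exact S.one_mem
    | cons y η ih =>
      rw [mon_headD]
      exact S.mul_mem (S.pow_mem (h y (by simp)) _) (ih (fun x hx => h x (by simp [hx])) _)
  induction p with
  | nil => exact S.zero_mem
  | cons t p ih => exact S.add_mem (S.mul_mem (S.algebraMap_mem _) (hm _)) ih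

theorem vars_ev_low {w : ℕ} (p : Poly K) : ∀ j ∈ (ev (low X w) p : MvPolynomial (Fin n) K).vars, (j : ℕ) < w := by
  have := ev_mem (supported K {j : Fin n | (j : ℕ) < w}) (η := low X w) (fun x hx => by
    rw [low, List.mem_reverse, List.mem_take_iff_getElem] at hx
    obtain ⟨i, hi, rfl⟩ := hx
    rw [List.getElem_ofFn]
    refine Algebra.subset_adjoin ⟨_, ?_, rfl⟩
    simp at hi ⊢
    omega) p
  rw [mem_supported] at this
  exact fun j hj => this hj

/-- The leading variable and the initial of a polynomial found by the elimination step. -/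
theorem lv_ini_outP {E e : ℕ} {w : Fin n} {G : Poly K} (hG : RB (w + 1) E G) (he : 1 ≤ e)
    (hle : ∀ i ∈ heads G, i ≤ e) (hne : coefH e G ≠ []) :
    lv (toMv n (outP (List.replicate (n - (w + 1)) 0) G)) = w ∧
      ∀ (A : Type v) [CommRing A] [Algebra K A] (η : Fin n → A),
        aeval η (ini (toMv n (outP (List.replicate (n - (w + 1)) 0) G))) =
          ev (low η w) (coefH e G) := by
  have h0 : ev (low X w) (coefH e G) ≠ (0 : MvPolynomial (Fin n) K) := by
    rw [← ev_outP X w.2.le (hG.1.len.coefH e)]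
    have := outP_rb (k := n - w) rfl (hG.coefH e)
    rw [Nat.add_sub_cancel' w.2.le] at this
    exact toMv_ne_zero this.1.len this.2 (by simpa [outP] using hne)
  have hd : (toPoly (low X w) G : Polynomial (MvPolynomial (Fin n) K)).natDegree = e := by
    refine le_antisymm ?_ (Polynomial.le_natDegree_of_ne_zero (by rwa [coeff_toPoly]))
    rw [Polynomial.natDegree_le_iff_coeff_eq_zero]
    intro i hi
    rw [coeff_toPoly]
    by_contra hc
    have := hle i (mem_heads_of_ev hc)
    omega
  have h1 := lv_ini_of_eval (v := w) (q := (toPoly (low X w) G : Polynomial (MvPolynomial (Fin n) K)))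
    (fun i j hj => by
      rw [coeff_toPoly] at hj
      exact Fin.lt_def.2 (vars_ev_low _ j hj)) (by omega)
  rw [eval_toPoly, ← low_succ X w, ← ev_outP X (by omega) hG.1.len, Polynomial.leadingCoeff, hd,
    coeff_toPoly] at h1
  refine ⟨h1.1, fun A _ _ η => ?_⟩
  rw [toMv, h1.2, ev_hom, low_map (K := K)]
  congr 2
  funext i
  simp

end

/-! ### The systems after each elimination step -/

section

variable {K : Type u} [Field K] {n : ℕ}

theorem ev_echelon {A : Type v} [CommRing A] [Algebra K A] (η : List A) (H : List (Poly K)) :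
    (∀ b ∈ echelon H, ev η b = 0) ↔ ∀ h ∈ H, ev η h = 0 := by
  have hred (bs : List (Poly K)) (hb : ∀ b ∈ bs, ev η b = 0) (h : Poly K) :
      ev η (bs.foldl redBy h) = ev η h := by
    induction bs generalizing h with
    | nil => rfl
    | cons b bs ih =>
      rw [List.foldl_cons, ih (fun c hc => hb c (by simp [hc])), redBy, ev_psum]
      simp [ev_pscal, hb b]
  induction H using List.reverseRecOn with
  | nil => simp [echelon]
  | append_singleton H h ih =>
    have e : echelon (H ++ [h]) = extend (echelon H) h := by simp [echelon]
    rw [e, extend]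
    split
    · rename_i h0
      rw [List.isEmpty_iff] at h0
      constructor
      · intro hb x hx
        rcases List.mem_append.1 hx with hx | hx
        · exact ih.1 hb x hx
        · rw [List.mem_singleton] at hx
          rw [hx, ← hred _ hb h, h0, ev_nil]
      · exact fun hx => ih.2 fun x hx' => hx x (by simp [hx'])
    · constructor
      · intro hb x hx
        have h1 : ∀ b ∈ echelon H, ev η b = 0 := fun b hb' => hb b (by simp [hb'])
        rcases List.mem_append.1 hx with hx | hx
        · exact ih.1 h1 x hx
        · rw [List.mem_singleton] at hx
          rw [hx, ← hred _ h1 h]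
          exact hb _ (by simp)
      · intro hx
        have h1 := ih.2 fun x hx' => hx x (by simp [hx'])
        intro b hb
        rcases List.mem_append.1 hb with hb | hb
        · exact h1 b hb
        · rw [List.mem_singleton] at hb
          rw [hb, hred _ h1]
          exact hx h (by simp)

/-- The triangular set of a system. -/
noncomputable def triSet (n : ℕ) (s : Sys K) : List (MvPolynomial (Fin n) K) := s.2.2.map (toMv n)

/-- A triangular set in which the least `w` variables are parameters. -/
def TriAbove (w : ℕ) (T : List (MvPolynomial (Fin n) K)) : Prop :=
  IsTriangular T ∧ ∀ f ∈ T, ∃ v : Fin n, lv f = v ∧ w ≤ v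

/-- The coordinate `l` of `η` is transcendental over the preceding coordinates. -/
def Gen (K : Type u) [Field K] {L : Type v} [Field L] [Algebra K L] (η : Fin n → L) (l : ℕ) : Prop :=
  ∀ q : Poly K, (∃ b, ev (low η l) (coefH b q) ≠ 0) → ev (low η (l + 1)) q ≠ 0

/-- The solutions of a system: the initials of its triangular set do not vanish, as long as the
parameters are generic and the preceding polynomials vanish, and generic zeros of its triangular set
are zeros of `H`. -/
def Sound (H : List (Poly K)) (w : ℕ) (s : Sys K) {L : Type v} [Field L] [Algebra K L]
    (η : Fin n → L) : Prop :=
  Holds (low η w) s.1 s.2.1 →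
    (∀ T1 f T2, triSet n s = T1 ++ f :: T2 → (∀ g ∈ T1, aeval η g = 0) →
      (∀ l : Fin n, w ≤ l → (l : WithBot (Fin n)) < lv f → l ∈ params (triSet n s) → Gen K η l) →
        aeval η (ini f) ≠ 0) ∧
    ((∀ f ∈ triSet n s, aeval η f = 0) →
      (∀ l : Fin n, w ≤ l → l ∈ params (triSet n s) → Gen K η l) →
        ∀ h ∈ H, ev (List.ofFn η) h = 0)

/-- The degree of the new polynomial of an item, if there is one, is positive and can be read off its
terms: its initial is the coefficient that the condition `Q ≠ 0` of the item keeps from vanishing. -/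
theorem item_new {zs : List ℕ} {P : List (Poly K)} {Q : Poly K} {it : Sys K}
    (hit : it ∈ sysItems zs P Q) : it.2.2 = [] ∨ ∃ G e, it.2.2 = [G] ∧ 1 ≤ e ∧
      (∀ i ∈ heads G, i ≤ e) ∧ coefH e G ≠ [] := by
  rcases List.mem_append.1 hit with hit | hit
  · obtain ⟨b, -, rfl⟩ := List.mem_map.1 hit
    exact .inl rfl
  · obtain ⟨F, hF, hit⟩ := List.mem_flatMap.1 hit
    obtain ⟨m, hm, hit⟩ := List.mem_flatMap.1 hit
    rw [itemsFor] at hit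
    split at hit
    · simp at hit
    obtain ⟨σ, -, hit⟩ := List.mem_flatMap.1 hit
    obtain ⟨e, -, hit⟩ := List.mem_flatMap.1 hit
    rw [item] at hit
    split at hit
    · simp at hit
    rename_i he
    split at hit
    · simp at hit
    rename_i hq
    rw [List.mem_singleton] at hit
    subst hit
    refine .inr ⟨_, e, rfl, ?_, ?_, ?_⟩
    · have : e ≠ 0 := by simpa using he
      omega
    · intro i hi
      obtain ⟨t, ht, rfl⟩ := List.mem_map.1 hi
      simpa using (List.mem_filter.1 ht).2
    · rw [coefH_filter_le, if_pos le_rfl]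
      intro h0
      rw [h0] at hq
      exact hq (by rw [pmul, List.flatMap_eq_nil_iff.2 (by simp)]; rfl)

theorem mem_step {x : List ℕ × List ℕ × List (Sys K)} {s : Sys K} (hs : s ∈ (step x).2.2) :
    ∃ s0 ∈ x.2.2, ∃ it ∈ sysItems x.1.tail s0.1 s0.2.1,
      s = (it.1, it.2.1, (it.2.2.map fun G => outP x.2.1 G) ++ s0.2.2) := by
  obtain ⟨s0, hs0, hs⟩ := List.mem_flatMap.1 hs
  obtain ⟨it, hit, rfl⟩ := List.mem_map.1 hs
  exact ⟨s0, hs0, it, hit, rfl⟩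

theorem TriAbove.cons {w : Fin n} {f : MvPolynomial (Fin n) K} {T : List (MvPolynomial (Fin n) K)}
    (hf : lv f = w) (hT : TriAbove (w + 1) T) : TriAbove w (f :: T) := by
  obtain ⟨⟨h1, h2⟩, h3⟩ := hT
  refine ⟨⟨?_, ?_⟩, ?_⟩
  · intro g hg
    rcases List.mem_cons.1 hg with rfl | hg
    · rw [hf]; exact WithBot.coe_ne_bot
    · exact h1 g hg
  · refine List.pairwise_cons.2 ⟨fun g hg => ?_, h2⟩
    obtain ⟨v, hv, hw⟩ := h3 g hg
    rw [hf, hv]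
    exact WithBot.coe_lt_coe.2 (Fin.lt_def.2 hw)
  · intro g hg
    rcases List.mem_cons.1 hg with rfl | hg
    · exact ⟨w, hf, le_rfl⟩
    · obtain ⟨v, hv, hw⟩ := h3 g hg
      exact ⟨v, hv, by omega⟩

/-- What an elimination step with respect to the variable `w` does to one system. -/
theorem step_cases {H : List (Poly K)} (hH : ∃ E, ∀ h ∈ H, RB n E h) {i : ℕ} (w : Fin n)
    (hw : n - i = w + 1) {s : Sys K} (hs : s ∈ (stage n H (i + 1)).2.2) :
    ∃ E, ∃ s0 ∈ (stage n H i).2.2, ∃ it ∈ sysItems (List.replicate w 0) s0.1 s0.2.1,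
      (∀ F ∈ s0.1, RB (w + 1) E F) ∧ RB (w + 1) E s0.2.1 ∧ s.1 = it.1 ∧ s.2.1 = it.2.1 ∧
        ((it.2.2 = [] ∧ triSet n s = triSet n s0) ∨ ∃ G, it.2.2 = [G] ∧ RB (w + 1) E G ∧
          triSet n s = toMv n (outP (List.replicate (n - (w + 1)) 0) G) :: triSet n s0) := by
  obtain ⟨E, hH⟩ := hH
  obtain ⟨h1, h2, ⟨E', -, h3⟩, -⟩ := stage_spec hH i (by omega)
  rw [stage_succ] at hs
  obtain ⟨s0, hs0, it, hit, rfl⟩ := mem_step hs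
  rw [h1, hw] at hit
  have hit : it ∈ sysItems (List.replicate w 0) s0.1 s0.2.1 := hit
  obtain ⟨a1, a2, -⟩ := h3 s0 hs0
  rw [hw] at a1 a2
  obtain ⟨-, -, a3⟩ := sysItems_spec rfl a1 a2 it hit
  have hE : E' ≤ (E' + 2) ^ 9 := by have := Nat.le_self_pow (n := 9) (by omega) (E' + 2); omega
  refine ⟨(E' + 2) ^ 9, s0, hs0, it, hit, fun F hF => (a1 F hF).mono hE, a2.mono hE, rfl, rfl, ?_⟩
  rcases item_new hit with h | ⟨G, e, h, -⟩
  · exact .inl ⟨h, by simp [triSet, h]⟩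
  · refine .inr ⟨G, h, a3 G (by simp [h]), ?_⟩
    rw [h2]
    simp [triSet, h, show n - (w + 1) = i by omega]

/-- The leading variable of each new polynomial is the variable that is eliminated. -/
theorem stage_tri {H : List (Poly K)} (hH : ∃ E, ∀ h ∈ H, RB n E h) (i : ℕ) (hi : i ≤ n) :
    ∀ s ∈ (stage n H i).2.2, TriAbove (n - i) (triSet n s) := by
  induction i with
  | zero =>
    intro s hs
    have hs : s ∈ (initial n H).2.2 := hs
    rw [initial, List.mem_singleton] at hs
    subst hs
    simp [TriAbove, IsTriangular, triSet]
  | succ i ih =>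
    intro s hs
    have hw : n - i = (⟨n - (i + 1), by omega⟩ : Fin n) + 1 := by simp; omega
    obtain ⟨E, s0, hs0, it, hit, -, -, -, -, h⟩ := step_cases hH _ hw hs
    have h0 := ih (by omega) s0 hs0
    rw [hw] at h0
    rcases h with ⟨-, h⟩ | ⟨G, hG, hG', h⟩
    · rw [h]
      refine ⟨h0.1, fun f hf => ?_⟩
      obtain ⟨v, hv, hw⟩ := h0.2 f hf
      exact ⟨v, hv, by simp at hw; omega⟩
    · rw [h]
      rcases item_new hit with h' | ⟨G', e, h', he, hle, hne⟩
      · simp [h'] at hG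
      · obtain rfl : G' = G := by simpa [h'] using hG
        exact h0.cons (lv_ini_outP.{u, u} hG' he hle hne).1

/-- By induction on the number of eliminated variables: a solution of a system extends by a zero of
the new polynomial, or by a generic value of the parameter if there is none, to a solution of the
system before. -/
theorem stage_sound [CharZero K] {H : List (Poly K)} (hH : ∃ E, ∀ h ∈ H, RB n E h)
    {L : Type v} [Field L] [Algebra K L] [IsAlgClosed L] (η : Fin n → L) (i : ℕ) (hi : i ≤ n) :
    ∀ s ∈ (stage n H i).2.2, Sound H (n - i) s η := by
  induction i with
  | zero =>
    intro s hs
    have hs : s ∈ (initial n H).2.2 := hs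
    rw [initial, List.mem_singleton] at hs
    subst hs
    rintro ⟨h, -⟩
    refine ⟨fun T1 f T2 e => by simp [triSet] at e, fun _ _ h' hh' => ?_⟩
    obtain ⟨E, hH⟩ := hH
    have := (ev_echelon _ _).1 h (outP [] h') (List.mem_map.2 ⟨h', hh', rfl⟩)
    have e := ev_outP η le_rfl ((outP_rb (k := 0) (pad := []) rfl (hH h' hh')).1.len)
    rw [Nat.sub_zero] at this
    rw [this, Nat.sub_self, List.replicate_zero] at e
    rw [← e]
    congr 1
    simp [outP, List.map_map, Function.comp_def]
  | succ i ih =>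
    intro s hs
    set w : Fin n := ⟨n - (i + 1), by omega⟩ with hwdef
    have hw : n - i = w + 1 := by simp [w]; omega
    have hw' : n - (i + 1) = w := rfl
    obtain ⟨E, s0, hs0, it, hit, hP, hQ, e1, e2, h⟩ := step_cases hH _ hw hs
    have htri := stage_tri hH i (by omega) s0 hs0
    have ih := ih (by omega) s0 hs0
    rw [hw] at ih htri
    rw [hw', Sound, e1, e2]
    intro hh
    have hl := low_length η w.2.le
    have hext := sysItems_extends (η := low η w) (by rw [hl]; exact fun F hF => (hP F hF).1)
      (by rw [hl]; exact hQ.1) (by rw [hl]; exact hit) hh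
    rw [Sound, low_succ] at ih
    rcases hext with ⟨hn, hb, hex⟩ | ⟨G, e, hG, he, hle, hne, hex⟩
    · obtain ⟨-, h⟩ : it.2.2 = [] ∧ triSet n s = triSet n s0 := by
        rcases h with h | ⟨G, hG, -⟩
        · exact h
        · simp [hn] at hG
      rw [h]
      have hpar : w ∈ params (triSet n s0) := by
        intro f hf e
        obtain ⟨v, hv, hwv⟩ := htri.2 f hf
        rw [hv] at e
        have := WithBot.coe_inj.1 e
        omega
      have hgen (hg : Gen K η w) : Holds (η w :: low η w) s0.1 s0.2.1 := by
        refine hex _ ?_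
        rw [← low_succ]
        exact hg _ hb
      refine ⟨fun T1 f T2 e h1 h2 => ?_, fun h1 h2 => ?_⟩
      · obtain ⟨v, hv, hwv⟩ := htri.2 f (by simp [e])
        refine (ih (hgen (h2 w le_rfl ?_ hpar))).1 T1 f T2 e h1 fun l hl => h2 l (by omega)
        rw [hv]
        exact WithBot.coe_lt_coe.2 (Fin.lt_def.2 hwv)
      · exact (ih (hgen (h2 w le_rfl hpar))).2 h1 fun l hl => h2 l (by omega)
    · obtain ⟨hG', h⟩ : RB (w + 1) E G ∧
          triSet n s = toMv n (outP (List.replicate (n - (w + 1)) 0) G) :: triSet n s0 := by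
        rcases h with ⟨h, -⟩ | ⟨G', hG', h⟩
        · simp [hG] at h
        · obtain rfl : G' = G := by simpa [hG] using hG'.symm
          exact h
      obtain ⟨hlv, hini⟩ := lv_ini_outP.{u, v} hG' he hle (fun h0 => by rw [h0] at hne; exact hne rfl)
      have hini := hini L η
      have hparams (l : Fin n) (hl : (w : ℕ) + 1 ≤ l) (hl' : l ∈ params (triSet n s0)) :
          l ∈ params (triSet n s) := by
        intro f hf
        rw [h] at hf
        rcases List.mem_cons.1 hf with rfl | hf
        · rw [hlv]
          intro e
          have := WithBot.coe_inj.1 e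
          omega
        · exact hl' f hf
      have hhold (h0 : aeval η (toMv n (outP (List.replicate (n - (w + 1)) 0) G)) = 0) :
          Holds (η w :: low η w) s0.1 s0.2.1 := by
        refine hex _ ?_
        rw [← low_succ, ← ev_outP η (by omega) hG'.1.len, ← aeval_toMv, h0]
      refine ⟨fun T1 f T2 e h1 h2 => ?_, fun h1 h2 => ?_⟩
      · rw [h] at e
        cases T1 with
        | nil =>
          obtain ⟨rfl, -⟩ := List.cons.inj e
          rw [hini]
          exact hne
        | cons g T1 =>
          obtain ⟨rfl, e'⟩ := List.cons.inj e
          exact (ih (hhold (h1 _ (by simp)))).1 T1 f T2 e' (fun g hg => h1 g (by simp [hg]))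
            fun l hl hlf hl' => h2 l (by omega) hlf (hparams l hl hl')
      · rw [h] at h1
        exact (ih (hhold (h1 _ (by simp)))).2 (fun f hf => h1 f (by simp [hf]))
          fun l hl hl' => h2 l (by omega) (hparams l hl hl')

/-- The eliminations lose no zeros. -/
theorem stage_cover [CharZero K] {H : List (Poly K)} (hH : ∃ E, ∀ h ∈ H, RB n E h)
    {L : Type v} [Field L] [Algebra K L] [IsAlgClosed L] (η : Fin n → L)
    (h0 : ∀ h ∈ H, ev (List.ofFn η) h = 0) (i : ℕ) (hi : i ≤ n) :
    ∃ s ∈ (stage n H i).2.2, Holds (low η (n - i)) s.1 s.2.1 ∧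
      ∀ f ∈ triSet n s, aeval η f = 0 ∧ aeval η (ini f) ≠ 0 := by
  induction i with
  | zero =>
    refine ⟨_, List.mem_singleton_self _, ⟨?_, ?_⟩, by simp [triSet]⟩
    · refine (ev_echelon _ _).2 fun g hg => ?_
      obtain ⟨h', hh', rfl⟩ := List.mem_map.1 hg
      obtain ⟨E, hH⟩ := hH
      have e := ev_outP η le_rfl ((outP_rb (k := 0) (pad := []) rfl (hH h' hh')).1.len)
      rw [Nat.sub_self, List.replicate_zero] at e
      rw [Nat.sub_zero, ← e, ← h0 h' hh']
      congr 1
      simp [outP, List.map_map, Function.comp_def]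
    · dsimp only
      rw [ev_constP]; simp
  | succ i ih =>
    obtain ⟨s0, hs0, hh, hT⟩ := ih (by omega)
    set w : Fin n := ⟨n - (i + 1), by omega⟩ with hwdef
    have hw : n - i = w + 1 := by simp [w]; omega
    have hw' : n - (i + 1) = w := rfl
    have hl := low_length η w.2.le
    rw [hw, low_succ] at hh
    obtain ⟨E, hH'⟩ := hH
    obtain ⟨h1, h2, ⟨E', -, h3⟩, -⟩ := stage_spec hH' i (by omega)
    obtain ⟨a1, a2, -⟩ := h3 s0 hs0
    rw [hw] at a1 a2
    obtain ⟨it, hit, hit1, hit2⟩ := exists_sysItems (η := low η w)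
      (by rw [hl]; exact fun F hF => (a1 F hF).1) (by rw [hl]; exact a2.1) hh
    rw [hl] at hit
    have hmem : (it.1, it.2.1, (it.2.2.map fun G => outP (stage n H i).2.1 G) ++ s0.2.2) ∈
        (stage n H (i + 1)).2.2 := by
      rw [stage_succ]
      refine List.mem_flatMap.2 ⟨s0, hs0, List.mem_map.2 ⟨it, ?_, rfl⟩⟩
      rw [h1, hw]
      exact hit
    refine ⟨_, hmem, hit1, ?_⟩
    have hext := sysItems_extends (η := low η w) (by rw [hl]; exact fun F hF => (a1 F hF).1)
      (by rw [hl]; exact a2.1) (by rw [hl]; exact hit) hit1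
    intro f hf
    rw [triSet, List.map_append] at hf
    rcases List.mem_append.1 hf with hf | hf
    · rcases hext with ⟨hn, -⟩ | ⟨G, e, hG, he, hle, hne, -⟩
      · simp [hn] at hf
      · have hG' := (sysItems_spec rfl a1 a2 it hit).2.2 G (by simp [hG])
        obtain ⟨-, hini⟩ := lv_ini_outP.{u, v} hG' he hle (fun h0 => by rw [h0] at hne; exact hne rfl)
        rw [h2, hG, show i = n - (w + 1) by omega] at hf
        simp only [List.map_cons, List.map_nil, List.mem_singleton] at hf
        rw [hf, hini L η, aeval_toMv, ev_outP η (by omega) hG'.1.len, low_succ]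
        exact ⟨hit2 G (by simp [hG]), hne⟩
    · exact hT f hf

end

/-! ### Dimension and transcendence degree -/

/-- Integral extensions preserve the dimension: primes lift along chains by going up, and
inclusions between primes stay strict when they are contracted. -/
theorem ringKrullDim_eq_of_integral {R : Type u} {S : Type v} [CommRing R] [CommRing S] [Algebra R S]
    [Algebra.IsIntegral R S] (hinj : Function.Injective (algebraMap R S)) :
    ringKrullDim S = ringKrullDim R := by
  have : FaithfulSMul R S := (faithfulSMul_iff_algebraMap_injective R S).2 hinj
  refine le_antisymm (Order.krullDim_le_of_strictMono (PrimeSpectrum.comap (algebraMap R S)) ?_) ?_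
  · intro P Q h
    exact Ideal.IsIntegral.comap_lt_comap (I := P.asIdeal) (J := Q.asIdeal) h
  · have hup : Algebra.HasGoingUp R S := ⟨fun {q} _ P _ hPq => by
      obtain ⟨Q, h1, h2, h3⟩ := Ideal.exists_ideal_over_prime_of_isIntegral_of_isPrime q P hPq.le
      exact ⟨Q, h1, h2, ⟨h3.symm⟩⟩⟩
    refine iSup_le fun l => ?_
    obtain ⟨⟨P, hP⟩⟩ := Ideal.nonempty_primesOver (S := S) (RelSeries.head l).asIdeal
    have := hP.1
    have := hP.2
    obtain ⟨L, hL, -⟩ := Ideal.exists_ltSeries_of_hasGoingUp (S := S) l P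
    rw [← hL]
    exact Order.LTSeries.length_le_krullDim L

/-- By Noether normalization, a finitely generated domain is integral over a polynomial ring, and this
preserves both the dimension and the transcendence degree. -/
theorem ringKrullDim_eq_trdeg (K : Type u) (R : Type u) [Field K] [CommRing R] [IsDomain R] [Algebra K R]
    [Algebra.FiniteType K R] : ringKrullDim R = ((Algebra.trdeg K R).toNat : WithBot ℕ∞) := by
  obtain ⟨s, g, hg, hi⟩ := exists_integral_inj_algHom_of_fg K R
  algebraize [g.toRingHom]
  have : IsScalarTower K (MvPolynomial (Fin s) K) R := IsScalarTower.of_algebraMap_eq fun a => (g.commutes a).symm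
  have : Algebra.IsIntegral (MvPolynomial (Fin s) K) R := ⟨hi⟩
  have hinj : Function.Injective (algebraMap (MvPolynomial (Fin s) K) R) := hg
  have : FaithfulSMul (MvPolynomial (Fin s) K) R := (faithfulSMul_iff_algebraMap_injective _ _).2 hinj
  rw [ringKrullDim_eq_of_integral hinj, MvPolynomial.ringKrullDim_of_isNoetherianRing,
    ringKrullDim_eq_zero_of_field, ← trdeg_add_eq K (MvPolynomial (Fin s) K) (A := R),
    MvPolynomial.trdeg_of_isDomain, trdeg_eq_zero (R := MvPolynomial (Fin s) K)]
  simp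

/-! ### Points over triangular sets -/

section

variable {K : Type u} [Field K] {n : ℕ} {A : Type v} [CommRing A] [IsDomain A] [Algebra K A]

/-- A root of a nonzero polynomial with algebraic coefficients is algebraic. -/
theorem isAlgebraic_of_root {B : Subalgebra K A} {p : Polynomial A}
    (hp : ∀ i, IsAlgebraic B (p.coeff i)) (h0 : p ≠ 0) {x : A} (hx : p.eval x = 0) : IsAlgebraic B x := by
  have h1 : p ∈ Polynomial.lifts (algebraMap (Subalgebra.algebraicClosure B A) A) := by
    rw [Polynomial.lifts_iff_coeff_lifts]
    exact fun i => ⟨⟨p.coeff i, hp i⟩, rfl⟩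
  obtain ⟨q, rfl⟩ := (Polynomial.mem_lifts _).1 h1
  have : IsAlgebraic (Subalgebra.algebraicClosure B A) x := by
    refine ⟨q, fun h => h0 (by simp [h]), ?_⟩
    rwa [Polynomial.eval_map_algebraMap] at hx
  exact this.restrictScalars _

/-- The coordinate `η l` is transcendental over the smaller coordinates. -/
def Free (K : Type u) [Field K] {A : Type v} [CommRing A] [Algebra K A] (η : Fin n → A) (l : Fin n) : Prop :=
  Transcendental (Algebra.adjoin K (η '' Set.Iio l)) (η l)

theorem Free.gen {L : Type v} [Field L] [Algebra K L] {η : Fin n → L} {l : Fin n} (h : Free K η l) :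
    Gen K η l := by
  rintro q ⟨b, hb⟩ h0
  rw [low_succ, ← eval_toPoly] at h0
  refine h (not_not.1 fun ht => ?_)
  have h1 := isAlgebraic_of_root (B := Algebra.adjoin K (η '' Set.Iio l)) (p := toPoly (low η l) q)
    (x := η l) ?_ ?_ h0
  · exact ht h1
  · intro i
    rw [coeff_toPoly]
    have : ev (low η l) (coefH i q) ∈ Algebra.adjoin K (η '' Set.Iio l) := by
      refine ev_mem _ (fun x hx => Algebra.subset_adjoin ?_) _
      rw [low, List.mem_reverse, List.mem_take_iff_getElem] at hx
      obtain ⟨i, hi, rfl⟩ := hx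
      rw [List.getElem_ofFn]
      refine ⟨_, ?_, rfl⟩
      simp at hi ⊢
      exact Fin.lt_def.2 (by simpa using hi)
    exact isAlgebraic_algebraMap (⟨_, this⟩ : Algebra.adjoin K (η '' Set.Iio l))
  · intro h
    apply hb
    rw [← coeff_toPoly, h, Polynomial.coeff_zero]

theorem lv_lt_iff {f : MvPolynomial (Fin n) K} {l : Fin n} : lv f < l ↔ ∀ j ∈ f.vars, j < l := by
  rw [lv, Finset.max, Finset.sup_lt_iff (WithBot.bot_lt_coe l)]
  simp

/-- The separation of the leading variable. -/
theorem sepVar_lv {f : MvPolynomial (Fin n) K} {j : Fin n} (h : lv f = j) :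
    (∀ i, ∀ k ∈ (coeffIn j i f).vars, k < j) ∧ ini f = coeffIn j (f.degreeOf j) f := by
  have hne : f.vars.Nonempty := by
    rw [Finset.nonempty_iff_ne_empty]
    rintro h0
    rw [lv, h0] at h
    simp at h
  have hmax : f.vars.max' hne = j := by
    have := h
    rw [lv, ← Finset.coe_max' hne] at this
    exact_mod_cast this
  refine ⟨fun i k hk => ?_, by rw [ini, dif_pos hne, hmax]⟩
  have := vars_coeffIn hk
  refine lt_of_le_of_ne ?_ this.2
  rw [← hmax]
  exact Finset.le_max' _ _ this.1

theorem aeval_mem_adjoin (η : Fin n → A) {f : MvPolynomial (Fin n) K} {s : Set (Fin n)}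
    (h : ∀ j ∈ f.vars, j ∈ s) : aeval η f ∈ Algebra.adjoin K (η '' s) := by
  have h1 : aeval η f ∈ (supported K s).map (aeval η : _ →ₐ[K] A) :=
    Subalgebra.mem_map.2 ⟨f, mem_supported.2 h, rfl⟩
  rw [supported, AlgHom.map_adjoin, Set.image_image] at h1
  simpa using h1

/-- The coordinates of a zero of a triangular set outside the parameters `S` are algebraic over the
parameters below, provided that the initials do not vanish at it. -/
theorem isAlgebraic_coord {S : Set (Fin n)} {η : Fin n → A} {l : ℕ}
    (hr : ∀ j : Fin n, (j : ℕ) < l → j ∉ S → ∃ f : MvPolynomial (Fin n) K, lv f = j ∧ aeval η f = 0 ∧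
      aeval η (ini f) ≠ 0) (j : Fin n) (hj : (j : ℕ) < l) :
    IsAlgebraic (Algebra.adjoin K (η '' {i | i ∈ S ∧ (i : ℕ) < l})) (η j) := by
  induction j using WellFoundedLT.induction with
  | ind j ih =>
    by_cases hS : j ∈ S
    · exact isAlgebraic_algebraMap (⟨η j, Algebra.subset_adjoin ⟨j, ⟨hS, hj⟩, rfl⟩⟩ :
        Algebra.adjoin K (η '' {i | i ∈ S ∧ (i : ℕ) < l}))
    obtain ⟨f, h1, h2, h3⟩ := hr j hj hS
    obtain ⟨h4, h5⟩ := sepVar_lv h1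
    refine isAlgebraic_of_root (p := (sepVar j f).map (aeval η : _ →ₐ[K] A)) ?_ ?_ ?_
    · intro i
      rw [Polynomial.coeff_map, coeff_sepVar]
      have h6 : aeval η (coeffIn j i f) ∈ Algebra.adjoin K (η '' Set.Iio j) := aeval_mem_adjoin η (h4 i)
      have h7 : Algebra.adjoin K (η '' Set.Iio j) ≤
          (Subalgebra.algebraicClosure (Algebra.adjoin K (η '' {i | i ∈ S ∧ (i : ℕ) < l})) A).restrictScalars K := by
        refine Algebra.adjoin_le ?_
        rintro _ ⟨i, hi, rfl⟩
        exact ih i hi (lt_trans hi hj)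
      exact h7 h6
    · intro h0
      apply h3
      rw [h5, ← coeff_sepVar]
      have := congrArg (fun p => p.coeff (f.degreeOf j)) h0
      simpa using this
    · rw [Polynomial.eval_map, show η j = (aeval η : _ →ₐ[K] A).toRingHom (X j) by simp]
      refine (Polynomial.eval₂_at_apply _ _).trans ?_
      rw [eval_sepVar]
      exact h2

/-- The parameters do not satisfy any algebraic relation at `η`. -/
def Generic (T : List (MvPolynomial (Fin n) K)) (η : Fin n → A) : Prop :=
  ∀ g ∈ supported K (params T), g ≠ 0 → aeval η g ≠ 0

theorem Generic.algebraicIndependent {T : List (MvPolynomial (Fin n) K)} {η : Fin n → A}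
    (h : Generic T η) : AlgebraicIndependent K fun i : params T => η i := by
  rw [algebraicIndependent_iff]
  intro p hp
  by_contra h0
  refine h (rename Subtype.val p) ?_ ?_ ?_
  · rw [supported_eq_range_rename]
    exact ⟨p, rfl⟩
  · intro h1
    exact h0 (rename_injective _ Subtype.val_injective (by rw [h1, map_zero]))
  · rw [aeval_rename]
    exact hp

theorem exists_lv_of_notMem_params {T : List (MvPolynomial (Fin n) K)} {j : Fin n}
    (h : j ∉ params T) : ∃ f ∈ T, lv f = j := by
  simpa [params] using h

/-- At a generic point, the parameters below the leading variables of the remaining polynomials are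
transcendental over the smaller variables. -/
theorem Generic.free {T T1 T2 : List (MvPolynomial (Fin n) K)} {η : Fin n → A} (h : Generic T η)
    (hT : T = T1 ++ T2) (h1 : ∀ f ∈ T1, aeval η f = 0 ∧ aeval η (ini f) ≠ 0) {l : Fin n}
    (hl : l ∈ params T) (h2 : ∀ f ∈ T2, (l : WithBot (Fin n)) < lv f) : Free K η l := by
  intro ht
  have h3 : ∀ x ∈ (η '' Set.Iio l) \ (η '' {i | i ∈ params T ∧ (i : ℕ) < l}),
      IsAlgebraic (Algebra.adjoin K (η '' {i | i ∈ params T ∧ (i : ℕ) < l})) x := by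
    rintro _ ⟨⟨i, hi, rfl⟩, -⟩
    refine isAlgebraic_coord (fun j hj hjS => ?_) i hi
    obtain ⟨f, hf, hfj⟩ := exists_lv_of_notMem_params hjS
    rw [hT, List.mem_append] at hf
    rcases hf with hf | hf
    · exact ⟨f, hfj, h1 f hf⟩
    · have := h2 f hf
      rw [hfj, WithBot.coe_lt_coe, Fin.lt_def] at this
      omega
  have h4 := IsAlgebraic.adjoin_of_forall_isAlgebraic h3 ht
  have h5 := h.algebraicIndependent.transcendental_adjoin (s := {i | (i : Fin n) < l}) (i := ⟨l, hl⟩)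
    (by simp)
  have h6 : (fun i : params T => η i) '' {i | (i : Fin n) < l} = η '' {i | i ∈ params T ∧ (i : ℕ) < l} := by
    ext x
    constructor
    · rintro ⟨⟨i, hi⟩, hil, rfl⟩
      exact ⟨i, ⟨hi, hil⟩, rfl⟩
    · rintro ⟨i, ⟨hi, hil⟩, rfl⟩
      exact ⟨⟨i, hi⟩, hil, rfl⟩
  rw [h6] at h5
  exact h5 h4

/-- The initials do not vanish at points with free parameters. -/
def GenReg (T : List (MvPolynomial (Fin n) K)) : Prop :=
  ∀ (L : Type u) [Field L] [Algebra K L] [IsAlgClosed L] (η : Fin n → L)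
    (T1 : List (MvPolynomial (Fin n) K)) (f : MvPolynomial (Fin n) K)
    (T2 : List (MvPolynomial (Fin n) K)), T = T1 ++ f :: T2 → (∀ g ∈ T1, aeval η g = 0) →
    (∀ l : Fin n, (l : WithBot (Fin n)) < lv f → l ∈ params T → Free K η l) → aeval η (ini f) ≠ 0

/-- `GenReg` asks for parameters free over all preceding coordinates, whereas at a generic point they
are independent among themselves. The two agree as the other preceding coordinates are algebraic over
the parameters, by nonvanishing of the preceding initials; hence the induction. -/
theorem Generic.ini_ne_zero {L : Type u} [Field L] [Algebra K L] [IsAlgClosed L] {η : Fin n → L}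
    {T : List (MvPolynomial (Fin n) K)} (hT : IsTriangular T) (hr : GenReg T) (h : Generic T η)
    (T1 : List (MvPolynomial (Fin n) K)) : ∀ f T2, T = T1 ++ f :: T2 → (∀ g ∈ T1, aeval η g = 0) →
      aeval η (ini f) ≠ 0 ∧ ∀ g ∈ T1, aeval η (ini g) ≠ 0 := by
  induction T1 using List.reverseRecOn with
  | nil =>
    intro f T2 he _
    refine ⟨hr L η [] f T2 he (by simp) fun l hl hp => ?_, by simp⟩
    refine h.free (T1 := []) (T2 := f :: T2) he (by simp) hp fun g hg => ?_
    rcases List.mem_cons.1 hg with rfl | hg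
    · exact hl
    · have := hT.2
      rw [he, List.nil_append, List.pairwise_cons] at this
      exact hl.trans (this.1 g hg)
  | append_singleton T1 g ih =>
    intro f T2 he h0
    have h1 := ih g (f :: T2) (by simpa using he) fun x hx => h0 x (by simp [hx])
    have h2 : ∀ x ∈ T1 ++ [g], aeval η (ini x) ≠ 0 := by
      intro x hx
      rcases List.mem_append.1 hx with hx | hx
      · exact h1.2 x hx
      · rw [List.mem_singleton.1 hx]; exact h1.1
    refine ⟨hr L η _ f T2 he h0 fun l hl hp => ?_, h2⟩
    refine h.free he (fun x hx => ⟨h0 x hx, h2 x hx⟩) hp fun x hx => ?_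
    rcases List.mem_cons.1 hx with rfl | hx
    · exact hl
    · have := hT.2
      rw [he, List.pairwise_append, List.pairwise_cons] at this
      exact hl.trans (this.2.1.1 x hx)

/-- The generic point of a prime ideal, over an algebraically closed field. -/
theorem exists_point (P : Ideal (MvPolynomial (Fin n) K)) [P.IsPrime] :
    ∃ (L : Type u) (_ : Field L) (_ : Algebra K L) (_ : IsAlgClosed L) (η : Fin n → L),
      ∀ f, aeval η f = 0 ↔ f ∈ P := by
  let R := MvPolynomial (Fin n) K ⧸ P
  refine ⟨AlgebraicClosure (FractionRing R), inferInstance, inferInstance, inferInstance,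
    fun i => algebraMap R _ (Ideal.Quotient.mk P (X i)), fun f => ?_⟩
  have h1 : aeval (fun i => algebraMap R (AlgebraicClosure (FractionRing R)) (Ideal.Quotient.mk P (X i))) f =
      algebraMap R (AlgebraicClosure (FractionRing R)) (Ideal.Quotient.mk P f) := by
    have : (aeval fun i => algebraMap R (AlgebraicClosure (FractionRing R)) (Ideal.Quotient.mk P (X i))) =
        (IsScalarTower.toAlgHom K R (AlgebraicClosure (FractionRing R))).comp (Ideal.Quotient.mkₐ K P) := by
      ext i
      simp [R]
    exact DFunLike.congr_fun this f
  rw [h1, IsScalarTower.algebraMap_apply R (FractionRing R), map_eq_zero,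
    IsFractionRing.to_map_eq_zero_iff, Ideal.Quotient.eq_zero_iff_mem]

/-- The nonzero polynomials in the parameters. -/
noncomputable def paramMon (T : List (MvPolynomial (Fin n) K)) : Submonoid (MvPolynomial (Fin n) K) :=
  (supported K (params T)).toSubmonoid ⊓ nonZeroDivisors _

theorem mem_paramMon {T : List (MvPolynomial (Fin n) K)} {g : MvPolynomial (Fin n) K} :
    g ∈ paramMon T ↔ g ∈ supported K (params T) ∧ g ≠ 0 := by
  simp [paramMon, Submonoid.mem_inf]

/-- If the ideal of the first polynomials and the next initial contained no nonzero polynomial in the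
parameters, it would be contained in a prime ideal with this property, at whose generic point the
initial would vanish. -/
theorem GenReg.isRegular {T : List (MvPolynomial (Fin n) K)} (hT : IsTriangular T) (hr : GenReg T) :
    IsRegular T := by
  intro i hi
  by_contra! hc
  obtain ⟨P, hP, hle, hd⟩ := Ideal.exists_le_prime_disjoint
    (Ideal.span ({f | f ∈ T.take i} ∪ {ini T[i]})) (paramMon T) (by
      rw [Set.disjoint_left]
      intro g hg hm
      obtain ⟨h1, h2⟩ := mem_paramMon.1 hm
      exact hc g h2 h1 hg)
  obtain ⟨L, _, _, _, η, hη⟩ := exists_point P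
  have hg : Generic T η := fun g h1 h2 h3 =>
    Set.disjoint_left.1 hd ((hη g).1 h3) (mem_paramMon.2 ⟨h1, h2⟩)
  refine (hg.ini_ne_zero hT hr (T.take i) T[i] (T.drop (i + 1)) ?_ fun g hg => ?_).1 ?_
  · rw [List.getElem_cons_drop, List.take_append_drop]
  · exact (hη g).2 (hle (Ideal.subset_span (Or.inl hg)))
  · exact (hη _).2 (hle (Ideal.subset_span (Or.inr rfl)))

theorem Generic.ini_ne_zero_of_mem {L : Type u} [Field L] [Algebra K L] [IsAlgClosed L] {η : Fin n → L}
    {T : List (MvPolynomial (Fin n) K)} (hT : IsTriangular T) (hr : GenReg T) (h : Generic T η)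
    (h0 : ∀ f ∈ T, aeval η f = 0) : ∀ f ∈ T, aeval η (ini f) ≠ 0 := by
  intro f hf
  obtain ⟨T1, T2, rfl⟩ := List.append_of_mem hf
  exact (h.ini_ne_zero hT hr T1 f T2 rfl fun g hg => h0 g (by simp [hg])).1

theorem Generic.free_of_mem {T : List (MvPolynomial (Fin n) K)} {η : Fin n → A} (h : Generic T η)
    (h1 : ∀ f ∈ T, aeval η f = 0 ∧ aeval η (ini f) ≠ 0) : ∀ l ∈ params T, Free K η l :=
  fun _ hl => h.free (T1 := T) (T2 := []) (by simp) h1 hl (by simp)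

/-- At a generic zero of `T`, the parameters form a transcendence basis. -/
theorem Generic.trdeg_eq {T : List (MvPolynomial (Fin n) K)} {R : Type u} [CommRing R] [IsDomain R]
    [Algebra K R] {η : Fin n → R} (h : Generic T η)
    (h1 : ∀ f ∈ T, aeval η f = 0 ∧ aeval η (ini f) ≠ 0) (htop : Algebra.adjoin K (Set.range η) = ⊤) :
    (Algebra.trdeg K R).toNat = Nat.card (params T) := by
  have h2 : IsTranscendenceBasis K fun i : params T => η i := by
    rw [h.algebraicIndependent.isTranscendenceBasis_iff_isAlgebraic]
    refine ⟨fun x => ?_⟩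
    have h3 : Algebra.adjoin K (Set.range η) ≤ (Subalgebra.algebraicClosure
        (Algebra.adjoin K (Set.range fun i : params T => η i)) R).restrictScalars K := by
      refine Algebra.adjoin_le ?_
      rintro _ ⟨i, rfl⟩
      have := isAlgebraic_coord (S := params T) (η := η) (l := n) (fun j _ hj => by
        obtain ⟨f, hf, hfj⟩ := exists_lv_of_notMem_params hj
        exact ⟨f, hfj, h1 f hf⟩) i i.2
      have h6 : η '' {i | i ∈ params T ∧ (i : ℕ) < n} = Set.range fun i : params T => η i := by
        ext x
        simp
      rw [h6] at this
      exact this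
    exact h3 (htop ▸ Algebra.mem_top)
  have := h2.lift_cardinalMk_eq_trdeg
  rw [← Cardinal.toNat_lift.{0}, ← this, Nat.card, Cardinal.toNat_lift]

end

/-! ### Pseudo-division -/

section

variable {B : Type u} [CommRing B] {p : Polynomial B} {e : ℕ}

/-- If the coefficient of `p` of degree `e` is not a zero divisor, a nonzero multiple of `p` has degree
at least `e`. -/
theorem eq_zero_of_mul_of_degree (hp : p.natDegree ≤ e) (hc : ∀ b, p.coeff e * b = 0 → b = 0)
    {z : Polynomial B} (hz : ∀ i, e ≤ i → (p * z).coeff i = 0) : z = 0 := by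
  have h := hz (e + z.natDegree) (Nat.le_add_right _ _)
  rw [Polynomial.coeff_mul_add_eq_of_natDegree_le hp le_rfl] at h
  exact Polynomial.leadingCoeff_eq_zero.1 (hc _ h)

theorem pseudo_division (hp : p.natDegree ≤ e) (N : ℕ) : ∀ f : Polynomial B,
    (∀ i, N ≤ i → f.coeff i = 0) → ∃ (k : ℕ) (q r : Polynomial B),
      Polynomial.C (p.coeff e) ^ k * f = q * p + r ∧ ∀ i, e ≤ i → r.coeff i = 0 := by
  induction N with
  | zero => exact fun f hf => ⟨0, 0, f, by simp, fun i _ => hf i (Nat.zero_le _)⟩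
  | succ N ih =>
    intro f hf
    by_cases hN : N < e
    · exact ⟨0, 0, f, by simp, fun i hi => hf i (by omega)⟩
    push Not at hN
    obtain ⟨k, q, r, h1, h2⟩ := ih (Polynomial.C (p.coeff e) * f -
        Polynomial.C (f.coeff N) * Polynomial.X ^ (N - e) * p) (by
      intro i hi
      rw [Polynomial.coeff_sub, Polynomial.coeff_C_mul, mul_assoc, Polynomial.coeff_C_mul, mul_comm _ p,
        Polynomial.coeff_mul_X_pow', if_pos (by omega)]
      rcases hi.eq_or_lt with rfl | hi
      · rw [Nat.sub_sub_self hN, mul_comm, sub_self]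
      · rw [hf i (by omega), mul_zero,
          Polynomial.coeff_eq_zero_of_natDegree_lt (p := p) (n := i - (N - e)) (by omega), mul_zero,
          sub_zero])
    refine ⟨k + 1, q + Polynomial.C (p.coeff e) ^ k * (Polynomial.C (f.coeff N) * Polynomial.X ^ (N - e)),
      r, ?_, h2⟩
    rw [mul_sub] at h1
    rw [add_mul, add_right_comm, ← h1]
    ring

/-- A multiple of `f` by a regular constant is divisible by `p` only if a multiple of `f` by a power of the
leading coefficient of `p` is. -/
theorem exists_dvd_of_regular_mul (hp : p.natDegree ≤ e) (hc : ∀ b, p.coeff e * b = 0 → b = 0) {s : B}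
    (hs : ∀ b, s * b = 0 → b = 0) {f a : Polynomial B} (h : Polynomial.C s * f = a * p) :
    ∃ (k : ℕ) (q : Polynomial B), Polynomial.C (p.coeff e) ^ k * f = q * p := by
  obtain ⟨k, q, r, h1, h2⟩ := pseudo_division hp (f.natDegree + 1) f
    fun i hi => Polynomial.coeff_eq_zero_of_natDegree_lt hi
  have h3 : p * (Polynomial.C (p.coeff e) ^ k * a - Polynomial.C s * q) = Polynomial.C s * r := by
    have : r = Polynomial.C (p.coeff e) ^ k * f - q * p := by rw [h1]; ring
    rw [this]
    linear_combination (-Polynomial.C (p.coeff e) ^ k) * h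
  have h4 := eq_zero_of_mul_of_degree hp hc (z := Polynomial.C (p.coeff e) ^ k * a - Polynomial.C s * q)
    (by intro i hi; rw [h3, Polynomial.coeff_C_mul, h2 i hi, mul_zero])
  have h5 : r = 0 := by
    rw [h4, mul_zero] at h3
    ext i
    refine hs _ ?_
    rw [← Polynomial.coeff_C_mul, ← h3, Polynomial.coeff_zero]
  exact ⟨k, q, by rw [h1, h5, add_zero]⟩

end

/-! ### Saturation ideals of regular sets -/

section

variable {K : Type u} [Field K] {n : ℕ}

theorem span_le_sat (T : List (MvPolynomial (Fin n) K)) : Ideal.span {g | g ∈ T} ≤ sat T :=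
  fun _ h => ⟨1, Nat.one_pos, Ideal.mul_mem_left _ _ h⟩

theorem mem_sat_of_iniProd {T : List (MvPolynomial (Fin n) K)} {f : MvPolynomial (Fin n) K} {m : ℕ}
    (h : iniProd T ^ m * f ∈ sat T) : f ∈ sat T := by
  obtain ⟨d, hd, h⟩ := h
  refine ⟨d + m, by omega, ?_⟩
  rwa [pow_add, mul_assoc]

theorem iniProd_snoc (T : List (MvPolynomial (Fin n) K)) (F : MvPolynomial (Fin n) K) :
    iniProd (T ++ [F]) = iniProd T * ini F := by simp [iniProd]

theorem sat_le_snoc (T : List (MvPolynomial (Fin n) K)) (F : MvPolynomial (Fin n) K) :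
    sat T ≤ sat (T ++ [F]) := by
  rintro f ⟨d, hd, h⟩
  refine ⟨d, hd, ?_⟩
  rw [iniProd_snoc, mul_pow, mul_comm (iniProd T ^ d), mul_assoc]
  exact Ideal.mul_mem_left _ _ (Ideal.span_mono (fun x hx => by simp_all) h)

/-- The coefficients of an element of the ideal generated by polynomials without the variable `v`
belong to the ideal. -/
theorem coeffIn_mem_span {S : Set (MvPolynomial (Fin n) K)} {v : Fin n} (hS : ∀ g ∈ S, v ∉ g.vars)
    {f : MvPolynomial (Fin n) K} (hf : f ∈ Ideal.span S) (i : ℕ) : coeffIn v i f ∈ Ideal.span S := by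
  rw [← coeff_sepVar]
  induction hf using Submodule.span_induction generalizing i with
  | mem x hx =>
    rw [sepVar_of_notMem (hS x hx), Polynomial.coeff_C]
    split_ifs
    · exact Ideal.subset_span hx
    · exact Ideal.zero_mem _
  | zero => simp
  | add x y _ _ hx hy =>
    rw [map_add, Polynomial.coeff_add]
    exact Ideal.add_mem _ (hx i) (hy i)
  | smul a x _ hx =>
    rw [smul_eq_mul, map_mul, Polynomial.coeff_mul]
    exact Ideal.sum_mem _ fun c _ => Ideal.mul_mem_left _ _ (hx _)

theorem notMem_vars_ini {f : MvPolynomial (Fin n) K} {w v : Fin n} (h : lv f = w) (hw : w ≤ v) :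
    v ∉ (ini f).vars := by
  intro hv
  obtain ⟨h1, h2⟩ := sepVar_lv h
  rw [h2] at hv
  exact absurd (h1 _ v hv) (not_lt.2 hw)

theorem notMem_vars_iniProd {T : List (MvPolynomial (Fin n) K)} {v : Fin n}
    (h : ∀ f ∈ T, lv f ≠ ⊥ ∧ lv f < v) : v ∉ (iniProd T).vars := by
  classical
  induction T with
  | nil => simp [iniProd]
  | cons f T ih =>
    intro hv
    rw [iniProd, List.map_cons, List.prod_cons] at hv
    rcases Finset.mem_union.1 (vars_mul _ _ hv) with hv | hv
    · obtain ⟨h1, h2⟩ := h f (by simp)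
      obtain ⟨w, hw⟩ := WithBot.ne_bot_iff_exists.1 h1
      rw [← hw, WithBot.coe_lt_coe] at h2
      exact notMem_vars_ini hw.symm h2.le hv
    · exact ih (fun g hg => h g (by simp [hg])) hv

theorem coeffIn_mem_sat {T : List (MvPolynomial (Fin n) K)} {v : Fin n}
    (h : ∀ f ∈ T, lv f ≠ ⊥ ∧ lv f < v) {f : MvPolynomial (Fin n) K} (hf : f ∈ sat T) (i : ℕ) :
    coeffIn v i f ∈ sat T := by
  obtain ⟨d, hd, hf⟩ := hf
  refine ⟨d, hd, ?_⟩
  have := coeffIn_mem_span (v := v) (fun g hg hv => (lv_lt_iff.1 (h g hg).2 v hv).false) hf i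
  rwa [← coeff_sepVar, map_mul, map_pow, sepVar_of_notMem (notMem_vars_iniProd h), ← Polynomial.C_pow,
    Polynomial.coeff_C_mul, coeff_sepVar] at this

theorem IsRegular.prefix {T : List (MvPolynomial (Fin n) K)} {F : MvPolynomial (Fin n) K}
    (h : IsRegular (T ++ [F])) : IsRegular T ∧ ∃ g ≠ 0, g ∈ supported K (params (T ++ [F])) ∧
      g ∈ Ideal.span ({f | f ∈ T} ∪ {ini F}) := by
  refine ⟨fun i hi => ?_, ?_⟩
  · obtain ⟨g, h1, h2, h3⟩ := h i (by simp; omega)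
    have hp : params (T ++ [F]) ⊆ params T := fun x hx f hf => hx f (by simp [hf])
    refine ⟨g, h1, supported_mono hp h2, ?_⟩
    rwa [List.take_append_of_le_length hi.le, List.getElem_append_left hi] at h3
  · obtain ⟨g, h1, h2, h3⟩ := h T.length (by simp)
    refine ⟨g, h1, h2, ?_⟩
    simpa using h3

/-- Nonzero polynomials in the parameters are not zero divisors modulo the saturation ideal of a
regular triangular set. -/
theorem mem_sat_of_param_mul (T : List (MvPolynomial (Fin n) K)) : IsTriangular T → IsRegular T →
    ∀ g ≠ 0, g ∈ supported K (params T) → ∀ f, g * f ∈ sat T → f ∈ sat T := by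
  induction T using List.reverseRecOn with
  | nil =>
    rintro - - g hg - f ⟨d, -, h⟩
    refine ⟨1, Nat.one_pos, ?_⟩
    simpa [iniProd, hg] using h
  | append_singleton T F ih =>
    intro hT hr g hg hgs f hf
    obtain ⟨hr', g', hg', hgs', hgi⟩ := hr.prefix
    have hT' : IsTriangular T := ⟨fun f hf => hT.1 f (by simp [hf]), (List.pairwise_append.1 hT.2).1⟩
    have ih := ih hT' hr'
    have hp : params (T ++ [F]) ⊆ params T := fun x hx f hf => hx f (by simp [hf])
    obtain ⟨v, hv⟩ := WithBot.ne_bot_iff_exists.1 (hT.1 F (by simp))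
    have hlt : ∀ f ∈ T, lv f ≠ ⊥ ∧ lv f < v := fun f hf =>
      ⟨hT'.1 f hf, by rw [hv]; exact (List.pairwise_append.1 hT.2).2.2 f hf F (by simp)⟩
    -- The initial of `F` is regular modulo the saturation ideal of `T`, because the ideal of `T` and
    -- `ini F` contains the nonzero polynomial `g'` in the parameters, which is regular by induction.
    have hreg : ∀ b, ini F * b ∈ sat T → b ∈ sat T := by
      intro b hb
      refine ih g' hg' (supported_mono hp hgs') b ?_
      rw [Ideal.span_union, Submodule.mem_sup] at hgi
      obtain ⟨t, ht, y, hy, rfl⟩ := hgi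
      obtain ⟨a, rfl⟩ := Ideal.mem_span_singleton'.1 hy
      rw [add_mul, mul_assoc]
      exact Ideal.add_mem _ (Ideal.mul_mem_right _ _ (span_le_sat T ht)) (Ideal.mul_mem_left _ _ hb)
    obtain ⟨d, hd, hf⟩ := hf
    rw [show {x | x ∈ T ++ [F]} = {x | x ∈ T} ∪ {F} by ext; simp [or_comm], Ideal.span_union,
      Submodule.mem_sup] at hf
    obtain ⟨t, ht, y, hy, hty⟩ := hf
    obtain ⟨a, rfl⟩ := Ideal.mem_span_singleton'.1 hy
    -- `φ` reads polynomials as polynomials in `v`, with coefficients modulo the saturation ideal of `T`.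
    let φ := (Polynomial.mapRingHom (Ideal.Quotient.mk (sat T))).comp (sepVar (K := K) v).toRingHom
    have hφ : ∀ x ∈ sat T, φ x = 0 := by
      intro x hx
      ext i
      simp only [φ, RingHom.comp_apply, Polynomial.coe_mapRingHom, Polynomial.coeff_map,
        Polynomial.coeff_zero]
      rw [Ideal.Quotient.eq_zero_iff_mem]
      refine (coeff_sepVar v i x).symm ▸ coeffIn_mem_sat hlt hx i
    have hφC : ∀ x : MvPolynomial (Fin n) K, v ∉ x.vars → φ x = Polynomial.C (Ideal.Quotient.mk (sat T) x) := by
      intro x hx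
      have := sepVar_of_notMem hx
      simp [φ, this]
    obtain ⟨hF, hini⟩ := sepVar_lv hv.symm
    have hvF : v ∉ (ini F).vars := notMem_vars_ini hv.symm le_rfl
    have hvg : v ∉ g.vars := fun h => by
      have := mem_supported.1 hgs h
      exact this F (by simp) hv.symm
    have hp1 : (φ F).natDegree ≤ F.degreeOf v := by
      refine Polynomial.natDegree_map_le.trans ?_
      exact (natDegree_sepVar v F).le
    have hp2 : (φ F).coeff (F.degreeOf v) = Ideal.Quotient.mk (sat T) (ini F) := by
      rw [hini, ← coeff_sepVar]
      exact Polynomial.coeff_map _ _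
    have hregpow : ∀ m b, ini F ^ m * b ∈ sat T → b ∈ sat T := by
      intro m
      induction m with
      | zero => intro b hb; simpa using hb
      | succ m ihm =>
        intro b hb
        rw [pow_succ, mul_assoc] at hb
        exact hreg b (ihm _ hb)
    -- Hence `φ F` divides a multiple of `φ f` by a power of its leading coefficient.
    obtain ⟨k, q, hq⟩ := exists_dvd_of_regular_mul (p := φ F) (f := φ f) (a := φ a)
      (s := Ideal.Quotient.mk (sat T) (iniProd T ^ d * (ini F ^ d * g))) hp1 (by
        intro b hb
        obtain ⟨b, rfl⟩ := Ideal.Quotient.mk_surjective b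
        rw [hp2, ← map_mul, Ideal.Quotient.eq_zero_iff_mem] at hb
        exact Ideal.Quotient.eq_zero_iff_mem.2 (hreg b hb)) (by
        intro b hb
        obtain ⟨b, rfl⟩ := Ideal.Quotient.mk_surjective b
        rw [← map_mul, Ideal.Quotient.eq_zero_iff_mem, mul_assoc, mul_assoc] at hb
        exact Ideal.Quotient.eq_zero_iff_mem.2 (ih g hg (supported_mono hp hgs) b
          (hregpow d _ (mem_sat_of_iniProd hb)))) (by
        have h1 := congrArg φ hty
        rw [map_add, hφ t (span_le_sat T ht), zero_add, map_mul, iniProd_snoc, map_mul, map_pow, map_mul,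
          map_mul, hφC _ (notMem_vars_iniProd hlt), hφC _ hvF, hφC _ hvg] at h1
        rw [h1]
        simp only [map_mul, map_pow]
        ring)
    -- Lift the quotient to polynomials and substitute the variable back.
    obtain ⟨q, rfl⟩ := Polynomial.map_surjective _ Ideal.Quotient.mk_surjective q
    have hz : ∀ i, (Polynomial.C (ini F) ^ k * sepVar v f - q * sepVar v F).coeff i ∈ sat T := by
      intro i
      rw [← Ideal.Quotient.eq_zero_iff_mem, ← Polynomial.coeff_map]
      rw [hp2, ← Polynomial.map_C, ← sub_eq_zero] at hq
      have := congrArg (fun p => p.coeff i) hq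
      simpa [φ] using this
    have hz2 : ini F ^ k * f - q.eval (X v) * F ∈ sat T := by
      have : (Polynomial.C (ini F) ^ k * sepVar v f - q * sepVar v F).eval (X v) =
          ini F ^ k * f - q.eval (X v) * F := by
        simp [eval_sepVar]
      rw [← this, Polynomial.eval_eq_sum_range]
      exact Ideal.sum_mem _ fun i _ => Ideal.mul_mem_right _ _ (hz i)
    refine mem_sat_of_iniProd (m := k) ?_
    rw [iniProd_snoc, mul_pow, mul_assoc, ← sub_add_cancel (ini F ^ k * f) (q.eval (X v) * F)]
    refine Ideal.mul_mem_left _ _ (Ideal.add_mem _ (sat_le_snoc T F hz2) (Ideal.mul_mem_left _ _ ?_))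
    exact span_le_sat _ (Ideal.subset_span (by simp))

theorem mem_sat_of_mem {T : List (MvPolynomial (Fin n) K)} {f : MvPolynomial (Fin n) K} (hf : f ∈ T) :
    f ∈ sat T := span_le_sat T (Ideal.subset_span hf)

/-- A prime ideal over the saturation ideal without nonzero polynomials in the parameters has a
generic point at which `T` vanishes and the initials do not. -/
theorem exists_generic_point {T : List (MvPolynomial (Fin n) K)} (hT : IsTriangular T) (hr : GenReg T)
    {P : Ideal (MvPolynomial (Fin n) K)} [P.IsPrime] (hP : sat T ≤ P)
    (hd : ∀ g ≠ 0, g ∈ supported K (params T) → g ∉ P) :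
    ∃ (L : Type u) (_ : Field L) (_ : Algebra K L) (_ : IsAlgClosed L) (η : Fin n → L),
      (∀ f, aeval η f = 0 ↔ f ∈ P) ∧ (∀ f ∈ T, aeval η f = 0 ∧ aeval η (ini f) ≠ 0) ∧
      ∀ l ∈ params T, Free K η l := by
  obtain ⟨L, _, _, _, η, hη⟩ := exists_point P
  have hg : Generic T η := fun g h1 h2 h3 => hd g h2 h1 ((hη g).1 h3)
  have h0 : ∀ f ∈ T, aeval η f = 0 := fun f hf => (hη f).2 (hP (mem_sat_of_mem hf))
  have h1 : ∀ f ∈ T, aeval η f = 0 ∧ aeval η (ini f) ≠ 0 := fun f hf =>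
    ⟨h0 f hf, hg.ini_ne_zero_of_mem hT hr h0 f hf⟩
  exact ⟨L, _, _, inferInstance, η, hη, h1, hg.free_of_mem h1⟩

/-- A polynomial that vanishes at the zeros of `T` with free parameters vanishes at all zeros of
the saturation ideal. -/
theorem exists_pow_mem_sat {T : List (MvPolynomial (Fin n) K)} (hT : IsTriangular T) (hr : GenReg T)
    {h : MvPolynomial (Fin n) K}
    (hh : ∀ (L : Type u) [Field L] [Algebra K L] [IsAlgClosed L] (η : Fin n → L),
      (∀ f ∈ T, aeval η f = 0) → (∀ l ∈ params T, Free K η l) → aeval η h = 0) :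
    ∃ m, h ^ m ∈ sat T := by
  by_contra! hc
  -- Products of powers of `h` and polynomials in the parameters avoid the saturation ideal, so some
  -- prime ideal over it avoids both.
  obtain ⟨P, hP, hle, hd⟩ := Ideal.exists_le_prime_disjoint (sat T) (Submonoid.powers h ⊔ paramMon T) (by
    rw [Set.disjoint_left]
    intro x hx hm
    obtain ⟨y, ⟨m, rfl⟩, g, hg, rfl⟩ := Submonoid.mem_sup.1 hm
    obtain ⟨h1, h2⟩ := mem_paramMon.1 hg
    exact hc m (mem_sat_of_param_mul T hT (hr.isRegular hT) g h2 h1 _ (by rwa [mul_comm])))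
  rw [Set.disjoint_left] at hd
  obtain ⟨L, _, _, _, η, h1, h2, h3⟩ := exists_generic_point hT hr hle fun g h1 h2 h3 =>
    hd h3 ((le_sup_right : paramMon T ≤ _) (mem_paramMon.2 ⟨h2, h1⟩))
  refine hd ((h1 h).1 (hh L η (fun f hf => (h2 f hf).1) h3)) ?_
  exact (le_sup_left : Submonoid.powers h ≤ _) (Submonoid.mem_powers h)

/-- Zeros of `T` at which the initials do not vanish are zeros of the saturation ideal. -/
theorem mem_zeroSet_sat {T : List (MvPolynomial (Fin n) K)} {E : Type v} [Field E] [Algebra K E]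
    {η : Fin n → E} (h : ∀ f ∈ T, aeval η f = 0 ∧ aeval η (ini f) ≠ 0) :
    η ∈ zeroSet E (sat T : Set (MvPolynomial (Fin n) K)) := by
  rintro f ⟨d, -, hf⟩
  have h1 : Ideal.span {g | g ∈ T} ≤ RingHom.ker (aeval η : _ →ₐ[K] E) :=
    Ideal.span_le.2 fun g hg => (h g hg).1
  have h2 := h1 hf
  rw [RingHom.mem_ker, map_mul, map_pow] at h2
  refine (mul_eq_zero.1 h2).resolve_left (pow_ne_zero _ ?_)
  rw [iniProd, map_list_prod, List.map_map]
  refine List.prod_ne_zero ?_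
  intro h0
  obtain ⟨f, hf, h0⟩ := List.mem_map.1 h0
  exact (h f hf).2 h0

/-- An associated prime contains no nonzero polynomial in the parameters, because these are not zero
divisors. So its generic point is a generic zero of `T`, and its dimension is the number of parameters. -/
theorem GenReg.isUnmixed {T : List (MvPolynomial (Fin n) K)} (hT : IsTriangular T) (hr : GenReg T) :
    IsUnmixed (sat T) := by
  have key : ∀ P ∈ associatedPrimes (MvPolynomial (Fin n) K) (MvPolynomial (Fin n) K ⧸ sat T),
      ringKrullDim (MvPolynomial (Fin n) K ⧸ P) = (Nat.card (params T) : WithBot ℕ∞) := by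
    intro P hP
    obtain ⟨hp, x, hx⟩ := Submodule.isAssociatedPrime_iff.1 hP
    obtain ⟨x, rfl⟩ := Ideal.Quotient.mk_surjective x
    have hmem : ∀ g, g ∈ P ↔ g * x ∈ sat T := by
      intro g
      rw [hx, Submodule.mem_colon_singleton, Submodule.mem_bot, ← Ideal.Quotient.eq_zero_iff_mem, map_mul]
      rfl
    have hx1 : x ∉ sat T := fun h => hp.ne_top ((Ideal.eq_top_iff_one _).2 ((hmem 1).2 (by rwa [one_mul])))
    obtain ⟨L, _, _, _, η, h1, h2, h3⟩ := exists_generic_point hT hr (P := P)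
      (fun g hg => (hmem g).2 (Ideal.mul_mem_right _ _ hg))
      (fun g h1 h2 h3 => hx1 (mem_sat_of_param_mul T hT (hr.isRegular hT) g h1 h2 x ((hmem g).1 h3)))
    have hae : ∀ f, aeval (fun i => Ideal.Quotient.mk P (X i)) f = Ideal.Quotient.mk P f := by
      intro f
      have : (aeval fun i => Ideal.Quotient.mk P (X i)) = Ideal.Quotient.mkₐ K P := by
        ext i
        simp
      exact DFunLike.congr_fun this f
    rw [ringKrullDim_eq_trdeg K, Generic.trdeg_eq (T := T) (η := fun i => Ideal.Quotient.mk P (X i))]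
    · intro g hg h0 h
      rw [hae, Ideal.Quotient.eq_zero_iff_mem] at h
      exact hx1 (mem_sat_of_param_mul T hT (hr.isRegular hT) g h0 hg x ((hmem g).1 h))
    · intro f hf
      simp only [hae, ne_eq, Ideal.Quotient.eq_zero_iff_mem, ← h1]
      exact h2 f hf
    · have h4 : (Algebra.adjoin K (Set.range X)).map (Ideal.Quotient.mkₐ K P) = ⊤ := by
        rw [adjoin_range_X, Algebra.map_top, AlgHom.range_eq_top]
        exact Ideal.Quotient.mkₐ_surjective K P
      rw [AlgHom.map_adjoin, ← Set.range_comp] at h4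
      exact h4
  intro P hP Q hQ
  rw [key P hP, key Q hQ]

end

/-! ### Encodings of polynomials -/

section

variable {K : Type u} [Field K] {n : ℕ}

theorem enc_term (t : Term K) (h : t.1.length = n) :
    (enc t : Data K) = encodeTerm (expo n t.1, t.2) := by
  have h1 : (List.ofFn fun i => (Data.ofNat (expo n t.1 i) : Data K)) = t.1.map Data.ofNat := by
    conv_rhs => rw [← ofFn_expo h, List.map_ofFn]
    rfl
  rw [encodeTerm, encodeMonomial, h1]
  rfl

theorem isPoly_toMv {E : ℕ} {p : Poly K} (h : RB n E p) : IsPoly (toMv n p) (enc p : Data K) := by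
  have hl := h.1.len
  refine ⟨p.map fun t => (expo n t.1, t.2), ?_, ?_, ?_, ?_⟩
  · rw [List.map_map]
    have : (Prod.fst ∘ fun t : Term K => (expo n t.1, t.2)) = expo n ∘ Prod.fst := rfl
    rw [this, ← List.map_map]
    refine List.Nodup.map_on ?_ h.2.1
    intro x hx y hy hxy
    obtain ⟨x, hx', rfl⟩ := List.mem_map.1 hx
    obtain ⟨y, hy', rfl⟩ := List.mem_map.1 hy
    exact expo_inj (hl x hx') (hl y hy') hxy
  · intro t ht
    obtain ⟨t, ht', rfl⟩ := List.mem_map.1 ht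
    exact h.2.2 t ht'
  · rw [toMv_eq_sum hl, List.map_map]; rfl
  · rw [List.map_map]
    refine congrArg Data.ofList (List.map_congr_left fun t ht => ?_)
    exact enc_term t (hl t ht)

theorem expo_ofFn (m : Fin n →₀ ℕ) : expo n (List.ofFn m) = m := by
  ext i
  simp [expo]

/-- Every encoding of a polynomial as a list of its nonzero terms is the encoding of a reduced list of
terms. -/
theorem IsPoly.exists_poly {E : ℕ} {f : MvPolynomial (Fin n) K} {y : Data K} (h : IsPoly f y)
    (hf : f.totalDegree ≤ E) : ∃ p : Poly K, RB n E p ∧ toMv n p = f ∧ enc p = y := by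
  obtain ⟨l, h1, h2, h3, rfl⟩ := h
  have hlen : Len n (l.map fun t => ((List.ofFn t.1, t.2) : Term K)) := by
    intro t ht
    obtain ⟨t, -, rfl⟩ := List.mem_map.1 ht
    simp
  have hnd : ((l.map fun t => ((List.ofFn t.1, t.2) : Term K)).map Prod.fst).Nodup := by
    rw [List.map_map]
    have : (Prod.fst ∘ fun t : (Fin n →₀ ℕ) × K => ((List.ofFn t.1, t.2) : Term K)) =
      (fun m : Fin n →₀ ℕ => List.ofFn m) ∘ Prod.fst := rfl
    rw [this, ← List.map_map]
    refine h1.map fun x y hxy => ?_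
    rw [← expo_ofFn x, ← expo_ofFn y]
    exact congrArg _ hxy
  have hmv : toMv n (l.map fun t => ((List.ofFn t.1, t.2) : Term K)) = f := by
    rw [toMv_eq_sum hlen, List.map_map, ← h3]
    congr 1
    refine List.map_congr_left fun t _ => ?_
    simp [expo_ofFn]
  have hE : ∀ t ∈ l, ∀ i, t.1 i ≤ E := by
    intro t ht i
    have hc := coeff_toMv hlen hnd (List.mem_map.2 ⟨t, ht, rfl⟩)
    rw [hmv] at hc
    simp only [expo_ofFn] at hc
    have hm : t.1 ∈ f.support := mem_support_iff.2 (hc ▸ h2 t ht)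
    refine le_trans ?_ ((le_totalDegree hm).trans hf)
    rw [Finsupp.sum_fintype _ _ (by simp)]
    exact Finset.single_le_sum (f := fun i => t.1 i) (fun _ _ => Nat.zero_le _) (Finset.mem_univ i)
  refine ⟨_, ⟨?_, hnd, ?_⟩, hmv, ?_⟩
  · intro t ht
    refine ⟨hlen t ht, ?_⟩
    obtain ⟨t, ht', rfl⟩ := List.mem_map.1 ht
    have hall : ∀ e ∈ List.ofFn t.1, e ≤ E := by
      intro e he
      obtain ⟨i, rfl⟩ := List.mem_ofFn.1 he
      exact hE t ht' i
    refine ⟨?_, fun e he => hall e (List.mem_of_mem_tail he)⟩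
    dsimp only
    cases hc : List.ofFn t.1 with
    | nil => simp
    | cons a l => exact hall a (by simp [hc])
  · intro t ht
    obtain ⟨t, ht', rfl⟩ := List.mem_map.1 ht
    exact h2 t ht'
  · refine congrArg Data.ofList ?_
    rw [List.map_map]
    refine List.map_congr_left fun t ht => ?_
    rw [Function.comp_apply, enc_term (n := n) _ (by simp)]
    simp [expo_ofFn]

theorem exists_polys {E : ℕ} {L : List (MvPolynomial (Fin n) K)} {ys : List (Data K)}
    (h : List.Forall₂ IsPoly L ys) (hL : ∀ f ∈ L, f.totalDegree ≤ E) :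
    ∃ H : List (Poly K), (∀ p ∈ H, RB n E p) ∧ H.map (toMv n) = L ∧ H.map enc = ys := by
  induction h with
  | nil => exact ⟨[], by simp⟩
  | cons h _ ih =>
    obtain ⟨H, h1, h2, h3⟩ := ih fun f hf => hL f (by simp [hf])
    obtain ⟨p, h4, h5, h6⟩ := h.exists_poly (hL _ (by simp))
    refine ⟨p :: H, ?_, by simp [h2, h5], by simp [h3, h6]⟩
    intro q hq
    rcases List.mem_cons.1 hq with rfl | hq
    · exact h4
    · exact h1 q hq

theorem isListOf_map {α : Type u} {β : Type w} {R : α → Data K → Prop} {f : β → α} {g : β → Data K}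
    {l : List β} (h : ∀ b ∈ l, R (f b) (g b)) : IsListOf R (l.map f) (Data.ofList (l.map g)) :=
  ⟨l.map g, by rw [List.forall₂_map_left_iff, List.forall₂_map_right_iff, List.forall₂_same]; exact h, rfl⟩

theorem totalDegree_toMv {E : ℕ} {p : Poly K} (h : RB n E p) : (toMv n p).totalDegree ≤ n * E := by
  rw [toMv_eq_sum h.1.len]
  have key : ∀ t ∈ p, ∀ i, expo n t.1 i ≤ E := by
    intro t ht i
    obtain ⟨h1, h2, h3⟩ := h.1 t ht
    have hi : expo n t.1 i ∈ t.1 := by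
      have := (List.mem_ofFn (f := fun i => expo n t.1 i)).2 ⟨i, rfl⟩
      rwa [ofFn_expo h1] at this
    cases hc : t.1 with
    | nil => rw [hc] at hi; simp at hi
    | cons a l =>
      rw [hc] at h2 h3 hi
      rcases List.mem_cons.1 hi with hi | hi
      · rw [hi]; exact h2
      · exact h3 _ hi
  clear h
  induction p with
  | nil => simp
  | cons t p ih =>
    rw [List.map_cons, List.sum_cons]
    refine (totalDegree_add _ _).trans (max_le ?_ (ih fun x hx => key x (by simp [hx])))
    refine (totalDegree_monomial_le _ _).trans ?_
    rw [Finsupp.sum_fintype _ _ (by simp)]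
    refine (Finset.sum_le_card_nsmul _ _ E fun i _ => key t (by simp) i).trans ?_
    simp

end

/-! ### Correctness -/

section

variable {K : Type u} [Field K] {n : ℕ}

/-- A reduced polynomial without variables is empty or consists of one term with nonzero
coefficient. -/
theorem ev_nil_eq_zero_iff {L : Type v} [Field L] [Algebra K L] {E : ℕ} {p : Poly K} (h : RB 0 E p) :
    ev ([] : List L) p = 0 ↔ p = [] := by
  refine ⟨fun h0 => ?_, fun h0 => by simp [h0]⟩
  cases p with
  | nil => rfl
  | cons t p =>
    cases p with
    | nil =>
      rw [ev_cons, mon_nil, ev_nil, mul_one, add_zero, map_eq_zero] at h0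
      exact absurd h0 (h.2.2 t (by simp))
    | cons t' p =>
      have h1 := h.2.1
      have h2 := (h.1 t (by simp)).1
      have h3 := (h.1 t' (by simp)).1
      rw [List.length_eq_zero_iff] at h2 h3
      simp [h2, h3] at h1

/-- The filter of `results` selects the systems without variables that hold. -/
theorem mem_results {L : List (Sys K)} {E : ℕ} (hL : ∀ s ∈ L, SysOK n 0 E s) {F : Type v} [Field F]
    [Algebra K F] {G : List (Poly K)} :
    G ∈ results L ↔ ∃ s ∈ L, Holds ([] : List F) s.1 s.2.1 ∧ s.2.2 = G := by
  rw [results, List.mem_map]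
  refine exists_congr fun s => ?_
  rw [List.mem_filter, and_assoc]
  refine and_congr_right fun hs => and_congr_left fun _ => ?_
  have h1 : ∀ p ∈ s.1, (ev ([] : List F) p = 0 ↔ p = []) := fun p hp => ev_nil_eq_zero_iff ((hL s hs).1 p hp)
  rw [Holds, Ne, ev_nil_eq_zero_iff (hL s hs).2.1]
  simp +contextual [h1]

variable [CharZero K] {H : List (Poly K)} {E : ℕ}

/-- When no variable is left, the conditions of a system do not depend on a point. -/
theorem genReg_triSet (hH : ∀ h ∈ H, RB n E h) {s : Sys K} (hs : s ∈ (stage n H n).2.2)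
    (hh : ∀ (F : Type u) [Field F] [Algebra K F], Holds ([] : List F) s.1 s.2.1) :
    GenReg (triSet n s) := by
  intro L _ _ _ η T1 f T2 he h1 h2
  have := stage_sound ⟨E, hH⟩ η n le_rfl s hs
  rw [Nat.sub_self] at this
  exact (this (by simpa [low] using hh L)).1 T1 f T2 he h1 fun l _ hl hp => (h2 l hl hp).gen

/-- The output consists of triangular sets whose initials do not vanish at generic points, and the
given polynomials belong to the radicals of the saturation ideals. -/
theorem results_spec (hH : ∀ h ∈ H, RB n E h) {G : List (Poly K)} (hG : G ∈ results (stage n H n).2.2) :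
    IsTriangular (G.map (toMv n)) ∧ GenReg (G.map (toMv n)) ∧
      ∀ h ∈ H, ∃ m, toMv n h ^ m ∈ sat (G.map (toMv n)) := by
  obtain ⟨-, -, ⟨E', -, hL⟩, -, -⟩ := stage_spec hH n le_rfl
  rw [Nat.sub_self] at hL
  have hG' (F : Type u) [Field F] [Algebra K F] := (mem_results hL (F := F)).1 hG
  obtain ⟨s, hs, hs', rfl⟩ := hG' K
  have hh : ∀ (F : Type u) [Field F] [Algebra K F], Holds ([] : List F) s.1 s.2.1 := by
    intro F _ _
    have h1 : ∀ p ∈ s.1, (ev ([] : List F) p = 0 ↔ p = []) := fun p hp => ev_nil_eq_zero_iff ((hL s hs).1 p hp)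
    have h2 : ∀ p ∈ s.1, (ev ([] : List K) p = 0 ↔ p = []) := fun p hp => ev_nil_eq_zero_iff ((hL s hs).1 p hp)
    rw [Holds, Ne, ev_nil_eq_zero_iff (hL s hs).2.1] at hs' ⊢
    exact ⟨fun p hp => (h1 p hp).2 ((h2 p hp).1 (hs'.1 p hp)), hs'.2⟩
  have ht := (stage_tri ⟨E, hH⟩ n le_rfl s hs).1
  have hg := genReg_triSet hH hs hh
  refine ⟨ht, hg, fun h hm => exists_pow_mem_sat ht hg fun L _ _ _ η h1 h2 => ?_⟩
  have := stage_sound ⟨E, hH⟩ η n le_rfl s hs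
  rw [Nat.sub_self] at this
  rw [aeval_toMv]
  exact (this (by simpa [low] using hh L)).2 h1 (fun l _ hp => (h2 l hp).gen) h hm

/-- Every zero of `H` is a zero of one of the triangular sets at which the initials do not vanish, by
`stage_cover`. Conversely, powers of the elements of `H` belong to the saturation ideals. -/
theorem zeroSet_results (hH : ∀ h ∈ H, RB n E h) (F : Type v) [Field F] [Algebra K F] [IsAlgClosed F] :
    zeroSet F {f | f ∈ H.map (toMv n)} = ⋃ T ∈ (results (stage n H n).2.2).map (List.map (toMv n)),
      zeroSet F (sat T : Set (MvPolynomial (Fin n) K)) := by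
  ext η
  simp only [Set.mem_iUnion, List.mem_map, exists_prop, exists_exists_and_eq_and]
  constructor
  · intro h0
    obtain ⟨s, hs, h1, h2⟩ := stage_cover ⟨E, hH⟩ η (fun h hm => by
      rw [← aeval_toMv]; exact h0 _ ⟨h, hm, rfl⟩) n le_rfl
    obtain ⟨-, -, ⟨E', -, hL⟩, -, -⟩ := stage_spec hH n le_rfl
    rw [Nat.sub_self] at hL h1
    exact ⟨s.2.2, (mem_results hL (F := F)).2 ⟨s, hs, by simpa [low] using h1, rfl⟩, mem_zeroSet_sat h2⟩
  · rintro ⟨G, hG, hη⟩ f hf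
    obtain ⟨h, hm, rfl⟩ := hf
    obtain ⟨m, hm⟩ := (results_spec hH hG).2.2 h hm
    have := hη _ hm
    rw [map_pow] at this
    exact IsReduced.eq_zero _ ⟨m, this⟩

end

/-! ### Bounds -/

section

variable {K : Type u} [Field K] {n : ℕ}

/-- The constant of the double exponential bounds. The factor `3` absorbs the linear factor `n + 3` of
the size bound and the passage from exponents to total degrees. -/
def boundBase.{a} : ℕ := 3 * stepBase.{a}

/-- The size of the final state is within the bound for the number of triangular sets. -/
theorem main_bound {n d : ℕ} (hn : 1 ≤ n) (hd : 2 ≤ d) :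
    ((d - 1 + 2) ^ (n + 3)) ^ stepBase.{u} ^ n ≤ d ^ (n * boundBase.{u} ^ (n + 2)) := by
  have h1 : d - 1 + 2 ≤ d ^ 2 := by nlinarith [Nat.sub_add_cancel (show 1 ≤ d by omega)]
  rw [← pow_mul]
  refine (Nat.pow_le_pow_left h1 _).trans ?_
  rw [← pow_mul]
  refine Nat.pow_le_pow_right (by omega) ?_
  have h2 : stepBase.{u} ^ n ≤ boundBase.{u} ^ n := Nat.pow_le_pow_left (by simp [boundBase]; omega) _
  have h3 : 8 ≤ boundBase.{u} ^ 2 := by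
    have : 3 ≤ boundBase.{u} := by simp [boundBase, stepBase]
    nlinarith
  calc 2 * ((n + 3) * stepBase.{u} ^ n) ≤ 2 * ((n + 3) * boundBase.{u} ^ n) := by gcongr
    _ ≤ n * (boundBase.{u} ^ n * 8) := by nlinarith [Nat.zero_le (boundBase.{u} ^ n)]
    _ ≤ n * (boundBase.{u} ^ n * boundBase.{u} ^ 2) := by gcongr
    _ = _ := by rw [pow_add]

theorem degree_bound {n d E : ℕ} (hn : 1 ≤ n) (hd : 2 ≤ d)
    (hE : E + 2 ≤ (d - 1 + 2) ^ stepBase.{u} ^ n) : n * E < d ^ boundBase.{u} ^ n := by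
  have h1 : d - 1 + 2 ≤ d ^ 2 := by nlinarith [Nat.sub_add_cancel (show 1 ≤ d by omega)]
  have h2 : n < d ^ n := Nat.lt_pow_self (by omega)
  have h3 : E < d ^ (2 * stepBase.{u} ^ n) := by
    rw [pow_mul]
    exact lt_of_lt_of_le (by omega) (hE.trans (Nat.pow_le_pow_left h1 _))
  calc n * E < d ^ n * d ^ (2 * stepBase.{u} ^ n) := Nat.mul_lt_mul'' h2 h3
    _ = d ^ (n + 2 * stepBase.{u} ^ n) := by rw [pow_add]
    _ ≤ _ := by
      refine Nat.pow_le_pow_right (by omega) ?_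
      have h4 : n < stepBase.{u} ^ n := Nat.lt_pow_self (by simp [stepBase])
      have h5 : 3 ≤ 3 ^ n := Nat.le_self_pow (by omega) 3
      rw [boundBase, mul_pow]
      nlinarith

/-- The program. For `d = 1` all polynomials are constants and the time may only depend on `k`, not
on `n`, hence a test for zero has to do in this case. -/
def program.{a} : Code :=
  Code.branch (Code.comp Code.right (Code.comp Code.left Code.right)) mainI.{a}.1.code easyI.{a}.1.code

/-- The running time of the program in terms of `k ^ n` and `d ^ (n * c ^ (n + 2))`. -/
noncomputable def timeBound.{a} : MvPolynomial (Fin 2) ℕ :=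
  (X 0 + X 1 + 2) ^ (mainI.{a}.1.e + 1) + (X 0 + X 1 + 2) ^ (easyI.{a}.1.e + 1) + 6

theorem eval_timeBound (a b : ℕ) : MvPolynomial.eval ![a, b] timeBound.{u} =
    (a + b + 2) ^ (mainI.{u}.1.e + 1) + (a + b + 2) ^ (easyI.{u}.1.e + 1) + 6 := by
  simp [timeBound]

theorem eval_test (x y : Data K) (d : ℕ) :
    Eval (Code.comp Code.right (Code.comp Code.left Code.right))
      (Data.node x (Data.node (Data.ofNat d) y)) (Data.ofNat (d - 1)) 5 := by
  have h : (Data.ofNat (d - 1) : Data K) = (Data.ofNat d).right := by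
    cases d with
    | zero => rfl
    | succ d => rfl
  rw [h]
  exact Eval.comp (Eval.comp (Eval.right _) (Eval.left _)) (Eval.right _)

theorem ofList_eq_nil {l : List (Data K)} (h : Data.ofList l = Data.nil) : l = [] := by
  cases l with
  | nil => rfl
  | cons x l => simp [Data.ofList] at h

theorem genReg_nil : GenReg ([] : List (MvPolynomial (Fin n) K)) := by
  intro L _ _ _ η T1 f T2 h
  simp at h

theorem isTriangular_nil : IsTriangular ([] : List (MvPolynomial (Fin n) K)) := ⟨by simp, by simp⟩

theorem zeroSet_sat_nil (E : Type v) [Field E] [Algebra K E] :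
    zeroSet E (sat ([] : List (MvPolynomial (Fin n) K)) : Set (MvPolynomial (Fin n) K)) = Set.univ :=
  Set.eq_univ_of_forall fun _ => mem_zeroSet_sat (by simp)

/-- The case of constants. -/
theorem easy_spec {h : List (MvPolynomial (Fin n) K)} {ys : List (Data K)} (hy : List.Forall₂ IsPoly h ys)
    (hd : ∀ f ∈ h, f.totalDegree = 0) {A : List (List (Poly K))}
    (hA : A = if ys.all fun y => isNilD y then [([] : List (Poly K))] else []) :
    (∀ G ∈ A, G = []) ∧ A.length ≤ 1 ∧ ∀ (E : Type v) [Field E] [Algebra K E],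
      zeroSet E {f | f ∈ h} = ⋃ T ∈ A.map (List.map (toMv n)),
        zeroSet E (sat T : Set (MvPolynomial (Fin n) K)) := by
  obtain ⟨H, h1, h2, h3⟩ := exists_polys (E := 0) hy fun f hf => (hd f hf).le
  have hnil : ∀ p : Poly K, isNilD (enc p : Data K) = true ↔ p = [] := by
    intro p
    cases p with
    | nil => exact ⟨fun _ => rfl, fun _ => rfl⟩
    | cons t p => simp [isNilD, enc, Data.ofList]
  have hall : (ys.all fun y => isNilD y) = true ↔ ∀ p ∈ H, p = [] := by
    simp [← h3, hnil]
  by_cases hc : (ys.all fun y => isNilD y) = true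
  · rw [if_pos hc] at hA
    subst hA
    refine ⟨by simp, by simp, fun E _ _ => ?_⟩
    have : ∀ f ∈ h, f = 0 := by
      rw [← h2]
      intro f hf
      obtain ⟨p, hp, rfl⟩ := List.mem_map.1 hf
      rw [hall.1 hc p hp]
      rfl
    simp only [List.map_cons, List.map_nil, List.mem_singleton, Set.iUnion_iUnion_eq_left, zeroSet_sat_nil]
    exact Set.eq_univ_of_forall fun η f hf => by rw [this f hf, map_zero]
  · rw [if_neg hc] at hA
    subst hA
    refine ⟨by simp, by simp, fun E _ _ => ?_⟩
    simp only [List.map_nil, List.not_mem_nil, Set.iUnion_of_empty, Set.iUnion_empty]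
    rw [Set.eq_empty_iff_forall_notMem]
    intro η hη
    rw [hall] at hc
    push Not at hc
    obtain ⟨p, hp, hp0⟩ := hc
    have hm : toMv n p ∈ h := h2 ▸ List.mem_map.2 ⟨p, hp, rfl⟩
    have h4 := hη _ hm
    have h5 := hd _ hm
    rw [totalDegree_eq_zero_iff_eq_C] at h5
    rw [h5, aeval_C, map_eq_zero] at h4
    rw [h4, map_zero] at h5
    exact toMv_ne_zero (h1 p hp).1.len (h1 p hp).2 hp0 h5

end

end TriDec

theorem theorem1 :
    ∃ (prog : TriDec.Code) (c : ℕ) (p : MvPolynomial (Fin 2) ℕ),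
      ∀ (K : Type u) [Field K] [CharZero K] (n k d : ℕ), 1 ≤ n → 1 ≤ k →
        ∀ h : Fin k → MvPolynomial (Fin n) K, (∀ i, (h i).totalDegree < d) →
          ∀ input : TriDec.Data K, TriDec.IsInput d h input →
            ∃ (output : TriDec.Data K) (time : ℕ) (A : List (List (MvPolynomial (Fin n) K))),
              TriDec.Eval prog input output time ∧ TriDec.IsOutput A output ∧
              (∀ T ∈ A, TriDec.IsTriangular T ∧ TriDec.IsRegular T) ∧
              (∀ (E : Type v) [Field E] [Algebra K E] [IsAlgClosed E],
                TriDec.zeroSet E (Set.range h) =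
                  ⋃ T ∈ A, TriDec.zeroSet E (TriDec.sat T : Set (MvPolynomial (Fin n) K))) ∧
              (∀ T ∈ A, TriDec.IsUnmixed (TriDec.sat T)) ∧
              (∀ T ∈ A, ∀ f ∈ T, f.totalDegree < d ^ c ^ n) ∧
              A.length ≤ k ^ n * d ^ (n * c ^ (n + 2)) ∧
              time ≤ MvPolynomial.eval ![k ^ n, d ^ (n * c ^ (n + 2))] p := by
  refine ⟨TriDec.program.{u}, TriDec.boundBase.{u}, TriDec.timeBound.{u}, ?_⟩
  intro K _ _ n k d hn hk h hd input hinput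
  obtain ⟨_, ⟨ys, hys, rfl⟩, rfl⟩ := hinput
  have hd1 : 1 ≤ d := by have := hd ⟨0, by omega⟩; omega
  have hlen : ys.length = k := by rw [← hys.length_eq, List.length_ofFn]
  have hk1 : k ≤ k ^ n := Nat.le_self_pow (by omega) k
  have hrange : Set.range h = {f | f ∈ List.ofFn h} := by
    ext f; simp [List.mem_ofFn]
  have htest := TriDec.eval_test (TriDec.Data.ofNat n) (TriDec.Data.ofList ys) d
  rw [TriDec.eval_timeBound]
  simp_rw [hrange]
  rcases hd1.eq_or_lt with rfl | hd2
  -- For `d = 1` the program only tests whether the polynomials are zero.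
  · obtain ⟨-, t, ht, he⟩ := TriDec.easyI.{u}.2 K (k + 2)
      (TriDec.Data.ofNat n, TriDec.Data.ofNat 1, ys) (by omega)
      ⟨trivial, trivial, by simp only [hlen]; omega, fun _ _ => trivial⟩
    obtain ⟨h1, h2, h3⟩ := TriDec.easy_spec.{u, v} hys (fun f hf => by
      obtain ⟨i, rfl⟩ := List.mem_ofFn.1 hf
      have := hd i
      omega) rfl
    have henc : (TriDec.Dat.enc ((TriDec.Data.ofNat n, TriDec.Data.ofNat 1, ys) :
        TriDec.Data K × TriDec.Data K × List (TriDec.Data K)) : TriDec.Data K) =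
        TriDec.Data.node (TriDec.Data.ofNat n) (TriDec.Data.node (TriDec.Data.ofNat 1)
          (TriDec.Data.ofList ys)) := by
      show TriDec.Data.node _ (TriDec.Data.node _ (TriDec.Data.ofList (ys.map fun x => x))) = _
      rw [List.map_id']
      rfl
    rw [henc] at he
    refine ⟨_, 5 + t + 1, _, TriDec.Eval.branch_no htest he,
      TriDec.isListOf_map fun G hG => TriDec.isListOf_map fun p hp => ?_, ?_, fun E _ _ _ => h3 E, ?_, ?_,
      ?_, ?_⟩
    · rw [h1 G hG] at hp
      simp at hp
    · intro T hT
      obtain ⟨G, hG, rfl⟩ := List.mem_map.1 hT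
      rw [h1 G hG]
      exact ⟨TriDec.isTriangular_nil, TriDec.genReg_nil.isRegular TriDec.isTriangular_nil⟩
    · intro T hT
      obtain ⟨G, hG, rfl⟩ := List.mem_map.1 hT
      rw [h1 G hG]
      exact TriDec.genReg_nil.isUnmixed TriDec.isTriangular_nil
    · intro T hT
      obtain ⟨G, hG, rfl⟩ := List.mem_map.1 hT
      rw [h1 G hG]
      simp
    · rw [List.length_map, one_pow, mul_one]
      exact h2.trans (by omega)
    · have : (k + 2) ^ (TriDec.easyI.{u}.1.e + 1) ≤
          (k ^ n + 1 ^ (n * TriDec.boundBase.{u} ^ (n + 2)) + 2) ^ (TriDec.easyI.{u}.1.e + 1) :=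
        Nat.pow_le_pow_left (by rw [one_pow]; omega) _
      omega
  · obtain ⟨H, hH, hmv, rfl⟩ := TriDec.exists_polys (E := d - 1) hys fun f hf => by
      obtain ⟨i, rfl⟩ := List.mem_ofFn.1 hf
      have := hd i
      omega
    rw [List.length_map] at hlen
    have hB := TriDec.main_bound.{u} hn hd2
    -- The bound `B` for the data has to be at least `2` and is at least `k` and the size of the final
    -- state.
    obtain ⟨-, t, ht, he⟩ := TriDec.mainI.{u}.2 K (k ^ n + d ^ (n * TriDec.boundBase.{u} ^ (n + 2)) + 2)
      (n, TriDec.Data.ofNat d, H) (by omega) ⟨d - 1, hH, by simp only [hlen]; omega, by dsimp only; omega⟩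
    obtain ⟨-, -, ⟨E', hE', hL⟩, hbd, -⟩ := TriDec.stage_spec hH n le_rfl
    have hRB : ∀ G ∈ TriDec.results (TriDec.stage n H n).2.2, ∀ p ∈ G, TriDec.RB n E' p := by
      intro G hG
      obtain ⟨s, hs, -, rfl⟩ := (TriDec.mem_results (by rwa [Nat.sub_self] at hL) (F := K)).1 hG
      exact (hL s hs).2.2
    refine ⟨_, 5 + t + 1, _, TriDec.Eval.branch_yes htest ?_ he,
      TriDec.isListOf_map fun G hG => TriDec.isListOf_map fun p hp => TriDec.isPoly_toMv (hRB G hG p hp),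
      ?_, fun E _ _ _ => hmv ▸ TriDec.zeroSet_results hH E, ?_, ?_, ?_, ?_⟩
    · intro h0
      have := TriDec.ofList_eq_nil h0
      simp at this
      omega
    · intro T hT
      obtain ⟨G, hG, rfl⟩ := List.mem_map.1 hT
      obtain ⟨h1, h2, -⟩ := TriDec.results_spec hH hG
      exact ⟨h1, h2.isRegular h1⟩
    · intro T hT
      obtain ⟨G, hG, rfl⟩ := List.mem_map.1 hT
      obtain ⟨h1, h2, -⟩ := TriDec.results_spec hH hG
      exact h2.isUnmixed h1
    · intro T hT f hf
      obtain ⟨G, hG, rfl⟩ := List.mem_map.1 hT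
      obtain ⟨p, hp, rfl⟩ := List.mem_map.1 hf
      exact (TriDec.totalDegree_toMv (hRB G hG p hp)).trans_lt (TriDec.degree_bound hn hd2 hE')
    · have hle : (TriDec.results (TriDec.stage n H n).2.2).length ≤ (TriDec.stage n H n).2.2.length := by
        rw [TriDec.results, List.length_map]
        exact List.length_filter_le _ _
      rw [List.length_map]
      refine hle.trans ?_
      exact (hbd.2.2.1.trans hB).trans (Nat.le_mul_of_pos_left _ (by omega))
    · omega
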